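/- **Setting.** In the memory-constrained model with parameters $S$ and $w$ a fixed random access program reads its input from a read-only, randomly accessible array of words, may read and write $S$ further words (the workspace), and writes its output word by word to a write-only memory; every word of the workspace is a signed integer of at most $w$ bits, and every instruction (constant, $+$, $-$, $\times$, integer division, direct and indirect access, comparison, jump, output) takes one time step. Let $P$ be a simple polygon with $n\ge 3$ vertices, given as the cyclic list of its vertices, and let $q\in P$ be a point that does not lie on the line through any two vertices of $P$ (weak general position). The coordinates are integers. Let $r_\theta$ be the ray from $q$ with angle $\theta\in[0,2\pi)$. A vertex $v$ is *critical* if both edges incident to it lie on the same side of the ray from $q$ through $v$; it is an *end* vertex if they lie on the right side, a *start* vertex if they lie on the left side. If $r_\theta$ contains no vertex, $e_\theta(j)$ is the $j$-th edge of $P$ that intersects $r_\theta$, starting from $q$. If $r_\theta$ contains a critical vertex $v$, then $e_\theta(j)$ is $e_{\theta-\varepsilon}(j)$ if $v$ is an end vertex and $e_{\theta+\varepsilon}(j)$ if $v$ is a start vertex, for all small $\varepsilon>0$; so $v$ counts as two consecutive edges. The $k$-visibility region $V_k(P,q)$ is the set of the points $p\in P$ such that the open segment $qp$ meets $\partial P$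 at most $k$ times (a critical vertex on it counts twice). Let $k$ be even. For each critical vertex $v\in V_k(P,q)$, with angle $\theta$, the segment on $r_\theta$ between $e_\theta(k+2)$ and $e_\theta(k+3)$, if these exist, is a *window*; it is of type CCW if $V_k(P,q)$ lies, along it, to the left of $r_\theta$, and of type CW otherwise. $W_k(P,q)$ is the set of all triples $(\theta,j,\text{type})$, where $\theta$ is the angle and $\text{type}$ the type of a window, and $j$ is the index of one of the two edges $e_\theta(k+2)$, $e_\theta(k+3)$ on which its endpoints lie. For odd $k$ one puts $W_k(P,q)=W_{k-1}(P,q)$. **Theorem.** There are a program and a constant $C$ such that the following holds for every such $P$ and $q$, all $k\in\mathbb N$, all $s$ with $1\le s\le n$, and every $w$ for which all the input words ($n$, $k$, $s$ and the coordinates of $q$ and of the vertices of $P$) have at most $w$ bits. With a workspace of $Cs$ words of $Cw$ bits each, the program reports $W_k(P,q)$, each triple exactly once, and stops after at most $$C\left(\frac{n^2}{s}+n\log s\right)$$ steps. In the output the angle $\theta$ of a triple is represented by the index of the vertex of $P$ on $r_\theta$. In particular, if the input words have $O(\log n)$ bits, then $W_k(P,q)$ can be reported in $O(n^2/s+n\log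 s)$ time using $O(s)$ words of workspace with $O(\log n)$ bits each. -/

import Mathlib

open scoped Topology

namespace KVis

/-! ## Geometry: polygons, rays, edge lists, the `k`-visibility region and its windows

The plane is `ℂ`.  A polygon with `n` vertices is Mathlib's `Polygon ℂ n`; its edge number `i` is
the closed segment `P.edgeSet ℝ i` from the vertex `P i` to the next vertex `P (finRotate n i)`,
and `P.boundary ℝ` is the union of its edges. -/

/-- A simple polygon: at least three vertices, pairwise distinct; two consecutive edges meet only
in their common vertex, and two other edges do not meet. -/
structure IsSimple {n : ℕ} (P : Polygon ℂ n) : Prop where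
  three_le : 3 ≤ n
  injective : Function.Injective P.vertices
  consecutive : ∀ i : Fin n,
    P.edgeSet ℝ i ∩ P.edgeSet ℝ (finRotate n i) = {P (finRotate n i)}
  disjoint : ∀ i j : Fin n, i ≠ j → j ≠ finRotate n i → i ≠ finRotate n j →
    Disjoint (P.edgeSet ℝ i) (P.edgeSet ℝ j)

/-- Weak general position: `q` does not lie on the line determined by any two vertices. -/
def WeakGeneralPosition {n : ℕ} (P : Polygon ℂ n) (q : ℂ) : Prop :=
  ∀ i j : Fin n, i ≠ j → q ∉ line[ℝ, P i, P j]

/-- The ray `r_θ` from `q` that forms the angle `θ` with the positive horizontal axis. -/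
def ray (q : ℂ) (θ : ℝ) : Set ℂ :=
  {x | ∃ t : ℝ, 0 ≤ t ∧ x = q + (t : ℂ) * Complex.exp ((θ : ℂ) * Complex.I)}

/-- The angle in `[0, 2π)` between the ray from `q` through `v` and the positive horizontal
axis. -/
noncomputable def angle (q v : ℂ) : ℝ :=
  toIcoMod Real.two_pi_pos 0 (Complex.arg (v - q))

/-- The closed region bounded by the polygon: the boundary together with the points from which
some (for a simple polygon, equivalently every) ray through no vertex meets an odd number of
edges. -/
def region {n : ℕ} (P : Polygon ℂ n) : Set ℂ :=
  P.boundary ℝ ∪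
    {x | ∃ θ : ℝ, (∀ i, P i ∉ ray x θ) ∧ Odd {i : Fin n | (ray x θ ∩ P.edgeSet ℝ i).Nonempty}.ncard}

/-- The cross product `det (u - q, v - q)`: positive if `v` lies to the left of the directed line
from `q` through `u`, negative if `v` lies to the right of it. -/
def side (q u v : ℂ) : ℝ := (u.re - q.re) * (v.im - q.im) - (u.im - q.im) * (v.re - q.re)

/-- The vertex `m` is an end vertex: both its incident edges lie on the right side of the ray from
`q` through it. -/
def IsEndVertex {n : ℕ} (P : Polygon ℂ n) (q : ℂ) (m : Fin n) : Prop :=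
  side q (P m) (P ((finRotate n).symm m)) < 0 ∧ side q (P m) (P (finRotate n m)) < 0

/-- The vertex `m` is a start vertex: both its incident edges lie on the left side of the ray from
`q` through it. -/
def IsStartVertex {n : ℕ} (P : Polygon ℂ n) (q : ℂ) (m : Fin n) : Prop :=
  0 < side q (P m) (P ((finRotate n).symm m)) ∧ 0 < side q (P m) (P (finRotate n m))

/-- The vertex `m` is critical: both its incident edges lie on the same side of the ray from `q`
through it. -/
def IsCritical {n : ℕ} (P : Polygon ℂ n) (q : ℂ) (m : Fin n) : Prop :=
  IsEndVertex P q m ∨ IsStartVertex P q m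

/-- How often the open segment from `q` to `p` meets the boundary.  Every edge that it meets in a
relatively interior point of the edge counts once; every vertex on it counts once if the boundary
passes there from one side to the other, and twice (once for each incident edge) if the vertex is
critical. -/
noncomputable def crossings {n : ℕ} (P : Polygon ℂ n) (q p : ℂ) : ℕ :=
  {i : Fin n | (openSegment ℝ q p ∩ openSegment ℝ (P i) (P (finRotate n i))).Nonempty}.ncard
    + {i : Fin n | P i ∈ openSegment ℝ q p ∧ ¬ IsCritical P q i}.ncard
    + 2 * {i : Fin n | P i ∈ openSegment ℝ q p ∧ IsCritical P q i}.ncard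

/-- The `k`-visibility region `V_k(P, q)`. -/
def visibilityRegion {n : ℕ} (P : Polygon ℂ n) (q : ℂ) (k : ℕ) : Set ℂ :=
  {p | p ∈ region P ∧ crossings P q p ≤ k}

/-- On a ray `r_θ` through no vertex: `i` is the `j`-th edge that intersects `r_θ`, starting
from `q` (`j = 1` is the first one). -/
def IsNthEdge {n : ℕ} (P : Polygon ℂ n) (q : ℂ) (θ : ℝ) (j : ℕ) (i : Fin n) : Prop :=
  ∃ x ∈ ray q θ ∩ P.edgeSet ℝ i,
    {i' : Fin n | ∃ y ∈ ray q θ ∩ P.edgeSet ℝ i', dist q y < dist q x}.ncard + 1 = j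

/-- On the ray `r_θ` through the critical vertex `m`: `i` is the `j`-th edge `e_θ(j)`.  The
vertex `m` counts as two consecutive edges of this list, namely its two incident edges; so the list
is that of the nearby rays on the side of `r_θ` on which these two edges lie, i.e. of `r_{θ-ε}` for
an end vertex and of `r_{θ+ε}` for a start vertex, for all small `ε > 0`. -/
def IsNthEdgeAtVertex {n : ℕ} (P : Polygon ℂ n) (q : ℂ) (m : Fin n) (j : ℕ) (i : Fin n) : Prop :=
  (IsEndVertex P q m ∧ ∀ᶠ φ in 𝓝[<] angle q (P m), IsNthEdge P q φ j i) ∨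
    (IsStartVertex P q m ∧ ∀ᶠ φ in 𝓝[>] angle q (P m), IsNthEdge P q φ j i)

/-- The ray through the vertex `m` has a window of `V_k(P, q)`, namely the segment from `A`, on the
edge `a = e_θ(k+2)`, to `B`, on the edge `b = e_θ(k+3)`: `m` is a `k`-visible critical vertex, and
these two edges exist. -/
structure IsWindow {n : ℕ} (P : Polygon ℂ n) (q : ℂ) (k : ℕ) (m a b : Fin n) (A B : ℂ) :
    Prop where
  critical : IsCritical P q m
  visible : P m ∈ visibilityRegion P q k
  edge_fst : IsNthEdgeAtVertex P q m (k + 2) a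
  edge_snd : IsNthEdgeAtVertex P q m (k + 3) b
  mem_fst : A ∈ ray q (angle q (P m)) ∩ P.edgeSet ℝ a
  mem_snd : B ∈ ray q (angle q (P m)) ∩ P.edgeSet ℝ b

/-- Along the segment between `A` and `B`, which lies on the ray from `q` through `v`, the region
`V_k(P, q)` lies to the left of that ray. -/
def LiesLeft {n : ℕ} (P : Polygon ℂ n) (q : ℂ) (k : ℕ) (v A B : ℂ) : Prop :=
  ∀ x ∈ openSegment ℝ A B, ∀ᶠ y in 𝓝 x, 0 < side q v y → y ∈ visibilityRegion P q k

/-- The type of a window. -/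
inductive WindowType where
  | ccw : WindowType
  | cw : WindowType

/-- The endpoints of the windows of `V_k(P, q)`, for even `k`, as triples `(θ, j, type)`: the angle
of the ray, the index of the edge on which the endpoint lies, and the type of the window. -/
def windowEndpoints {n : ℕ} (P : Polygon ℂ n) (q : ℂ) (k : ℕ) : Set (ℝ × Fin n × WindowType) :=
  {w | ∃ m a b A B, IsWindow P q k m a b A B ∧ w.1 = angle q (P m) ∧ (w.2.1 = a ∨ w.2.1 = b) ∧
    ((LiesLeft P q k (P m) A B ∧ w.2.2 = WindowType.ccw) ∨
      (¬ LiesLeft P q k (P m) A B ∧ w.2.2 = WindowType.cw))}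

/-- `W_k(P, q)`: for even `k` the set of endpoints of windows of `V_k(P, q)`, for odd `k` by
convention that of `V_{k-1}(P, q)`. -/
def W {n : ℕ} (P : Polygon ℂ n) (q : ℂ) (k : ℕ) : Set (ℝ × Fin n × WindowType) :=
  windowEndpoints P q (2 * (k / 2))

/-! ## The memory-constrained model

A random access machine with a read-only input array, a workspace of `S` words and a write-only
output.  A word is a signed integer of at most `w` bits.  Every instruction takes one step.  A
computation that addresses a cell outside the workspace or outside the input, or that would store a
number which does not fit in a word, gets stuck. -/

/-- The instructions; `a`, `b`, `d` are addresses of workspace cells and `l` is a line number. -/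
inductive Instr where
  /-- cell `d` := the constant `c` -/
  | const (d : ℕ) (c : ℤ) : Instr
  /-- cell `d` := cell `a` + cell `b` -/
  | add (d a b : ℕ) : Instr
  /-- cell `d` := cell `a` - cell `b` -/
  | sub (d a b : ℕ) : Instr
  /-- cell `d` := cell `a` * cell `b` -/
  | mul (d a b : ℕ) : Instr
  /-- cell `d` := the integer quotient of cell `a` by cell `b` -/
  | div (d a b : ℕ) : Instr
  /-- cell `d` := the workspace cell whose address is in cell `a` -/
  | load (d a : ℕ) : Instr
  /-- the workspace cell whose address is in cell `d` := cell `a` -/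
  | store (d a : ℕ) : Instr
  /-- cell `d` := the input word whose position is in cell `a` -/
  | read (d a : ℕ) : Instr
  /-- append cell `a` to the output -/
  | write (a : ℕ) : Instr
  /-- go to line `l` -/
  | jump (l : ℕ) : Instr
  /-- go to line `l` if cell `a` < cell `b` -/
  | jumpLT (a b l : ℕ) : Instr
  /-- stop -/
  | halt : Instr

/-- A program: a finite list of instructions, the lines `0, 1, 2, …`. -/
abbrev Program := List Instr

/-- A configuration: the current line, the content of the workspace, the output so far. -/
structure Config where
  pc : ℕ
  mem : ℕ → ℤ
  out : List ℤ

/-- The start: line `0`, the workspace filled with zeros, no output. -/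
def Config.init : Config := ⟨0, fun _ => 0, []⟩

/-- The word in cell `a` of a workspace of `S` words. -/
def Config.get (S : ℕ) (σ : Config) (a : ℕ) : Option ℤ :=
  if a < S then some (σ.mem a) else none

/-- Put the number `x` into cell `d` of a workspace of `S` words of `w` bits, and go to the next
line. -/
def Config.put (S w : ℕ) (σ : Config) (d : ℕ) (x : ℤ) : Option Config :=
  if d < S ∧ |x| < 2 ^ w then some ⟨σ.pc + 1, Function.update σ.mem d x, σ.out⟩ else none

/-- A word used as an address: it must not be negative. -/
def toAddress (x : ℤ) : Option ℕ := if 0 ≤ x then some x.toNat else none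

/-- Apply a binary operation to the cells `a` and `b` and put the result into cell `d`. -/
def Config.binary (S w : ℕ) (σ : Config) (f : ℤ → ℤ → ℤ) (d a b : ℕ) : Option Config :=
  (σ.get S a).bind fun x => (σ.get S b).bind fun y => σ.put S w d (f x y)

/-- One step on a workspace of `S` words of `w` bits; `none` if the machine has halted or is
stuck. -/
def step (prog : Program) (S w : ℕ) (input : List ℤ) (σ : Config) : Option Config :=
  match prog[σ.pc]? with
  | none => none
  | some (Instr.const d c) => σ.put S w d c
  | some (Instr.add d a b) => σ.binary S w (fun x y => x + y) d a b
  | some (Instr.sub d a b) => σ.binary S w (fun x y => x - y) d a b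
  | some (Instr.mul d a b) => σ.binary S w (fun x y => x * y) d a b
  | some (Instr.div d a b) => σ.binary S w (fun x y => x / y) d a b
  | some (Instr.load d a) =>
      (σ.get S a).bind fun x => (toAddress x).bind fun p => (σ.get S p).bind fun y =>
        σ.put S w d y
  | some (Instr.store d a) =>
      (σ.get S d).bind fun x => (toAddress x).bind fun p => (σ.get S a).bind fun y =>
        σ.put S w p y
  | some (Instr.read d a) =>
      (σ.get S a).bind fun x => (toAddress x).bind fun p => (input[p]?).bind fun y =>
        σ.put S w d y
  | some (Instr.write a) =>
      (σ.get S a).bind fun x => some ⟨σ.pc + 1, σ.mem, σ.out ++ [x]⟩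
  | some (Instr.jump l) => some ⟨l, σ.mem, σ.out⟩
  | some (Instr.jumpLT a b l) =>
      (σ.get S a).bind fun x => (σ.get S b).bind fun y =>
        some ⟨if x < y then l else σ.pc + 1, σ.mem, σ.out⟩
  | some Instr.halt => none

/-- The configuration after `t` steps, if there is one. -/
def run (prog : Program) (S w : ℕ) (input : List ℤ) : ℕ → Option Config
  | 0 => some Config.init
  | t + 1 => (run prog S w input t).bind (step prog S w input)

/-- With a workspace of `S` words of `w` bits, the program reaches a `halt` instruction after
exactly `t` steps, with the given output. -/
def Computes (prog : Program) (S w : ℕ) (input : List ℤ) (t : ℕ) (output : List ℤ) : Prop :=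
  ∃ σ, run prog S w input t = some σ ∧ prog[σ.pc]? = some Instr.halt ∧ σ.out = output

/-! ## Input and output -/

/-- The point of the plane with the given integer coordinates. -/
def toPoint (p : ℤ × ℤ) : ℂ := ⟨p.1, p.2⟩

/-- The polygon in the plane with the given integer vertices. -/
def toPolygon {n : ℕ} (v : Fin n → ℤ × ℤ) : Polygon ℂ n := ⟨fun i => toPoint (v i)⟩

/-- The input array: the numbers `n`, `k`, `s`, the query point, and the list of vertices. -/
def inputArray {n : ℕ} (v : Fin n → ℤ × ℤ) (q : ℤ × ℤ) (k s : ℕ) : List ℤ :=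
  [(n : ℤ), (k : ℤ), (s : ℤ), q.1, q.2] ++ (List.ofFn v).flatMap fun p => [p.1, p.2]

/-- The word that stands for a window type. -/
def WindowType.code : WindowType → ℤ
  | WindowType.ccw => 0
  | WindowType.cw => 1

/-- A reported triple: the index `m` of a vertex, which stands for the angle of that vertex, the
index `j` of an edge, and a window type. -/
abbrev Report (n : ℕ) := Fin n × Fin n × WindowType

/-- The three output words of a reported triple. -/
def Report.words {n : ℕ} (r : Report n) : List ℤ :=
  [((r.1 : ℕ) : ℤ), ((r.2.1 : ℕ) : ℤ), r.2.2.code]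

/-- The triple `(θ, j, type)` that a reported triple stands for. -/
noncomputable def Report.decode {n : ℕ} (P : Polygon ℂ n) (q : ℂ) (r : Report n) :
    ℝ × Fin n × WindowType :=
  (angle q (P r.1), r.2.1, r.2.2)

end KVis

/-! A ray is rotated once counterclockwise around `q`, starting just after vertex 0. Take k even.
The program keeps a pointer to edge number k + 2 of the current ray, or to its last edge if there
are fewer. The workspace cannot hold all crossed edges, so the pointer is supported by tournament
trees. The n elements are cut into s blocks of ⌈n/s⌉, the blocks are the leaves, and a node stores
only the winner among the elements below it. One tree yields the next vertex in angular order; two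
others yield the predecessor and the successor of the pointer along the ray. After a change that
concerns one element, its block is scanned again from the input and the path to the root is
replayed, in O(n/s + log s) steps (`wp_refresh`).

Few such repairs are needed because disjoint segments never change their order along a turning ray
(`tk_lt_of_weak`). The trees therefore survive a rotation, except for edges that begin or cease to
be crossed. Between consecutive vertices there are none (`Inst.Next.iAct_iff`), and at a vertex only
its two incident edges are concerned (`Inst.iAct_dir_iff`). The rank of the pointer changes by at
most 2, so boundedly many moves to neighbouring edges put it back in place (`wp_event`). Building
the trees and bringing the pointer into its first position costs at most a multiple of n repairs,
and so do the n vertices together; this gives the time bound.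

Windows can be read off at the pointer. Close to a critical vertex, on the side of its edges, the
edges in front of the vertex keep their places and the two incident edges follow them, so the vertex
is k-visible exactly if both incident edges have numbers at most k + 2 (`visible_iff`). Just left of
a window the number of crossed edges is k at an end vertex and k + 2 at a start vertex
(`eventually_left_of_window`). As `q` is in the polygon, generic rays cross an odd number of edges
(`odd_total`), so points behind an even number of edges are in the polygon. The type of a window is
thus decided by the kind of the vertex (`liesLeft_iff`).

All of this is done in integers of O(w) bits. The directions just before and after a vertex u are
K·u ∓ i·u with an integer K that dominates all scalar products (`Inst.near_dir`), and positions
along rays are quotients of determinants, compared by cross-multiplication. The program is written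
in a small structured language; `Cmd.code_correct` translates it to the machine, sizes of numbers
are bounded by syntax alone (`Expr.abs_val_lt`), and `wp` tracks correctness together with time. -/

namespace KVis

/-! ## A structured language and its translation to the machine -/

/-- The registers of the structured language. -/
inductive Reg where
  | n | k | s | qx | qy | B | K | u0x | u0y
  | m | e1 | e2 | h1 | h2 | cA | cD
  | dx | dy
  | p | r | pA | nA | pD
  | old | new
  | b
  | node | best | bA | bD | hi | lft | rgt | i
  | A | D | j | ux | uy | vx | vy | cu | cv | eA | eD | act | dot
  deriving DecidableEq

/-- The number of a register. -/
def Reg.index (x : Reg) : ℕ := x.ctorIdx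

/-- The size of a register: its content has at most `x.bits * w` bits. -/
def Reg.bits : Reg → ℕ
  | .n | .s | .qx | .qy => 1
  | .K => 7
  | .i | .node => 20
  | .hi | .j | .best => 22
  | .u0x | .u0y | .ux | .uy | .vx | .vy => 2
  | .dx | .dy => 12
  | .cA | .cD | .pA | .pD | .bA | .bD | .A | .D => 24
  | .nA => 25
  | .cu | .cv | .eA | .eD | .dot | .h1 | .h2 => 20
  | _ => 8

/-- The nesting level of a register: a routine only changes registers of low level. -/
def Reg.level : Reg → ℕ
  | .n | .k | .s | .qx | .qy | .B | .K | .u0x | .u0y => 6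
  | .m | .e1 | .e2 | .h1 | .h2 | .cA | .cD => 5
  | .dx | .dy => 4
  | .p | .r | .pA | .nA | .pD => 3
  | .old | .new | .b => 2
  | .node | .best | .bA | .bD | .hi | .lft | .rgt | .i => 1
  | _ => 0

theorem Reg.index_injective : Function.Injective Reg.index := by
  intro x y h
  cases x <;> cases y <;> first | rfl | (exact absurd h (by decide))

theorem Reg.index_lt (x : Reg) : x.index < 60 := by cases x <;> decide

/-- The workspace cell of a register. -/
def Reg.cell (x : Reg) : ℕ := x.index + 1

/-- The first temporary cell. -/
abbrev tempBase : ℕ := 61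

/-- The first cell of the array. -/
abbrev arrBase : ℕ := 81

/-- Binary operations. -/
inductive Op where
  | add | sub | mul | div

/-- The meaning of an operation. -/
def Op.fn : Op → ℤ → ℤ → ℤ
  | .add => fun x y => x + y
  | .sub => fun x y => x - y
  | .mul => fun x y => x * y
  | .div => fun x y => x / y

/-- The instruction for an operation. -/
def Op.instr : Op → ℕ → ℕ → ℕ → Instr
  | .add => Instr.add
  | .sub => Instr.sub
  | .mul => Instr.mul
  | .div => Instr.div

/-- Expressions. -/
inductive Expr where
  | lit (c : ℤ)
  | reg (x : Reg)
  | bin (o : Op) (a b : Expr)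
  | rd (a : Expr)
  | ld (a : Expr)

/-- States of the structured language. -/
structure State where
  reg : Reg → ℤ
  arr : ℕ → ℤ
  out : List ℤ

/-- Assignment to a register. -/
def State.set (σ : State) (x : Reg) (v : ℤ) : State := ⟨Function.update σ.reg x v, σ.arr, σ.out⟩

/-- Assignment to an array cell. -/
def State.setArr (σ : State) (a : ℕ) (v : ℤ) : State := ⟨σ.reg, Function.update σ.arr a v, σ.out⟩

/-- Output of a word. -/
def State.emit (σ : State) (v : ℤ) : State := ⟨σ.reg, σ.arr, σ.out ++ [v]⟩

@[simp] theorem State.set_reg (σ : State) (x y : Reg) (v : ℤ) :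
    (σ.set x v).reg y = if y = x then v else σ.reg y := by
  simp [State.set, Function.update_apply]
@[simp] theorem State.set_arr (σ : State) (x : Reg) (v : ℤ) : (σ.set x v).arr = σ.arr := rfl
@[simp] theorem State.set_out (σ : State) (x : Reg) (v : ℤ) : (σ.set x v).out = σ.out := rfl
@[simp] theorem State.setArr_reg (σ : State) (a : ℕ) (v : ℤ) : (σ.setArr a v).reg = σ.reg := rfl
@[simp] theorem State.setArr_out (σ : State) (a : ℕ) (v : ℤ) : (σ.setArr a v).out = σ.out := rfl
theorem State.setArr_arr (σ : State) (a : ℕ) (v : ℤ) (c : ℕ) :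
    (σ.setArr a v).arr c = if c = a then v else σ.arr c := by
  simp [State.setArr, Function.update_apply]
@[simp] theorem State.emit_reg (σ : State) (v : ℤ) : (σ.emit v).reg = σ.reg := rfl
@[simp] theorem State.emit_arr (σ : State) (v : ℤ) : (σ.emit v).arr = σ.arr := rfl
@[simp] theorem State.emit_out (σ : State) (v : ℤ) : (σ.emit v).out = σ.out ++ [v] := rfl

/-! ### Values, sizes and big-step semantics of the structured language. -/

/-- The environment of a computation: the input, the size of the array, and the word size. -/
structure Env where
  inp : List ℤ
  N : ℕ
  w : ℕ
  pos : 1 ≤ w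
  inp_lt : ∀ x ∈ inp, |x| < 2 ^ w

/-- The value of an expression. -/
def Expr.val (E : Env) (σ : State) : Expr → ℤ
  | lit c => c
  | reg x => σ.reg x
  | bin o a b => o.fn (a.val E σ) (b.val E σ)
  | rd a => E.inp.getD (a.val E σ).toNat 0
  | ld a => σ.arr (a.val E σ).toNat

/-- All addresses that occur in the evaluation are valid. -/
def Expr.Safe (E : Env) (σ : State) : Expr → Prop
  | lit _ => True
  | reg _ => True
  | bin _ a b => a.Safe E σ ∧ b.Safe E σ
  | rd a => a.Safe E σ ∧ 0 ≤ a.val E σ ∧ (a.val E σ).toNat < E.inp.length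
  | ld a => a.Safe E σ ∧ 0 ≤ a.val E σ ∧ (a.val E σ).toNat < E.N

/-- A bound for the size of the value of an expression. -/
def Expr.bits : Expr → ℕ
  | lit c => c.natAbs
  | reg x => x.bits
  | bin .add a b => max a.bits b.bits + 1
  | bin .sub a b => max a.bits b.bits + 1
  | bin .mul a b => a.bits + b.bits
  | bin .div a _ => a.bits
  | rd _ => 1
  | ld _ => 1

/-- The registers and the array contain words of the prescribed sizes. -/
structure Bounded (E : Env) (σ : State) : Prop where
  reg : ∀ x, |σ.reg x| < 2 ^ (x.bits * E.w)
  arr : ∀ i, |σ.arr i| < 2 ^ E.w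

theorem two_pow_mono {a b w : ℕ} (h : a ≤ b) : (2 : ℤ) ^ (a * w) ≤ 2 ^ (b * w) :=
  pow_le_pow_right₀ (by norm_num) (Nat.mul_le_mul_right _ h)

theorem abs_add_lt_two_pow {x y : ℤ} {a b w : ℕ} (hw : 1 ≤ w) (hx : |x| < 2 ^ (a * w))
    (hy : |y| < 2 ^ (b * w)) : |x| + |y| < 2 ^ ((max a b + 1) * w) := by
  have h1 : |x| < 2 ^ (max a b * w) := hx.trans_le (two_pow_mono (le_max_left _ _))
  have h2 : |y| < 2 ^ (max a b * w) := hy.trans_le (two_pow_mono (le_max_right _ _))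
  have h3 : (2 : ℤ) ^ (max a b * w) * 2 ≤ 2 ^ ((max a b + 1) * w) := by
    rw [← pow_succ]
    exact pow_le_pow_right₀ (by norm_num) (by nlinarith)
  linarith

/-- Sizes count multiples of `w` bits and are computed from the syntax: sums and differences gain
one multiple because `w ≥ 1`, products add their sizes, integer quotients do not grow. Overflow can
thus be excluded without knowing the values. -/
theorem Expr.abs_val_lt {E : Env} {σ : State} (hb : Bounded E σ) :
    ∀ e : Expr, |e.val E σ| < 2 ^ (e.bits * E.w)
  | lit c => by
      have h1 : |c| = (c.natAbs : ℤ) := Int.abs_eq_natAbs c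
      have h2 : c.natAbs < 2 ^ (c.natAbs * E.w) :=
        Nat.lt_two_pow_self.trans_le
          (Nat.pow_le_pow_right (by norm_num) (Nat.le_mul_of_pos_right _ E.pos))
      simp only [val, bits]
      rw [h1]
      exact_mod_cast h2
  | reg x => hb.reg x
  | bin o a b => by
      have ha := a.abs_val_lt hb
      have hb' := b.abs_val_lt hb
      cases o with
      | add => exact (abs_add_le _ _).trans_lt (abs_add_lt_two_pow E.pos ha hb')
      | sub => exact (abs_sub _ _).trans_lt (abs_add_lt_two_pow E.pos ha hb')
      | mul =>
        simp only [val, bits, Op.fn, abs_mul, Nat.add_mul, pow_add]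
        exact mul_lt_mul'' ha hb' (abs_nonneg _) (abs_nonneg _)
      | div =>
        refine lt_of_le_of_lt ?_ ha
        simp only [val, Op.fn]
        rw [Int.abs_eq_natAbs, Int.abs_eq_natAbs]
        exact_mod_cast Int.natAbs_ediv_le_natAbs _ _
  | rd a => by
      simp only [val, bits, one_mul]
      rw [List.getD_eq_getElem?_getD]
      rcases h : E.inp[(a.val E σ).toNat]? with _ | y
      · simp
      · exact E.inp_lt y (List.mem_of_getElem? h)
  | ld a => by simpa [val, bits] using hb.arr _

/-- Commands. -/
inductive Cmd where
  | skip
  | set (x : Reg) (e : Expr)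
  | store (a e : Expr)
  | emit (e : Expr)
  | seq (c d : Cmd)
  | ite (a b : Expr) (c d : Cmd)
  | loop (a b : Expr) (c : Cmd)

/-- The semantics of commands: `Exec E c σ t σ'` if `c` leads from `σ` to `σ'`; `t` counts the
elementary commands and the evaluated conditions. -/
inductive Exec (E : Env) : Cmd → State → ℕ → State → Prop
  | skip (σ) : Exec E .skip σ 0 σ
  | set (σ x e) : e.Safe E σ → |e.val E σ| < 2 ^ (x.bits * E.w) →
      Exec E (.set x e) σ 1 (σ.set x (e.val E σ))
  | store (σ a e) : a.Safe E σ → e.Safe E σ → 0 ≤ a.val E σ → (a.val E σ).toNat < E.N →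
      |e.val E σ| < 2 ^ E.w → Exec E (.store a e) σ 1 (σ.setArr (a.val E σ).toNat (e.val E σ))
  | emit (σ e) : e.Safe E σ → Exec E (.emit e) σ 1 (σ.emit (e.val E σ))
  | seq (c d σ σ' σ'' t t') : Exec E c σ t σ' → Exec E d σ' t' σ'' →
      Exec E (.seq c d) σ (t + t') σ''
  | iteTrue (a b c d σ σ' t) : a.Safe E σ → b.Safe E σ → a.val E σ < b.val E σ →
      Exec E c σ t σ' → Exec E (.ite a b c d) σ (t + 1) σ'
  | iteFalse (a b c d σ σ' t) : a.Safe E σ → b.Safe E σ → ¬ a.val E σ < b.val E σ →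
      Exec E d σ t σ' → Exec E (.ite a b c d) σ (t + 1) σ'
  | loopTrue (a b c σ σ' σ'' t t') : a.Safe E σ → b.Safe E σ → a.val E σ < b.val E σ →
      Exec E c σ t σ' → Exec E (.loop a b c) σ' t' σ'' →
      Exec E (.loop a b c) σ (t + t' + 1) σ''
  | loopFalse (a b c σ) : a.Safe E σ → b.Safe E σ → ¬ a.val E σ < b.val E σ →
      Exec E (.loop a b c) σ 1 σ

/-- The rules for assignments and stores demand that the new value fits, so the bounds persist along
every execution. -/
theorem Exec.bounded {E : Env} {c : Cmd} {σ σ' : State} {t : ℕ} (h : Exec E c σ t σ')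
    (hb : Bounded E σ) : Bounded E σ' := by
  induction h with
  | skip => exact hb
  | set σ x e _ hx =>
    refine ⟨fun y => ?_, hb.arr⟩
    rw [State.set_reg]
    split_ifs with hy
    · rw [hy]; exact hx
    · exact hb.reg y
  | store σ a e _ _ _ _ hx =>
    refine ⟨hb.reg, fun y => ?_⟩
    rw [State.setArr_arr]
    split_ifs with hy
    · exact hx
    · exact hb.arr y
  | emit => exact ⟨hb.reg, hb.arr⟩
  | seq _ _ _ _ _ _ _ _ _ h1 h2 => exact h2 (h1 hb)
  | iteTrue _ _ _ _ _ _ _ _ _ _ _ h1 => exact h1 hb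
  | iteFalse _ _ _ _ _ _ _ _ _ _ _ h1 => exact h1 hb
  | loopTrue _ _ _ _ _ _ _ _ _ _ _ _ _ h1 h2 => exact h2 (h1 hb)
  | loopFalse => exact hb

/-! ### Translation -/

/-- Code that puts the value of an expression into the temporary cell number `t`. -/
def Expr.code : Expr → ℕ → List Instr
  | lit c, t => [Instr.const (tempBase + t) c]
  | reg x, t => [Instr.add (tempBase + t) x.cell 0]
  | bin o a b, t => a.code t ++ (b.code (t + 1) ++
      [o.instr (tempBase + t) (tempBase + t) (tempBase + (t + 1))])
  | rd a, t => a.code t ++ [Instr.read (tempBase + t) (tempBase + t)]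
  | ld a, t => a.code t ++ [Instr.const (tempBase + (t + 1)) arrBase,
      Instr.add (tempBase + t) (tempBase + t) (tempBase + (t + 1)),
      Instr.load (tempBase + t) (tempBase + t)]

/-- The number of temporary cells that are needed. -/
def Expr.depth : Expr → ℕ
  | lit _ => 1
  | reg _ => 1
  | bin _ a b => max a.depth (b.depth + 1)
  | rd a => a.depth
  | ld a => max a.depth 2

/-- The length of the code. -/
def Expr.cost : Expr → ℕ
  | lit _ => 1
  | reg _ => 1
  | bin _ a b => a.cost + (b.cost + 1)
  | rd a => a.cost + 1
  | ld a => a.cost + 3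

/-- All subexpressions have at most `W` bits. -/
def Expr.small (W : ℕ) : Expr → Bool
  | lit c => decide (c.natAbs ≤ W)
  | reg x => decide (x.bits ≤ W)
  | bin o a b => a.small W && (b.small W && decide ((Expr.bin o a b).bits ≤ W))
  | rd a => a.small W
  | ld a => a.small W

/-- The header of a conditional. -/
def condCode (a b : Expr) : List Instr := a.code 0 ++ b.code 1

/-- Code for a command that starts in line `l`. -/
def Cmd.code : Cmd → ℕ → List Instr
  | skip, _ => []
  | set x e, _ => e.code 0 ++ [Instr.add x.cell tempBase 0]
  | store a e, _ => condCode a e ++ [Instr.const (tempBase + 2) arrBase,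
      Instr.add tempBase tempBase (tempBase + 2), Instr.store tempBase (tempBase + 1)]
  | emit e, _ => e.code 0 ++ [Instr.write tempBase]
  | seq c d, l => c.code l ++ d.code (l + (c.code l).length)
  | ite a b c d, l =>
      condCode a b ++
      ([Instr.jumpLT tempBase (tempBase + 1)
          (l + (condCode a b).length + 1 + (d.code (l + (condCode a b).length + 1)).length + 1)] ++
      (d.code (l + (condCode a b).length + 1) ++
      ([Instr.jump (l + (condCode a b).length + 1 +
          (d.code (l + (condCode a b).length + 1)).length + 1 +
          (c.code (l + (condCode a b).length + 1 +
            (d.code (l + (condCode a b).length + 1)).length + 1)).length)] ++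
      c.code (l + (condCode a b).length + 1 +
            (d.code (l + (condCode a b).length + 1)).length + 1))))
  | loop a b c, l =>
      condCode a b ++
      ([Instr.jumpLT tempBase (tempBase + 1) (l + (condCode a b).length + 2),
        Instr.jump (l + (condCode a b).length + 2 +
          (c.code (l + (condCode a b).length + 2)).length + 1)] ++
      (c.code (l + (condCode a b).length + 2) ++ [Instr.jump l]))

/-- The size of all values, the number of temporary cells and the length of all expressions are
admissible. -/
def Expr.ok (W : ℕ) (e : Expr) : Bool :=
  e.small W && (decide (e.bits ≤ W) && (decide (e.depth ≤ 18) && decide (e.cost ≤ 60)))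

/-- All expressions of a command are admissible. -/
def Cmd.ok (W : ℕ) : Cmd → Bool
  | skip => true
  | set x e => e.ok W && decide (x.bits ≤ W)
  | store a e => a.ok W && e.ok W
  | emit e => e.ok W
  | seq c d => c.ok W && d.ok W
  | ite a b c d => a.ok W && (b.ok W && (c.ok W && d.ok W))
  | loop a b c => a.ok W && (b.ok W && c.ok W)

/-! ### Code fragments on the machine. -/

/-- `t` steps from a given configuration. -/
def steps (prog : Program) (S w : ℕ) (input : List ℤ) : ℕ → Config → Option Config
  | 0, c => some c
  | t + 1, c => (step prog S w input c).bind (steps prog S w input t)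

theorem steps_add (prog : Program) (S w : ℕ) (input : List ℤ) (t t' : ℕ) (c : Config) :
    steps prog S w input (t + t') c =
      (steps prog S w input t c).bind (steps prog S w input t') := by
  induction t generalizing c with
  | zero => simp [steps]
  | succ t ih =>
    rw [Nat.add_right_comm]
    simp only [steps]
    cases step prog S w input c with
    | none => rfl
    | some d => simpa using ih d

/-- `run` adds steps at the end, `steps` at the beginning; the second form is the one that composes
from arbitrary configurations. -/
theorem run_eq_steps (prog : Program) (S w : ℕ) (input : List ℤ) (t : ℕ) :
    run prog S w input t = steps prog S w input t Config.init := by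
  induction t with
  | zero => rfl
  | succ t ih =>
    rw [steps_add, run, ih]
    congr 1
    funext c
    simp [steps]

/-- The program contains the given code, starting in line `l`. -/
def CodeAt (prog : Program) (l : ℕ) (code : List Instr) : Prop :=
  ∀ i, i < code.length → prog[l + i]? = code[i]?

theorem CodeAt.left {prog : Program} {l : ℕ} {c d : List Instr} (h : CodeAt prog l (c ++ d)) :
    CodeAt prog l c := fun i hi => by
  rw [h i (by simp; omega), List.getElem?_append_left hi]

theorem CodeAt.right {prog : Program} {l : ℕ} {c d : List Instr} (h : CodeAt prog l (c ++ d)) :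
    CodeAt prog (l + c.length) d := fun i hi => by
  rw [Nat.add_assoc, h (c.length + i) (by simp; omega), List.getElem?_append_right (by omega)]
  congr 1
  omega

theorem CodeAt.head {prog : Program} {l : ℕ} {c : Instr} {d : List Instr}
    (h : CodeAt prog l (c :: d)) : prog[l]? = some c := by
  simpa using h 0 (by simp)

theorem CodeAt.tail {prog : Program} {l : ℕ} {c : Instr} {d : List Instr}
    (h : CodeAt prog l (c :: d)) : CodeAt prog (l + 1) d :=
  CodeAt.right (c := [c]) h

/-- The memory represents the state, up to the temporary cells. -/
structure Represents (σ : State) (mem : ℕ → ℤ) : Prop where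
  zero : mem 0 = 0
  reg : ∀ x : Reg, mem x.cell = σ.reg x
  arr : ∀ i, mem (arrBase + i) = σ.arr i

/-- The cells from `tempBase` up to `arrBase` carry no part of the state, so code may overwrite them
freely. -/
theorem Represents.congr {σ : State} {mem mem' : ℕ → ℤ} (h : Represents σ mem)
    (h' : ∀ a, a < tempBase ∨ arrBase ≤ a → mem' a = mem a) : Represents σ mem' := by
  refine ⟨?_, fun x => ?_, fun i => ?_⟩
  · rw [h' 0 (by simp), h.zero]
  · have := x.index_lt
    rw [h' _ (by left; unfold Reg.cell tempBase; omega), h.reg]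
  · rw [h' _ (by right; omega), h.arr]

/-- The machine that executes translated commands. -/
structure Machine (E : Env) where
  prog : Program
  S : ℕ
  W : ℕ
  hW : 7 ≤ W
  hS : arrBase + E.N ≤ S
  hN : (arrBase : ℤ) + E.N < 2 ^ (W * E.w)

variable {E : Env}

/-- `t` steps of the machine. -/
def Machine.steps (M : Machine E) : ℕ → Config → Option Config :=
  KVis.steps M.prog M.S (M.W * E.w) E.inp

theorem Machine.steps_trans {M : Machine E} {t t' : ℕ} {c c' c'' : Config}
    (h : M.steps t c = some c') (h' : M.steps t' c' = some c'') :
    M.steps (t + t') c = some c'' := by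
  unfold Machine.steps at *
  rw [steps_add, h]
  exact h'

theorem Machine.lt_pow {M : Machine E} {x : ℤ} {b : ℕ} (h : |x| < 2 ^ (b * E.w))
    (hb : b ≤ M.W) : |x| < 2 ^ (M.W * E.w) := h.trans_le (two_pow_mono hb)

theorem Machine.put {M : Machine E} {d : ℕ} {x : ℤ} (hd : d < M.S) (c : Config)
    (hx : |x| < 2 ^ (M.W * E.w)) :
    c.put M.S (M.W * E.w) d x = some ⟨c.pc + 1, Function.update c.mem d x, c.out⟩ := by
  simp [Config.put, hd, hx]

theorem Machine.get {M : Machine E} {a : ℕ} (ha : a < M.S) (c : Config) :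
    c.get M.S a = some (c.mem a) := by
  simp [Config.get, ha]

theorem Machine.step_const {M : Machine E} {c : Config} {d : ℕ} {x : ℤ}
    (hp : M.prog[c.pc]? = some (Instr.const d x)) (hd : d < M.S) (hx : |x| < 2 ^ (M.W * E.w)) :
    M.steps 1 c = some ⟨c.pc + 1, Function.update c.mem d x, c.out⟩ := by
  simp [Machine.steps, KVis.steps, step, hp, M.put hd c hx]

theorem Machine.step_op {M : Machine E} {c : Config} {o : Op} {d a b : ℕ}
    (hp : M.prog[c.pc]? = some (o.instr d a b)) (hd : d < M.S) (ha : a < M.S) (hb : b < M.S)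
    (hx : |o.fn (c.mem a) (c.mem b)| < 2 ^ (M.W * E.w)) :
    M.steps 1 c = some ⟨c.pc + 1, Function.update c.mem d (o.fn (c.mem a) (c.mem b)), c.out⟩ := by
  cases o <;> simp [Op.instr] at hp <;>
    simp [Machine.steps, KVis.steps, step, hp, Config.binary, M.get ha, M.get hb] <;>
    exact M.put hd c hx

theorem Machine.step_read {M : Machine E} {c : Config} {d a : ℕ} {y : ℤ}
    (hp : M.prog[c.pc]? = some (Instr.read d a)) (hd : d < M.S) (ha : a < M.S)
    (h0 : 0 ≤ c.mem a) (hy : E.inp[(c.mem a).toNat]? = some y) (hx : |y| < 2 ^ (M.W * E.w)) :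
    M.steps 1 c = some ⟨c.pc + 1, Function.update c.mem d y, c.out⟩ := by
  simp [Machine.steps, KVis.steps, step, hp, M.get ha, toAddress, h0, hy, M.put hd c hx]

theorem Machine.step_load {M : Machine E} {c : Config} {d a : ℕ}
    (hp : M.prog[c.pc]? = some (Instr.load d a)) (hd : d < M.S) (ha : a < M.S)
    (h0 : 0 ≤ c.mem a) (hy : (c.mem a).toNat < M.S)
    (hx : |c.mem (c.mem a).toNat| < 2 ^ (M.W * E.w)) :
    M.steps 1 c = some ⟨c.pc + 1, Function.update c.mem d (c.mem (c.mem a).toNat), c.out⟩ := by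
  simp [Machine.steps, KVis.steps, step, hp, M.get ha, toAddress, h0, M.get hy, M.put hd c hx]

theorem Machine.step_store {M : Machine E} {c : Config} {d a : ℕ}
    (hp : M.prog[c.pc]? = some (Instr.store d a)) (hd : d < M.S) (ha : a < M.S)
    (h0 : 0 ≤ c.mem d) (hy : (c.mem d).toNat < M.S) (hx : |c.mem a| < 2 ^ (M.W * E.w)) :
    M.steps 1 c = some ⟨c.pc + 1, Function.update c.mem (c.mem d).toNat (c.mem a), c.out⟩ := by
  simp [Machine.steps, KVis.steps, step, hp, M.get ha, toAddress, h0, M.get hd, M.put hy c hx]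

theorem Machine.step_write {M : Machine E} {c : Config} {a : ℕ}
    (hp : M.prog[c.pc]? = some (Instr.write a)) (ha : a < M.S) :
    M.steps 1 c = some ⟨c.pc + 1, c.mem, c.out ++ [c.mem a]⟩ := by
  simp [Machine.steps, KVis.steps, step, hp, M.get ha]

theorem Machine.step_jump {M : Machine E} {c : Config} {l : ℕ}
    (hp : M.prog[c.pc]? = some (Instr.jump l)) : M.steps 1 c = some ⟨l, c.mem, c.out⟩ := by
  simp [Machine.steps, KVis.steps, step, hp]

theorem Machine.step_jumpLT {M : Machine E} {c : Config} {a b l : ℕ}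
    (hp : M.prog[c.pc]? = some (Instr.jumpLT a b l)) (ha : a < M.S) (hb : b < M.S) :
    M.steps 1 c = some ⟨if c.mem a < c.mem b then l else c.pc + 1, c.mem, c.out⟩ := by
  simp [Machine.steps, KVis.steps, step, hp, M.get ha, M.get hb]

theorem Expr.depth_pos (e : Expr) : 1 ≤ e.depth := by
  induction e with
  | bin o a b iha ihb => simp only [depth]; omega
  | rd a ih => exact ih
  | ld a ih => simp only [depth]; omega
  | _ => simp [depth]

/-- Evaluation with target cell number `t` touches only temporary cells from `t` on, so a left
operand survives the evaluation of the right one. The bound on `depth` keeps everything within the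
20 temporary cells. -/
theorem Expr.code_correct (M : Machine E) {σ : State} (hb : Bounded E σ) :
    ∀ (e : Expr) (t pc : ℕ) (mem : ℕ → ℤ) (out : List ℤ), CodeAt M.prog pc (e.code t) →
      Represents σ mem → e.Safe E σ → e.depth + t ≤ 20 → e.small M.W = true →
      ∃ mem', M.steps e.cost ⟨pc, mem, out⟩ = some ⟨pc + (e.code t).length, mem', out⟩ ∧
        mem' (tempBase + t) = e.val E σ ∧
        (∀ a, a < tempBase + t ∨ arrBase ≤ a → mem' a = mem a)
  | lit c, t, pc, mem, out, hc, hr, hs, hd, hw => by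
      simp only [depth, small, decide_eq_true_eq] at hd hw
      have := M.hS
      unfold arrBase at this
      refine ⟨_, M.step_const (c := ⟨pc, mem, out⟩) hc.head (by unfold tempBase; omega)
        (M.lt_pow ((Expr.lit c).abs_val_lt hb) hw), by simp [val], fun a ha => ?_⟩
      rw [Function.update_of_ne]
      unfold tempBase arrBase at *; omega
  | reg x, t, pc, mem, out, hc, hr, hs, hd, hw => by
      simp only [depth, small, decide_eq_true_eq] at hd hw
      have := M.hS
      have hx := x.index_lt
      unfold arrBase at this
      -- There is no copy instruction: a register is copied by adding cell 0, which always contains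
      -- 0.
      refine ⟨_, M.step_op (c := ⟨pc, mem, out⟩) (o := .add) hc.head
        (by unfold tempBase; omega) (by unfold Reg.cell; omega) (by omega) ?_, ?_, fun a ha => ?_⟩
      · simp only [Op.fn, hr.reg, hr.zero, add_zero]
        exact M.lt_pow ((Expr.reg x).abs_val_lt hb) hw
      · simp [Op.fn, hr.reg, hr.zero, val]
      · rw [Function.update_of_ne]
        unfold tempBase arrBase at *; omega
  | bin o a b, t, pc, mem, out, hc, hr, hs, hd, hw => by
      simp only [depth, small, Bool.and_eq_true, decide_eq_true_eq] at hd hw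
      have := M.hS
      have hd1 := b.depth_pos
      unfold arrBase at this
      obtain ⟨m1, h1, v1, f1⟩ := a.code_correct M hb t pc mem out hc.left hr hs.1 (by omega) hw.1
      obtain ⟨m2, h2, v2, f2⟩ := b.code_correct M hb (t + 1) _ m1 out hc.right.left
        (hr.congr fun a ha => f1 a (by omega)) hs.2 (by omega) hw.2.1
      have v1' : m2 (tempBase + t) = a.val E σ := by rw [f2 _ (by omega), v1]
      have h3 := M.step_op (c := ⟨_, m2, out⟩) (o := o) hc.right.right.head
        (by unfold tempBase; omega) (by unfold tempBase; omega) (by unfold tempBase; omega)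
        (by
          simp only [v1', v2]
          exact M.lt_pow ((Expr.bin o a b).abs_val_lt hb) hw.2.2)
      refine ⟨Function.update m2 (tempBase + t) (o.fn (m2 (tempBase + t)) (m2 (tempBase + (t + 1)))),
        (M.steps_trans h1 (M.steps_trans h2 h3)).trans ?_, ?_, fun c hc => ?_⟩
      · simp [code, Nat.add_assoc]
      · simp [v1', v2, val]
      · rw [Function.update_of_ne (by unfold tempBase arrBase at *; omega), f2 _ (by omega),
          f1 _ hc]
  | rd a, t, pc, mem, out, hc, hr, hs, hd, hw => by
      simp only [depth, small] at hd hw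
      have := M.hS
      have hd1 := a.depth_pos
      unfold arrBase at this
      obtain ⟨m1, h1, v1, f1⟩ := a.code_correct M hb t pc mem out hc.left hr hs.1 (by omega) hw
      obtain ⟨h0, hl⟩ := hs.2
      have h3 := M.step_read (c := ⟨_, m1, out⟩) (y := (Expr.rd a).val E σ) hc.right.head
        (by unfold tempBase; omega) (by unfold tempBase; omega) (by simp [v1, h0])
        (by simp [v1, val, hl])
        (M.lt_pow ((Expr.rd a).abs_val_lt hb) (by simp only [bits]; have := M.hW; omega))
      refine ⟨Function.update m1 (tempBase + t) ((Expr.rd a).val E σ),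
        (M.steps_trans h1 h3).trans ?_, ?_, fun c hc => ?_⟩
      · simp [code, Nat.add_assoc]
      · simp
      · rw [Function.update_of_ne (by unfold tempBase arrBase at *; omega), f1 _ hc]
  | ld a, t, pc, mem, out, hc, hr, hs, hd, hw => by
      simp only [depth, small] at hd hw
      have := M.hS
      have hN := M.hN
      have hW := M.hW
      unfold arrBase at this hN
      obtain ⟨m1, h1, v1, f1⟩ := a.code_correct M hb t pc mem out hc.left hr hs.1 (by omega) hw
      obtain ⟨h0, hl⟩ := hs.2
      -- The array begins at `arrBase`, so this offset is put into the next temporary cell and added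
      -- to the index.
      have h2 := M.step_const (c := ⟨_, m1, out⟩) (x := arrBase) hc.right.head
        (by unfold tempBase; omega) (by unfold arrBase; rw [abs_of_nonneg (by norm_num)]; push_cast; omega)
      have e1 : tempBase + t ≠ tempBase + (t + 1) := by omega
      have h3 := M.step_op (c := ⟨_, Function.update m1 (tempBase + (t + 1)) arrBase, out⟩)
        (o := .add) hc.right.tail.head
        (by unfold tempBase; omega) (by unfold tempBase; omega) (by unfold tempBase; omega)
        (by
          simp only [Function.update_self, Function.update_of_ne e1, v1, Op.fn]
          rw [abs_of_nonneg (by unfold arrBase; push_cast; omega)]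
          unfold arrBase; push_cast; omega)
      simp only [Function.update_self, Function.update_of_ne e1, v1, Op.fn] at h3
      have e2 : (a.val E σ + (arrBase : ℕ)).toNat = arrBase + (a.val E σ).toNat := by
        unfold arrBase; omega
      have hr1 : Represents σ m1 := hr.congr fun a ha => f1 a (by omega)
      have e3 : Function.update (Function.update m1 (tempBase + (t + 1)) arrBase) (tempBase + t)
          (a.val E σ + (arrBase : ℕ)) (arrBase + (a.val E σ).toNat) = (Expr.ld a).val E σ := by
        rw [Function.update_of_ne (by unfold arrBase tempBase; omega),
          Function.update_of_ne (by unfold arrBase tempBase; omega), hr1.arr, val]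
      have h4 := M.step_load (c := ⟨_, Function.update (Function.update m1 (tempBase + (t + 1))
          arrBase) (tempBase + t) (a.val E σ + (arrBase : ℕ)), out⟩) hc.right.tail.tail.head
        (by unfold tempBase; omega) (by unfold tempBase; omega)
        (by simp only [Function.update_self]; unfold arrBase; omega)
        (by simp only [Function.update_self, e2]; unfold arrBase; omega)
        (by
          simp only [Function.update_self, e2, e3]
          exact M.lt_pow ((Expr.ld a).abs_val_lt hb) (by simp only [bits]; omega))
      simp only [Function.update_self, e2, e3] at h4
      refine ⟨Function.update (Function.update (Function.update m1 (tempBase + (t + 1))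
          arrBase) (tempBase + t) (a.val E σ + (arrBase : ℕ))) (tempBase + t) ((Expr.ld a).val E σ),
        (M.steps_trans h1 (M.steps_trans h2 (M.steps_trans h3 h4))).trans ?_, ?_, fun c hc => ?_⟩
      · simp [code, Nat.add_assoc]
      · simp
      · rw [Function.update_of_ne (by unfold tempBase arrBase at *; omega),
          Function.update_of_ne (by unfold tempBase arrBase at *; omega),
          Function.update_of_ne (by unfold tempBase arrBase at *; omega), f1 _ hc]

theorem condCode_correct (M : Machine E) {σ : State} (hb : Bounded E σ) (a b : Expr) (pc : ℕ)
    (mem : ℕ → ℤ) (out : List ℤ) (hc : CodeAt M.prog pc (condCode a b)) (hr : Represents σ mem)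
    (ha : a.Safe E σ) (hb' : b.Safe E σ) (oa : a.ok M.W = true) (ob : b.ok M.W = true) :
    ∃ mem', M.steps (a.cost + b.cost) ⟨pc, mem, out⟩ =
        some ⟨pc + (condCode a b).length, mem', out⟩ ∧
      mem' tempBase = a.val E σ ∧ mem' (tempBase + 1) = b.val E σ ∧ Represents σ mem' := by
  simp only [Expr.ok, Bool.and_eq_true, decide_eq_true_eq] at oa ob
  obtain ⟨m1, h1, v1, f1⟩ := a.code_correct M hb 0 pc mem out hc.left hr ha (by omega) oa.1
  have hr1 := hr.congr fun a ha => f1 a (by omega)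
  obtain ⟨m2, h2, v2, f2⟩ := b.code_correct M hb 1 _ m1 out hc.right hr1 hb' (by omega) ob.1
  refine ⟨m2, ?_, ?_, v2, hr1.congr fun a ha => f2 a (by omega)⟩
  · rw [M.steps_trans h1 h2]
    simp [condCode, Nat.add_assoc]
  · rw [f2 _ (by omega)]
    exact v1

theorem Represents.set {σ : State} {mem : ℕ → ℤ} (h : Represents σ mem) (x : Reg) (v : ℤ) :
    Represents (σ.set x v) (Function.update mem x.cell v) := by
  have hx := x.index_lt
  refine ⟨?_, fun y => ?_, fun i => ?_⟩
  · rw [Function.update_of_ne (by unfold Reg.cell; omega), h.zero]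
  · rw [State.set_reg]
    split_ifs with hy
    · rw [hy, Function.update_self]
    · rw [Function.update_of_ne, h.reg]
      exact fun h => hy (Reg.index_injective (Nat.succ_injective h))
  · rw [Function.update_of_ne (by unfold Reg.cell arrBase; omega), h.arr]
    rfl

theorem Represents.setArr {σ : State} {mem : ℕ → ℤ} (h : Represents σ mem) (a : ℕ) (v : ℤ) :
    Represents (σ.setArr a v) (Function.update mem (arrBase + a) v) := by
  refine ⟨?_, fun y => ?_, fun i => ?_⟩
  · rw [Function.update_of_ne (by unfold arrBase; omega), h.zero]
  · have hx := y.index_lt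
    rw [Function.update_of_ne (by unfold Reg.cell arrBase; omega), h.reg]
    rfl
  · rw [State.setArr_arr]
    split_ifs with hy
    · rw [hy, Function.update_self]
    · rw [Function.update_of_ne (by omega), h.arr]

/-- Translated commands simulate the semantics, with at most 130 machine steps per elementary
command. -/
theorem Cmd.code_correct (M : Machine E) {c : Cmd} {σ σ' : State} {t : ℕ} (h : Exec E c σ t σ')
    (hb : Bounded E σ) (ok : c.ok M.W = true) (pc : ℕ) (mem : ℕ → ℤ)
    (hc : CodeAt M.prog pc (c.code pc)) (hr : Represents σ mem) :
    ∃ mem' t', t' ≤ 130 * t ∧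
      M.steps t' ⟨pc, mem, σ.out⟩ = some ⟨pc + (c.code pc).length, mem', σ'.out⟩ ∧
      Represents σ' mem' := by
  have hS := M.hS
  have hN := M.hN
  unfold arrBase at hS hN
  -- The induction runs over the execution and not over the command, since a loop is unfolded once
  -- per pass. An admissible expression costs at most 60 machine steps; two of them with the few
  -- jumps or memory instructions around them stay below 130.
  induction h generalizing pc mem with
  | skip σ => exact ⟨mem, 0, by simp, by simp [Machine.steps, KVis.steps, code], hr⟩
  | set σ x e hs hx =>
    simp only [Cmd.ok, Bool.and_eq_true, decide_eq_true_eq] at ok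
    obtain ⟨oe, ox⟩ := ok
    simp only [Expr.ok, Bool.and_eq_true, decide_eq_true_eq] at oe
    obtain ⟨m1, h1, v1, f1⟩ := e.code_correct M hb 0 pc mem σ.out hc.left hr hs (by omega) oe.1
    have hr1 := hr.congr fun a ha => f1 a (by omega)
    have hx' := x.index_lt
    have h2 := M.step_op (c := ⟨_, m1, σ.out⟩) (o := .add) hc.right.head
      (by unfold Reg.cell; omega) (by unfold tempBase; omega) (by omega) (by
        simp only [Op.fn, hr1.zero, add_zero] at v1 ⊢
        rw [v1]
        exact M.lt_pow hx ox)
    simp only [Op.fn, hr1.zero, add_zero] at v1 h2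
    rw [v1] at h2
    refine ⟨_, _, ?_, (M.steps_trans h1 h2).trans ?_, hr1.set x _⟩
    · omega
    · simp [code, Nat.add_assoc]
  | store σ a e ha he h0 hlt hx =>
    simp only [Cmd.ok, Bool.and_eq_true] at ok
    obtain ⟨oa, oe⟩ := ok
    obtain ⟨m1, h1, v1, v1', hr1⟩ := condCode_correct M hb a e pc mem σ.out hc.left hr ha he oa oe
    simp only [Expr.ok, Bool.and_eq_true, decide_eq_true_eq] at oa oe
    have hW := M.hW
    have h2 := M.step_const (c := ⟨_, m1, σ.out⟩) (x := arrBase) hc.right.head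
      (by unfold tempBase; omega)
      (by unfold arrBase; rw [abs_of_nonneg (by norm_num)]; push_cast; omega)
    have e1 : tempBase ≠ tempBase + 2 := by omega
    have h3 := M.step_op (c := ⟨_, Function.update m1 (tempBase + 2) arrBase, σ.out⟩)
      (o := .add) hc.right.tail.head
      (by unfold tempBase; omega) (by unfold tempBase; omega) (by unfold tempBase; omega)
      (by
        simp only [Function.update_self, Function.update_of_ne e1, v1, Op.fn]
        rw [abs_of_nonneg (by unfold arrBase; push_cast; omega)]
        unfold arrBase; push_cast; omega)
    simp only [Function.update_self, Function.update_of_ne e1, v1, Op.fn] at h3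
    have e2 : (a.val E σ + (arrBase : ℕ)).toNat = arrBase + (a.val E σ).toNat := by
      unfold arrBase; omega
    have e3 : Function.update (Function.update m1 (tempBase + 2) arrBase) tempBase
        (a.val E σ + (arrBase : ℕ)) (tempBase + 1) = e.val E σ := by
      rw [Function.update_of_ne (by omega), Function.update_of_ne (by omega), v1']
    have h4 := M.step_store (c := ⟨_, Function.update (Function.update m1 (tempBase + 2)
        arrBase) tempBase (a.val E σ + (arrBase : ℕ)), σ.out⟩) hc.right.tail.tail.head
      (by unfold tempBase; omega) (by unfold tempBase; omega)
      (by simp only [Function.update_self]; unfold arrBase; omega)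
      (by simp only [Function.update_self, e2]; unfold arrBase; omega)
      (by
        simp only [e3]
        exact M.lt_pow (b := 1) (by simpa using hx) (by omega))
    simp only [Function.update_self, e2, e3] at h4
    refine ⟨_, _, ?_, (M.steps_trans h1 (M.steps_trans h2 (M.steps_trans h3 h4))).trans ?_,
      (hr1.congr (mem' := Function.update (Function.update m1 (tempBase + 2)
        arrBase) tempBase (a.val E σ + (arrBase : ℕ))) fun c hc => ?_).setArr _ _⟩
    · omega
    · simp [code, Nat.add_assoc, State.setArr]
    · rw [Function.update_of_ne (by unfold tempBase arrBase at *; omega),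
        Function.update_of_ne (by unfold tempBase arrBase at *; omega)]
  | emit σ e hs =>
    simp only [Cmd.ok, Expr.ok, Bool.and_eq_true, decide_eq_true_eq] at ok
    obtain ⟨m1, h1, v1, f1⟩ := e.code_correct M hb 0 pc mem σ.out hc.left hr hs (by omega) ok.1
    have hr1 := hr.congr fun a ha => f1 a (by omega)
    have h2 := M.step_write (c := ⟨_, m1, σ.out⟩) hc.right.head (by unfold tempBase; omega)
    rw [add_zero] at v1
    simp only [v1] at h2
    refine ⟨_, _, ?_, (M.steps_trans h1 h2).trans ?_, hr1.zero, hr1.reg, hr1.arr⟩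
    · omega
    · simp [code, Nat.add_assoc]
  | seq c d σ σ1 σ2 t t' hc1 hd1 ih1 ih2 =>
    simp only [Cmd.ok, Bool.and_eq_true] at ok
    obtain ⟨m1, t1, l1, s1, r1⟩ := ih1 hb ok.1 pc mem hc.left hr
    obtain ⟨m2, t2, l2, s2, r2⟩ := ih2 (hc1.bounded hb) ok.2 _ m1 hc.right r1
    refine ⟨m2, _, ?_, (M.steps_trans s1 s2).trans ?_, r2⟩
    · omega
    · simp [code, Nat.add_assoc]
  | iteTrue a b c d σ σ' t ha hb' hlt hc1 ih =>
    simp only [Cmd.ok, Bool.and_eq_true] at ok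
    obtain ⟨oa, ob, oc, od⟩ := ok
    obtain ⟨m1, h1, v1, v1', hr1⟩ := condCode_correct M hb a b pc mem σ.out hc.left hr ha hb' oa ob
    simp only [Expr.ok, Bool.and_eq_true, decide_eq_true_eq] at oa ob
    have h2 := M.step_jumpLT (c := ⟨_, m1, σ.out⟩) hc.right.head (by unfold tempBase; omega)
      (by unfold tempBase; omega)
    simp only [v1, v1', if_pos hlt] at h2
    have hcc := hc.right.right.right.right
    simp only [List.length_singleton, Nat.add_assoc] at hcc h2
    obtain ⟨m2, t2, l2, s2, r2⟩ := ih hb oc _ m1 hcc hr1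
    refine ⟨m2, _, ?_, (M.steps_trans h1 (M.steps_trans h2 s2)).trans ?_, r2⟩
    · omega
    · simp [code, Nat.add_assoc]
      try omega
  | iteFalse a b c d σ σ' t ha hb' hlt hc1 ih =>
    simp only [Cmd.ok, Bool.and_eq_true] at ok
    obtain ⟨oa, ob, oc, od⟩ := ok
    obtain ⟨m1, h1, v1, v1', hr1⟩ := condCode_correct M hb a b pc mem σ.out hc.left hr ha hb' oa ob
    simp only [Expr.ok, Bool.and_eq_true, decide_eq_true_eq] at oa ob
    have h2 := M.step_jumpLT (c := ⟨_, m1, σ.out⟩) hc.right.head (by unfold tempBase; omega)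
      (by unfold tempBase; omega)
    simp only [v1, v1', if_neg hlt] at h2
    obtain ⟨m2, t2, l2, s2, r2⟩ := ih hb od _ m1 hc.right.right.left hr1
    have h3 := M.step_jump (c := ⟨_, m2, σ'.out⟩) hc.right.right.right.head
    refine ⟨m2, _, ?_, (M.steps_trans h1 (M.steps_trans h2 (M.steps_trans s2 h3))).trans ?_, r2⟩
    · omega
    · simp [code, Nat.add_assoc]
      try omega
  | loopTrue a b c σ σ1 σ2 t t' ha hb' hlt hc1 hc2 ih1 ih2 =>
    have ok' := ok
    simp only [Cmd.ok, Bool.and_eq_true] at ok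
    obtain ⟨oa, ob, oc⟩ := ok
    obtain ⟨m1, h1, v1, v1', hr1⟩ := condCode_correct M hb a b pc mem σ.out hc.left hr ha hb' oa ob
    simp only [Expr.ok, Bool.and_eq_true, decide_eq_true_eq] at oa ob
    have h2 := M.step_jumpLT (c := ⟨_, m1, σ.out⟩) hc.right.head (by unfold tempBase; omega)
      (by unfold tempBase; omega)
    simp only [v1, v1', if_pos hlt] at h2
    obtain ⟨m2, t2, l2, s2, r2⟩ := ih1 hb oc _ m1 hc.right.right.left hr1
    have h3 := M.step_jump (c := ⟨_, m2, σ1.out⟩) hc.right.right.right.head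
    -- The last jump leads back to the head of the loop, so the remaining passes run the same code
    -- from the same line.
    obtain ⟨m3, t3, l3, s3, r3⟩ := ih2 (hc1.bounded hb) ok' pc m2 hc r2
    refine ⟨m3, _, ?_,
      (M.steps_trans h1 (M.steps_trans h2 (M.steps_trans s2 (M.steps_trans h3 s3)))), r3⟩
    omega
  | loopFalse a b c σ ha hb' hlt =>
    simp only [Cmd.ok, Bool.and_eq_true] at ok
    obtain ⟨oa, ob, oc⟩ := ok
    obtain ⟨m1, h1, v1, v1', hr1⟩ := condCode_correct M hb a b pc mem σ.out hc.left hr ha hb' oa ob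
    simp only [Expr.ok, Bool.and_eq_true, decide_eq_true_eq] at oa ob
    have h2 := M.step_jumpLT (c := ⟨_, m1, σ.out⟩) hc.right.head (by unfold tempBase; omega)
      (by unfold tempBase; omega)
    simp only [v1, v1', if_neg hlt] at h2
    have h3 := M.step_jump (c := ⟨_, m1, σ.out⟩) hc.right.left.tail.head
    refine ⟨m1, _, ?_, (M.steps_trans h1 (M.steps_trans h2 h3)).trans ?_, hr1⟩
    · omega
    · simp [code, Nat.add_assoc]
      try omega


/-! ## Reasoning about commands -/

instance : Add Expr := ⟨Expr.bin .add⟩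
instance : Sub Expr := ⟨Expr.bin .sub⟩
instance : Mul Expr := ⟨Expr.bin .mul⟩
instance : Div Expr := ⟨Expr.bin .div⟩
instance (c : ℕ) : OfNat Expr c := ⟨Expr.lit c⟩

/-- The content of a register. -/
abbrev rg (x : Reg) : Expr := Expr.reg x

/-- Sequential composition. -/
def block : List Cmd → Cmd
  | [] => .skip
  | c :: l => .seq c (block l)

/-- A conditional without alternative. -/
abbrev when (a b : Expr) (c : Cmd) : Cmd := .ite a b c .skip

section
variable {E : Env} {σ : State}

@[simp] theorem val_add (a b : Expr) : (a + b).val E σ = a.val E σ + b.val E σ := rfl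
@[simp] theorem val_sub (a b : Expr) : (a - b).val E σ = a.val E σ - b.val E σ := rfl
@[simp] theorem val_mul (a b : Expr) : (a * b).val E σ = a.val E σ * b.val E σ := rfl
@[simp] theorem val_div (a b : Expr) : (a / b).val E σ = a.val E σ / b.val E σ := rfl
@[simp] theorem val_two : (2 : Expr).val E σ = 2 := rfl
@[simp] theorem val_three : (3 : Expr).val E σ = 3 := rfl
@[simp] theorem val_five : (5 : Expr).val E σ = 5 := rfl
@[simp] theorem val_six : (6 : Expr).val E σ = 6 := rfl
@[simp] theorem val_lit (c : ℤ) : (Expr.lit c).val E σ = c := rfl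
@[simp] theorem val_zero : (0 : Expr).val E σ = 0 := rfl
@[simp] theorem val_one : (1 : Expr).val E σ = 1 := rfl
@[simp] theorem val_reg (x : Reg) : (Expr.reg x).val E σ = σ.reg x := rfl
@[simp] theorem val_rd (a : Expr) : (Expr.rd a).val E σ = E.inp.getD (a.val E σ).toNat 0 := rfl
@[simp] theorem val_ld (a : Expr) : (Expr.ld a).val E σ = σ.arr (a.val E σ).toNat := rfl
@[simp] theorem safe_add (a b : Expr) : (a + b).Safe E σ ↔ a.Safe E σ ∧ b.Safe E σ := Iff.rfl
@[simp] theorem safe_sub (a b : Expr) : (a - b).Safe E σ ↔ a.Safe E σ ∧ b.Safe E σ := Iff.rfl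
@[simp] theorem safe_mul (a b : Expr) : (a * b).Safe E σ ↔ a.Safe E σ ∧ b.Safe E σ := Iff.rfl
@[simp] theorem safe_div (a b : Expr) : (a / b).Safe E σ ↔ a.Safe E σ ∧ b.Safe E σ := Iff.rfl
@[simp] theorem safe_two : (2 : Expr).Safe E σ := trivial
@[simp] theorem safe_three : (3 : Expr).Safe E σ := trivial
@[simp] theorem safe_five : (5 : Expr).Safe E σ := trivial
@[simp] theorem safe_six : (6 : Expr).Safe E σ := trivial
@[simp] theorem safe_lit (c : ℤ) : (Expr.lit c).Safe E σ := trivial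
@[simp] theorem safe_zero : (0 : Expr).Safe E σ := trivial
@[simp] theorem safe_one : (1 : Expr).Safe E σ := trivial
@[simp] theorem safe_reg (x : Reg) : (Expr.reg x).Safe E σ := trivial
@[simp] theorem safe_rd (a : Expr) : (Expr.rd a).Safe E σ ↔
    a.Safe E σ ∧ 0 ≤ a.val E σ ∧ (a.val E σ).toNat < E.inp.length := Iff.rfl
@[simp] theorem safe_ld (a : Expr) : (Expr.ld a).Safe E σ ↔
    a.Safe E σ ∧ 0 ≤ a.val E σ ∧ (a.val E σ).toNat < E.N := Iff.rfl
end

/-! ### Total correctness with time bounds. -/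

/-- The command `c` leads in at most `T` elementary steps to a state that satisfies `Q`. -/
def wp (E : Env) (c : Cmd) (T : ℕ) (Q : State → Prop) (σ : State) : Prop :=
  Bounded E σ → ∃ σ' t, Exec E c σ t σ' ∧ t ≤ T ∧ Q σ'

section
variable {E : Env} {c d : Cmd} {T T' T₁ T₂ : ℕ} {Q Q' : State → Prop} {σ : State}

theorem wp.mono (h : wp E c T Q σ) (hT : T ≤ T') (hQ : ∀ σ', Q σ' → Q' σ') : wp E c T' Q' σ :=
  fun hb => by
    obtain ⟨σ', t, h1, h2, h3⟩ := h hb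
    exact ⟨σ', t, h1, h2.trans hT, hQ _ h3⟩

theorem wp_skip (h : Q σ) : wp E .skip T Q σ := fun _ => ⟨σ, 0, .skip σ, by simp, h⟩

theorem wp_nil (h : Q σ) : wp E (block []) T Q σ := wp_skip h

/-- The syntactic size settles the overflow question here. The variant `wp_set_of_lt` serves
counters such as `i := i + 1`, whose syntactic size exceeds that of their register. -/
theorem wp_set {x : Reg} {e : Expr} (hs : e.Safe E σ) (hb : e.bits ≤ x.bits)
    (h : Q (σ.set x (e.val E σ))) : wp E (.set x e) (T + 1) Q σ := fun hB =>
  ⟨_, 1, .set σ x e hs ((e.abs_val_lt hB).trans_le (two_pow_mono hb)), by simp, h⟩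

theorem wp_set_of_lt {x : Reg} {e : Expr} (hs : e.Safe E σ)
    (hb : |e.val E σ| < 2 ^ (x.bits * E.w)) (h : Q (σ.set x (e.val E σ))) :
    wp E (.set x e) (T + 1) Q σ := fun _ => ⟨_, 1, .set σ x e hs hb, by simp, h⟩

theorem wp_store {a e : Expr} (ha : a.Safe E σ) (he : e.Safe E σ) (h0 : 0 ≤ a.val E σ)
    (hN : (a.val E σ).toNat < E.N) (hv : |e.val E σ| < 2 ^ E.w)
    (h : Q (σ.setArr (a.val E σ).toNat (e.val E σ))) : wp E (.store a e) (T + 1) Q σ :=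
  fun _ => ⟨_, 1, .store σ a e ha he h0 hN hv, by simp, h⟩

theorem wp_emit {e : Expr} (he : e.Safe E σ) (h : Q (σ.emit (e.val E σ))) :
    wp E (.emit e) (T + 1) Q σ := fun _ => ⟨_, 1, .emit σ e he, by simp, h⟩

theorem wp_seq (h : wp E c T₁ (fun σ' => wp E d T₂ Q σ') σ) (hT : T₁ + T₂ ≤ T) :
    wp E (.seq c d) T Q σ := fun hb => by
  obtain ⟨σ₁, t₁, h1, h2, h3⟩ := h hb
  obtain ⟨σ₂, t₂, h4, h5, h6⟩ := h3 (h1.bounded hb)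
  exact ⟨σ₂, _, .seq _ _ _ _ _ _ _ h1 h4, by omega, h6⟩

theorem wp_cons {l : List Cmd} (h : wp E c T₁ (fun σ' => wp E (block l) T₂ Q σ') σ)
    (hT : T₁ + T₂ ≤ T) : wp E (block (c :: l)) T Q σ := wp_seq h hT

theorem wp_cons_set {x : Reg} {e : Expr} {l : List Cmd} (hs : e.Safe E σ)
    (hb : e.bits ≤ x.bits) (h : wp E (block l) T Q (σ.set x (e.val E σ))) :
    wp E (block (.set x e :: l)) (T + 1) Q σ :=
  wp_cons (T₁ := 1) (wp_set hs hb h) (by omega)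

theorem wp_ite {a b : Expr} (ha : a.Safe E σ) (hb : b.Safe E σ)
    (h1 : a.val E σ < b.val E σ → wp E c T Q σ) (h2 : ¬ a.val E σ < b.val E σ → wp E d T Q σ) :
    wp E (.ite a b c d) (T + 1) Q σ := fun hB => by
  by_cases h : a.val E σ < b.val E σ
  · obtain ⟨σ', t, h3, h4, h5⟩ := h1 h hB
    exact ⟨σ', _, .iteTrue _ _ _ _ _ _ _ ha hb h h3, by omega, h5⟩
  · obtain ⟨σ', t, h3, h4, h5⟩ := h2 h hB
    exact ⟨σ', _, .iteFalse _ _ _ _ _ _ _ ha hb h h3, by omega, h5⟩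

/-- The invariant is indexed by fuel that drops in every pass, so the fuel bounds the number of
passes; each costs its body and one test, and the last test is added. -/
theorem wp_loop {a b : Expr} (I : ℕ → State → Prop)
    (hI : ∀ f σ, I f σ → a.Safe E σ ∧ b.Safe E σ ∧
      (a.val E σ < b.val E σ → 0 < f ∧ wp E c T (fun σ' => ∃ f', f' < f ∧ I f' σ') σ))
    (f : ℕ) (σ : State) (h : I f σ) :
    wp E (.loop a b c) (f * (T + 1) + 1)
      (fun σ' => (∃ f', I f' σ') ∧ ¬ a.val E σ' < b.val E σ') σ := by
  induction f using Nat.strong_induction_on generalizing σ with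
  | _ f ih =>
    intro hB
    obtain ⟨ha, hb, hc⟩ := hI f σ h
    by_cases hlt : a.val E σ < b.val E σ
    · obtain ⟨hf, hw⟩ := hc hlt
      obtain ⟨σ₁, t₁, e1, l1, f', hf', i1⟩ := hw hB
      obtain ⟨σ₂, t₂, e2, l2, q2⟩ := ih f' hf' σ₁ i1 (e1.bounded hB)
      refine ⟨σ₂, _, .loopTrue _ _ _ _ _ _ _ _ ha hb hlt e1 e2, ?_, q2⟩
      have : (f' + 1) * (T + 1) ≤ f * (T + 1) := Nat.mul_le_mul_right _ hf'
      nlinarith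
    · exact ⟨σ, 1, .loopFalse _ _ _ _ ha hb hlt, by omega, ⟨f, h⟩, hlt⟩
end

/-! ### Frames: what a command leaves unchanged. -/

/-- The registers of level at least `l` agree. -/
def SameReg (l : ℕ) (σ σ' : State) : Prop := ∀ x : Reg, l ≤ x.level → σ'.reg x = σ.reg x

/-- The registers of level at least `l`, the array and the output agree. -/
structure Same (l : ℕ) (σ σ' : State) : Prop where
  reg : SameReg l σ σ'
  arr : σ'.arr = σ.arr
  out : σ'.out = σ.out

theorem SameReg.refl (l : ℕ) (σ : State) : SameReg l σ σ := fun _ _ => rfl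
theorem SameReg.trans {l : ℕ} {σ σ' σ'' : State} (h : SameReg l σ σ') (h' : SameReg l σ' σ'') :
    SameReg l σ σ'' := fun x hx => (h' x hx).trans (h x hx)
theorem SameReg.mono {l l' : ℕ} {σ σ' : State} (h : SameReg l σ σ') (hl : l ≤ l') :
    SameReg l' σ σ' := fun x hx => h x (hl.trans hx)
theorem SameReg.set {l : ℕ} {σ σ' : State} (h : SameReg l σ σ') {x : Reg} {v : ℤ}
    (hx : x.level < l) : SameReg l σ (σ'.set x v) := fun y hy => by
  rw [State.set_reg, if_neg (by rintro rfl; omega), h y hy]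
theorem SameReg.setArr {l : ℕ} {σ σ' : State} (h : SameReg l σ σ') {a : ℕ} {v : ℤ} :
    SameReg l σ (σ'.setArr a v) := h
theorem Same.refl (l : ℕ) (σ : State) : Same l σ σ := ⟨.refl l σ, rfl, rfl⟩
theorem Same.trans {l : ℕ} {σ σ' σ'' : State} (h : Same l σ σ') (h' : Same l σ' σ'') :
    Same l σ σ'' := ⟨h.reg.trans h'.reg, h'.arr.trans h.arr, h'.out.trans h.out⟩
theorem Same.mono {l l' : ℕ} {σ σ' : State} (h : Same l σ σ') (hl : l ≤ l') :
    Same l' σ σ' := ⟨h.reg.mono hl, h.arr, h.out⟩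
theorem Same.set {l : ℕ} {σ σ' : State} (h : Same l σ σ') {x : Reg} {v : ℤ}
    (hx : x.level < l) : Same l σ (σ'.set x v) := ⟨h.reg.set hx, h.arr, h.out⟩

/-! ## Tournament trees -/

/-- `v` is `0` if no element of `S` is a candidate, and otherwise `e + 1` for a candidate `e` in `S`
with smallest key. -/
def Best (cand : ℕ → Prop) (key : ℕ → ℝ) (S : ℕ → Prop) (v : ℤ) : Prop :=
  (v = 0 ∧ ∀ e, S e → ¬ cand e) ∨
    ∃ e : ℕ, v = e + 1 ∧ S e ∧ cand e ∧ ∀ e', S e' → cand e' → key e ≤ key e'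

/-- The element `e` belongs to a block whose leaf is in the subtree of `node`. -/
def Below (s B node e : ℕ) : Prop := ∃ j, (s + e / B) / 2 ^ j = node

/-- The cells `3 * node + τ` form a tournament tree, which is correct at all nodes without dirty
elements in their subtrees. -/
def TreeOK (n s B τ : ℕ) (cand : ℕ → Prop) (key : ℕ → ℝ) (dirty : ℕ → Prop) (arr : ℕ → ℤ) : Prop :=
  ∀ node, 1 ≤ node → node < 2 * s → (0 ≤ arr (3 * node + τ) ∧ arr (3 * node + τ) ≤ n) ∧
    ((∀ e, e < n → Below s B node e → ¬ dirty e) →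
      Best cand key (fun e => e < n ∧ Below s B node e) (arr (3 * node + τ)))

/-- The cells of the other trees agree. -/
def SameArr (τ : ℕ) (arr arr' : ℕ → ℤ) : Prop := ∀ a, a % 3 ≠ τ → arr' a = arr a

/-- Only the order of the keys of candidates matters, not their values. This is what lets a tree
survive a rotation of the ray, which changes all keys. -/
theorem Best.congr {cand cand' : ℕ → Prop} {key key' : ℕ → ℝ} {S S' : ℕ → Prop} {v : ℤ}
    (h : Best cand key S v) (hS : ∀ e, S' e ↔ S e) (hc : ∀ e, S e → (cand' e ↔ cand e))
    (hk : ∀ e e', S e → S e' → cand e → cand e' → key e ≤ key e' → key' e ≤ key' e') :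
    Best cand' key' S' v := by
  rcases h with ⟨h1, h2⟩ | ⟨e, h1, h2, h3, h4⟩
  · exact Or.inl ⟨h1, fun e he => by rw [hc e ((hS e).1 he)]; exact h2 e ((hS e).1 he)⟩
  · refine Or.inr ⟨e, h1, (hS e).2 h2, (hc e h2).2 h3, fun e' he' hc' => ?_⟩
    have h5 := (hS e').1 he'
    have h6 := (hc e' h5).1 hc'
    exact hk e e' h2 h5 h3 h6 (h4 e' h5 h6)

theorem Best.nonneg {cand : ℕ → Prop} {key : ℕ → ℝ} {S : ℕ → Prop} {v : ℤ}
    (h : Best cand key S v) : 0 ≤ v := by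
  rcases h with ⟨h1, _⟩ | ⟨e, h1, _⟩ <;> omega

/-- Elements whose candidacy may have changed are declared dirty. A node without dirty elements
below it keeps its winner, and no memory has to be touched. -/
theorem TreeOK.congr {n s B τ : ℕ} {cand cand' : ℕ → Prop} {key key' : ℕ → ℝ}
    {dirty dirty' : ℕ → Prop} {arr : ℕ → ℤ} (h : TreeOK n s B τ cand key dirty arr)
    (hd : ∀ e, e < n → ¬ dirty' e → ¬ dirty e)
    (hc : ∀ e, e < n → ¬ dirty' e → (cand' e ↔ cand e))
    (hk : ∀ e e', e < n → e' < n → ¬ dirty' e → ¬ dirty' e' → cand e → cand e' →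
      key e ≤ key e' → key' e ≤ key' e') :
    TreeOK n s B τ cand' key' dirty' arr := fun node h1 h2 => by
  obtain ⟨h3, h4⟩ := h node h1 h2
  refine ⟨h3, fun h5 => (h4 fun e he hb => hd e he (h5 e he hb)).congr (fun _ => Iff.rfl)
    (fun e he => hc e he.1 (h5 e he.1 he.2)) fun e e' he he' => ?_⟩
  exact hk e e' he.1 he'.1 (h5 e he.1 he.2) (h5 e' he'.1 he'.2)

/-- The three trees are interleaved modulo 3, so writing to one of them leaves the others alone. -/
theorem TreeOK.sameArr {n s B τ τ' : ℕ} {cand : ℕ → Prop} {key : ℕ → ℝ}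
    {dirty : ℕ → Prop} {arr arr' : ℕ → ℤ} (h : TreeOK n s B τ cand key dirty arr)
    (hτ : τ % 3 ≠ τ') (ha : SameArr τ' arr arr') : TreeOK n s B τ cand key dirty arr' :=
  fun node h1 h2 => by
    rw [ha _ (by omega)]
    exact h node h1 h2

/-- Every positive leaf number reaches 1 by halving; `s` need not be a power of two. -/
theorem below_root (s B e : ℕ) (hs : 1 ≤ s) : Below s B 1 e := by
  refine ⟨Nat.log 2 (s + e / B), ?_⟩
  have h0 : s + e / B ≠ 0 := by have := Nat.zero_le (e / B); positivity
  have h1 := Nat.pow_log_le_self 2 h0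
  have h2 := Nat.lt_pow_succ_log_self (b := 2) (by norm_num) (s + e / B)
  apply le_antisymm
  · rw [← Nat.lt_succ_iff, Nat.div_lt_iff_lt_mul (by positivity)]
    rw [pow_succ] at h2
    omega
  · rw [Nat.one_le_div_iff (by positivity)]
    exact h1

/-- The root is node 1, so for the vertices, the predecessors and the successors the winners stand
in cells 3, 4 and 5. -/
theorem TreeOK.root {n s B τ : ℕ} {cand : ℕ → Prop} {key : ℕ → ℝ}
    {dirty : ℕ → Prop} {arr : ℕ → ℤ} (h : TreeOK n s B τ cand key dirty arr) (hs : 1 ≤ s)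
    (hd : ∀ e, e < n → ¬ dirty e) : Best cand key (fun e => e < n) (arr (3 + τ)) :=
  ((h 1 le_rfl (by omega)).2 fun e he _ => hd e he).congr
    (fun e => ⟨fun he => ⟨he, below_root s B e hs⟩, fun he => he.1⟩) (fun _ _ => Iff.rfl)
    fun _ _ _ _ _ _ h => h

/-- The specification of a command that computes the key `kA / kD` of the element in register `i`,
and whether this element is active. -/
structure LoadSpec (E : Env) (load : Cmd) (ctx : State → Prop) (n : ℕ) (act : ℕ → Prop)
    (kA kD : ℕ → ℤ) : Prop where
  spec : ∀ σ (i : ℕ), ctx σ → i < n → σ.reg .i = i →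
    wp E load 30 (fun σ' => (act i → σ'.reg .act = 1) ∧ (¬ act i → σ'.reg .act = 0) ∧
      σ'.reg .A = kA i ∧ σ'.reg .D = kD i ∧ Same 1 σ σ') σ
  pos : ∀ i, i < n → act i → 0 < kD i
  ctx_same : ∀ σ σ', ctx σ → SameReg 3 σ σ' → ctx σ'

/-- The candidate in register `i` becomes the best one. -/
def takeCmd : Cmd := block [.set .best (rg .i + 1), .set .bA (rg .A), .set .bD (rg .D)]

/-- One step of the scan of a block. -/
def scanBody (load : Cmd) (tA tD : Reg) : Cmd := block [load,
  when 0 (rg .act) (when (rg tA * rg .D) (rg .A * rg tD)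
    (.ite (rg .best) 1 takeCmd (when (rg .A * rg .bD) (rg .bA * rg .D) takeCmd))),
  .set .i (rg .i + 1)]

/-- The scan of the block in register `b`. -/
def scanCmd (load : Cmd) (tA tD : Reg) : Cmd := block [
  .set .best 0, .set .i (rg .b * rg .B), .set .hi (rg .i + rg .B),
  when (rg .n) (rg .hi) (.set .hi (rg .n)),
  .loop (rg .i) (rg .hi) (scanBody load tA tD)]

/-- One step of the way from a leaf to the root. -/
def climbBody (load : Cmd) (τ : ℕ) : Cmd := block [
  .set .node (rg .node / 2),
  .set .lft (.ld (3 * (2 * rg .node) + .lit τ)),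
  .set .rgt (.ld (3 * (2 * rg .node + 1) + .lit τ)),
  .set .best (rg .lft),
  when 0 (rg .rgt) (.ite (rg .lft) 1 (.set .best (rg .rgt))
    (block [.set .i (rg .lft - 1), load, .set .bA (rg .A), .set .bD (rg .D),
      .set .i (rg .rgt - 1), load,
      when (rg .A * rg .bD) (rg .bA * rg .D) (.set .best (rg .rgt))])),
  .store (3 * rg .node + .lit τ) (rg .best)]

/-- Recompute the leaf of the block in register `b` and its ancestors. -/
def refreshCmd (load : Cmd) (tA tD : Reg) (τ : ℕ) : Cmd := block [
  scanCmd load tA tD,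
  .set .node (rg .s + rg .b),
  .store (3 * rg .node + .lit τ) (rg .best),
  .loop 1 (rg .node) (climbBody load τ)]


/-! ### Scanning the block of a leaf. -/

/-- The parameters of a tournament tree: `n` elements in `s` blocks of length `B`. -/
structure Sizes (E : Env) (n s B : ℕ) : Prop where
  s_pos : 1 ≤ s
  B_pos : 1 ≤ B
  n_le : n ≤ s * B
  n_lt : n < 2 ^ E.w
  N_le : 6 * s ≤ E.N

/-- A candidate is an active element beyond the threshold. -/
def Cand (act : ℕ → Prop) (kA kD : ℕ → ℤ) (zA zD : ℤ) (e : ℕ) : Prop :=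
  act e ∧ zA * kD e < kA e * zD

/-- The key of an element. -/
noncomputable def ratio (kA kD : ℕ → ℤ) (e : ℕ) : ℝ := (kA e : ℝ) / kD e

/-- Positive denominators make keys comparable by integer products; this is why every specification
of a key includes a sign condition on the denominator. -/
theorem ratio_lt {kA kD : ℕ → ℤ} {e f : ℕ} (he : 0 < kD e) (hf : 0 < kD f) :
    ratio kA kD e < ratio kA kD f ↔ kA e * kD f < kA f * kD e := by
  unfold ratio
  rw [div_lt_div_iff₀ (by exact_mod_cast he) (by exact_mod_cast hf)]
  exact_mod_cast Iff.rfl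

/-- The context in which the key data are computed. -/
structure TreeCtx (E : Env) (load : Cmd) (tA tD : Reg) (ctx : State → Prop) (n s B : ℕ)
    (act : ℕ → Prop) (kA kD : ℕ → ℤ) (zA zD : ℤ) : Prop where
  sizes : Sizes E n s B
  load : LoadSpec E load ctx n act kA kD
  regs : ∀ σ, ctx σ → σ.reg .n = n ∧ σ.reg .s = s ∧ σ.reg .B = B ∧ σ.reg tA = zA ∧ σ.reg tD = zD

section
variable {E : Env} {load : Cmd} {tA tD : Reg} {ctx : State → Prop} {n s B : ℕ}
  {act : ℕ → Prop} {kA kD : ℕ → ℤ} {zA zD : ℤ}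

/-- The state of the scan of a block before element `i`. -/
structure ScanInv (n B b : ℕ) (act : ℕ → Prop) (kA kD : ℕ → ℤ) (zA zD : ℤ) (σ₀ : State) (f : ℕ)
    (σ : State) (i : ℕ) : Prop where
  reg_i : σ.reg .i = i
  lower : b * B ≤ i
  hi : σ.reg .hi = (min n (b * B + B) : ℕ)
  fuel : min n (b * B + B) - i ≤ f
  same : Same 2 σ₀ σ
  best : Best (Cand act kA kD zA zD) (ratio kA kD) (fun e => e < n ∧ e / B = b ∧ e < i)
    (σ.reg .best)
  keys : ∀ e : ℕ, σ.reg .best = e + 1 → σ.reg .bA = kA e ∧ σ.reg .bD = kD e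

theorem Nat.div_eq_iff_bounds {e B b : ℕ} (hB : 1 ≤ B) :
    e / B = b ↔ b * B ≤ e ∧ e < b * B + B := by
  rw [Nat.div_eq_iff hB]
  constructor <;> rintro ⟨h1, h2⟩ <;> constructor <;> omega

theorem best_step_skip {cand : ℕ → Prop} {key : ℕ → ℝ} {S S' : ℕ → Prop} {v : ℤ} {i : ℕ}
    (h : Best cand key S v) (hS : ∀ e, S' e ↔ S e ∨ e = i)
    (hi : ¬ cand i ∨ ∃ e : ℕ, v = e + 1 ∧ key e ≤ key i) : Best cand key S' v := by
  rcases h with ⟨h1, h2⟩ | ⟨e, h1, h2, h3, h4⟩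
  · rcases hi with hi | ⟨e, he, _⟩
    · refine Or.inl ⟨h1, fun e he => ?_⟩
      rcases (hS e).1 he with h | rfl
      · exact h2 e h
      · exact hi
    · omega
  · refine Or.inr ⟨e, h1, (hS e).2 (Or.inl h2), h3, fun e' he' hc' => ?_⟩
    rcases (hS e').1 he' with h | rfl
    · exact h4 e' h hc'
    · rcases hi with hi | ⟨e'', he, hk⟩
      · exact absurd hc' hi
      · have : e'' = e := by omega
        rwa [this] at hk

theorem best_step_take {cand : ℕ → Prop} {key : ℕ → ℝ} {S S' : ℕ → Prop} {v : ℤ} {i : ℕ}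
    (h : Best cand key S v) (hS : ∀ e, S' e ↔ S e ∨ e = i) (hc : cand i)
    (hi : ∀ e : ℕ, v = e + 1 → key i ≤ key e) : Best cand key S' (i + 1) := by
  refine Or.inr ⟨i, rfl, (hS i).2 (Or.inr rfl), hc, fun e' he' hc' => ?_⟩
  rcases (hS e').1 he' with h' | rfl
  · rcases h with ⟨h1, h2⟩ | ⟨e, h1, h2, h3, h4⟩
    · exact absurd hc' (h2 e' h')
    · exact (hi e h1).trans (h4 e' h' hc')
  · exact le_rfl

theorem Best.le {cand : ℕ → Prop} {key : ℕ → ℝ} {S : ℕ → Prop} {v : ℤ}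
    (h : Best cand key S v) (hS : ∀ e, S e → e < n) : v ≤ n := by
  rcases h with ⟨h1, _⟩ | ⟨e, h1, h2, _⟩
  · omega
  · have := hS e h2
    omega

theorem wp_take {σ : State} {T : ℕ} {Q : State → Prop} (hT : 3 ≤ T)
    (hQ : Q (((σ.set .best (σ.reg .i + 1)).set .bA (σ.reg .A)).set .bD (σ.reg .D))) :
    wp E takeCmd T Q σ := by
  obtain ⟨T, rfl⟩ := Nat.exists_eq_add_of_le' hT
  refine wp_cons_set (T := T + 2) (by simp) (by decide) ?_
  refine wp_cons_set (T := T + 1) (by simp) (by decide) ?_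
  refine wp_cons_set (T := T) (by simp) (by decide) (wp_nil ?_)
  simpa using hQ

theorem wp_scanBody (C : TreeCtx E load tA tD ctx n s B act kA kD zA zD) {b f : ℕ} {σ₀ σ : State}
    (h₀ : ctx σ₀) {i : ℕ} (h : ScanInv n B b act kA kD zA zD σ₀ f σ i)
    (hi : i < min n (b * B + B)) :
    wp E (scanBody load tA tD) 40
      (fun σ' => ∃ f', f' < f ∧ ScanInv n B b act kA kD zA zD σ₀ f' σ' (i + 1)) σ := by
  have hB := C.sizes.B_pos
  have hib : i / B = b := (Nat.div_eq_iff_bounds hB).2 ⟨h.lower, by omega⟩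
  have hS : ∀ e, (e < n ∧ e / B = b ∧ e < i + 1) ↔ (e < n ∧ e / B = b ∧ e < i) ∨ e = i := by
    intro e
    constructor
    · rintro ⟨h1, h2, h3⟩
      by_cases he : e = i
      · exact Or.inr he
      · exact Or.inl ⟨h1, h2, by omega⟩
    · rintro (⟨h1, h2, h3⟩ | rfl)
      · exact ⟨h1, h2, by omega⟩
      · exact ⟨by omega, hib, by omega⟩
  have hctx := C.load.ctx_same σ₀ σ h₀ (h.same.reg.mono (by norm_num))
  refine wp_cons (T₁ := 30) (T₂ := 10) (C.load.spec σ i hctx (by omega) h.reg_i |>.mono le_rfl ?_)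
    (by norm_num)
  rintro σ₁ ⟨ha1, ha0, hA, hD, hs1⟩
  have hs1' : Same 2 σ₀ σ₁ := h.same.trans (hs1.mono (by norm_num))
  have hr := C.regs σ₁ (C.load.ctx_same σ₀ σ₁ h₀ (hs1'.reg.mono (by norm_num)))
  have hi1 : σ₁.reg .i = i := (hs1.reg .i (by decide)).trans h.reg_i
  have hhi : σ₁.reg .hi = (min n (b * B + B) : ℕ) := (hs1.reg .hi (by decide)).trans h.hi
  have hbest : σ₁.reg .best = σ.reg .best := hs1.reg .best (by decide)
  have hbA : σ₁.reg .bA = σ.reg .bA := hs1.reg .bA (by decide)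
  have hbD : σ₁.reg .bD = σ.reg .bD := hs1.reg .bD (by decide)
  have hlast : ∀ σ₂ : State, σ₂.reg .i = i → σ₂.reg .hi = (min n (b * B + B) : ℕ) →
      Same 2 σ₀ σ₂ →
      Best (Cand act kA kD zA zD) (ratio kA kD) (fun e => e < n ∧ e / B = b ∧ e < i + 1)
        (σ₂.reg .best) →
      (∀ e : ℕ, σ₂.reg .best = e + 1 → σ₂.reg .bA = kA e ∧ σ₂.reg .bD = kD e) →
      wp E (block [.set .i (rg .i + 1)]) 1
        (fun σ' => ∃ f', f' < f ∧ ScanInv n B b act kA kD zA zD σ₀ f' σ' (i + 1)) σ₂ := by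
    intro σ₂ g1 g2 g3 g4 g5
    -- The counter stays at most `n`, which is an input word; its syntactic size alone would not
    -- fit.
    refine wp_cons (T₁ := 1) (T₂ := 0) (wp_set_of_lt (by simp) ?_ (wp_nil ?_)) (by norm_num)
    · simp only [val_add, val_reg, val_one, g1]
      have h1 := C.sizes.n_lt
      have h2 : (2 : ℤ) ^ E.w ≤ 2 ^ (Reg.i.bits * E.w) :=
        pow_le_pow_right₀ (by norm_num) (Nat.le_mul_of_pos_left _ (by decide))
      have h3 : (n : ℤ) < 2 ^ E.w := by exact_mod_cast h1
      rw [abs_of_nonneg (by omega)]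
      omega
    · refine ⟨f - 1, by have := h.fuel; omega, ?_, by have := h.lower; omega, ?_, ?_, ?_, ?_, ?_⟩
      · simp [g1]
      · simpa using g2
      · have := h.fuel; omega
      · exact g3.set (by decide)
      · simpa using g4
      · simpa using g5
  have hno : ¬ Cand act kA kD zA zD i →
      Best (Cand act kA kD zA zD) (ratio kA kD) (fun e => e < n ∧ e / B = b ∧ e < i + 1)
        (σ₁.reg .best) := fun hc => by
    rw [hbest]
    exact best_step_skip h.best hS (Or.inl hc)
  have hkeys : ∀ e : ℕ, σ₁.reg .best = e + 1 → σ₁.reg .bA = kA e ∧ σ₁.reg .bD = kD e := by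
    rw [hbest, hbA, hbD]
    exact h.keys
  have htake : Cand act kA kD zA zD i →
      (∀ e : ℕ, σ.reg .best = e + 1 → ratio kA kD i ≤ ratio kA kD e) →
      wp E takeCmd 3 (fun σ' => wp E (block [.set .i (rg .i + 1)]) 1
        (fun σ' => ∃ f', f' < f ∧ ScanInv n B b act kA kD zA zD σ₀ f' σ' (i + 1)) σ') σ₁ := by
    intro hc hle
    refine wp_take le_rfl (hlast _ (by simp [hi1]) (by simp [hhi]) ?_ ?_ ?_)
    · exact ((hs1'.set (by decide)).set (by decide)).set (by decide)
    · simp only [State.set_reg, reduceCtorEq, if_false, if_true, hi1]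
      exact best_step_take h.best hS hc hle
    · intro e he
      simp only [State.set_reg, reduceCtorEq, if_false, if_true, hi1] at he ⊢
      have : e = i := by omega
      rw [this, hA, hD]
      simp
  have hskip : ¬ Cand act kA kD zA zD i → ∀ T, wp E .skip T
      (fun σ' => wp E (block [.set .i (rg .i + 1)]) 1
        (fun σ' => ∃ f', f' < f ∧ ScanInv n B b act kA kD zA zD σ₀ f' σ' (i + 1)) σ') σ₁ :=
    fun hc T => wp_skip (hlast σ₁ hi1 hhi hs1' (hno hc) hkeys)
  refine wp_cons (T₁ := 9) (T₂ := 1) ?_ (by norm_num)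
  refine wp_ite (T := 8) (by simp) (by simp) (fun h1 => ?_) (fun h1 => ?_)
  · have hact : act i := by
      by_contra hcon
      simp [ha0 hcon] at h1
    have hDi := C.load.pos i (by omega) hact
    refine wp_ite (T := 7) (by simp) (by simp) (fun h2 => ?_) (fun h2 => ?_)
    · simp only [val_mul, val_reg, hr.2.2.2.1, hr.2.2.2.2, hA, hD] at h2
      have hc : Cand act kA kD zA zD i := ⟨hact, h2⟩
      refine wp_ite (T := 6) (by simp) (by simp) (fun h3 => ?_) (fun h3 => ?_)
      · refine (htake hc fun e he => ?_).mono (by norm_num) fun _ h => h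
        simp [hbest, he] at h3
        omega
      · simp only [val_reg, val_one, hbest] at h3
        have hb := h.best
        rcases hb with ⟨hb1, _⟩ | ⟨e, hb1, hb2, hb3, hb4⟩
        · omega
        obtain ⟨k1, k2⟩ := h.keys e hb1
        have hDe := C.load.pos e hb2.1 hb3.1
        refine wp_ite (T := 5) (by simp) (by simp) (fun h4 => ?_) (fun h4 => ?_)
        · simp only [val_mul, val_reg, hA, hD, hbA, hbD, k1, k2] at h4
          rw [← ratio_lt hDi hDe] at h4
          refine (htake hc fun e' he' => ?_).mono (by norm_num) fun _ h => h
          have : e' = e := by omega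
          rw [this]
          exact h4.le
        · simp only [val_mul, val_reg, hA, hD, hbA, hbD, k1, k2] at h4
          rw [← ratio_lt hDi hDe] at h4
          refine wp_skip (hlast σ₁ hi1 hhi hs1' ?_ hkeys)
          rw [hbest]
          exact best_step_skip h.best hS (Or.inr ⟨e, hb1, not_lt.1 h4⟩)
    · simp only [val_mul, val_reg, hr.2.2.2.1, hr.2.2.2.2, hA, hD] at h2
      exact hskip (fun hc => h2 hc.2) _
  · refine hskip (fun hc => h1 ?_) _
    simp [ha1 hc.1]

theorem wp_scan (C : TreeCtx E load tA tD ctx n s B act kA kD zA zD) {b : ℕ} {σ : State}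
    (hctx : ctx σ) (hb : σ.reg .b = b) :
    wp E (scanCmd load tA tD) (41 * B + 6)
      (fun σ' => Same 2 σ σ' ∧ Best (Cand act kA kD zA zD) (ratio kA kD)
        (fun e => e < n ∧ e / B = b) (σ'.reg .best)) σ := by
  have hB := C.sizes.B_pos
  obtain ⟨hn, -, hBr, -, -⟩ := C.regs σ hctx
  refine wp_cons_set (T := 41 * B + 5) (by simp) (by decide) ?_
  refine wp_cons_set (T := 41 * B + 4) (by simp) (by decide) ?_
  refine wp_cons_set (T := 41 * B + 3) (by simp) (by decide) ?_
  simp only [val_mul, val_add, val_reg, val_zero, State.set_reg, reduceCtorEq, if_false, if_true,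
    hb, hBr]
  have hloop : ∀ σ₁ : State, ScanInv n B b act kA kD zA zD σ B σ₁ (b * B) →
      wp E (block [.loop (rg .i) (rg .hi) (scanBody load tA tD)]) (41 * B + 1)
        (fun σ' => Same 2 σ σ' ∧ Best (Cand act kA kD zA zD) (ratio kA kD)
        (fun e => e < n ∧ e / B = b) (σ'.reg .best)) σ₁ := by
    intro σ₁ h1
    refine wp_cons (T₁ := B * (40 + 1) + 1) (T₂ := 0)
      ((wp_loop (T := 40) (fun f σ' => ∃ i, ScanInv n B b act kA kD zA zD σ f σ' i) ?_ B σ₁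
        ⟨_, h1⟩).mono le_rfl ?_) (by omega)
    · rintro f σ' ⟨i, h⟩
      refine ⟨by simp, by simp, fun hlt => ?_⟩
      simp only [val_reg, h.reg_i, h.hi] at hlt
      have hlt' : i < min n (b * B + B) := by exact_mod_cast hlt
      refine ⟨by have := h.fuel; omega, (wp_scanBody C hctx h hlt').mono le_rfl ?_⟩
      rintro σ'' ⟨f', h1, h2⟩
      exact ⟨f', h1, _, h2⟩
    · rintro σ' ⟨⟨f', i, h⟩, hlt⟩
      simp only [val_reg, h.reg_i, h.hi] at hlt
      have hlt' : ¬ i < min n (b * B + B) := by exact_mod_cast hlt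
      refine wp_nil ⟨h.same, h.best.congr (fun e => ?_) (fun _ _ => Iff.rfl)
        fun _ _ _ _ _ _ h => h⟩
      rw [Nat.div_eq_iff_bounds hB]
      constructor
      · rintro ⟨h1, h2⟩
        exact ⟨h1, h2, by omega⟩
      · rintro ⟨h1, h2, _⟩
        exact ⟨h1, h2⟩
  have hbest0 : Best (Cand act kA kD zA zD) (ratio kA kD)
      (fun e => e < n ∧ e / B = b ∧ e < b * B) 0 := by
    refine Or.inl ⟨rfl, fun e he => ?_⟩
    have := (Nat.div_eq_iff_bounds hB).1 he.2.1
    omega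
  -- The blocks may extend beyond `n`; the upper end of the scan is then cut to `n`.
  refine wp_cons (T₁ := 2) (T₂ := 41 * B + 1) ?_ (by omega)
  refine wp_ite (T := 1) (by simp) (by simp) (fun h1 => ?_) (fun h1 => ?_)
  · simp [hn] at h1
    refine wp_set (T := 0) (by simp) (by decide) (hloop _ ⟨?_, le_rfl, ?_, ?_, ?_, ?_, ?_⟩)
    · simp
    · simp [hn]
      omega
    · omega
    · exact ((((Same.refl 2 σ).set (by decide)).set (by decide)).set (by decide)).set (by decide)
    · simpa using hbest0
    · intro e he
      simp at he
      omega
  · simp [hn] at h1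
    refine wp_skip (hloop _ ⟨?_, le_rfl, ?_, ?_, ?_, ?_, ?_⟩)
    · simp
    · simp
      norm_cast at h1 ⊢
    · omega
    · exact (((Same.refl 2 σ).set (by decide)).set (by decide)).set (by decide)
    · simpa using hbest0
    · intro e he
      simp at he
      omega

end


/-! ### Replaying the path from a leaf to the root. -/

section
variable {E : Env} {load : Cmd} {tA tD : Reg} {ctx : State → Prop} {n s B : ℕ}
  {act : ℕ → Prop} {kA kD : ℕ → ℤ} {zA zD : ℤ}

/-- The state on the way from a leaf to the root: the proper ancestors of the node `ν` have not yet
been recomputed. -/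
structure ClimbInv (n s B τ : ℕ) (cand : ℕ → Prop) (key : ℕ → ℝ) (dirty : ℕ → Prop) (σ₀ : State)
    (f : ℕ) (σ : State) (ν : ℕ) : Prop where
  reg_node : σ.reg .node = ν
  pos : 1 ≤ ν
  lt : ν < 2 * s
  fuel : ν < 2 ^ (f + 1)
  same : SameReg 2 σ₀ σ
  out : σ.out = σ₀.out
  arr : SameArr τ σ₀.arr σ.arr
  nodes : ∀ node, 1 ≤ node → node < 2 * s →
    (0 ≤ σ.arr (3 * node + τ) ∧ σ.arr (3 * node + τ) ≤ n) ∧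
    ((∀ e, e < n → Below s B node e → ¬ dirty e) → (∀ j, ν / 2 ^ (j + 1) ≠ node) →
      Best cand key (fun e => e < n ∧ Below s B node e) (σ.arr (3 * node + τ)))

/-- Leaves have numbers at least `s`, so a leaf needs at least one halving to reach the inner node,
and the number just before is one of its two children, according to parity. -/
theorem below_children {s B ν e : ℕ} (hν : ν < s) :
    Below s B ν e ↔ Below s B (2 * ν) e ∨ Below s B (2 * ν + 1) e := by
  constructor
  · rintro ⟨j, hj⟩
    rcases j with _ | j
    · simp at hj
      have := Nat.zero_le (e / B)
      omega
    · rw [pow_succ, ← Nat.div_div_eq_div_mul] at hj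
      rcases Nat.mod_two_eq_zero_or_one ((s + e / B) / 2 ^ j) with h | h
      · exact Or.inl ⟨j, by omega⟩
      · exact Or.inr ⟨j, by omega⟩
  · rintro (⟨j, hj⟩ | ⟨j, hj⟩) <;> refine ⟨j + 1, ?_⟩ <;>
      rw [pow_succ, ← Nat.div_div_eq_div_mul, hj] <;> omega

theorem Best.merge_left {cand : ℕ → Prop} {key : ℕ → ℝ} {S T U : ℕ → Prop} {v w : ℤ}
    (h : Best cand key S v) (h' : Best cand key T w) (hU : ∀ e, U e ↔ S e ∨ T e)
    (hle : w = 0 ∨ ∃ e f : ℕ, v = e + 1 ∧ w = f + 1 ∧ key e ≤ key f) : Best cand key U v := by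
  rcases h' with ⟨g1, g2⟩ | ⟨f, g1, g2, g3, g4⟩
  · refine h.elim (fun h => Or.inl ⟨h.1, fun e he => ?_⟩) fun ⟨e, h1, h2, h3, h4⟩ =>
      Or.inr ⟨e, h1, (hU e).2 (Or.inl h2), h3, fun e' he' hc => ?_⟩
    · exact ((hU e).1 he).elim (h.2 e) (g2 e)
    · exact ((hU e').1 he').elim (fun h => h4 e' h hc) fun h => absurd hc (g2 e' h)
  · rcases hle with hle | ⟨e', f', h5, h6, h7⟩
    · omega
    · obtain rfl : f' = f := by omega
      rcases h with ⟨h1, _⟩ | ⟨e, h1, h2, h3, h4⟩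
      · omega
      · obtain rfl : e' = e := by omega
        refine Or.inr ⟨e', h1, (hU e').2 (Or.inl h2), h3, fun x hx hc => ?_⟩
        exact ((hU x).1 hx).elim (fun h => h4 x h hc) fun h => h7.trans (g4 x h hc)

theorem natCast_eq_sub_one {v : ℤ} (hv : 0 < v) : ((v - 1).toNat : ℤ) = v - 1 := by omega

/-- Nodes store winners without keys, so the keys of the two winners below are loaded again. Even
where the subtree is dirty, the stored numbers lie between 0 and `n`, so all addresses are valid
although the comparison may mean nothing. -/
theorem wp_climbBody {τ : ℕ} (hτ : τ < 3) (C : TreeCtx E load tA tD ctx n s B act kA kD zA zD)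
    {dirty : ℕ → Prop} {f : ℕ} {σ₀ σ : State} (h₀ : ctx σ₀) {ν : ℕ}
    (h : ClimbInv n s B τ (Cand act kA kD zA zD) (ratio kA kD) dirty σ₀ f σ ν) (hν : 1 < ν) :
    wp E (climbBody load τ) 80 (fun σ' => ∃ f', f' < f ∧
      ClimbInv n s B τ (Cand act kA kD zA zD) (ratio kA kD) dirty σ₀ f' σ' (ν / 2)) σ := by
  have hN := C.sizes.N_le
  have hs2 : ν / 2 < s := by have := h.lt; omega
  set μ := ν / 2 with hμ
  have hμ1 : 1 ≤ μ := by omega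
  obtain ⟨rl, bl⟩ := h.nodes (2 * μ) (by omega) (by omega)
  obtain ⟨rr, br⟩ := h.nodes (2 * μ + 1) (by omega) (by omega)
  -- Both children of `μ` are larger than every proper ancestor of `ν`, so the invariant already
  -- covers them.
  have hnot : ∀ c, 2 * μ ≤ c → ∀ j, ν / 2 ^ (j + 1) ≠ c := by
    intro c hc j hj
    have : ν / 2 ^ (j + 1) ≤ ν / 2 := Nat.div_le_div_left (by
      rw [pow_succ]; have := Nat.one_le_two_pow (n := j); omega) (by norm_num)
    omega
  set L := σ.arr (3 * (2 * μ) + τ) with hL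
  set R := σ.arr (3 * (2 * μ + 1) + τ) with hR
  have hfinal : ∀ σ₁ : State, σ₁.reg .node = μ → SameReg 2 σ₀ σ₁ → σ₁.arr = σ.arr →
      σ₁.out = σ.out → (0 ≤ σ₁.reg .best ∧ σ₁.reg .best ≤ n) →
      (Best (Cand act kA kD zA zD) (ratio kA kD) (fun e => e < n ∧ Below s B (2 * μ) e) L →
        Best (Cand act kA kD zA zD) (ratio kA kD) (fun e => e < n ∧ Below s B (2 * μ + 1) e) R →
        Best (Cand act kA kD zA zD) (ratio kA kD) (fun e => e < n ∧ Below s B μ e)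
          (σ₁.reg .best)) →
      wp E (block [.store (3 * rg .node + .lit τ) (rg .best)]) 1 (fun σ' => ∃ f', f' < f ∧
        ClimbInv n s B τ (Cand act kA kD zA zD) (ratio kA kD) dirty σ₀ f' σ' μ) σ₁ := by
    intro σ₁ g1 g2 g3 g4 g5 g6
    have hv : (3 * rg .node + .lit τ : Expr).val E σ₁ = ((3 * μ + τ : ℕ) : ℤ) := by
      simp [g1]
    refine wp_cons (T₁ := 1) (T₂ := 0) (wp_store (by simp) (by simp) ?_ ?_ ?_
      (wp_nil ?_)) (by norm_num)
    · rw [hv]; positivity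
    · rw [hv, Int.toNat_natCast]; omega
    · have h1 := C.sizes.n_lt
      have h3 : (n : ℤ) < 2 ^ E.w := by exact_mod_cast h1
      simp only [val_reg]
      rw [abs_of_nonneg g5.1]
      omega
    · rw [hv, Int.toNat_natCast]
      have hf := h.fuel
      have hf0 : f ≠ 0 := by
        rintro rfl
        simp at hf
        omega
      refine ⟨f - 1, by omega, by simpa using g1, hμ1, by omega, ?_, g2.setArr, ?_, ?_, ?_⟩
      · rw [Nat.sub_add_cancel (by omega)]
        rw [pow_succ] at hf
        omega
      · rw [State.setArr_out, g4, h.out]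
      · intro a ha
        rw [State.setArr_arr, if_neg (by omega), g3, h.arr a ha]
      · intro node hn1 hn2
        rw [State.setArr_arr]
        by_cases hnode : node = μ
        · rw [if_pos (by rw [hnode])]
          refine ⟨g5, fun hd _ => ?_⟩
          rw [hnode] at hd ⊢
          exact g6 (bl (fun e he hb => hd e he ((below_children hs2).2 (Or.inl hb)))
            (hnot _ le_rfl)) (br (fun e he hb => hd e he ((below_children hs2).2 (Or.inr hb)))
            (hnot _ (by omega)))
        · rw [if_neg (by omega), g3]
          obtain ⟨k1, k2⟩ := h.nodes node hn1 hn2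
          refine ⟨k1, fun hd hj => k2 hd fun j hj' => ?_⟩
          rcases j with _ | j
          · exact hnode (by rw [← hj', hμ, zero_add, pow_one])
          · refine hj j ?_
            rw [hμ, Nat.div_div_eq_div_mul, ← pow_succ', hj']
  have hUb : ∀ e, (e < n ∧ Below s B μ e) ↔
      (e < n ∧ Below s B (2 * μ) e) ∨ (e < n ∧ Below s B (2 * μ + 1) e) := by
    intro e
    rw [below_children hs2]
    tauto
  have hUb' : ∀ e, (e < n ∧ Below s B μ e) ↔
      (e < n ∧ Below s B (2 * μ + 1) e) ∨ (e < n ∧ Below s B (2 * μ) e) := by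
    intro e
    rw [below_children hs2]
    tauto
  refine wp_cons_set (T := 79) (by simp) (by decide) ?_
  have e1 : σ.reg .node / 2 = μ := by rw [h.reg_node, hμ]; norm_num
  simp only [val_div, val_reg, val_two, e1]
  have hvl : ∀ σ₁ : State, σ₁.reg .node = μ →
      (3 * (2 * rg .node) + .lit τ : Expr).val E σ₁ = ((3 * (2 * μ) + τ : ℕ) : ℤ) := by
    intro σ₁ g
    simp [g]
  have hvr : ∀ σ₁ : State, σ₁.reg .node = μ →
      (3 * (2 * rg .node + 1) + .lit τ : Expr).val E σ₁ = ((3 * (2 * μ + 1) + τ : ℕ) : ℤ) := by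
    intro σ₁ g
    simp [g]
  refine wp_cons_set (T := 78) ?_ (Nat.le_of_ble_eq_true rfl) ?_
  · rw [safe_ld, hvl _ (by simp), Int.toNat_natCast]
    exact ⟨by simp, by positivity, by omega⟩
  rw [val_ld, hvl _ (by simp), Int.toNat_natCast, State.set_arr, ← hL]
  refine wp_cons_set (T := 77) ?_ (Nat.le_of_ble_eq_true rfl) ?_
  · rw [safe_ld, hvr _ (by simp), Int.toNat_natCast]
    exact ⟨by simp, by positivity, by omega⟩
  rw [val_ld, hvr _ (by simp), Int.toNat_natCast, State.set_arr, State.set_arr, ← hR]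
  refine wp_cons_set (T := 76) (by simp) (by decide) ?_
  set σ₁ : State := ((((σ.set .node μ).set .lft L).set .rgt R).set .best
    ((rg .lft).val E (((σ.set .node μ).set .lft L).set .rgt R))) with hσ₁
  have sm : SameReg 2 σ₀ σ₁ := (((h.same.set (by decide)).set (by decide)).set (by decide)).set
    (by decide)
  have n1 : σ₁.reg .node = μ := by simp [hσ₁]
  have l1 : σ₁.reg .lft = L := by simp [hσ₁]
  have r1 : σ₁.reg .rgt = R := by simp [hσ₁]
  have b1 : σ₁.reg .best = L := by simp [hσ₁]
  have a1 : σ₁.arr = σ.arr := rfl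
  have o1 : σ₁.out = σ.out := rfl
  clear_value σ₁
  refine wp_cons (T₁ := 75) (T₂ := 1) ?_ (by norm_num)
  refine wp_ite (T := 74) (by simp) (by simp) (fun h1 => ?_) (fun h1 => ?_)
  · simp only [val_zero, val_reg, r1] at h1
    refine wp_ite (T := 73) (by simp) (by simp) (fun h2 => ?_) (fun h2 => ?_)
    · simp only [val_one, val_reg, l1] at h2
      refine wp_set (T := 72) (by simp) (by decide) (hfinal _ (by simp [n1]) (sm.set (by decide))
        a1 o1 (by simpa [r1] using rr) fun hb1 hb2 => ?_)
      simp only [State.set_reg, if_true, val_reg, r1]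
      exact hb2.merge_left hb1 hUb' (Or.inl (by omega))
    · simp only [val_one, val_reg, l1] at h2
      have hl0 : (L - 1).toNat < n := by omega
      have hr0 : (R - 1).toNat < n := by omega
      have hlc := natCast_eq_sub_one (v := L) (by omega)
      have hrc := natCast_eq_sub_one (v := R) (by omega)
      refine wp_cons_set (T := 72) (by simp) (by decide) ?_
      refine wp_cons (T₁ := 30) (T₂ := 42) ((C.load.spec _ (L - 1).toNat
        (C.load.ctx_same σ₀ _ h₀ ((sm.set (by decide)).mono (by norm_num))) hl0 ?_).mono le_rfl ?_)
        (by norm_num)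
      · rw [hlc]; simp [l1]
      rintro σ₂ ⟨-, -, A2, D2, s2⟩
      refine wp_cons_set (T := 41) (by simp) (by decide) ?_
      refine wp_cons_set (T := 40) (by simp) (by decide) ?_
      refine wp_cons_set (T := 39) (by simp) (by decide) ?_
      have sr2 : ∀ x : Reg, 1 ≤ x.level → x ≠ .i → σ₂.reg x = σ₁.reg x := by
        intro x hx hxi
        rw [s2.reg x hx, State.set_reg, if_neg hxi]
      have sm2 : SameReg 2 σ₀ σ₂ := (sm.set (by decide)).trans (s2.reg.mono (by norm_num))
      have sm2' := (((sm2.set (x := .bA) (v := (rg .A).val E σ₂) (by decide)).set (x := .bD)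
        (v := (rg .D).val E (σ₂.set .bA ((rg .A).val E σ₂))) (by decide)).set (x := .i)
        (v := (rg .rgt - 1).val E ((σ₂.set .bA ((rg .A).val E σ₂)).set .bD
          ((rg .D).val E (σ₂.set .bA ((rg .A).val E σ₂))))) (by decide))
      refine wp_cons (T₁ := 30) (T₂ := 9) ((C.load.spec _ (R - 1).toNat
        (C.load.ctx_same σ₀ _ h₀ (sm2'.mono (by norm_num))) hr0 ?_).mono le_rfl ?_)
        (by norm_num)
      · rw [hrc]; simp [sr2 .rgt (by decide) (by decide), r1]
      rintro σ₃ ⟨-, -, A3, D3, s3⟩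
      have sm3 : SameReg 2 σ₀ σ₃ := sm2'.trans (s3.reg.mono (by norm_num))
      have bA3 : σ₃.reg .bA = kA (L - 1).toNat := by
        rw [s3.reg _ (by decide)]; simp [A2]
      have bD3 : σ₃.reg .bD = kD (L - 1).toNat := by
        rw [s3.reg _ (by decide)]; simp [D2]
      have n3 : σ₃.reg .node = μ := by
        rw [s3.reg _ (by decide)]; simp [sr2 .node (by decide) (by decide), n1]
      have b3 : σ₃.reg .best = L := by
        rw [s3.reg _ (by decide)]; simp [sr2 .best (by decide) (by decide), b1]
      have r3 : σ₃.reg .rgt = R := by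
        rw [s3.reg _ (by decide)]; simp [sr2 .rgt (by decide) (by decide), r1]
      have a3 : σ₃.arr = σ.arr := by rw [s3.arr]; simp [s2.arr, a1]
      have o3 : σ₃.out = σ.out := by rw [s3.out]; simp [s2.out, o1]
      have hcmp : Best (Cand act kA kD zA zD) (ratio kA kD)
            (fun e => e < n ∧ Below s B (2 * μ) e) L →
          Best (Cand act kA kD zA zD) (ratio kA kD)
            (fun e => e < n ∧ Below s B (2 * μ + 1) e) R →
          (kA (R - 1).toNat * kD (L - 1).toNat < kA (L - 1).toNat * kD (R - 1).toNat ↔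
            ratio kA kD (R - 1).toNat < ratio kA kD (L - 1).toNat) := by
        intro hb1 hb2
        rcases hb1 with ⟨z, _⟩ | ⟨e, e1, _, e2, _⟩
        · omega
        rcases hb2 with ⟨z, _⟩ | ⟨f, f1, _, f2, _⟩
        · omega
        have he : (L - 1).toNat = e := by omega
        have hf : (R - 1).toNat = f := by omega
        rw [he] at hl0 ⊢
        rw [hf] at hr0 ⊢
        exact (ratio_lt (C.load.pos f hr0 f2.1) (C.load.pos e hl0 e2.1)).symm
      refine wp_cons (T₁ := 9) (T₂ := 0) ?_ (by norm_num)
      refine wp_ite (T := 8) (by simp) (by simp) (fun h3 => ?_) (fun h3 => ?_)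
      · simp only [val_mul, val_reg, A3, D3, bA3, bD3] at h3
        refine wp_set (T := 7) (by simp) (by decide) (wp_nil (hfinal _ (by simp [n3])
          (sm3.set (by decide)) a3 o3 (by simpa [r3] using rr) fun hb1 hb2 => ?_))
        simp only [State.set_reg, if_true, val_reg, r3]
        have hk := (hcmp hb1 hb2).1 h3
        exact hb2.merge_left hb1 hUb' (Or.inr ⟨_, _, by rw [hrc]; ring, by rw [hlc]; ring, hk.le⟩)
      · simp only [val_mul, val_reg, A3, D3, bA3, bD3] at h3
        refine wp_skip (wp_nil (hfinal _ n3 sm3 a3 o3 (by simpa [b3] using rl) fun hb1 hb2 => ?_))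
        rw [b3]
        have hk := not_lt.1 fun hk => h3 ((hcmp hb1 hb2).2 hk)
        exact hb1.merge_left hb2 hUb (Or.inr ⟨_, _, by rw [hlc]; ring, by rw [hrc]; ring, hk⟩)
  · simp only [val_zero, val_reg, r1] at h1
    refine wp_skip (hfinal _ n1 sm a1 o1 (by simpa [b1] using rl) fun hb1 hb2 => ?_)
    rw [b1]
    exact hb1.merge_left hb2 hUb (Or.inl (by omega))

/-- Recomputing the path of a block cleans it. -/
theorem wp_refresh {τ : ℕ} (hτ : τ < 3) (C : TreeCtx E load tA tD ctx n s B act kA kD zA zD)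
    {dirty : ℕ → Prop} {b : ℕ} {σ : State} (hctx : ctx σ) (hb : σ.reg .b = b) (hbs : b < s)
    (h : TreeOK n s B τ (Cand act kA kD zA zD) (ratio kA kD) dirty σ.arr) :
    wp E (refreshCmd load tA tD τ) (41 * B + 81 * Nat.log 2 s + 100)
      (fun σ' => SameReg 2 σ σ' ∧ σ'.out = σ.out ∧ SameArr τ σ.arr σ'.arr ∧
        TreeOK n s B τ (Cand act kA kD zA zD) (ratio kA kD) (fun e => dirty e ∧ e / B ≠ b)
          σ'.arr) σ := by
  have hN := C.sizes.N_le
  have hB := C.sizes.B_pos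
  have hdiv : ∀ e, e < n → e / B < s := fun e he =>
    (Nat.div_lt_iff_lt_mul hB).2 (he.trans_le C.sizes.n_le)
  refine wp_cons (T₁ := 41 * B + 6) (T₂ := 81 * Nat.log 2 s + 94)
    ((wp_scan C hctx hb).mono le_rfl ?_) (by omega)
  rintro σ₁ ⟨s1, best1⟩
  have reg1 := C.regs σ₁ (C.load.ctx_same σ σ₁ hctx (s1.reg.mono (by norm_num)))
  have hb1 : σ₁.reg .b = b := (s1.reg .b (by decide)).trans hb
  refine wp_cons_set (T := 81 * Nat.log 2 s + 93) (by simp) (by decide) ?_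
  simp only [val_add, val_reg, reg1.2.1, hb1]
  have hv : (3 * rg .node + .lit τ : Expr).val E (σ₁.set .node (s + b)) =
      ((3 * (s + b) + τ : ℕ) : ℤ) := by
    simp
  have hle : σ₁.reg .best ≤ n := best1.le fun e he => he.1
  refine wp_cons (T₁ := 1) (T₂ := 81 * Nat.log 2 s + 92) (wp_store (by simp) (by simp)
    ?_ ?_ ?_ ?_) (by omega)
  · rw [hv]; positivity
  · rw [hv, Int.toNat_natCast]; omega
  · have h1 := C.sizes.n_lt
    have h3 : (n : ℤ) < 2 ^ E.w := by exact_mod_cast h1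
    simp only [val_reg, State.set_reg, reduceCtorEq, if_false]
    rw [abs_of_nonneg best1.nonneg]
    omega
  rw [hv, Int.toNat_natCast]
  simp only [val_reg, State.set_reg, reduceCtorEq, if_false]
  -- Once the leaf is written, only its proper ancestors are stale: every other node with an element
  -- of the block below it would have to be the leaf or one of these ancestors. The leaf number is
  -- below `2 * s`, which yields the fuel `Nat.log 2 s + 1`.
  have inv : ClimbInv n s B τ (Cand act kA kD zA zD) (ratio kA kD)
      (fun e => dirty e ∧ e / B ≠ b) σ (Nat.log 2 s + 1)
      ((σ₁.set .node (s + b)).setArr (3 * (s + b) + τ) (σ₁.reg .best)) (s + b) := by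
    refine ⟨by simp, by have := C.sizes.s_pos; omega, by omega, ?_,
      ((s1.reg).set (by decide)).setArr, by simp [s1.out], fun a ha => ?_, fun node hn1 hn2 => ?_⟩
    · have h2 := Nat.lt_pow_succ_log_self (b := 2) (by norm_num) s
      rw [pow_succ]
      omega
    · rw [State.setArr_arr, if_neg (by omega), State.set_arr, s1.arr]
    · rw [State.setArr_arr]
      by_cases hnode : node = s + b
      · rw [if_pos (by rw [hnode])]
        refine ⟨⟨best1.nonneg, hle⟩, fun _ _ => best1.congr (fun e => ?_) (fun _ _ => Iff.rfl)
          fun _ _ _ _ _ _ h => h⟩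
        refine and_congr_right fun he => ?_
        rw [hnode]
        constructor
        · rintro ⟨j, hj⟩
          rcases j with _ | j
          · simpa using hj
          · have h1 : (s + e / B) / 2 ^ (j + 1) ≤ (s + e / B) / 2 := Nat.div_le_div_left (by
              rw [pow_succ]; have := Nat.one_le_two_pow (n := j); omega) (by norm_num)
            have := hdiv e he
            omega
        · intro h1
          exact ⟨0, by simp [h1]⟩
      · rw [if_neg (by omega), State.set_arr, s1.arr]
        obtain ⟨k1, k2⟩ := h node hn1 hn2
        refine ⟨k1, fun hd hj => k2 fun e he hbl hde => hd e he hbl ⟨hde, fun heb => ?_⟩⟩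
        obtain ⟨j, hj'⟩ := hbl
        rw [heb] at hj'
        rcases j with _ | j
        · exact hnode (by rw [← hj']; simp)
        · exact hj j hj'
  refine wp_cons (T₁ := (Nat.log 2 s + 1) * (80 + 1) + 1) (T₂ := 0)
    ((wp_loop (T := 80) (fun f σ' => ∃ ν, ClimbInv n s B τ (Cand act kA kD zA zD) (ratio kA kD)
      (fun e => dirty e ∧ e / B ≠ b) σ f σ' ν) ?_ _ _ ⟨_, inv⟩).mono le_rfl ?_) (by omega)
  · rintro f σ' ⟨ν, hI⟩
    refine ⟨by simp, by simp, fun hlt => ?_⟩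
    simp only [val_reg, val_one, hI.reg_node] at hlt
    have hν : 1 < ν := by exact_mod_cast hlt
    have hf0 : f ≠ 0 := by
      rintro rfl
      have := hI.fuel
      simp at this
      omega
    refine ⟨by omega, (wp_climbBody hτ C hctx hI hν).mono le_rfl ?_⟩
    rintro σ'' ⟨f', h1, h2⟩
    exact ⟨f', h1, _, h2⟩
  · rintro σ' ⟨⟨f', ν, hI⟩, hlt⟩
    simp only [val_reg, val_one, hI.reg_node] at hlt
    have hν : ν = 1 := by
      have : ¬ 1 < ν := by exact_mod_cast hlt
      have := hI.pos
      omega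
    refine wp_nil ⟨hI.same, hI.out, hI.arr, fun node hn1 hn2 => ?_⟩
    obtain ⟨k1, k2⟩ := hI.nodes node hn1 hn2
    refine ⟨k1, fun hd => k2 hd fun j hj => ?_⟩
    rw [hν, pow_succ] at hj
    have : 1 / (2 ^ j * 2) = 0 := Nat.div_eq_of_lt (by have := Nat.one_le_two_pow (n := j); omega)
    omega

end


/-! ## Segments and rays from the origin -/

/-- The determinant of two vectors. -/
def cross (a b : ℂ) : ℝ := a.re * b.im - a.im * b.re

/-- The open ray in direction `d` crosses the segment from `a` to `b`. -/
def Act (d a b : ℂ) : Prop := cross a b * cross d a < 0 ∧ 0 < cross a b * cross d b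

/-- The position, in multiples of `d`, of the intersection with the line through `a` and `b`. -/
noncomputable def tk (d a b : ℂ) : ℝ := cross a b / (cross d b - cross d a)

theorem cross_self (a : ℂ) : cross a a = 0 := by unfold cross; ring
theorem cross_swap (a b : ℂ) : cross b a = -cross a b := by unfold cross; ring
theorem cross_add_left (a b c : ℂ) : cross (a + b) c = cross a c + cross b c := by
  simp [cross]; ring
theorem cross_smul_left (t : ℝ) (a b : ℂ) : cross (t • a) b = t * cross a b := by
  simp [cross]; ring
theorem cross_add_right (a b c : ℂ) : cross a (b + c) = cross a b + cross a c := by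
  simp [cross]; ring
theorem cross_smul_right (t : ℝ) (a b : ℂ) : cross a (t • b) = t * cross a b := by
  simp [cross]; ring

/-- Cramer's rule. It turns the point where the line of `d` meets the line through `a` and `b` into
an affine combination of `a` and `b`. -/
theorem cross_relation (a b d : ℂ) : cross a b • d = cross d b • a - cross d a • b := by
  apply Complex.ext <;> simp [cross] <;> ring

theorem Act.det_pos {d a b : ℂ} (h : Act d a b) :
    0 < cross a b * (cross d b - cross d a) := by
  obtain ⟨h1, h2⟩ := h
  linarith

theorem tk_pos_of_det_pos {d a b : ℂ} (h : 0 < cross a b * (cross d b - cross d a)) :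
    0 < tk d a b := by
  unfold tk
  rcases pos_and_pos_or_neg_and_neg_of_mul_pos h with ⟨h1, h2⟩ | ⟨h1, h2⟩
  · exact div_pos h1 h2
  · exact div_pos_of_neg_of_neg h1 h2

theorem Act.tk_pos {d a b : ℂ} (h : Act d a b) : 0 < tk d a b := tk_pos_of_det_pos h.det_pos

theorem tk_smul (d a b : ℂ) (t : ℝ) : tk (t • d) a b = tk d a b / t := by
  unfold tk
  rw [cross_smul_left, cross_smul_left, ← mul_sub, div_div, mul_comm t]

/-- The intersection point as a combination of the end points. -/
theorem tk_smul_eq (d a b : ℂ) :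
    tk d a b • d = (cross d b / (cross d b - cross d a)) • a +
      (-cross d a / (cross d b - cross d a)) • b := by
  have h1 := cross_relation a b d
  have h2 : tk d a b • d = (cross d b - cross d a)⁻¹ • (cross a b • d) := by
    rw [smul_smul, tk, div_eq_inv_mul]
  rw [h2, h1, smul_sub, smul_smul, smul_smul, sub_eq_add_neg, ← neg_smul]
  congr 2 <;> ring

theorem Act.mem_openSegment {d a b : ℂ} (h : Act d a b) : tk d a b • d ∈ openSegment ℝ a b := by
  have h0 := h.det_pos
  obtain ⟨h1, h2⟩ := h
  have hA : cross a b ≠ 0 := by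
    intro h; rw [h] at h2; simp at h2
  have hD : cross d b - cross d a ≠ 0 := by
    intro h; rw [h] at h0; simp at h0
  refine ⟨_, _, ?_, ?_, ?_, (tk_smul_eq d _ _).symm⟩
  · rw [← mul_div_mul_left _ _ hA]; exact div_pos h2 h0
  · rw [← mul_div_mul_left _ _ hA]; exact div_pos (by linarith) h0
  · rw [← add_div, ← sub_eq_add_neg, div_self hD]

/-- Taking determinants of `t • d = p • a + r • b` with `a` and `b` and subtracting uses only `p + r
= 1`; as `cross a b` is not zero, the denominator is not zero either. -/
theorem eq_tk_of_mem_segment {d a b : ℂ} {t : ℝ} (hA : cross a b ≠ 0)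
    (h : t • d ∈ segment ℝ a b) : t * (cross d b - cross d a) = cross a b ∧ t = tk d a b := by
  obtain ⟨p, r, hp, hr, hpr, h⟩ := h
  have h1 : cross (t • d) b - cross (t • d) a = cross a b := by
    rw [← h]
    simp only [cross_add_left, cross_smul_left, cross_self, cross_swap a b]
    linear_combination cross a b * hpr
  rw [cross_smul_left, cross_smul_left, ← mul_sub] at h1
  refine ⟨h1, ?_⟩
  have hD : cross d b - cross d a ≠ 0 := by
    intro h2
    rw [h2, mul_zero] at h1
    exact hA h1.symm
  rw [tk, ← h1, mul_div_cancel_right₀ _ hD]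

/-- The same determinants give the signs: `t * cross d a` is `-r` times, and `t * cross d b` is `p`
times, the number `cross a b`, with positive weights and positive `t`. -/
theorem act_of_mem_openSegment {d a b : ℂ} {t : ℝ} (hA : cross a b ≠ 0) (ht : 0 ≤ t)
    (h : t • d ∈ openSegment ℝ a b) : Act d a b ∧ t = tk d a b := by
  obtain ⟨h1, h2⟩ := eq_tk_of_mem_segment hA (openSegment_subset_segment ℝ a b h)
  refine ⟨?_, h2⟩
  obtain ⟨p, r, hp, hr, hpr, h⟩ := h
  have ht0 : t ≠ 0 := by
    rintro rfl
    rw [zero_mul] at h1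
    exact hA h1.symm
  have htp : 0 < t := lt_of_le_of_ne ht (Ne.symm ht0)
  have ha : t * cross d a = -(r * cross a b) := by
    rw [← cross_smul_left, ← h, cross_add_left, cross_smul_left, cross_smul_left, cross_self,
      cross_swap a b]
    ring
  have hb : t * cross d b = p * cross a b := by
    rw [← cross_smul_left, ← h, cross_add_left, cross_smul_left, cross_smul_left, cross_self]
    ring
  have hAA : 0 < cross a b * cross a b := mul_self_pos.2 hA
  constructor
  · have : t * (cross a b * cross d a) < 0 := by
      have : t * (cross a b * cross d a) = -(r * (cross a b * cross a b)) := by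
        linear_combination cross a b * ha
      rw [this]
      have := mul_pos hr hAA
      linarith
    exact neg_of_mul_neg_right this htp.le
  · have : 0 < t * (cross a b * cross d b) := by
      have : t * (cross a b * cross d b) = p * (cross a b * cross a b) := by
        linear_combination cross a b * hb
      rw [this]
      exact mul_pos hp hAA
    exact pos_of_mul_pos_right this htp.le

/-- On a ray through neither end point. -/
theorem mem_segment_iff {d a b : ℂ} {t : ℝ} (hA : cross a b ≠ 0)
    (ha : ∀ t : ℝ, 0 ≤ t → a ≠ t • d) (hb : ∀ t : ℝ, 0 ≤ t → b ≠ t • d) :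
    (0 ≤ t ∧ t • d ∈ segment ℝ a b) ↔ Act d a b ∧ t = tk d a b := by
  constructor
  · rintro ⟨h1, h2⟩
    refine act_of_mem_openSegment hA h1 ?_
    rw [← insert_endpoints_openSegment] at h2
    rcases h2 with h2 | h2 | h2
    · exact absurd h2.symm (ha t h1)
    · exact absurd h2.symm (hb t h1)
    · exact h2
  · rintro ⟨h1, rfl⟩
    exact ⟨h1.tk_pos.le, openSegment_subset_segment ℝ a b h1.mem_openSegment⟩

/-- The order of two disjoint segments along the rays does not depend on the ray; one of the two
rays may pass through end points. -/
theorem tk_lt_of_weak {d d' a b a' b' : ℂ}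
    (hdis : Disjoint (openSegment ℝ a b) (openSegment ℝ a' b'))
    (h1 : Act d a b) (h2 : Act d a' b')
    (w1 : cross a b * cross d' a ≤ 0) (w2 : 0 ≤ cross a b * cross d' b)
    (w3 : 0 < cross a b * (cross d' b - cross d' a))
    (w1' : cross a' b' * cross d' a' ≤ 0) (w2' : 0 ≤ cross a' b' * cross d' b')
    (w3' : 0 < cross a' b' * (cross d' b' - cross d' a'))
    (hlt : tk d' a b < tk d' a' b') : tk d a b < tk d a' b' := by
  by_contra hcon
  rw [not_lt] at hcon
  have key : ∀ x : ℂ, 0 < cross a b * (cross x b - cross x a) →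
      tk x a b = cross a b ^ 2 / (cross a b * (cross x b - cross x a)) := by
    intro x hx
    have hA : cross a b ≠ 0 := by rintro h; rw [h] at hx; simp at hx
    rw [tk, pow_two, mul_div_mul_left _ _ hA]
  have key' : ∀ x : ℂ, 0 < cross a' b' * (cross x b' - cross x a') →
      tk x a' b' = cross a' b' ^ 2 / (cross a' b' * (cross x b' - cross x a')) := by
    intro x hx
    have hA : cross a' b' ≠ 0 := by rintro h; rw [h] at hx; simp at hx
    rw [tk, pow_two, mul_div_mul_left _ _ hA]
  rw [key d' w3, key' d' w3', div_lt_div_iff₀ w3 w3'] at hlt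
  rw [key d h1.det_pos, key' d h2.det_pos, div_le_div_iff₀ h2.det_pos h1.det_pos] at hcon
  -- The reciprocal of `tk` is linear in the direction. So `F` is linear and, where both
  -- denominators have the right sign, has the sign of `tk x a b - tk x a' b'`. If the order were
  -- reversed, `F` would vanish at a direction `x` between `d` and `d'` and different from `d'`.
  -- Both crossings are strict at `x` because they are strict at `d`, and the open segments would
  -- meet there.
  set F : ℂ → ℝ := fun x => cross a b ^ 2 * (cross a' b' * (cross x b' - cross x a')) -
    cross a' b' ^ 2 * (cross a b * (cross x b - cross x a)) with hF
  have hF1 : F d' < 0 := by simp only [hF]; linarith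
  have hF2 : 0 ≤ F d := by simp only [hF]; linarith
  set l : ℝ := F d / (F d - F d') with hl
  have hpos : 0 < F d - F d' := by linarith
  have hl0 : 0 ≤ l := div_nonneg hF2 hpos.le
  have hl1 : l < 1 := by rw [hl, div_lt_one hpos]; linarith
  set x : ℂ := (1 - l) • d + l • d' with hx
  have hcr : ∀ c, cross x c = (1 - l) * cross d c + l * cross d' c := by
    intro c
    rw [hx, cross_add_left, cross_smul_left, cross_smul_left]
  have hF0 : F x = 0 := by
    have : F x = (1 - l) * F d + l * F d' := by
      simp only [hF, hcr]
      ring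
    rw [this, hl]
    field_simp
    ring
  have act1 : Act x a b := by
    obtain ⟨h3, h4⟩ := h1
    constructor <;> rw [hcr] <;> nlinarith
  have act2 : Act x a' b' := by
    obtain ⟨h3, h4⟩ := h2
    constructor <;> rw [hcr] <;> nlinarith
  have heq : tk x a b = tk x a' b' := by
    rw [key x act1.det_pos, key' x act2.det_pos,
      div_eq_div_iff act1.det_pos.ne' act2.det_pos.ne']
    simp only [hF] at hF0
    linarith
  refine Set.disjoint_left.1 hdis act1.mem_openSegment ?_
  rw [heq]
  exact act2.mem_openSegment

theorem Act.tk_ne {d a b a' b' : ℂ}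
    (hdis : Disjoint (openSegment ℝ a b) (openSegment ℝ a' b'))
    (h1 : Act d a b) (h2 : Act d a' b') : tk d a b ≠ tk d a' b' := fun heq => by
  refine Set.disjoint_left.1 hdis h1.mem_openSegment ?_
  rw [heq]
  exact h2.mem_openSegment

theorem Act.tk_lt_iff {d d' a b a' b' : ℂ}
    (hdis : Disjoint (openSegment ℝ a b) (openSegment ℝ a' b'))
    (h1 : Act d a b) (h2 : Act d a' b') (h1' : Act d' a b) (h2' : Act d' a' b') :
    tk d a b < tk d a' b' ↔ tk d' a b < tk d' a' b' :=
  ⟨fun h => tk_lt_of_weak hdis h1' h2' h1.1.le h1.2.le h1.det_pos h2.1.le h2.2.le h2.det_pos h,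
    fun h => tk_lt_of_weak hdis h1 h2 h1'.1.le h1'.2.le h1'.det_pos h2'.1.le h2'.2.le
      h2'.det_pos h⟩

/-- The parities of the crossings with two rays differ by the numbers of end points between them. -/
theorem act_parity {d d' a b : ℂ} (hd : 0 < cross d d') (hA : cross a b ≠ 0)
    (h1 : cross d a ≠ 0) (h2 : cross d b ≠ 0) (h3 : cross d' a ≠ 0) (h4 : cross d' b ≠ 0) :
    (Act d a b ↔ Act d' a b) ↔
      ((0 < cross d a ∧ cross d' a < 0) ↔ (0 < cross d b ∧ cross d' b < 0)) := by
  -- The three-term relation between determinants excludes the sign patterns that cannot occur in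
  -- the plane; the others are checked one by one.
  have hrel : cross d d' * cross a b = cross d a * cross d' b - cross d b * cross d' a := by
    unfold cross; ring
  rcases lt_or_gt_of_ne h1 with s1 | s1 <;> rcases lt_or_gt_of_ne h2 with s2 | s2 <;>
  rcases lt_or_gt_of_ne h3 with s3 | s3 <;> rcases lt_or_gt_of_ne h4 with s4 | s4 <;>
  rcases lt_or_gt_of_ne hA with s5 | s5 <;>
  simp only [Act, s1, s2, s3, s4, mul_pos_iff, mul_neg_iff, s5, s1.not_gt, s2.not_gt, s3.not_gt,
    s4.not_gt, s5.not_gt, and_true, and_false, or_false, iff_true, iff_false, not_true, iff_self,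
    and_self, or_true] <;>
  nlinarith


/-! ## Polygons seen from the origin -/

theorem val_finRotate {n : ℕ} (i : Fin n) :
    (finRotate n i : ℕ) = if (i : ℕ) + 1 < n then (i : ℕ) + 1 else 0 := by
  rcases n with _ | n
  · exact i.elim0
  · rw [coe_finRotate]
    have hi := i.isLt
    by_cases h : i = Fin.last n
    · rw [if_pos h, if_neg (by rw [h]; simp)]
    · have : (i : ℕ) ≠ n := fun h' => h (Fin.ext h')
      rw [if_neg h, if_pos (by omega)]

theorem finRotate_ne_self {n : ℕ} (hn : 3 ≤ n) (i : Fin n) : finRotate n i ≠ i := fun h => by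
  have h1 := val_finRotate i
  rw [h] at h1
  split_ifs at h1 <;> omega

/-- The position vectors of the vertices of a simple polygon; the origin is in weak general
position. -/
structure Star {n : ℕ} (u : Fin n → ℂ) : Prop where
  three_le : 3 ≤ n
  cross_ne : ∀ i j, i ≠ j → cross (u i) (u j) ≠ 0
  disj : ∀ i j, i ≠ j → Disjoint (openSegment ℝ (u i) (u (finRotate n i)))
    (openSegment ℝ (u j) (u (finRotate n j)))
  not_mem : ∀ m j, m ≠ j → m ≠ finRotate n j → u m ∉ segment ℝ (u j) (u (finRotate n j))

/-- The ray in direction `d` crosses edge `i`. -/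
def EAct {n : ℕ} (u : Fin n → ℂ) (d : ℂ) (i : Fin n) : Prop := Act d (u i) (u (finRotate n i))

/-- The position of edge `i` on the ray in direction `d`. -/
noncomputable def ekey {n : ℕ} (u : Fin n → ℂ) (d : ℂ) (i : Fin n) : ℝ :=
  tk d (u i) (u (finRotate n i))

/-- The number of edges that cross the ray in direction `d`. -/
noncomputable def total {n : ℕ} (u : Fin n → ℂ) (d : ℂ) : ℕ := {i | EAct u d i}.ncard

/-- The direction `d` is close to the vertex `m`, to the left of it if `ε > 0` and to the right of
it if `ε < 0`. -/
structure Near {n : ℕ} (u : Fin n → ℂ) (m : Fin n) (ε : ℝ) (d : ℂ) : Prop where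
  other : ∀ j, j ≠ m → 0 < cross d (u j) * cross (u m) (u j)
  self : 0 < ε * cross (u m) d

section
variable {n : ℕ} {u : Fin n → ℂ}

theorem Star.ne_zero (S : Star u) (i : Fin n) : u i ≠ 0 := fun h => by
  have := S.cross_ne i _ (finRotate_ne_self S.three_le i).symm
  rw [h] at this
  simp [cross] at this

theorem Star.edge_ne (S : Star u) (i : Fin n) : cross (u i) (u (finRotate n i)) ≠ 0 :=
  S.cross_ne i _ (finRotate_ne_self S.three_le i).symm

theorem pos_mul_congr {A x y : ℝ} (h : 0 < x * y) : (0 < A * x ↔ 0 < A * y) := by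
  rcases pos_and_pos_or_neg_and_neg_of_mul_pos h with ⟨h1, h2⟩ | ⟨h1, h2⟩
  · rw [mul_pos_iff_of_pos_right h1, mul_pos_iff_of_pos_right h2]
  · simp only [mul_pos_iff, h1, h2, h1.not_gt, h2.not_gt, and_false, and_true]

theorem neg_mul_congr {A x y : ℝ} (h : 0 < x * y) : (A * x < 0 ↔ A * y < 0) := by
  have := pos_mul_congr (A := -A) h
  simpa using this

theorem act_congr {d d' a b : ℂ} (ha : 0 < cross d a * cross d' a)
    (hb : 0 < cross d b * cross d' b) : Act d a b ↔ Act d' a b := by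
  unfold Act
  rw [neg_mul_congr ha, pos_mul_congr hb]

theorem Near.generic {m : Fin n} {ε : ℝ} {d : ℂ} (h : Near u m ε d) (j : Fin n) :
    cross d (u j) ≠ 0 := by
  by_cases hj : j = m
  · rw [hj, cross_swap, neg_ne_zero]
    intro h0
    have := h.self
    rw [h0] at this
    simp at this
  · intro h0
    have := h.other j hj
    rw [h0] at this
    simp at this

/-- Nearness fixes the sign of every vertex. All nearby directions on one side are therefore
interchangeable: the limiting rays of the geometric definition and the integer directions of the
program see the same edges. -/
theorem Near.sign {m : Fin n} {ε : ℝ} {d d' : ℂ} (h : Near u m ε d) (h' : Near u m ε d')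
    (j : Fin n) : 0 < cross d (u j) * cross d' (u j) := by
  by_cases hj : j = m
  · rw [hj, cross_swap (u m) d, cross_swap (u m) d']
    have h1 := h.self
    have h2 := h'.self
    have h3 := mul_pos h1 h2
    have h4 : 0 < (ε * ε) * (cross (u m) d * cross (u m) d') := by linarith
    have h5 := pos_of_mul_pos_right h4 (mul_self_nonneg ε)
    linarith
  · have h1 := h.other j hj
    have h2 := h'.other j hj
    have h3 := mul_pos h1 h2
    have h4 : 0 < (cross (u m) (u j) * cross (u m) (u j)) *
      (cross d (u j) * cross d' (u j)) := by linarith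
    exact pos_of_mul_pos_right h4 (mul_self_nonneg _)

theorem Near.eact_iff {m : Fin n} {ε : ℝ} {d d' : ℂ} (h : Near u m ε d) (h' : Near u m ε d')
    (i : Fin n) : EAct u d i ↔ EAct u d' i := act_congr (h.sign h' _) (h.sign h' _)

theorem Near.eact_iff_vertex {m : Fin n} {ε : ℝ} {d : ℂ} (h : Near u m ε d) {i : Fin n}
    (h1 : i ≠ m) (h2 : finRotate n i ≠ m) : EAct u d i ↔ EAct u (u m) i :=
  act_congr (h.other _ h1) (h.other _ h2)

/-- The far end of the edge is on the correct side of `d` in any case, so the position of `d`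
relative to `u m` decides. -/
theorem eact_incident_fst (S : Star u) {m : Fin n} {ε : ℝ} {d : ℂ} (h : Near u m ε d) :
    EAct u d m ↔ 0 < ε * cross (u m) (u (finRotate n m)) := by
  have h0 := h.self
  have hA := S.edge_ne m
  have h1 := h.other _ (finRotate_ne_self S.three_le m)
  have h2 : 0 < cross (u m) (u (finRotate n m)) * cross d (u (finRotate n m)) := by
    rw [mul_comm]; exact h1
  unfold EAct Act
  simp only [h2, and_true]
  rw [cross_swap (u m) d, mul_neg, neg_lt_zero]
  constructor
  · intro h3
    have h4 := mul_pos h0 h3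
    have h5 : 0 < (cross (u m) d * cross (u m) d) * (ε * cross (u m) (u (finRotate n m))) := by
      linarith
    exact pos_of_mul_pos_right h5 (mul_self_nonneg _)
  · intro h3
    have h4 := mul_pos h0 h3
    have h5 : 0 < (ε * ε) * (cross (u m) (u (finRotate n m)) * cross (u m) d) := by
      linarith
    exact pos_of_mul_pos_right h5 (mul_self_nonneg _)

theorem eact_incident_snd (S : Star u) {m i : Fin n} (hi : finRotate n i = m) {ε : ℝ} {d : ℂ}
    (h : Near u m ε d) : EAct u d i ↔ 0 < ε * cross (u m) (u i) := by
  have h0 := h.self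
  have him : i ≠ m := fun h => finRotate_ne_self S.three_le i (hi.trans h.symm)
  have h1 := h.other _ him
  have h2 : cross (u i) (u m) * cross d (u i) < 0 := by
    rw [cross_swap (u m) (u i)]
    linarith
  unfold EAct Act
  rw [hi]
  simp only [h2, true_and]
  rw [cross_swap (u m) d, cross_swap (u m) (u i), neg_mul_neg]
  constructor
  · intro h3
    have h4 := mul_pos h0 h3
    have h5 : 0 < (cross (u m) d * cross (u m) d) * (ε * cross (u m) (u i)) := by
      linarith
    exact pos_of_mul_pos_right h5 (mul_self_nonneg _)
  · intro h3
    have h4 := mul_pos h0 h3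
    have h5 : 0 < (ε * ε) * (cross (u m) (u i) * cross (u m) d) := by
      linarith
    exact pos_of_mul_pos_right h5 (mul_self_nonneg _)

/-- Distinct edges have disjoint interiors, so they cannot change their order along the rays that
cross both. -/
theorem ekey_lt_iff (S : Star u) {d d' : ℂ} {i j : Fin n} (h1 : EAct u d i) (h2 : EAct u d j)
    (h1' : EAct u d' i) (h2' : EAct u d' j) :
    ekey u d i < ekey u d j ↔ ekey u d' i < ekey u d' j := by
  by_cases hij : i = j
  · rw [hij]; simp
  · exact Act.tk_lt_iff (S.disj i j hij) h1 h2 h1' h2'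

theorem ekey_le_iff (S : Star u) {d d' : ℂ} {i j : Fin n} (h1 : EAct u d i) (h2 : EAct u d j)
    (h1' : EAct u d' i) (h2' : EAct u d' j) :
    ekey u d i ≤ ekey u d j ↔ ekey u d' i ≤ ekey u d' j := by
  rw [← not_lt, ← not_lt, ekey_lt_iff S h2 h1 h2' h1']

theorem ekey_injective (S : Star u) {d : ℂ} {i j : Fin n} (h1 : EAct u d i) (h2 : EAct u d j)
    (h : ekey u d i = ekey u d j) : i = j := by
  by_contra hij
  exact Act.tk_ne (S.disj i j hij) h1 h2 h

theorem ekey_vertex_ne_one (S : Star u) {m i : Fin n} (h1 : i ≠ m) (h2 : finRotate n i ≠ m)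
    (h : EAct u (u m) i) : ekey u (u m) i ≠ 1 := fun h3 => by
  refine S.not_mem m i h1.symm h2.symm (openSegment_subset_segment ℝ _ _ ?_)
  have := h.mem_openSegment
  rw [ekey] at h3
  rwa [h3, one_smul] at this

/-- An edge `e` incident to `m`. -/
def Incident (m e : Fin n) : Prop := e = m ∨ finRotate n e = m

theorem ekey_incident (S : Star u) {m e : Fin n} (he : Incident m e) : ekey u (u m) e = 1 := by
  rcases he with rfl | he
  · have := S.edge_ne e
    rw [ekey, tk, cross_self, sub_zero, div_self this]
  · have := S.edge_ne e
    rw [he] at this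
    rw [ekey, tk, he, cross_self, cross_swap (u e) (u m), zero_sub, neg_neg, div_self this]

/-- The ray through `m` meets an incident edge only at an end point. The weak inequalities that hold
there are all that `tk_lt_of_weak` asks of its second direction. -/
theorem weak_incident (S : Star u) {m e : Fin n} (he : Incident m e) :
    cross (u e) (u (finRotate n e)) * cross (u m) (u e) ≤ 0 ∧
    0 ≤ cross (u e) (u (finRotate n e)) * cross (u m) (u (finRotate n e)) ∧
    0 < cross (u e) (u (finRotate n e)) * (cross (u m) (u (finRotate n e)) - cross (u m) (u e)) := by
  have h0 := S.edge_ne e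
  have h1 : 0 < cross (u e) (u (finRotate n e)) * cross (u e) (u (finRotate n e)) :=
    mul_self_pos.2 h0
  rcases he with rfl | he
  · rw [cross_self]
    refine ⟨by simp, h1.le, by rwa [sub_zero]⟩
  · rw [he] at h1 ⊢
    rw [cross_self, cross_swap (u e) (u m)]
    refine ⟨by linarith, by simp, by linarith⟩

theorem not_incident {m e : Fin n} : ¬ Incident m e ↔ e ≠ m ∧ finRotate n e ≠ m := not_or

/-- The nearby ray is compared with the ray through `m`, where incident edges have key 1; no other
edge has key 1 there because `m` lies on no other edge. -/
theorem ekey_lt_incident_iff (S : Star u) {m i e : Fin n} {ε : ℝ} {d : ℂ} (h : Near u m ε d)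
    (hi : ¬ Incident m i) (he : Incident m e) (h1 : EAct u d i) (h2 : EAct u d e) :
    ekey u d i < ekey u d e ↔ ekey u (u m) i < 1 := by
  have hie : i ≠ e := fun h => hi (h ▸ he)
  rw [not_incident] at hi
  have h3 := (h.eact_iff_vertex hi.1 hi.2).1 h1
  obtain ⟨w1, w2, w3⟩ := weak_incident S he
  have h4 := ekey_vertex_ne_one S hi.1 hi.2 h3
  constructor
  · intro h5
    by_contra h6
    have h7 : ekey u (u m) e < ekey u (u m) i := by
      rw [ekey_incident S he]
      exact lt_of_le_of_ne (not_lt.1 h6) h4.symm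
    exact lt_asymm h5 (tk_lt_of_weak (S.disj e i hie.symm) h2 h1 w1 w2 w3 h3.1.le h3.2.le
      h3.det_pos h7)
  · intro h5
    rw [← ekey_incident S he] at h5
    exact tk_lt_of_weak (S.disj i e hie) h1 h2 h3.1.le h3.2.le h3.det_pos w1 w2 w3 h5

/-! ### Parity -/

theorem ite_add_ite_of_iff {p q r t : Prop} [Decidable p] [Decidable q] [Decidable r] [Decidable t]
    (h : (p ↔ q) ↔ (r ↔ t)) : ((if p then (1 : ZMod 2) else 0) + if q then 1 else 0) =
      (if r then 1 else 0) + if t then 1 else 0 := by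
  have e2 : (1 : ZMod 2) + 1 = 0 := by decide
  by_cases a1 : p <;> by_cases a2 : q <;> by_cases a3 : r <;> by_cases a4 : t <;>
    simp [a1, a2, a3, a4, e2] at h ⊢

/-- By `act_parity` an edge changes its activity exactly if one of its two ends lies in the wedge
between the directions. Every vertex is an end of two edges, so the sum over all edges vanishes
modulo 2. -/
theorem total_parity_of_pos (S : Star u) {d d' : ℂ} (hd : 0 < cross d d')
    (g : ∀ j, cross d (u j) ≠ 0) (g' : ∀ j, cross d' (u j) ≠ 0) :
    Odd (total u d) ↔ Odd (total u d') := by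
  classical
  have hcast : ∀ x : ℂ, (total u x : ZMod 2) = ∑ i, if EAct u x i then (1 : ZMod 2) else 0 := by
    intro x
    rw [Finset.sum_boole, total, Set.ncard_eq_toFinset_card']
    simp
  set T : Fin n → Prop := fun i => 0 < cross d (u i) ∧ cross d' (u i) < 0 with hT
  have h1 : (total u d : ZMod 2) + total u d' = 0 := by
    rw [hcast, hcast, ← Finset.sum_add_distrib]
    have : ∀ i, ((if EAct u d i then (1 : ZMod 2) else 0) + if EAct u d' i then 1 else 0) =
        (if T i then 1 else 0) + if T (finRotate n i) then 1 else 0 := by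
      intro i
      have := act_parity hd (S.edge_ne i) (g i) (g _) (g' i) (g' (finRotate n i))
      have h2 : (EAct u d i ↔ EAct u d' i) ↔ (T i ↔ T (finRotate n i)) := this
      exact ite_add_ite_of_iff h2
    rw [Finset.sum_congr rfl fun i _ => this i, Finset.sum_add_distrib,
      Equiv.sum_comp (finRotate n) fun i => if T i then (1 : ZMod 2) else 0]
    exact CharTwo.add_self_eq_zero _
  have h2 : Even (total u d + total u d') := by
    rw [← ZMod.natCast_eq_zero_iff_even]
    push_cast
    exact h1
  rw [Nat.even_add] at h2
  rw [← Nat.not_even_iff_odd, ← Nat.not_even_iff_odd, h2]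

theorem total_parity (S : Star u) {d d' : ℂ} (hd : cross d d' ≠ 0)
    (g : ∀ j, cross d (u j) ≠ 0) (g' : ∀ j, cross d' (u j) ≠ 0) :
    Odd (total u d) ↔ Odd (total u d') := by
  rcases lt_or_gt_of_ne hd with h | h
  · rw [total_parity_of_pos S (d := d') (d' := d) (by rw [cross_swap]; linarith) g' g]
  · exact total_parity_of_pos S h g g'

theorem exists_smul_of_cross_eq_zero {d x : ℂ} (hd : d ≠ 0) (h : cross d x = 0) :
    ∃ t : ℝ, x = t • d := by
  have hn : 0 < d.re * d.re + d.im * d.im := by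
    have := Complex.normSq_pos.2 hd
    rwa [Complex.normSq_apply] at this
  unfold cross at h
  refine ⟨(d.re * x.re + d.im * x.im) / (d.re * d.re + d.im * d.im), ?_⟩
  apply Complex.ext
  · simp only [Complex.real_smul, Complex.re_ofReal_mul]
    rw [div_mul_eq_mul_div, eq_div_iff hn.ne']
    linear_combination -d.im * h
  · simp only [Complex.real_smul, Complex.im_ofReal_mul]
    rw [div_mul_eq_mul_div, eq_div_iff hn.ne']
    linear_combination d.re * h

/-- A small rotation leaves the line through `x` and keeps every sign that was not zero; it serves
to make a direction generic. -/
theorem eventually_rotated {d x : ℂ} (hd : d ≠ 0) (hx : x ≠ 0) :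
    ∀ᶠ ε : ℝ in 𝓝[>] 0, cross (d + ε • (Complex.I * d)) x ≠ 0 ∧
      (cross d x ≠ 0 → 0 < cross (d + ε • (Complex.I * d)) x * cross d x) := by
  by_cases h : cross d x = 0
  · filter_upwards [self_mem_nhdsWithin] with ε (hε : 0 < ε)
    refine ⟨?_, fun h' => absurd h h'⟩
    obtain ⟨t, rfl⟩ := exists_smul_of_cross_eq_zero hd h
    have ht : t ≠ 0 := by rintro rfl; simp at hx
    have hn := Complex.normSq_pos.2 hd
    rw [cross_add_left, h, cross_smul_left, cross_smul_right, zero_add]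
    have : cross (Complex.I * d) d = -Complex.normSq d := by
      simp [cross, Complex.normSq_apply]; ring
    rw [this]
    exact mul_ne_zero hε.ne' (mul_ne_zero ht (neg_ne_zero.2 hn.ne'))
  · have hc : Filter.Tendsto (fun ε : ℝ => cross (d + ε • (Complex.I * d)) x * cross d x)
        (𝓝[>] 0) (𝓝 (cross d x * cross d x)) := by
      have : Continuous fun ε : ℝ => cross (d + ε • (Complex.I * d)) x * cross d x := by
        simp only [cross_add_left, cross_smul_left]
        fun_prop
      have h2 := this.tendsto 0
      simp only [zero_smul, add_zero] at h2
      exact h2.mono_left nhdsWithin_le_nhds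
    filter_upwards [hc.eventually (lt_mem_nhds (mul_self_pos.2 h))] with ε hε
    refine ⟨fun h0 => ?_, fun _ => hε⟩
    rw [h0, zero_mul] at hε
    exact lt_irrefl _ hε

/-- If some ray through no vertex crosses an odd number of edges, then this holds for all
directions that are not parallel to a vertex. -/
theorem odd_total (S : Star u) {d₀ : ℂ} (hd₀ : d₀ ≠ 0)
    (h0 : ∀ i, ∀ t : ℝ, 0 ≤ t → u i ≠ t • d₀) (hodd : Odd (total u d₀)) {d : ℂ} (hd : d ≠ 0)
    (g : ∀ j, cross d (u j) ≠ 0) : Odd (total u d) := by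
  have hev : ∀ᶠ ε : ℝ in 𝓝[>] 0, (∀ j, cross (d₀ + ε • (Complex.I * d₀)) (u j) ≠ 0 ∧
      (cross d₀ (u j) ≠ 0 → 0 < cross (d₀ + ε • (Complex.I * d₀)) (u j) * cross d₀ (u j))) ∧
      cross (d₀ + ε • (Complex.I * d₀)) d ≠ 0 :=
    (Filter.eventually_all.2 fun j => eventually_rotated hd₀ (S.ne_zero j)).and
      ((eventually_rotated hd₀ hd).mono fun ε h => h.1)
  obtain ⟨ε, h1, h2⟩ := hev.exists
  set d₁ := d₀ + ε • (Complex.I * d₀)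
  rw [← total_parity S h2 (fun j => (h1 j).1) g]
  -- A vertex parallel to `d₀` lies behind the origin, since the ray itself contains none. An edge
  -- with such an end is crossed neither before nor after the rotation; for all other edges no sign
  -- changes.
  have : total u d₁ = total u d₀ := by
    unfold total
    congr 1
    ext i
    simp only [Set.mem_ofPred_eq, EAct]
    have hA := S.edge_ne i
    have hopp : ∀ j, cross d₀ (u j) = 0 → ∃ t : ℝ, t < 0 ∧ u j = t • d₀ := fun j hj => by
      obtain ⟨t, ht⟩ := exists_smul_of_cross_eq_zero hd₀ hj
      refine ⟨t, ?_, ht⟩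
      by_contra h
      exact h0 j t (not_lt.1 h) ht
    by_cases ha : cross d₀ (u i) = 0
    · obtain ⟨t, ht, hu⟩ := hopp i ha
      have hb : cross d₀ (u (finRotate n i)) ≠ 0 := by
        intro hb
        rw [hu, cross_smul_left, hb, mul_zero] at hA
        exact hA rfl
      have h3 := (h1 (finRotate n i)).2 hb
      constructor
      · rintro ⟨-, h4⟩
        rw [hu, cross_smul_left] at h4
        nlinarith
      · rintro ⟨h4, -⟩
        rw [ha] at h4
        simp at h4
    · by_cases hb : cross d₀ (u (finRotate n i)) = 0
      · obtain ⟨t, ht, hu⟩ := hopp _ hb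
        have h3 := (h1 i).2 ha
        constructor
        · rintro ⟨h4, -⟩
          rw [hu, cross_smul_right, cross_swap d₀ (u i)] at h4
          nlinarith
        · rintro ⟨-, h4⟩
          rw [hb] at h4
          simp at h4
      · exact act_congr ((h1 i).2 ha) ((h1 _).2 hb)
  rw [this]
  exact hodd

end


/-! ## Windows in terms of the order of the edges along nearby rays -/

section
variable {n : ℕ} {P : Polygon ℂ n} {q : ℂ}

/-- The vertices relative to `q`. -/
def rel (P : Polygon ℂ n) (q : ℂ) (i : Fin n) : ℂ := P i - q

theorem mem_edgeSet_iff {i : Fin n} {x : ℂ} :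
    q + x ∈ P.edgeSet ℝ i ↔ x ∈ segment ℝ (rel P q i) (rel P q (finRotate n i)) := by
  have : P.edgeSet ℝ i = segment ℝ (q + rel P q i) (q + rel P q (finRotate n i)) := by
    simp only [rel, add_sub_cancel]
    exact affineSegment_eq_segment ℝ _ _
  rw [this, mem_segment_translate]

theorem mem_openEdge_iff {i : Fin n} {x : ℂ} :
    q + x ∈ openSegment ℝ (P i) (P (finRotate n i)) ↔
      x ∈ openSegment ℝ (rel P q i) (rel P q (finRotate n i)) := by
  have : openSegment ℝ (P i) (P (finRotate n i)) =
      openSegment ℝ (q + rel P q i) (q + rel P q (finRotate n i)) := by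
    simp only [rel, add_sub_cancel]
  rw [this, mem_openSegment_translate]

theorem side_eq (m : Fin n) (y : ℂ) : side q (P m) y = cross (rel P q m) (y - q) := by
  simp [side, cross, rel]

/-- A vanishing determinant would put `q` on the line through the two distinct vertices. -/
theorem cross_ne_of_general (hS : IsSimple P) (hW : WeakGeneralPosition P q) {i j : Fin n}
    (hij : i ≠ j) : cross (rel P q i) (rel P q j) ≠ 0 := fun h => by
  have hne : rel P q j - rel P q i ≠ 0 := by
    rw [rel, rel, sub_sub_sub_cancel_right]
    exact sub_ne_zero.2 fun h => hij (hS.injective h.symm)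
  have h1 : cross (rel P q j - rel P q i) (rel P q i) = 0 := by
    have : cross (rel P q j - rel P q i) (rel P q i) = -cross (rel P q i) (rel P q j) := by
      simp [cross]; ring
    rw [this, h, neg_zero]
  obtain ⟨t, ht⟩ := exists_smul_of_cross_eq_zero hne h1
  apply hW i j hij
  have : q = AffineMap.lineMap (P i) (P j) (-t) := by
    rw [AffineMap.lineMap_apply]
    simp only [vsub_eq_sub, vadd_eq_add, neg_smul]
    have h2 : P i - q = t • (P j - P i) := by
      have : P j - P i = rel P q j - rel P q i := by simp [rel]
      rw [this]; exact ht
    rw [← h2]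
    ring
  rw [this]
  exact AffineMap.lineMap_mem_affineSpan_pair _ _ _

/-- Consecutive edges share only a vertex, which is in neither open edge, and other edges are
disjoint. A vertex `m` on a foreign edge would be common to that edge and to edge `m`, which could
at most share the vertex after `m`. -/
theorem star_of_simple (hS : IsSimple P) (hW : WeakGeneralPosition P q) : Star (rel P q) := by
  have hn := hS.three_le
  have hcross : ∀ i j, i ≠ j → cross (rel P q i) (rel P q j) ≠ 0 := fun i j hij =>
    cross_ne_of_general hS hW hij
  have hend : ∀ i, P i ∉ openSegment ℝ (P i) (P (finRotate n i)) := by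
    intro i h
    rw [left_mem_openSegment_iff] at h
    exact finRotate_ne_self hn i (hS.injective h.symm)
  have hend' : ∀ i, P (finRotate n i) ∉ openSegment ℝ (P i) (P (finRotate n i)) := by
    intro i h
    rw [right_mem_openSegment_iff] at h
    exact finRotate_ne_self hn i (hS.injective h.symm)
  have hmem : ∀ i x, x ∈ openSegment ℝ (rel P q i) (rel P q (finRotate n i)) →
      q + x ∈ P.edgeSet ℝ i := fun i x hx => mem_edgeSet_iff.2 (openSegment_subset_segment ℝ _ _ hx)
  have hcons : ∀ i x, x ∈ openSegment ℝ (rel P q i) (rel P q (finRotate n i)) →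
      x ∈ openSegment ℝ (rel P q (finRotate n i)) (rel P q (finRotate n (finRotate n i))) →
      False := by
    intro i x h1 h2
    have h3 : q + x ∈ P.edgeSet ℝ i ∩ P.edgeSet ℝ (finRotate n i) := ⟨hmem _ _ h1, hmem _ _ h2⟩
    rw [hS.consecutive, Set.mem_singleton_iff] at h3
    have h4 := mem_openEdge_iff.2 h1
    rw [h3] at h4
    exact hend' i h4
  refine ⟨hn, hcross, fun i j hij => ?_, fun m j h1 h2 h3 => ?_⟩
  · rw [Set.disjoint_left]
    intro x h1 h2
    by_cases hj : j = finRotate n i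
    · subst hj
      exact hcons i x h1 h2
    by_cases hi : i = finRotate n j
    · subst hi
      exact hcons j x h2 h1
    exact Set.disjoint_left.1 (hS.disjoint i j hij hj hi) (hmem _ _ h1) (hmem _ _ h2)
  · have h4 : P m ∈ P.edgeSet ℝ j := by
      have := (mem_edgeSet_iff (P := P) (q := q)).2 h3
      simpa [rel] using this
    have h5 : P m ∈ P.edgeSet ℝ m := by
      have := (mem_edgeSet_iff (P := P) (q := q) (i := m)).2 (left_mem_segment ℝ _ _)
      simpa [rel] using this
    by_cases hj : j = finRotate n m
    · have h6 : P m ∈ P.edgeSet ℝ m ∩ P.edgeSet ℝ (finRotate n m) := ⟨h5, hj ▸ h4⟩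
      rw [hS.consecutive, Set.mem_singleton_iff] at h6
      exact finRotate_ne_self hn m (hS.injective h6.symm)
    · exact Set.disjoint_left.1 (hS.disjoint m j h1 hj h2) h5 h4

/-- The unit vector with angle `φ`. -/
noncomputable def unit (φ : ℝ) : ℂ := Complex.exp ((φ : ℂ) * Complex.I)

theorem norm_unit (φ : ℝ) : ‖unit φ‖ = 1 := Complex.norm_exp_ofReal_mul_I φ

theorem unit_ne_zero (φ : ℝ) : unit φ ≠ 0 := Complex.exp_ne_zero _

theorem norm_smul_unit_angle (v : ℂ) : ‖v - q‖ • unit (angle q v) = v - q := by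
  have h1 : unit (angle q v) = unit (Complex.arg (v - q)) := by
    unfold unit angle
    rw [← self_sub_toIcoDiv_zsmul, Complex.exp_eq_exp_iff_exists_int]
    refine ⟨-toIcoDiv Real.two_pi_pos 0 (Complex.arg (v - q)), ?_⟩
    push_cast [zsmul_eq_mul]
    ring
  rw [h1, Complex.real_smul]
  exact Complex.norm_mul_exp_arg_mul_I (v - q)

theorem mem_ray_iff {x : ℂ} {φ : ℝ} : x ∈ ray q φ ↔ ∃ t : ℝ, 0 ≤ t ∧ x = q + t • unit φ := by
  simp [ray, unit, Complex.real_smul]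

theorem mem_ray_angle_iff {v x : ℂ} (hv : v - q ≠ 0) :
    x ∈ ray q (angle q v) ↔ ∃ t : ℝ, 0 ≤ t ∧ x = q + t • (v - q) := by
  have hn : 0 < ‖v - q‖ := norm_pos_iff.2 hv
  rw [mem_ray_iff]
  constructor
  · rintro ⟨t, ht, rfl⟩
    refine ⟨t / ‖v - q‖, by positivity, ?_⟩
    conv_rhs => rw [← norm_smul_unit_angle (q := q) v, smul_smul]
    rw [norm_smul_unit_angle, div_mul_cancel₀ _ hn.ne']
  · rintro ⟨t, ht, rfl⟩
    refine ⟨t * ‖v - q‖, by positivity, ?_⟩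
    rw [mul_smul, norm_smul_unit_angle]

/-- The number of edge `i` on the ray in direction `d`. -/
noncomputable def rk (u : Fin n → ℂ) (d : ℂ) (i : Fin n) : ℕ :=
  {j | EAct u d j ∧ ekey u d j < ekey u d i}.ncard + 1

theorem rk_eq_ncard_le {u : Fin n → ℂ} (S : Star u) {d : ℂ} {i : Fin n} (hi : EAct u d i) :
    rk u d i = {j | EAct u d j ∧ ekey u d j ≤ ekey u d i}.ncard := by
  have : {j | EAct u d j ∧ ekey u d j ≤ ekey u d i} =
      insert i {j | EAct u d j ∧ ekey u d j < ekey u d i} := by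
    ext j
    simp only [Set.mem_ofPred_eq, Set.mem_insert_iff]
    constructor
    · rintro ⟨h1, h2⟩
      rcases h2.lt_or_eq with h | h
      · exact Or.inr ⟨h1, h⟩
      · exact Or.inl (ekey_injective S h1 hi h)
    · rintro (rfl | ⟨h1, h2⟩)
      · exact ⟨hi, le_rfl⟩
      · exact ⟨h1, h2.le⟩
  rw [this, Set.ncard_insert_of_notMem (by simp) (Set.toFinite _), rk]

theorem rk_lt_iff {u : Fin n → ℂ} {d : ℂ} {i j : Fin n} (hi : EAct u d i) :
    rk u d i < rk u d j ↔ ekey u d i < ekey u d j := by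
  constructor
  · intro h
    by_contra hcon
    rw [not_lt] at hcon
    have : rk u d j ≤ rk u d i := by
      unfold rk
      have := Set.ncard_le_ncard (s := {l | EAct u d l ∧ ekey u d l < ekey u d j})
        (t := {l | EAct u d l ∧ ekey u d l < ekey u d i})
        (fun l hl => ⟨hl.1, hl.2.trans_le hcon⟩) (Set.toFinite _)
      omega
    omega
  · intro h
    unfold rk
    have := Set.ncard_lt_ncard (s := {l | EAct u d l ∧ ekey u d l < ekey u d i})
      (t := {l | EAct u d l ∧ ekey u d l < ekey u d j})
      ⟨fun l hl => ⟨hl.1, hl.2.trans h⟩, fun hsub => by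
        have := hsub (show i ∈ _ from ⟨hi, h⟩)
        exact lt_irrefl _ this.2⟩ (Set.toFinite _)
    omega

theorem rk_congr {u : Fin n → ℂ} (S : Star u) {d d' : ℂ} (h : ∀ i, EAct u d i ↔ EAct u d' i)
    {i : Fin n} (hi : EAct u d i) : rk u d i = rk u d' i := by
  unfold rk
  congr 2
  ext j
  simp only [Set.mem_ofPred_eq]
  rw [h j]
  refine and_congr_right fun hj => ekey_lt_iff S ((h j).2 hj) hi hj ((h i).1 hi)

theorem mem_ray_inter_edge_iff (S : Star (rel P q)) {φ : ℝ}
    (g : ∀ j, cross (unit φ) (rel P q j) ≠ 0) {i : Fin n} {x : ℂ} :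
    x ∈ ray q φ ∩ P.edgeSet ℝ i ↔
      EAct (rel P q) (unit φ) i ∧ x = q + ekey (rel P q) (unit φ) i • unit φ := by
  have hoff : ∀ j, ∀ t : ℝ, 0 ≤ t → rel P q j ≠ t • unit φ := fun j t _ h => by
    apply g j
    rw [h, cross_smul_right, cross_self, mul_zero]
  constructor
  · rintro ⟨h1, h2⟩
    obtain ⟨t, ht, rfl⟩ := mem_ray_iff.1 h1
    obtain ⟨h3, h4⟩ := (mem_segment_iff (S.edge_ne i) (hoff _) (hoff _)).1 ⟨ht, mem_edgeSet_iff.1 h2⟩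
    exact ⟨h3, by rw [h4]; rfl⟩
  · rintro ⟨h1, rfl⟩
    obtain ⟨h3, h4⟩ := (mem_segment_iff (S.edge_ne i) (hoff _) (hoff _)).2 ⟨h1, rfl⟩
    exact ⟨mem_ray_iff.2 ⟨_, h3, rfl⟩, mem_edgeSet_iff.2 h4⟩

/-- The direction vector has norm 1, so distances from `q` are keys. -/
theorem isNthEdge_iff (S : Star (rel P q)) {φ : ℝ}
    (g : ∀ j, cross (unit φ) (rel P q j) ≠ 0) {i : Fin n} {j : ℕ} :
    IsNthEdge P q φ j i ↔ EAct (rel P q) (unit φ) i ∧ rk (rel P q) (unit φ) i = j := by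
  have hdist : ∀ t : ℝ, 0 ≤ t → dist q (q + t • unit φ) = t := fun t ht => by
    rw [dist_self_add_right, norm_smul, norm_unit, mul_one, Real.norm_of_nonneg ht]
  have hset : ∀ x, x = q + ekey (rel P q) (unit φ) i • unit φ → EAct (rel P q) (unit φ) i →
      {i' : Fin n | ∃ y ∈ ray q φ ∩ P.edgeSet ℝ i', dist q y < dist q x} =
        {j | EAct (rel P q) (unit φ) j ∧
          ekey (rel P q) (unit φ) j < ekey (rel P q) (unit φ) i} := by
    rintro x rfl hi
    ext i'
    simp only [Set.mem_ofPred_eq]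
    constructor
    · rintro ⟨y, hy, hlt⟩
      obtain ⟨h1, rfl⟩ := (mem_ray_inter_edge_iff S g).1 hy
      rw [hdist _ (show 0 ≤ ekey (rel P q) (unit φ) i' from h1.tk_pos.le),
        hdist _ (show 0 ≤ ekey (rel P q) (unit φ) i from hi.tk_pos.le)] at hlt
      exact ⟨h1, hlt⟩
    · rintro ⟨h1, h2⟩
      refine ⟨_, (mem_ray_inter_edge_iff S g).2 ⟨h1, rfl⟩, ?_⟩
      rwa [hdist _ (show 0 ≤ ekey (rel P q) (unit φ) i' from h1.tk_pos.le),
        hdist _ (show 0 ≤ ekey (rel P q) (unit φ) i from hi.tk_pos.le)]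
  constructor
  · rintro ⟨x, hx, h⟩
    obtain ⟨h1, h2⟩ := (mem_ray_inter_edge_iff S g).1 hx
    rw [hset x h2 h1] at h
    exact ⟨h1, h⟩
  · rintro ⟨h1, h2⟩
    refine ⟨_, (mem_ray_inter_edge_iff S g).2 ⟨h1, rfl⟩, ?_⟩
    rw [hset _ rfl h1]
    exact h2

theorem continuous_cross_unit (x : ℂ) : Continuous fun φ : ℝ => cross (unit φ) x := by
  unfold cross unit
  fun_prop

theorem cross_unit_unit (φ ψ : ℝ) : cross (unit φ) (unit ψ) = Real.sin (ψ - φ) := by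
  simp only [cross, unit, Complex.exp_ofReal_mul_I_re, Complex.exp_ofReal_mul_I_im, Real.sin_sub]
  ring

theorem eventually_other (S : Star (rel P q)) (m : Fin n) :
    ∀ᶠ φ in 𝓝 (angle q (P m)), ∀ j, j ≠ m →
      0 < cross (unit φ) (rel P q j) * cross (rel P q m) (rel P q j) := by
  refine Filter.eventually_all.2 fun j => ?_
  by_cases hj : j = m
  · simp [hj]
  have hc : Continuous fun φ : ℝ =>
      cross (unit φ) (rel P q j) * cross (rel P q m) (rel P q j) :=
    (continuous_cross_unit _).mul continuous_const
  have h0 : 0 < cross (unit (angle q (P m))) (rel P q j) * cross (rel P q m) (rel P q j) := by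
    have h1 : cross (rel P q m) (rel P q j) =
        ‖P m - q‖ * cross (unit (angle q (P m))) (rel P q j) := by
      rw [← cross_smul_left, norm_smul_unit_angle]; rfl
    have h2 := S.cross_ne m j (Ne.symm hj)
    have h3 : 0 < ‖P m - q‖ := norm_pos_iff.2 (S.ne_zero m)
    rw [h1] at h2 ⊢
    have h4 : cross (unit (angle q (P m))) (rel P q j) ≠ 0 := right_ne_zero_of_mul h2
    have := mul_pos h3 (mul_self_pos.2 h4)
    linarith
  filter_upwards [hc.tendsto _ |>.eventually (lt_mem_nhds h0)] with φ hφ _ using hφ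

theorem eventually_near_right (S : Star (rel P q)) (m : Fin n) :
    ∀ᶠ φ in 𝓝[>] angle q (P m), Near (rel P q) m 1 (unit φ) := by
  have h1 := (eventually_other S m).filter_mono (nhdsWithin_le_nhds (s := Set.Ioi (angle q (P m))))
  have h2 : ∀ᶠ φ in 𝓝[>] angle q (P m), φ ∈ Set.Ioo (angle q (P m)) (angle q (P m) + Real.pi) :=
    Ioo_mem_nhdsGT (by linarith [Real.pi_pos])
  filter_upwards [h1, h2] with φ h1 h2
  refine ⟨h1, ?_⟩
  have h3 : 0 < ‖P m - q‖ := norm_pos_iff.2 (S.ne_zero m)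
  have : rel P q m = ‖P m - q‖ • unit (angle q (P m)) := (norm_smul_unit_angle _).symm
  rw [this, cross_smul_left, cross_unit_unit, one_mul]
  exact mul_pos h3 (Real.sin_pos_of_pos_of_lt_pi (by linarith [h2.1]) (by linarith [h2.2]))

theorem eventually_near_left (S : Star (rel P q)) (m : Fin n) :
    ∀ᶠ φ in 𝓝[<] angle q (P m), Near (rel P q) m (-1) (unit φ) := by
  have h1 := (eventually_other S m).filter_mono (nhdsWithin_le_nhds (s := Set.Iio (angle q (P m))))
  have h2 : ∀ᶠ φ in 𝓝[<] angle q (P m), φ ∈ Set.Ioo (angle q (P m) - Real.pi) (angle q (P m)) :=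
    Ioo_mem_nhdsLT (by linarith [Real.pi_pos])
  filter_upwards [h1, h2] with φ h1 h2
  refine ⟨h1, ?_⟩
  have h3 : 0 < ‖P m - q‖ := norm_pos_iff.2 (S.ne_zero m)
  have : rel P q m = ‖P m - q‖ • unit (angle q (P m)) := (norm_smul_unit_angle _).symm
  rw [this, cross_smul_left, cross_unit_unit]
  have h4 := Real.sin_neg_of_neg_of_neg_pi_lt (x := φ - angle q (P m)) (by linarith [h2.2])
    (by linarith [h2.1])
  nlinarith

/-- The vertex `m` is critical; `ε = 1` for a start vertex and `ε = -1` for an end vertex. -/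
structure Crit (u : Fin n → ℂ) (ε : ℝ) (m : Fin n) : Prop where
  sign : ε = 1 ∨ ε = -1
  fst : 0 < ε * cross (u m) (u (finRotate n m))
  snd : 0 < ε * cross (u m) (u ((finRotate n).symm m))

theorem isStartVertex_iff {m : Fin n} : IsStartVertex P q m ↔ Crit (rel P q) 1 m := by
  unfold IsStartVertex
  rw [side_eq, side_eq]
  exact ⟨fun h => ⟨Or.inl rfl, by rw [one_mul]; exact h.2, by rw [one_mul]; exact h.1⟩,
    fun h => ⟨by have := h.snd; rwa [one_mul] at this, by have := h.fst; rwa [one_mul] at this⟩⟩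

theorem isEndVertex_iff {m : Fin n} : IsEndVertex P q m ↔ Crit (rel P q) (-1) m := by
  unfold IsEndVertex
  rw [side_eq, side_eq]
  refine ⟨fun h => ⟨Or.inr rfl, ?_, ?_⟩, fun h => ⟨?_, ?_⟩⟩
  · have : cross (rel P q m) (rel P q (finRotate n m)) < 0 := h.2
    linarith
  · have : cross (rel P q m) (rel P q ((finRotate n).symm m)) < 0 := h.1
    linarith
  · have := h.snd
    have h' : cross (rel P q m) (rel P q ((finRotate n).symm m)) < 0 := by linarith
    exact h'
  · have := h.fst
    have h' : cross (rel P q m) (rel P q (finRotate n m)) < 0 := by linarith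
    exact h'

theorem Crit.sign_unique {u : Fin n → ℂ} {ε ε' : ℝ} {m : Fin n} (h : Crit u ε m)
    (h' : Crit u ε' m) : ε = ε' := by
  have h1 := h.fst
  have h2 := h'.fst
  rcases h.sign with rfl | rfl <;> rcases h'.sign with rfl | rfl <;> first | rfl | (exfalso; linarith)

theorem isCritical_iff {m : Fin n} : IsCritical P q m ↔ ∃ ε, Crit (rel P q) ε m := by
  unfold IsCritical
  rw [isStartVertex_iff, isEndVertex_iff]
  constructor
  · rintro (h | h) <;> exact ⟨_, h⟩
  · rintro ⟨ε, h⟩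
    rcases h.sign with rfl | rfl
    · exact Or.inr h
    · exact Or.inl h

theorem Crit.incident_iff {u : Fin n → ℂ} (S : Star u) {ε : ℝ} {m : Fin n} (h : Crit u ε m)
    {ε' : ℝ} (hε' : ε' = 1 ∨ ε' = -1)
    {d : ℂ} (hd : Near u m ε' d) {e : Fin n} (he : Incident m e) : EAct u d e ↔ ε' = ε := by
  rcases he with rfl | he
  · rw [eact_incident_fst S hd]
    have := h.fst
    rcases h.sign with rfl | rfl <;> rcases hε' with rfl | rfl <;> norm_num at * <;> linarith
  · rw [eact_incident_snd S he hd]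
    have h1 := h.snd
    rw [← he, Equiv.symm_apply_apply] at h1
    rw [← he]
    rcases h.sign with rfl | rfl <;> rcases hε' with rfl | rfl <;> norm_num at * <;> linarith

/-- The numbering is the same for all directions near `m` on the side `ε`. Hence the statement about
all rays close enough can be tested on a single direction `d`. -/
theorem isNthEdgeAtVertex_iff (S : Star (rel P q)) {ε : ℝ} {m : Fin n} (hc : Crit (rel P q) ε m)
    {d : ℂ} (hd : Near (rel P q) m ε d) {j : ℕ} {i : Fin n} :
    IsNthEdgeAtVertex P q m j i ↔ EAct (rel P q) d i ∧ rk (rel P q) d i = j := by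
  have key : ∀ φ, Near (rel P q) m ε (unit φ) → (IsNthEdge P q φ j i ↔
      EAct (rel P q) d i ∧ rk (rel P q) d i = j) := fun φ hφ => by
    rw [isNthEdge_iff S hφ.generic, hφ.eact_iff hd]
    refine and_congr_right fun hi => ?_
    rw [rk_congr S (fun i => hd.eact_iff hφ i) hi]
  unfold IsNthEdgeAtVertex
  rw [isStartVertex_iff, isEndVertex_iff]
  rcases hc.sign with rfl | rfl
  · have hno : ¬ Crit (rel P q) (-1) m := fun h => by
      have := h.sign_unique hc
      norm_num at this
    simp only [hno, false_and, false_or, hc, true_and]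
    constructor
    · intro h
      obtain ⟨φ, h1, h2⟩ := (h.and (eventually_near_right S m)).exists
      exact (key φ h2).1 h1
    · intro h
      filter_upwards [eventually_near_right S m] with φ hφ using (key φ hφ).2 h
  · have hno : ¬ Crit (rel P q) 1 m := fun h => by
      have := h.sign_unique hc
      norm_num at this
    simp only [hno, false_and, or_false, hc, true_and]
    constructor
    · intro h
      obtain ⟨φ, h1, h2⟩ := (h.and (eventually_near_left S m)).exists
      exact (key φ h2).1 h1
    · intro h
      filter_upwards [eventually_near_left S m] with φ hφ using (key φ hφ).2 h

end


/-! ### Visible vertices, windows and their types. -/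

section
variable {n : ℕ} {P : Polygon ℂ n} {q : ℂ}

/-- No vertex lies on the open segment, by the hypothesis, so the terms for vertices vanish. The
point `q + z` is at position 1 of its ray, and the open edges met before it remain. -/
theorem crossings_eq (S : Star (rel P q)) {z : ℂ}
    (h : ∀ i, cross z (rel P q i) = 0 → rel P q i = z) :
    crossings P q (q + z) = {i | EAct (rel P q) z i ∧ ekey (rel P q) z i < 1}.ncard := by
  have hseg : ∀ x : ℂ, x ∈ openSegment ℝ q (q + z) ↔ ∃ t : ℝ, 0 < t ∧ t < 1 ∧ x = q + t • z := by
    intro x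
    rw [openSegment_eq_image']
    constructor
    · rintro ⟨t, ht, rfl⟩
      exact ⟨t, ht.1, ht.2, by simp⟩
    · rintro ⟨t, h1, h2, rfl⟩
      exact ⟨t, ⟨h1, h2⟩, by simp⟩
  have hno : ∀ i, P i ∉ openSegment ℝ q (q + z) := by
    intro i hi
    obtain ⟨t, h1, h2, h3⟩ := (hseg _).1 hi
    have h4 : rel P q i = t • z := by rw [rel, h3]; ring
    have h5 := h i (by rw [h4, cross_smul_right, cross_self, mul_zero])
    have h6 : (1 - t) • z = 0 := by rw [sub_smul, one_smul, ← h4, h5, sub_self]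
    rcases smul_eq_zero.1 h6 with h7 | h7
    · linarith
    · exact S.ne_zero i (h5.trans h7)
  have h1 : {i : Fin n | P i ∈ openSegment ℝ q (q + z) ∧ ¬ IsCritical P q i} = ∅ :=
    Set.eq_empty_of_forall_notMem fun i hi => hno i hi.1
  have h2 : {i : Fin n | P i ∈ openSegment ℝ q (q + z) ∧ IsCritical P q i} = ∅ :=
    Set.eq_empty_of_forall_notMem fun i hi => hno i hi.1
  rw [crossings, h1, h2, Set.ncard_empty, mul_zero, add_zero, add_zero]
  congr 1
  ext i
  simp only [Set.mem_ofPred_eq]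
  constructor
  · rintro ⟨x, hx, hx'⟩
    obtain ⟨t, h1, h2, rfl⟩ := (hseg _).1 hx
    obtain ⟨h3, h4⟩ := act_of_mem_openSegment (S.edge_ne i) h1.le (mem_openEdge_iff.1 hx')
    exact ⟨h3, by rw [ekey, ← h4]; exact h2⟩
  · rintro ⟨h3, h4⟩
    exact ⟨q + ekey (rel P q) z i • z, (hseg _).2 ⟨_, h3.tk_pos, h4, rfl⟩,
      mem_openEdge_iff.2 h3.mem_openSegment⟩

theorem mem_boundary_vertex (m : Fin n) : P m ∈ P.boundary ℝ := by
  rw [Polygon.boundary, Set.mem_iUnion]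
  refine ⟨m, ?_⟩
  have := (mem_edgeSet_iff (P := P) (q := 0) (i := m)).2 (left_mem_segment ℝ _ _)
  simpa [rel] using this

theorem incident_self (m : Fin n) : Incident m m := Or.inl rfl

theorem pred_ne_self (hn : 3 ≤ n) (m : Fin n) : (finRotate n).symm m ≠ m := fun h => by
  have := finRotate_ne_self hn m
  rw [← h, Equiv.apply_symm_apply] at this
  exact this h.symm

theorem incident_iff_mem {m e : Fin n} : Incident m e ↔ e = m ∨ e = (finRotate n).symm m := by
  unfold Incident
  rw [Equiv.eq_symm_apply]

theorem ncard_incident (hn : 3 ≤ n) (m : Fin n) : {e | Incident m e}.ncard = 2 := by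
  have : {e : Fin n | Incident m e} = {m, (finRotate n).symm m} := by
    ext e
    simp [incident_iff_mem]
  rw [this, Set.ncard_pair (pred_ne_self hn m).symm]

theorem eact_vertex_not_incident {u : Fin n → ℂ} {m i : Fin n} (h : EAct u (u m) i) :
    ¬ Incident m i := by
  obtain ⟨h1, h2⟩ := h
  rintro (rfl | h3)
  · rw [cross_self, mul_zero] at h1
    exact lt_irrefl _ h1
  · rw [h3, cross_self, mul_zero] at h2
    exact lt_irrefl _ h2

/-- The edges in front of `m` are exactly those in front of the two incident edges on the nearby
ray. Hence at most `k` of them means that the incident edges are among the first `k + 2`. -/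
theorem visible_iff {u : Fin n → ℂ} (S : Star u) {ε : ℝ} {m : Fin n} (hc : Crit u ε m)
    {d : ℂ} (hd : Near u m ε d) {k : ℕ} {a : Fin n} (hr : EAct u d a ∧ rk u d a = k + 2) :
    {i | EAct u (u m) i ∧ ekey u (u m) i < 1}.ncard ≤ k ↔
      ∀ e, Incident m e → ekey u d e ≤ ekey u d a := by
  obtain ⟨ha, hr⟩ := hr
  rw [rk_eq_ncard_le S ha] at hr
  have hact : ∀ e, Incident m e → EAct u d e := fun e he =>
    (hc.incident_iff S hc.sign hd he).2 rfl
  have hinc := ncard_incident S.three_le m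
  constructor
  · intro hV e he
    by_contra hlt
    rw [not_le] at hlt
    -- If the incident edge `e` came after `a`, the `k + 2` edges up to `a` would consist of edges
    -- in front of `m` and at most one incident edge.
    have hsub : {j | EAct u d j ∧ ekey u d j ≤ ekey u d a} ⊆
        {i | EAct u (u m) i ∧ ekey u (u m) i < 1} ∪ ({e' | Incident m e'} \ {e}) := by
      rintro j ⟨h1, h2⟩
      by_cases hj : Incident m j
      · exact Or.inr ⟨hj, fun h => absurd hlt (by rw [← Set.mem_singleton_iff.1 h]; exact not_lt.2 h2)⟩
      · refine Or.inl ⟨?_, (ekey_lt_incident_iff S hd hj he h1 (hact e he)).1 (h2.trans_lt hlt)⟩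
        exact (hd.eact_iff_vertex (not_incident.1 hj).1 (not_incident.1 hj).2).1 h1
    have h1 := Set.ncard_le_ncard hsub (Set.toFinite _)
    have h2 := Set.ncard_union_le {i | EAct u (u m) i ∧ ekey u (u m) i < 1}
      ({e' | Incident m e'} \ {e})
    have h3 := Set.ncard_sdiff_singleton_of_mem (s := {e' | Incident m e'}) he
    omega
  · intro h
    have hdis : Disjoint {i | EAct u (u m) i ∧ ekey u (u m) i < 1} {e | Incident m e} :=
      Set.disjoint_left.2 fun i hi hi' => eact_vertex_not_incident hi.1 hi'
    have hsub : {i | EAct u (u m) i ∧ ekey u (u m) i < 1} ∪ {e | Incident m e} ⊆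
        {j | EAct u d j ∧ ekey u d j ≤ ekey u d a} := by
      rintro j (⟨h1, h2⟩ | hj)
      · have hj := eact_vertex_not_incident h1
        have h3 := (hd.eact_iff_vertex (not_incident.1 hj).1 (not_incident.1 hj).2).2 h1
        have h4 := (ekey_lt_incident_iff S hd hj (incident_self m) h3
          (hact m (incident_self m))).2 h2
        exact ⟨h3, h4.le.trans (h m (incident_self m))⟩
      · exact ⟨hact j hj, h j hj⟩
    have h1 := Set.ncard_le_ncard hsub (Set.toFinite _)
    rw [Set.ncard_union_eq hdis (Set.toFinite _) (Set.toFinite _)] at h1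
    omega

/-- In the order along a ray close to the vertex `m`, the edges `a` and `b` have the numbers
`k + 2` and `k + 3`, and the edges incident to `m` do not come after `a`. -/
structure Win (u : Fin n → ℂ) (k : ℕ) (m : Fin n) (d : ℂ) (a b : Fin n) : Prop where
  fst : EAct u d a ∧ rk u d a = k + 2
  snd : EAct u d b ∧ rk u d b = k + 3
  inc : ∀ e, Incident m e → ekey u d e ≤ ekey u d a

theorem Near.not_incident_or {u : Fin n → ℂ} {m : Fin n} {ε : ℝ} {d : ℂ} (hd : Near u m ε d)
    {i : Fin n} (h : EAct u d i) : Incident m i ∨ EAct u (u m) i := by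
  by_cases hi : Incident m i
  · exact Or.inl hi
  · exact Or.inr ((hd.eact_iff_vertex (not_incident.1 hi).1 (not_incident.1 hi).2).1 h)

theorem mem_ray_vertex_inter_edge_iff (S : Star (rel P q)) {m i : Fin n}
    (h : Incident m i ∨ EAct (rel P q) (rel P q m) i) {x : ℂ} :
    x ∈ ray q (angle q (P m)) ∩ P.edgeSet ℝ i ↔
      x = q + ekey (rel P q) (rel P q m) i • rel P q m := by
  have hv : P m - q ≠ 0 := S.ne_zero m
  constructor
  · rintro ⟨h1, h2⟩
    obtain ⟨t, ht, rfl⟩ := (mem_ray_angle_iff hv).1 h1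
    have h3 := mem_edgeSet_iff.1 h2
    have h4 := (eq_tk_of_mem_segment (S.edge_ne i) h3).2
    rw [h4]; rfl
  · rintro rfl
    rcases h with h | h
    · rw [ekey_incident S h]
      refine ⟨(mem_ray_angle_iff hv).2 ⟨1, zero_le_one, rfl⟩, mem_edgeSet_iff.2 ?_⟩
      rw [one_smul]
      rcases h with rfl | h
      · exact left_mem_segment ℝ _ _
      · rw [h]; exact right_mem_segment ℝ _ _
    · exact ⟨(mem_ray_angle_iff hv).2 ⟨_, h.tk_pos.le, rfl⟩,
        mem_edgeSet_iff.2 (openSegment_subset_segment ℝ _ _ h.mem_openSegment)⟩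

theorem isWindow_iff (S : Star (rel P q)) {ε : ℝ} {m : Fin n} (hc : Crit (rel P q) ε m)
    {d : ℂ} (hd : Near (rel P q) m ε d) {k : ℕ} {a b : Fin n} {A B : ℂ} :
    IsWindow P q k m a b A B ↔ Win (rel P q) k m d a b ∧
      A = q + ekey (rel P q) (rel P q m) a • rel P q m ∧
      B = q + ekey (rel P q) (rel P q m) b • rel P q m := by
  have hvis : P m ∈ visibilityRegion P q k ↔
      {i | EAct (rel P q) (rel P q m) i ∧ ekey (rel P q) (rel P q m) i < 1}.ncard ≤ k := by
    rw [← crossings_eq S (z := rel P q m)]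
    · have : q + rel P q m = P m := by simp [rel]
      rw [this]
      exact ⟨fun h => h.2, fun h => ⟨Or.inl (mem_boundary_vertex m), h⟩⟩
    · intro i hi
      by_contra hne
      exact S.cross_ne m i (fun h => hne (by rw [h])) hi
  constructor
  · rintro ⟨h1, h2, h3, h4, h5, h6⟩
    rw [isNthEdgeAtVertex_iff S hc hd] at h3 h4
    exact ⟨⟨h3, h4, (visible_iff S hc hd h3).1 (hvis.1 h2)⟩,
      (mem_ray_vertex_inter_edge_iff S (hd.not_incident_or h3.1)).1 h5,
      (mem_ray_vertex_inter_edge_iff S (hd.not_incident_or h4.1)).1 h6⟩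
  · rintro ⟨⟨h3, h4, h5⟩, h6, h7⟩
    exact ⟨isCritical_iff.2 ⟨ε, hc⟩, hvis.2 ((visible_iff S hc hd h3).2 h5),
      (isNthEdgeAtVertex_iff S hc hd).2 h3, (isNthEdgeAtVertex_iff S hc hd).2 h4,
      (mem_ray_vertex_inter_edge_iff S (hd.not_incident_or h3.1)).2 h6,
      (mem_ray_vertex_inter_edge_iff S (hd.not_incident_or h4.1)).2 h7⟩

/-! ### Parity of crossings and membership in the polygon. -/

/-- Every ray from the origin that meets no line through a vertex crosses an odd number of edges. -/
def OddTotal (u : Fin n → ℂ) : Prop := ∀ d, d ≠ 0 → (∀ j, cross d (u j) ≠ 0) → Odd (total u d)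

/-- General position keeps `q` off the boundary, since an edge through `q` would have determinant 0.
So some ray through no vertex crosses an odd number of edges, and `odd_total` carries this to every
generic direction. -/
theorem oddTotal_of_mem_region (S : Star (rel P q)) (h : q ∈ region P) : OddTotal (rel P q) := by
  rcases h with h | ⟨θ, h1, h2⟩
  · exfalso
    rw [Polygon.boundary, Set.mem_iUnion] at h
    obtain ⟨i, hi⟩ := h
    have h1 := (mem_edgeSet_iff (P := P) (q := q) (i := i) (x := 0)).1 (by rwa [add_zero])
    rw [← smul_zero (0 : ℝ)] at h1
    have := (eq_tk_of_mem_segment (S.edge_ne i) h1).1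
    rw [zero_mul] at this
    exact S.edge_ne i this.symm
  · have hoff : ∀ i, ∀ t : ℝ, 0 ≤ t → rel P q i ≠ t • unit θ := fun i t ht h => by
      refine h1 i (mem_ray_iff.2 ⟨t, ht, ?_⟩)
      rw [← h]; simp [rel]
    intro d hd g
    refine odd_total S (unit_ne_zero θ) hoff ?_ hd g
    have : total (rel P q) (unit θ) = {i : Fin n | (ray q θ ∩ P.edgeSet ℝ i).Nonempty}.ncard := by
      unfold total
      congr 1
      ext i
      simp only [Set.mem_ofPred_eq]
      constructor
      · intro h
        obtain ⟨h3, h4⟩ := (mem_segment_iff (S.edge_ne i) (hoff _) (hoff _)).2 ⟨h, rfl⟩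
        exact ⟨_, mem_ray_iff.2 ⟨_, h3, rfl⟩, mem_edgeSet_iff.2 h4⟩
      · rintro ⟨x, h3, h4⟩
        obtain ⟨t, ht, rfl⟩ := mem_ray_iff.1 h3
        exact ((mem_segment_iff (S.edge_ne i) (hoff _) (hoff _)).1
          ⟨ht, mem_edgeSet_iff.1 h4⟩).1
    rw [this]
    exact h2

/-- The ray that leaves `q + z` in direction `z` is the part with parameters at least 1 of the ray
from `q`. -/
theorem mem_region_of_generic (S : Star (rel P q)) {z : ℂ} (hz : z ≠ 0)
    (g : ∀ j, cross z (rel P q j) ≠ 0)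
    (h : Odd {i | EAct (rel P q) z i ∧ 1 ≤ ekey (rel P q) z i}.ncard) : q + z ∈ region P := by
  have hn : 0 < ‖z‖ := norm_pos_iff.2 hz
  have hun : ‖z‖ • unit (Complex.arg z) = z := by
    rw [Complex.real_smul]
    exact Complex.norm_mul_exp_arg_mul_I z
  have hray : ∀ x, x ∈ ray (q + z) (Complex.arg z) ↔ ∃ t : ℝ, 1 ≤ t ∧ x = q + t • z := by
    intro x
    rw [mem_ray_iff]
    constructor
    · rintro ⟨t, ht, rfl⟩
      refine ⟨1 + t / ‖z‖, by have : 0 ≤ t / ‖z‖ := by positivity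
                              linarith, ?_⟩
      have : (t / ‖z‖) • z = t • unit (Complex.arg z) := by
        conv_lhs => rw [← hun, smul_smul]
        rw [hun, div_mul_cancel₀ _ hn.ne']
      rw [add_smul, one_smul, this, add_assoc]
    · rintro ⟨t, ht, rfl⟩
      refine ⟨(t - 1) * ‖z‖, mul_nonneg (by linarith) hn.le, ?_⟩
      rw [mul_smul, hun, sub_smul, one_smul]
      ring
  have hoff : ∀ j, ∀ t : ℝ, 0 ≤ t → rel P q j ≠ t • z := fun j t _ h => by
    apply g j
    rw [h, cross_smul_right, cross_self, mul_zero]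
  refine Or.inr ⟨Complex.arg z, fun i hi => ?_, ?_⟩
  · obtain ⟨t, ht, h1⟩ := (hray _).1 hi
    refine hoff i t (by linarith) ?_
    rw [rel, h1]; ring
  · convert h using 2
    ext i
    simp only [Set.mem_ofPred_eq]
    constructor
    · rintro ⟨x, h1, h2⟩
      obtain ⟨t, ht, rfl⟩ := (hray _).1 h1
      obtain ⟨h3, h4⟩ := (mem_segment_iff (S.edge_ne i) (hoff _) (hoff _)).1
        ⟨by linarith, mem_edgeSet_iff.1 h2⟩
      exact ⟨h3, by rw [ekey, ← h4]; exact ht⟩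
    · rintro ⟨h1, h2⟩
      obtain ⟨h3, h4⟩ := (mem_segment_iff (S.edge_ne i) (hoff _) (hoff _)).2 ⟨h1, rfl⟩
      exact ⟨_, (hray _).2 ⟨_, h2, rfl⟩, mem_edgeSet_iff.2 h4⟩

/-- The ray crosses an odd number of edges in all. If an even number of them lies in front of the
point, an odd number is left behind it, so the point is in the polygon and only the count decides.
-/
theorem visible_generic_iff (S : Star (rel P q)) (hodd : OddTotal (rel P q)) {z : ℂ} (hz : z ≠ 0)
    (g : ∀ j, cross z (rel P q j) ≠ 0) {k : ℕ} {c : ℕ}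
    (hc : {i | EAct (rel P q) z i ∧ ekey (rel P q) z i < 1}.ncard = c) (hev : Even c) :
    q + z ∈ visibilityRegion P q k ↔ c ≤ k := by
  have hcr : crossings P q (q + z) = c := by
    rw [crossings_eq S fun i hi => absurd hi (g i), hc]
  have hreg : q + z ∈ region P := by
    refine mem_region_of_generic S hz g ?_
    have h1 := hodd z hz g
    have h2 : total (rel P q) z = c + {i | EAct (rel P q) z i ∧ 1 ≤ ekey (rel P q) z i}.ncard := by
      rw [← hc, ← Set.ncard_union_eq ?_ (Set.toFinite _) (Set.toFinite _)]
      · unfold total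
        congr 1
        ext i
        simp only [Set.mem_ofPred_eq, Set.mem_union, ← and_or_left, lt_or_ge, and_true]
      · rw [Set.disjoint_left]
        rintro i ⟨-, h3⟩ ⟨-, h4⟩
        linarith
    rw [h2, Nat.odd_add] at h1
    rwa [← Nat.not_even_iff_odd, ← h1, Nat.not_odd_iff_even]
  exact ⟨fun h => hcr ▸ h.2, fun h => ⟨hreg, by rw [hcr]; exact h⟩⟩

theorem Win.not_incident_snd {u : Fin n → ℂ} {k : ℕ} {m : Fin n} {d : ℂ} {a b : Fin n}
    (h : Win u k m d a b) : ekey u d a < ekey u d b ∧ ¬ Incident m b := by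
  have h1 : ekey u d a < ekey u d b := (rk_lt_iff h.fst.1).1 (by rw [h.fst.2, h.snd.2]; omega)
  exact ⟨h1, fun h2 => absurd (h.inc b h2) (not_le.2 h1)⟩

/-- The edges at the vertex `m` in the order along the ray through `m`. -/
theorem Win.le_fst {u : Fin n → ℂ} (S : Star u) {ε : ℝ} {m : Fin n} {k : ℕ} (hc : Crit u ε m)
    {d : ℂ} (hd : Near u m ε d) {a b : Fin n} (h : Win u k m d a b) {j : Fin n} (hj : EAct u d j)
    (hja : ekey u d j ≤ ekey u d a) : ekey u (u m) j ≤ ekey u (u m) a := by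
  have hact : ∀ e, Incident m e → EAct u d e := fun e he =>
    (hc.incident_iff S hc.sign hd he).2 rfl
  have hone : Incident m j → 1 ≤ ekey u (u m) a := fun hi => by
    by_cases ha : Incident m a
    · exact (ekey_incident S ha).ge
    · by_contra hlt
      have := (ekey_lt_incident_iff S hd ha hi h.fst.1 hj).2 (not_le.1 hlt)
      exact absurd hja (not_le.2 this)
  by_cases hi : Incident m j
  · rw [ekey_incident S hi]
    exact hone hi
  · have hj' := (hd.eact_iff_vertex (not_incident.1 hi).1 (not_incident.1 hi).2).1 hj
    by_cases ha : Incident m a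
    · rw [ekey_incident S ha]
      rcases hja.lt_or_eq with hlt | heq
      · exact ((ekey_lt_incident_iff S hd hi ha hj h.fst.1).1 hlt).le
      · exact absurd (ekey_injective S hj h.fst.1 heq ▸ ha) hi
    · have ha' := (hd.eact_iff_vertex (not_incident.1 ha).1 (not_incident.1 ha).2).1 h.fst.1
      exact (ekey_le_iff S hj h.fst.1 hj' ha').1 hja

theorem Win.snd_le {u : Fin n → ℂ} (S : Star u) {ε : ℝ} {m : Fin n} {k : ℕ}
    {d : ℂ} (hd : Near u m ε d) {a b : Fin n} (h : Win u k m d a b) {j : Fin n} (hj : EAct u d j)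
    (hja : ekey u d a < ekey u d j) : ekey u (u m) b ≤ ekey u (u m) j ∧ ¬ Incident m j := by
  have hi : ¬ Incident m j := fun hi => absurd (h.inc j hi) (not_le.2 hja)
  have hj' := (hd.eact_iff_vertex (not_incident.1 hi).1 (not_incident.1 hi).2).1 hj
  have hb := h.not_incident_snd.2
  have hb' := (hd.eact_iff_vertex (not_incident.1 hb).1 (not_incident.1 hb).2).1 h.snd.1
  refine ⟨(ekey_le_iff S h.snd.1 hj hb' hj').1 ?_, hi⟩
  by_contra hlt
  have h1 := (rk_lt_iff (u := u) hj (j := b)).2 (not_le.1 hlt)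
  have h2 := (rk_lt_iff (u := u) h.fst.1 (j := j)).2 hja
  rw [h.snd.2] at h1
  rw [h.fst.2] at h2
  omega

/-- On the ray through `m` the window lies at or beyond `m` and is not degenerate: `b` is not
incident, so its order relative to `a` remains strict in the limit. -/
theorem Win.lt_snd {u : Fin n → ℂ} (S : Star u) {ε : ℝ} {m : Fin n} {k : ℕ} (hc : Crit u ε m)
    {d : ℂ} (hd : Near u m ε d) {a b : Fin n} (h : Win u k m d a b) :
    1 ≤ ekey u (u m) a ∧ ekey u (u m) a < ekey u (u m) b := by
  have hact : ∀ e, Incident m e → EAct u d e := fun e he =>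
    (hc.incident_iff S hc.sign hd he).2 rfl
  have h1 : 1 ≤ ekey u (u m) a := by
    rw [← ekey_incident S (incident_self m)]
    exact h.le_fst S hc hd (hact _ (incident_self m)) (h.inc _ (incident_self m))
  refine ⟨h1, ?_⟩
  obtain ⟨hlt, hb⟩ := h.not_incident_snd
  have hb' := (hd.eact_iff_vertex (not_incident.1 hb).1 (not_incident.1 hb).2).1 h.snd.1
  by_cases ha : Incident m a
  · rw [ekey_incident S ha]
    refine lt_of_le_of_ne ?_ (ekey_vertex_ne_one S (not_incident.1 hb).1 (not_incident.1 hb).2 hb').symm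
    by_contra h2
    exact lt_asymm hlt ((ekey_lt_incident_iff S hd hb ha h.snd.1 h.fst.1).2 (not_le.1 h2))
  · have ha' := (hd.eact_iff_vertex (not_incident.1 ha).1 (not_incident.1 ha).2).1 h.fst.1
    exact (ekey_lt_iff S h.fst.1 h.snd.1 ha' hb').1 hlt

theorem continuous_cross_left (x : ℂ) : Continuous fun z : ℂ => cross z x := by
  unfold cross
  fun_prop

theorem eventually_ekey {u : Fin n → ℂ} {x : ℂ} {j : Fin n}
    (hD : cross x (u (finRotate n j)) - cross x (u j) ≠ 0) :
    Filter.Tendsto (fun z => ekey u z j) (𝓝 x) (𝓝 (ekey u x j)) := by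
  unfold ekey tk
  exact tendsto_const_nhds.div
    (((continuous_cross_left _).sub (continuous_cross_left _)).tendsto x) hD

/-- Close to a point of the window, to the left of the ray through the vertex. -/
theorem eventually_left_of_window {u : Fin n → ℂ} (S : Star u) {ε : ℝ} {m : Fin n} {k : ℕ}
    (hc : Crit u ε m) {d : ℂ} (hd : Near u m ε d) {a b : Fin n} (h : Win u k m d a b) {c : ℝ}
    (h1 : ekey u (u m) a < c) (h2 : c < ekey u (u m) b) :
    ∀ᶠ z in 𝓝 (c • u m), 0 < cross (u m) z → Near u m 1 z ∧
      {j | EAct u z j ∧ ekey u z j < 1}.ncard = if ε = 1 then k + 2 else k := by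
  have hc0 : 0 < c := by linarith [(h.lt_snd S hc hd).1]
  have hact : ∀ e, Incident m e → EAct u d e := fun e he =>
    (hc.incident_iff S hc.sign hd he).2 rfl
  have hother : ∀ᶠ z in 𝓝 (c • u m), ∀ j, j ≠ m → 0 < cross z (u j) * cross (u m) (u j) := by
    refine Filter.eventually_all.2 fun j => ?_
    by_cases hj : j = m
    · simp [hj]
    have hcont : Continuous fun z : ℂ => cross z (u j) * cross (u m) (u j) :=
      (continuous_cross_left _).mul continuous_const
    have h0 : 0 < cross (c • u m) (u j) * cross (u m) (u j) := by
      rw [cross_smul_left, mul_assoc]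
      exact mul_pos hc0 (mul_self_pos.2 (S.cross_ne m j (Ne.symm hj)))
    filter_upwards [(hcont.tendsto _).eventually (lt_mem_nhds h0)] with z hz _ using hz
  have hD : ∀ j, EAct u d j → cross (c • u m) (u (finRotate n j)) - cross (c • u m) (u j) ≠ 0 := by
    intro j hj
    rw [cross_smul_left, cross_smul_left, ← mul_sub]
    refine mul_ne_zero hc0.ne' fun h0 => ?_
    rcases hd.not_incident_or hj with hj | hj
    · have := (weak_incident S hj).2.2
      rw [h0, mul_zero] at this
      exact lt_irrefl _ this
    · have := hj.det_pos
      rw [h0, mul_zero] at this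
      exact lt_irrefl _ this
  have hkey : ∀ᶠ z in 𝓝 (c • u m), ∀ j, EAct u d j →
      (ekey u z j < 1 ↔ ekey u d j ≤ ekey u d a) := by
    refine Filter.eventually_all.2 fun j => ?_
    by_cases hj : EAct u d j
    · have htend := eventually_ekey (hD j hj)
      have hval : ekey u (c • u m) j = ekey u (u m) j / c := tk_smul _ _ _ _
      by_cases hja : ekey u d j ≤ ekey u d a
      · have : ekey u (c • u m) j < 1 := by
          rw [hval, div_lt_one hc0]
          exact (h.le_fst S hc hd hj hja).trans_lt h1
        filter_upwards [htend.eventually (gt_mem_nhds this)] with z hz _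
        exact iff_of_true hz hja
      · have : 1 < ekey u (c • u m) j := by
          rw [hval, one_lt_div hc0]
          exact h2.trans_le (h.snd_le S hd hj (not_le.1 hja)).1
        filter_upwards [htend.eventually (lt_mem_nhds this)] with z hz _
        exact iff_of_false hz.not_gt hja
    · simp [hj]
  filter_upwards [hother, hkey] with z hz1 hz2 hz3
  have hz : Near u m 1 z := ⟨hz1, by rwa [one_mul]⟩
  refine ⟨hz, ?_⟩
  have hrk := h.fst.2
  rw [rk_eq_ncard_le S h.fst.1] at hrk
  -- Left of a start vertex all `k + 2` edges up to `a` are crossed. Left of an end vertex the two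
  -- incident ones among them are gone, and `k` remain.
  rcases hc.sign with rfl | rfl
  · rw [if_pos rfl, ← hrk]
    congr 1
    ext j
    simp only [Set.mem_ofPred_eq]
    rw [hz.eact_iff hd]
    exact and_congr_right fun hj => hz2 j hj
  · rw [if_neg (by norm_num)]
    have hset : {j | EAct u z j ∧ ekey u z j < 1} =
        {j | EAct u d j ∧ ekey u d j ≤ ekey u d a} \ {e | Incident m e} := by
      ext j
      simp only [Set.mem_ofPred_eq, Set.mem_sdiff]
      by_cases hj : Incident m j
      · have : ¬ EAct u z j := by
          rw [hc.incident_iff S (Or.inl rfl) hz hj]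
          norm_num
        simp [hj, this]
      · have h3 : EAct u z j ↔ EAct u d j := by
          rw [hz.eact_iff_vertex (not_incident.1 hj).1 (not_incident.1 hj).2,
            hd.eact_iff_vertex (not_incident.1 hj).1 (not_incident.1 hj).2]
        rw [h3]
        simp only [hj, not_false_eq_true, and_true]
        exact and_congr_right fun hj => hz2 j hj
    have hsub : {e | Incident m e} ⊆ {j | EAct u d j ∧ ekey u d j ≤ ekey u d a} :=
      fun e he => ⟨hact e he, h.inc e he⟩
    rw [hset, Set.ncard_sdiff hsub (Set.toFinite _), hrk, ncard_incident S.three_le]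
    omega

/-- Just left of the window `k` edges are crossed at an end vertex and `k + 2` at a start vertex.
Both numbers are even, so the points are in the polygon, and they are visible only in the first
case. -/
theorem liesLeft_iff (S : Star (rel P q)) (hodd : OddTotal (rel P q)) {ε : ℝ} {m : Fin n} {k : ℕ}
    (hk : Even k) (hc : Crit (rel P q) ε m) {d : ℂ} (hd : Near (rel P q) m ε d) {a b : Fin n}
    (h : Win (rel P q) k m d a b) :
    LiesLeft P q k (P m) (q + ekey (rel P q) (rel P q m) a • rel P q m)
      (q + ekey (rel P q) (rel P q m) b • rel P q m) ↔ ε = -1 := by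
  obtain ⟨h1, h2⟩ := h.lt_snd S hc hd
  set α := ekey (rel P q) (rel P q m) a
  set β := ekey (rel P q) (rel P q m) b
  have hseg : ∀ x, x ∈ openSegment ℝ (q + α • rel P q m) (q + β • rel P q m) ↔
      ∃ c, α < c ∧ c < β ∧ x = q + c • rel P q m := by
    intro x
    rw [openSegment_eq_image']
    constructor
    · rintro ⟨t, ⟨ht0, ht1⟩, rfl⟩
      refine ⟨α + t * (β - α), by nlinarith, by nlinarith, ?_⟩
      simp only [add_sub_add_left_eq_sub, ← sub_smul, smul_smul, add_smul, add_assoc]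
    · rintro ⟨c, h3, h4, rfl⟩
      refine ⟨(c - α) / (β - α), ⟨div_pos (by linarith) (by linarith),
        (div_lt_one (by linarith)).2 (by linarith)⟩, ?_⟩
      simp only [add_sub_add_left_eq_sub, ← sub_smul, smul_smul, add_assoc, ← add_smul]
      rw [div_mul_cancel₀ _ (by linarith), add_sub_cancel]
  have hev : ∀ c, α < c → c < β → ∀ᶠ y in 𝓝 (q + c • rel P q m), 0 < side q (P m) y →
      (y ∈ visibilityRegion P q k ↔ ε = -1) := by
    intro c h3 h4
    have hten : Filter.Tendsto (fun y : ℂ => y - q) (𝓝 (q + c • rel P q m))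
        (𝓝 (c • rel P q m)) := by
      have : Continuous fun y : ℂ => y - q := by fun_prop
      have h5 := this.tendsto (q + c • rel P q m)
      rwa [add_sub_cancel_left] at h5
    filter_upwards [hten.eventually (eventually_left_of_window S hc hd h h3 h4)] with y hy hs
    rw [side_eq] at hs
    obtain ⟨h5, h6⟩ := hy hs
    have hy0 : y - q ≠ 0 := by
      intro h0
      rw [h0] at hs
      simp [cross] at hs
    have hkey := visible_generic_iff S hodd hy0 h5.generic (k := k) h6
      (by split_ifs
          · exact hk.add (by decide)
          · exact hk)
    rw [add_sub_cancel] at hkey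
    rw [hkey]
    rcases hc.sign with rfl | rfl <;> norm_num
  constructor
  · intro hl
    obtain ⟨c, h3, h4⟩ := exists_between h2
    have h5 := hl _ ((hseg _).2 ⟨c, h3, h4, rfl⟩)
    have h6 := h5.and (hev c h3 h4)
    -- A point of the window is approached from its left along the normal `i` times `rel P q m`.
    have hten : Filter.Tendsto (fun t : ℝ => q + c • rel P q m + t • (Complex.I * rel P q m))
        (𝓝[>] 0) (𝓝 (q + c • rel P q m)) := by
      have : Continuous fun t : ℝ => q + c • rel P q m + t • (Complex.I * rel P q m) := by fun_prop
      have h7 := this.tendsto 0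
      simp only [zero_smul, add_zero] at h7
      exact h7.mono_left nhdsWithin_le_nhds
    obtain ⟨t, h7, h8⟩ := ((hten.eventually h6).and self_mem_nhdsWithin).exists
    have h9 : 0 < side q (P m) (q + c • rel P q m + t • (Complex.I * rel P q m)) := by
      rw [side_eq, add_assoc, add_sub_cancel_left, cross_add_right, cross_smul_right, cross_self,
        mul_zero, zero_add, cross_smul_right]
      refine mul_pos h8 ?_
      have := Complex.normSq_pos.2 (S.ne_zero m)
      simp only [Complex.normSq_apply] at this
      simp only [cross, Complex.mul_re, Complex.mul_im, Complex.I_re, Complex.I_im]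
      linarith
    exact (h7.2 h9).1 (h7.1 h9)
  · intro hε x hx
    obtain ⟨c, h3, h4, rfl⟩ := (hseg _).1 hx
    filter_upwards [hev c h3 h4] with y hy hs using (hy hs).2 hε

/-- The type of the windows at start (`ε = 1`) and end (`ε = -1`) vertices. -/
def SignType (ε : ℝ) (t : WindowType) : Prop :=
  (ε = -1 ∧ t = WindowType.ccw) ∨ (ε = 1 ∧ t = WindowType.cw)

/-- Limits and neighbourhoods are gone: one direction per vertex and side is enough, and the order
of the edges along it is a finite computation. -/
theorem windowEndpoints_eq (S : Star (rel P q)) (hodd : OddTotal (rel P q)) {k : ℕ} (hk : Even k)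
    (D : ℝ → Fin n → ℂ) (hD : ∀ ε m, ε = 1 ∨ ε = -1 → Near (rel P q) m ε (D ε m)) :
    windowEndpoints P q k = {w | ∃ ε m a b, Crit (rel P q) ε m ∧
      Win (rel P q) k m (D ε m) a b ∧ w.1 = angle q (P m) ∧ (w.2.1 = a ∨ w.2.1 = b) ∧
      SignType ε w.2.2} := by
  ext ⟨θ, j, t⟩
  simp only [windowEndpoints, Set.mem_ofPred_eq]
  constructor
  · rintro ⟨m, a, b, A, B, hw, h1, h2, h3⟩
    obtain ⟨ε, hc⟩ := isCritical_iff.1 hw.critical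
    have hd := hD ε m hc.sign
    obtain ⟨hwin, rfl, rfl⟩ := (isWindow_iff S hc hd).1 hw
    rw [liesLeft_iff S hodd hk hc hd hwin] at h3
    refine ⟨ε, m, a, b, hc, hwin, h1, h2, ?_⟩
    rcases h3 with ⟨h3, h4⟩ | ⟨h3, h4⟩
    · exact Or.inl ⟨h3, h4⟩
    · exact Or.inr ⟨hc.sign.resolve_right h3, h4⟩
  · rintro ⟨ε, m, a, b, hc, hwin, h1, h2, h3⟩
    have hd := hD ε m hc.sign
    refine ⟨m, a, b, _, _, (isWindow_iff S hc hd).2 ⟨hwin, rfl, rfl⟩, h1, h2, ?_⟩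
    rw [liesLeft_iff S hodd hk hc hd hwin]
    rcases h3 with ⟨h3, h4⟩ | ⟨h3, h4⟩
    · exact Or.inl ⟨h3, h4⟩
    · refine Or.inr ⟨?_, h4⟩
      rw [h3]
      norm_num

/-- Distinct vertices lie on different rays, so the index of a vertex can stand for its angle in the
output. -/
theorem angle_injective (S : Star (rel P q)) {m m' : Fin n}
    (h : angle q (P m) = angle q (P m')) : m = m' := by
  by_contra hne
  apply S.cross_ne m m' hne
  have h1 : rel P q m = ‖P m - q‖ • unit (angle q (P m)) := (norm_smul_unit_angle _).symm
  have h2 : rel P q m' = ‖P m' - q‖ • unit (angle q (P m')) := (norm_smul_unit_angle _).symm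
  rw [h1, h2, h, cross_smul_left, cross_smul_right, cross_self, mul_zero, mul_zero]

end


/-! ## Integer instances -/

/-- The determinant of two integer vectors. -/
def icross (a b : ℤ × ℤ) : ℤ := a.1 * b.2 - a.2 * b.1

theorem cross_toPoint (a b : ℤ × ℤ) : cross (toPoint a) (toPoint b) = icross a b := by
  simp [cross, toPoint, icross]

/-- The index of the next vertex. -/
def nxt (n i : ℕ) : ℕ := if i + 1 < n then i + 1 else 0

theorem nxt_lt {n i : ℕ} (h : i < n) : nxt n i < n := by
  unfold nxt
  split_ifs <;> omega

/-- The data of the computation: `U i` is the position of vertex `i` relative to `q`. -/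
structure Inst (E : Env) where
  n : ℕ
  s : ℕ
  B : ℕ
  k : ℕ
  K : ℤ
  q : ℤ × ℤ
  U : ℕ → ℤ × ℤ
  k_ge : 2 ≤ k
  sizes : Sizes E n s B
  inp_fst : ∀ i < n, E.inp[5 + 2 * i]? = some ((U i).1 + q.1)
  inp_snd : ∀ i < n, E.inp[6 + 2 * i]? = some ((U i).2 + q.2)
  star : Star fun i : Fin n => toPoint (U i)
  odd : OddTotal fun i : Fin n => toPoint (U i)
  K_ge : ∀ i < n, 2 * ((U i).1 * (U i).1 + (U i).2 * (U i).2) + 1 ≤ K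

variable {E : Env}

namespace Inst
variable (I : Inst E)

/-- The vertices as points of the plane. -/
def u (i : Fin I.n) : ℂ := toPoint (I.U i)

theorem star_u : Star I.u := I.star

/-- The registers with the parameters have the right contents. -/
structure Base (σ : State) : Prop where
  n : σ.reg .n = I.n
  s : σ.reg .s = I.s
  B : σ.reg .B = I.B
  k : σ.reg .k = I.k
  K : σ.reg .K = I.K
  qx : σ.reg .qx = I.q.1
  qy : σ.reg .qy = I.q.2
  u0x : σ.reg .u0x = (I.U 0).1
  u0y : σ.reg .u0y = (I.U 0).2

variable {I} in
theorem Base.same {σ σ' : State} (h : I.Base σ) (hs : SameReg 6 σ σ') : I.Base σ' :=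
  ⟨(hs _ (by decide)).trans h.n, (hs _ (by decide)).trans h.s, (hs _ (by decide)).trans h.B,
    (hs _ (by decide)).trans h.k, (hs _ (by decide)).trans h.K, (hs _ (by decide)).trans h.qx,
    (hs _ (by decide)).trans h.qy, (hs _ (by decide)).trans h.u0x, (hs _ (by decide)).trans h.u0y⟩

/-- The determinant of the end points of edge `e`. -/
def det (e : ℕ) : ℤ := icross (I.U e) (I.U (nxt I.n e))

/-- The numerator of the key of edge `e`. -/
def kA (e : ℕ) : ℤ := |I.det e|

/-- The denominator of the key of edge `e` for the direction `d`. -/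
def kD (d : ℤ × ℤ) (e : ℕ) : ℤ :=
  if I.det e < 0 then icross d (I.U e) - icross d (I.U (nxt I.n e))
  else icross d (I.U (nxt I.n e)) - icross d (I.U e)

/-- Edge `e` crosses the ray in direction `d`. -/
def IAct (d : ℤ × ℤ) (e : ℕ) : Prop :=
  (I.det e < 0 ∧ 0 < icross d (I.U e) ∧ icross d (I.U (nxt I.n e)) < 0) ∨
    (¬ I.det e < 0 ∧ icross d (I.U e) < 0 ∧ 0 < icross d (I.U (nxt I.n e)))

/-- The position of edge `e` on the ray in direction `d`. -/
noncomputable def key (d : ℤ × ℤ) (e : ℕ) : ℝ := ratio I.kA (I.kD d) e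

variable {I}

theorem u_finRotate (i : Fin I.n) : I.u (finRotate I.n i) = toPoint (I.U (nxt I.n i)) := by
  unfold u nxt
  rw [val_finRotate]

theorem det_ne_zero {e : ℕ} (he : e < I.n) : I.det e ≠ 0 := fun h => by
  have h1 := I.star_u.edge_ne ⟨e, he⟩
  rw [u_finRotate, u, cross_toPoint] at h1
  exact h1 (by exact_mod_cast h)

/-- Distinguishing the sign of `det` replaces products of determinants by comparisons with 0. -/
theorem iAct_iff {d : ℤ × ℤ} {e : ℕ} (he : e < I.n) :
    I.IAct d e ↔ EAct I.u (toPoint d) ⟨e, he⟩ := by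
  have h0 := det_ne_zero he
  unfold IAct EAct Act
  rw [u_finRotate, u, cross_toPoint, cross_toPoint, cross_toPoint]
  have h1 : (icross (I.U e) (I.U (nxt I.n e)) : ℝ) = I.det e := rfl
  simp only [h1]
  norm_cast
  rcases lt_or_gt_of_ne h0 with h | h
  · simp only [h, not_true, false_and, or_false, true_and, mul_neg_iff, mul_pos_iff, h.not_gt,
      false_or]
  · simp only [h, h.not_gt, not_false_eq_true, false_and, false_or, true_and, mul_neg_iff,
      mul_pos_iff, or_false]

/-- Numerator and denominator are both multiplied by the sign of `det`; the quotient stays, and the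
denominator becomes positive on active edges. -/
theorem key_eq {d : ℤ × ℤ} {e : ℕ} (he : e < I.n) :
    I.key d e = ekey I.u (toPoint d) ⟨e, he⟩ := by
  unfold key ratio ekey tk kA kD
  rw [u_finRotate, u, cross_toPoint, cross_toPoint, cross_toPoint]
  have h1 : (icross (I.U e) (I.U (nxt I.n e)) : ℝ) = I.det e := rfl
  simp only [h1]
  split_ifs with h
  · rw [abs_of_neg h]
    push_cast
    rw [← neg_sub ((icross d (I.U (nxt I.n e)) : ℤ) : ℝ), neg_div_neg_eq]
  · rw [abs_of_nonneg (not_lt.1 h)]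
    push_cast
    rfl

theorem kD_pos {d : ℤ × ℤ} {e : ℕ} (h : I.IAct d e) : 0 < I.kD d e := by
  unfold kD
  rcases h with ⟨h1, h2, h3⟩ | ⟨h1, h2, h3⟩
  · rw [if_pos h1]; omega
  · rw [if_neg h1]; omega

theorem key_pos {d : ℤ × ℤ} {e : ℕ} (he : e < I.n) (h : I.IAct d e) : 0 < I.key d e := by
  rw [key_eq he]
  exact ((iAct_iff he).1 h).tk_pos

theorem key_le_iff {d d' : ℤ × ℤ} {e f : ℕ} (he : e < I.n) (hf : f < I.n) (h1 : I.IAct d e)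
    (h2 : I.IAct d f) (h1' : I.IAct d' e) (h2' : I.IAct d' f) :
    I.key d e ≤ I.key d f ↔ I.key d' e ≤ I.key d' f := by
  rw [key_eq he, key_eq hf, key_eq he, key_eq hf]
  rw [iAct_iff he] at h1 h1'
  rw [iAct_iff hf] at h2 h2'
  exact ekey_le_iff I.star_u h1 h2 h1' h2'

theorem key_injective {d : ℤ × ℤ} {e f : ℕ} (he : e < I.n) (hf : f < I.n) (h1 : I.IAct d e)
    (h2 : I.IAct d f) (h : I.key d e = I.key d f) : e = f := by
  rw [key_eq he, key_eq hf] at h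
  have := ekey_injective I.star_u ((iAct_iff he).1 h1) ((iAct_iff hf).1 h2) h
  exact Fin.mk.inj_iff.1 this

variable (I)

/-- The threshold of the pointer `P`, which is `0` or the successor of an edge. -/
def zA (P : ℕ) : ℤ := if P = 0 then 0 else I.kA (P - 1)

/-- The denominator of the threshold. -/
def zD (d : ℤ × ℤ) (P : ℕ) : ℤ := if P = 0 then 1 else I.kD d (P - 1)

/-- The position of the pointer on the ray in direction `d`. -/
noncomputable def tkey (d : ℤ × ℤ) (P : ℕ) : ℝ := if P = 0 then 0 else I.key d (P - 1)

/-- The pointer is at the origin or at an active edge. -/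
def PAct (d : ℤ × ℤ) (P : ℕ) : Prop := ∀ e, P = e + 1 → e < I.n ∧ I.IAct d e

variable {I}

theorem PAct.zD_pos {d : ℤ × ℤ} {P : ℕ} (h : I.PAct d P) : 0 < I.zD d P := by
  unfold zD
  split_ifs with h0
  · norm_num
  · exact kD_pos (h (P - 1) (by omega)).2

theorem tkey_eq (d : ℤ × ℤ) (P : ℕ) : I.tkey d P = (I.zA P : ℝ) / I.zD d P := by
  unfold tkey zA zD key ratio
  split_ifs <;> simp

theorem lt_key_iff {d : ℤ × ℤ} {P e : ℕ} (h : I.PAct d P) (he : I.IAct d e) :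
    I.zA P * I.kD d e < I.kA e * I.zD d P ↔ I.tkey d P < I.key d e := by
  rw [tkey_eq, key, ratio, div_lt_div_iff₀ (by exact_mod_cast h.zD_pos)
    (by exact_mod_cast kD_pos he)]
  exact_mod_cast Iff.rfl

theorem key_lt_iff' {d : ℤ × ℤ} {P e : ℕ} (h : I.PAct d P) (he : I.IAct d e) :
    I.kA e * I.zD d P < I.zA P * I.kD d e ↔ I.key d e < I.tkey d P := by
  rw [tkey_eq, key, ratio, div_lt_div_iff₀ (by exact_mod_cast kD_pos he)
    (by exact_mod_cast h.zD_pos)]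
  exact_mod_cast Iff.rfl

end Inst

/-! ### Loading edges -/

/-- Compute the data of the edge in register `i` for the direction in `dx`, `dy`. -/
def edgeCmd : Cmd := block [
  .set .j (rg .i + 1),
  .ite (rg .j) (rg .n) .skip (.set .j 0),
  .set .ux (.rd (5 + 2 * rg .i) - rg .qx),
  .set .uy (.rd (6 + 2 * rg .i) - rg .qy),
  .set .vx (.rd (5 + 2 * rg .j) - rg .qx),
  .set .vy (.rd (6 + 2 * rg .j) - rg .qy),
  .set .cu (rg .dx * rg .uy - rg .dy * rg .ux),
  .set .cv (rg .dx * rg .vy - rg .dy * rg .vx),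
  .set .dot (rg .ux * rg .vy - rg .uy * rg .vx),
  .set .act 0,
  .ite (rg .dot) 0
    (block [.set .eA (rg .uy * rg .vx - rg .ux * rg .vy),
      .set .eD (rg .dx * (rg .uy - rg .vy) - rg .dy * (rg .ux - rg .vx)),
      when 0 (rg .cu) (when (rg .cv) 0 (.set .act 1))])
    (block [.set .eA (rg .ux * rg .vy - rg .uy * rg .vx),
      .set .eD (rg .dx * (rg .vy - rg .uy) - rg .dy * (rg .vx - rg .ux)),
      when (rg .cu) 0 (when 0 (rg .cv) (.set .act 1))])]

/-- The result of `edgeCmd`. -/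
structure EdgeData (I : Inst E) (d : ℤ × ℤ) (i : ℕ) (σ σ' : State) : Prop where
  act : I.IAct d i → σ'.reg .act = 1
  nact : ¬ I.IAct d i → σ'.reg .act = 0
  eA : σ'.reg .eA = I.kA i
  eD : σ'.reg .eD = I.kD d i
  dot : σ'.reg .dot = I.det i
  ux : σ'.reg .ux = (I.U i).1
  uy : σ'.reg .uy = (I.U i).2
  same : Same 1 σ σ'

theorem getD_of_getElem? {l : List ℤ} {i : ℕ} {x : ℤ} (h : l[i]? = some x) :
    i < l.length ∧ l.getD i 0 = x := by
  refine ⟨(List.getElem?_eq_some_iff.1 h).1, ?_⟩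
  rw [List.getD_eq_getElem?_getD, h]
  rfl

theorem wp_edge (I : Inst E) {d : ℤ × ℤ} {i : ℕ} {σ : State} (hb : I.Base σ)
    (hdx : σ.reg .dx = d.1) (hdy : σ.reg .dy = d.2) (hi : i < I.n) (hr : σ.reg .i = i) :
    wp E edgeCmd 18 (EdgeData I d i σ) σ := by
  have hj := nxt_lt hi
  obtain ⟨l1, g1⟩ := getD_of_getElem? (I.inp_fst i hi)
  obtain ⟨l2, g2⟩ := getD_of_getElem? (I.inp_snd i hi)
  obtain ⟨l3, g3⟩ := getD_of_getElem? (I.inp_fst _ hj)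
  obtain ⟨l4, g4⟩ := getD_of_getElem? (I.inp_snd _ hj)
  have a1 : ((5 : ℤ) + 2 * (i : ℤ)).toNat = 5 + 2 * i := by omega
  have a2 : ((6 : ℤ) + 2 * (i : ℤ)).toNat = 6 + 2 * i := by omega
  have a3 : ((5 : ℤ) + 2 * (nxt I.n i : ℤ)).toNat = 5 + 2 * nxt I.n i := by omega
  have a4 : ((6 : ℤ) + 2 * (nxt I.n i : ℤ)).toNat = 6 + 2 * nxt I.n i := by omega
  unfold edgeCmd
  refine wp_cons_set (T := 17) (by simp) (by decide) ?_
  simp only [val_add, val_reg, val_one, hr]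
  refine wp_cons (T₁ := 2) (T₂ := 15)
    (wp.mono (T := 2) (Q := fun σ' => Same 1 σ σ' ∧ σ'.reg .i = i ∧ σ'.reg .j = nxt I.n i)
      (wp_ite (T := 1) (by simp) (by simp) (fun h => ?_) fun h => ?_) le_rfl ?_) (by omega)
  · simp only [val_reg, State.set_reg, reduceCtorEq, if_false, if_true, hb.n] at h
    refine wp_skip ⟨(Same.refl 1 σ).set (by decide), by simp [hr], ?_⟩
    rw [State.set_reg, if_pos rfl, nxt, if_pos (by omega)]
    push_cast; rfl
  · simp only [val_reg, State.set_reg, reduceCtorEq, if_false, if_true, hb.n] at h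
    refine wp_set (T := 0) (by simp) (by decide) ⟨((Same.refl 1 σ).set (by decide)).set (by decide),
      by simp [hr], ?_⟩
    rw [State.set_reg, if_pos rfl, nxt, if_neg (by omega)]
    simp
  rintro σ₁ ⟨s1, hi1, hj1⟩
  have hqx := (s1.reg .qx (by decide)).trans hb.qx
  have hqy := (s1.reg .qy (by decide)).trans hb.qy
  replace hdx := (s1.reg .dx (by decide)).trans hdx
  replace hdy := (s1.reg .dy (by decide)).trans hdy
  refine wp_cons_set (T := 14) ?_ (by decide) ?_
  · simp only [safe_sub, safe_rd, safe_add, safe_mul, safe_reg, safe_five, safe_two, val_add,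
      val_mul, val_five, val_two, val_reg, hi1, a1, l1, and_true, true_and]
    positivity
  simp only [val_sub, val_rd, val_add, val_mul, val_five, val_two, val_reg, hi1, a1, g1, hqx,
    add_sub_cancel_right]
  refine wp_cons_set (T := 13) ?_ (by decide) ?_
  · simp only [safe_sub, safe_rd, safe_add, safe_mul, safe_reg, safe_six, safe_two, val_add,
      val_mul, val_six, val_two, val_reg, State.set_reg, reduceCtorEq, if_false, hi1, a2, l2,
      and_true, true_and]
    positivity
  simp only [val_sub, val_rd, val_add, val_mul, val_six, val_two, val_reg, State.set_reg,
    reduceCtorEq, if_false, hi1, a2, g2, hqy, add_sub_cancel_right]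
  refine wp_cons_set (T := 12) ?_ (by decide) ?_
  · simp only [safe_sub, safe_rd, safe_add, safe_mul, safe_reg, safe_five, safe_two, val_add,
      val_mul, val_five, val_two, val_reg, State.set_reg, reduceCtorEq, if_false, hj1, a3, l3,
      and_true, true_and]
    positivity
  simp only [val_sub, val_rd, val_add, val_mul, val_five, val_two, val_reg, State.set_reg,
    reduceCtorEq, if_false, hj1, a3, g3, hqx, add_sub_cancel_right]
  refine wp_cons_set (T := 11) ?_ (by decide) ?_
  · simp only [safe_sub, safe_rd, safe_add, safe_mul, safe_reg, safe_six, safe_two, val_add,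
      val_mul, val_six, val_two, val_reg, State.set_reg, reduceCtorEq, if_false, hj1, a4, l4,
      and_true, true_and]
    positivity
  simp only [val_sub, val_rd, val_add, val_mul, val_six, val_two, val_reg, State.set_reg,
    reduceCtorEq, if_false, hj1, a4, g4, hqy, add_sub_cancel_right]
  refine wp_cons_set (T := 10) (by simp) (by decide) ?_
  refine wp_cons_set (T := 9) (by simp) (by decide) ?_
  refine wp_cons_set (T := 8) (by simp) (by decide) ?_
  refine wp_cons_set (T := 7) (by simp) (by decide) ?_
  simp only [val_sub, val_mul, val_reg, State.set_reg, reduceCtorEq, if_false, if_true, hdx, hdy,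
    val_zero]
  have e1 : d.1 * (I.U i).2 - d.2 * (I.U i).1 = icross d (I.U i) := rfl
  have e2 : d.1 * (I.U (nxt I.n i)).2 - d.2 * (I.U (nxt I.n i)).1 = icross d (I.U (nxt I.n i)) :=
    rfl
  have e3 : (I.U i).1 * (I.U (nxt I.n i)).2 - (I.U i).2 * (I.U (nxt I.n i)).1 = I.det i := rfl
  simp only [e1, e2, e3]
  have s2 : Same 1 σ (((((((((σ₁.set .ux (I.U i).1).set .uy (I.U i).2).set .vx
      (I.U (nxt I.n i)).1).set .vy (I.U (nxt I.n i)).2).set .cu (icross d (I.U i))).set .cv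
      (icross d (I.U (nxt I.n i)))).set .dot (I.det i)).set .act 0)) :=
    (((((((s1.set (by decide)).set (by decide)).set (by decide)).set (by decide)).set
      (by decide)).set (by decide)).set (by decide)).set (by decide)
  refine wp_cons (T₁ := 6) (T₂ := 1) (wp_ite (T := 5) (by simp) (by simp) (fun h => ?_)
    fun h => ?_) (by omega)
  · simp only [val_reg, State.set_reg, reduceCtorEq, if_false, if_true, val_zero] at h
    refine wp_cons_set (T := 4) (by simp) (by decide) ?_
    refine wp_cons_set (T := 3) (by simp) (by decide) ?_
    simp only [val_sub, val_mul, val_reg, State.set_reg, reduceCtorEq, if_false, if_true, hdx, hdy]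
    have e4 : (I.U i).2 * (I.U (nxt I.n i)).1 - (I.U i).1 * (I.U (nxt I.n i)).2 = I.kA i := by
      rw [Inst.kA, abs_of_neg h, ← e3]; ring
    have e5 : d.1 * ((I.U i).2 - (I.U (nxt I.n i)).2) - d.2 * ((I.U i).1 - (I.U (nxt I.n i)).1) =
        I.kD d i := by
      rw [Inst.kD, if_pos h, ← e1, ← e2]; ring
    simp only [e4, e5]
    refine wp_cons (T₁ := 3) (T₂ := 0) (wp_ite (T := 2) (by simp) (by simp) (fun h1 => ?_)
      fun h1 => ?_) (by omega)
    · simp only [val_reg, State.set_reg, reduceCtorEq, if_false, if_true, val_zero] at h1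
      refine wp_ite (T := 1) (by simp) (by simp) (fun h2 => ?_) fun h2 => ?_
      · simp only [val_reg, State.set_reg, reduceCtorEq, if_false, if_true, val_zero] at h2
        refine wp_set (T := 0) (by simp) (by decide) (wp_nil (wp_nil ⟨?_, ?_, ?_, ?_, ?_, ?_, ?_,
          ((s2.set (by decide)).set (by decide)).set (by decide)⟩))
        · simp
        · intro h3; exact absurd (Or.inl ⟨h, h1, h2⟩) h3
        all_goals simp
      · simp only [val_reg, State.set_reg, reduceCtorEq, if_false, if_true, val_zero] at h2
        refine wp_skip (wp_nil (wp_nil ⟨?_, ?_, ?_, ?_, ?_, ?_, ?_,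
          (s2.set (by decide)).set (by decide)⟩))
        · rintro (h3 | h3)
          · exact absurd h3.2.2 h2
          · exact absurd h h3.1
        all_goals simp
    · simp only [val_reg, State.set_reg, reduceCtorEq, if_false, if_true, val_zero] at h1
      refine wp_skip (wp_nil (wp_nil ⟨?_, ?_, ?_, ?_, ?_, ?_, ?_,
          (s2.set (by decide)).set (by decide)⟩))
      · rintro (h3 | h3)
        · exact absurd h3.2.1 h1
        · exact absurd h h3.1
      all_goals simp
  · simp only [val_reg, State.set_reg, reduceCtorEq, if_false, if_true, val_zero] at h
    refine wp_cons_set (T := 4) (by simp) (by decide) ?_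
    refine wp_cons_set (T := 3) (by simp) (by decide) ?_
    simp only [val_sub, val_mul, val_reg, State.set_reg, reduceCtorEq, if_false, if_true, hdx, hdy]
    have e4 : I.det i = I.kA i := by
      rw [Inst.kA, abs_of_nonneg (not_lt.1 h)]
    have e5 : d.1 * ((I.U (nxt I.n i)).2 - (I.U i).2) - d.2 * ((I.U (nxt I.n i)).1 - (I.U i).1) =
        I.kD d i := by
      rw [Inst.kD, if_neg h, ← e1, ← e2]; ring
    simp only [e3, e5]
    refine wp_cons (T₁ := 3) (T₂ := 0) (wp_ite (T := 2) (by simp) (by simp) (fun h1 => ?_)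
      fun h1 => ?_) (by omega)
    · simp only [val_reg, State.set_reg, reduceCtorEq, if_false, if_true, val_zero] at h1
      refine wp_ite (T := 1) (by simp) (by simp) (fun h2 => ?_) fun h2 => ?_
      · simp only [val_reg, State.set_reg, reduceCtorEq, if_false, if_true, val_zero] at h2
        refine wp_set (T := 0) (by simp) (by decide) (wp_nil (wp_nil ⟨?_, ?_, ?_, ?_, ?_, ?_, ?_,
          ((s2.set (by decide)).set (by decide)).set (by decide)⟩))
        · simp
        · intro h3; exact absurd (Or.inr ⟨h, h1, h2⟩) h3
        · simp [e4]
        all_goals simp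
      · simp only [val_reg, State.set_reg, reduceCtorEq, if_false, if_true, val_zero] at h2
        refine wp_skip (wp_nil (wp_nil ⟨?_, ?_, ?_, ?_, ?_, ?_, ?_,
          (s2.set (by decide)).set (by decide)⟩))
        · rintro (h3 | h3)
          · exact absurd h3.1 h
          · exact absurd h3.2.2 h2
        · simp
        · simp [e4]
        all_goals simp
    · simp only [val_reg, State.set_reg, reduceCtorEq, if_false, if_true, val_zero] at h1
      refine wp_skip (wp_nil (wp_nil ⟨?_, ?_, ?_, ?_, ?_, ?_, ?_,
          (s2.set (by decide)).set (by decide)⟩))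
      · rintro (h3 | h3)
        · exact absurd h3.1 h
        · exact absurd h3.2.1 h1
      · simp
      · simp [e4]
      all_goals simp

/-- Load an edge for the tree of successors. -/
def loadSucc : Cmd := block [edgeCmd, .set .A (rg .eA), .set .D (rg .eD)]

/-- Load an edge for the tree of predecessors. -/
def loadPred : Cmd := block [edgeCmd, .set .A (0 - rg .eA), .set .D (rg .eD)]

/-- The direction and the threshold are in their registers. -/
structure PtrCtx (I : Inst E) (d : ℤ × ℤ) (P : ℕ) (σ : State) : Prop where
  base : I.Base σ
  dx : σ.reg .dx = d.1
  dy : σ.reg .dy = d.2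
  pA : σ.reg .pA = I.zA P
  nA : σ.reg .nA = -I.zA P
  pD : σ.reg .pD = I.zD d P

theorem PtrCtx.same {I : Inst E} {d : ℤ × ℤ} {P : ℕ} {σ σ' : State} (h : PtrCtx I d P σ)
    (hs : SameReg 3 σ σ') : PtrCtx I d P σ' :=
  ⟨h.base.same (hs.mono (by norm_num)), (hs _ (by decide)).trans h.dx,
    (hs _ (by decide)).trans h.dy, (hs _ (by decide)).trans h.pA, (hs _ (by decide)).trans h.nA,
    (hs _ (by decide)).trans h.pD⟩

theorem loadSucc_spec (I : Inst E) (d : ℤ × ℤ) (P : ℕ) :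
    LoadSpec E loadSucc (PtrCtx I d P) I.n (I.IAct d) I.kA (I.kD d) := by
  refine ⟨fun σ i hc hi hr => ?_, fun i _ h => Inst.kD_pos h, fun σ σ' h hs => h.same hs⟩
  refine wp_cons (T₁ := 18) (T₂ := 12) ((wp_edge I hc.base hc.dx hc.dy hi hr).mono le_rfl ?_)
    (by omega)
  intro σ₁ h1
  refine wp_cons_set (T := 11) (by simp) (by decide) ?_
  refine wp_cons_set (T := 10) (by simp) (by decide) (wp_nil ?_)
  refine ⟨fun h => by simp [h1.act h], fun h => by simp [h1.nact h], by simp [h1.eA],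
    by simp [h1.eD], (h1.same.set (by decide)).set (by decide)⟩

/-- Negated numerators reverse the order, so a predecessor is a smallest candidate as well and one
kind of tree suffices. -/
theorem loadPred_spec (I : Inst E) (d : ℤ × ℤ) (P : ℕ) :
    LoadSpec E loadPred (PtrCtx I d P) I.n (I.IAct d) (fun e => -I.kA e) (I.kD d) := by
  refine ⟨fun σ i hc hi hr => ?_, fun i _ h => Inst.kD_pos h, fun σ σ' h hs => h.same hs⟩
  refine wp_cons (T₁ := 18) (T₂ := 12) ((wp_edge I hc.base hc.dx hc.dy hi hr).mono le_rfl ?_)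
    (by omega)
  intro σ₁ h1
  refine wp_cons_set (T := 11) (by simp) (by decide) ?_
  refine wp_cons_set (T := 10) (by simp) (by decide) (wp_nil ?_)
  refine ⟨fun h => by simp [h1.act h], fun h => by simp [h1.nact h], by simp [h1.eA],
    by simp [h1.eD], (h1.same.set (by decide)).set (by decide)⟩


/-! ## The pointer and its trees -/

variable {E : Env}

/-- The trees of predecessors and successors of the pointer `P` in direction `d`. -/
structure Trees (I : Inst E) (d : ℤ × ℤ) (P : ℕ) (dirty : ℕ → Prop) (arr : ℕ → ℤ) : Prop where
  pred : TreeOK I.n I.s I.B 1 (Cand (I.IAct d) (fun e => -I.kA e) (I.kD d) (-I.zA P) (I.zD d P))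
    (ratio (fun e => -I.kA e) (I.kD d)) dirty arr
  succ : TreeOK I.n I.s I.B 2 (Cand (I.IAct d) I.kA (I.kD d) (I.zA P) (I.zD d P))
    (ratio I.kA (I.kD d)) dirty arr

section
variable {I : Inst E} {d d' : ℤ × ℤ} {P P' : ℕ}

theorem cand_succ_iff (h : I.PAct d P) {e : ℕ} :
    Cand (I.IAct d) I.kA (I.kD d) (I.zA P) (I.zD d P) e ↔
      I.IAct d e ∧ I.tkey d P < I.key d e :=
  and_congr_right fun he => Inst.lt_key_iff h he

theorem cand_pred_iff (h : I.PAct d P) {e : ℕ} :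
    Cand (I.IAct d) (fun e => -I.kA e) (I.kD d) (-I.zA P) (I.zD d P) e ↔
      I.IAct d e ∧ I.key d e < I.tkey d P := by
  refine and_congr_right fun he => ?_
  rw [← Inst.key_lt_iff' h he]
  constructor <;> intro h <;> linarith

theorem ratio_neg (e : ℕ) : ratio (fun e => -I.kA e) (I.kD d) e = -I.key d e := by
  unfold ratio Inst.key ratio
  push_cast
  rw [neg_div]

/-- The order among clean active edges is independent of the direction by `key_le_iff`. What has to
be supplied is their activity and their position relative to the pointer. -/
theorem Trees.congr {dirty dirty' : ℕ → Prop} {arr : ℕ → ℤ} (h : Trees I d P dirty arr)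
    (hP : I.PAct d P) (hP' : I.PAct d' P') (hd : ∀ e, e < I.n → ¬ dirty' e → ¬ dirty e)
    (hact : ∀ e, e < I.n → ¬ dirty' e → (I.IAct d' e ↔ I.IAct d e))
    (hgt : ∀ e, e < I.n → ¬ dirty' e → I.IAct d e → I.IAct d' e →
      (I.tkey d' P' < I.key d' e ↔ I.tkey d P < I.key d e))
    (hlt : ∀ e, e < I.n → ¬ dirty' e → I.IAct d e → I.IAct d' e →
      (I.key d' e < I.tkey d' P' ↔ I.key d e < I.tkey d P)) : Trees I d' P' dirty' arr := by
  refine ⟨h.pred.congr hd (fun e he hn => ?_) fun e f he hf hne hnf ce cf hk => ?_,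
    h.succ.congr hd (fun e he hn => ?_) fun e f he hf hne hnf ce cf hk => ?_⟩
  · rw [cand_pred_iff hP, cand_pred_iff hP']
    constructor
    · rintro ⟨h1, h2⟩
      have h3 := (hact e he hn).1 h1
      exact ⟨h3, (hlt e he hn h3 h1).1 h2⟩
    · rintro ⟨h1, h2⟩
      have h3 := (hact e he hn).2 h1
      exact ⟨h3, (hlt e he hn h1 h3).2 h2⟩
  · rw [ratio_neg, ratio_neg, neg_le_neg_iff] at hk ⊢
    exact (Inst.key_le_iff hf he cf.1 ce.1 ((hact f hf hnf).2 cf.1)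
      ((hact e he hne).2 ce.1)).1 hk
  · rw [cand_succ_iff hP, cand_succ_iff hP']
    constructor
    · rintro ⟨h1, h2⟩
      have h3 := (hact e he hn).1 h1
      exact ⟨h3, (hgt e he hn h3 h1).1 h2⟩
    · rintro ⟨h1, h2⟩
      have h3 := (hact e he hn).2 h1
      exact ⟨h3, (hgt e he hn h1 h3).2 h2⟩
  · exact (Inst.key_le_iff he hf ce.1 cf.1 ((hact e he hne).2 ce.1)
      ((hact f hf hnf).2 cf.1)).1 hk

theorem Trees.mono {dirty dirty' : ℕ → Prop} {arr : ℕ → ℤ} (h : Trees I d P dirty arr)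
    (hd : ∀ e, e < I.n → dirty e → dirty' e) : Trees I d P dirty' arr :=
  ⟨h.pred.congr (fun e he h1 h2 => h1 (hd e he h2)) (fun _ _ _ => Iff.rfl)
    fun _ _ _ _ _ _ _ _ h => h,
  h.succ.congr (fun e he h1 h2 => h1 (hd e he h2)) (fun _ _ _ => Iff.rfl)
    fun _ _ _ _ _ _ _ _ h => h⟩

end

/-- The cells of the tree of vertices agree. -/
def SameVertexTree (arr arr' : ℕ → ℤ) : Prop := ∀ a, a % 3 = 0 → arr' a = arr a

theorem SameVertexTree.trans {a b c : ℕ → ℤ} (h : SameVertexTree a b) (h' : SameVertexTree b c) :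
    SameVertexTree a c := fun x hx => (h' x hx).trans (h x hx)

/-- A bound for the time to refresh one block. -/
def Inst.cost (I : Inst E) : ℕ := 41 * I.B + 81 * Nat.log 2 I.s + 100

/-- Refresh the block in register `b`. -/
def refreshBoth : Cmd := block [refreshCmd loadPred .nA .pD 1, refreshCmd loadSucc .pA .pD 2]

theorem wp_refreshBoth {I : Inst E} {d : ℤ × ℤ} {P : ℕ} {dirty : ℕ → Prop} {σ : State}
    (hc : PtrCtx I d P σ) {b : ℕ} (hb : σ.reg .b = b) (hbs : b < I.s)
    (h : Trees I d P dirty σ.arr) :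
    wp E refreshBoth (2 * I.cost) (fun σ' => SameReg 2 σ σ' ∧ σ'.out = σ.out ∧
      SameVertexTree σ.arr σ'.arr ∧ Trees I d P (fun e => dirty e ∧ e / I.B ≠ b) σ'.arr) σ := by
  have C1 : TreeCtx E loadPred .nA .pD (PtrCtx I d P) I.n I.s I.B (I.IAct d)
      (fun e => -I.kA e) (I.kD d) (-I.zA P) (I.zD d P) :=
    ⟨I.sizes, loadPred_spec I d P, fun σ h => ⟨h.base.n, h.base.s, h.base.B, h.nA, h.pD⟩⟩
  have C2 : TreeCtx E loadSucc .pA .pD (PtrCtx I d P) I.n I.s I.B (I.IAct d)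
      I.kA (I.kD d) (I.zA P) (I.zD d P) :=
    ⟨I.sizes, loadSucc_spec I d P, fun σ h => ⟨h.base.n, h.base.s, h.base.B, h.pA, h.pD⟩⟩
  refine wp_cons (T₁ := I.cost) (T₂ := I.cost)
    ((wp_refresh (by norm_num) C1 hc hb hbs h.pred).mono le_rfl ?_) (by omega)
  rintro σ₁ ⟨s1, o1, a1, t1⟩
  refine wp_cons (T₁ := I.cost) (T₂ := 0)
    ((wp_refresh (by norm_num) C2 (hc.same (s1.mono (by norm_num)))
      ((s1 .b (by decide)).trans hb) hbs (h.succ.sameArr (by norm_num) a1)).mono le_rfl ?_)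
    (by omega)
  rintro σ₂ ⟨s2, o2, a2, t2⟩
  refine wp_nil ⟨s1.trans s2, o2.trans o1, fun x hx => ?_, t1.sameArr (by norm_num) a2, t2⟩
  rw [a2 x (by omega), a1 x (by omega)]

/-- Refresh the block of an edge. -/
def refreshEdge (e : Expr) : Cmd := .seq (.set .b (e / rg .B)) refreshBoth

/-- The registers of level at least `2` except those in `l` agree. -/
def Frame (l : List Reg) (σ σ' : State) : Prop := ∀ x : Reg, 2 ≤ x.level → x ∉ l →
  σ'.reg x = σ.reg x

theorem Frame.trans {l l' : List Reg} {σ σ' σ'' : State} (h : Frame l σ σ') (h' : Frame l' σ' σ'')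
    {l'' : List Reg} (hl : l ⊆ l'') (hl' : l' ⊆ l'') : Frame l'' σ σ'' := fun x h1 h2 =>
  (h' x h1 fun h => h2 (hl' h)).trans (h x h1 fun h => h2 (hl h))

theorem Frame.mono {l l' : List Reg} {σ σ' : State} (h : Frame l σ σ') (hl : l ⊆ l') :
    Frame l' σ σ' := fun x h1 h2 => h x h1 fun h => h2 (hl h)

theorem SameReg.frame {σ σ' : State} {l : ℕ} (h : SameReg l σ σ') (hl : l ≤ 2) : Frame [] σ σ' :=
  fun x hx _ => h x (hl.trans hx)

theorem Frame.set {l : List Reg} {σ σ' : State} (h : Frame l σ σ') {x : Reg} {v : ℤ}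
    (hx : x.level < 2 ∨ x ∈ l) : Frame l σ (σ'.set x v) := fun y h1 h2 => by
  rw [State.set_reg, if_neg, h y h1 h2]
  rintro rfl
  rcases hx with hx | hx
  · omega
  · exact h2 hx

theorem Frame.refl (l : List Reg) (σ : State) : Frame l σ σ := fun _ _ _ => rfl

theorem Frame.sameReg {l : List Reg} {σ σ' : State} (h : Frame l σ σ') {k : ℕ} (hk : 2 ≤ k)
    (hl : ∀ x ∈ l, x.level < k) : SameReg k σ σ' := fun x hx => h x (hk.trans hx) fun h => by
  have := hl x h
  omega

theorem natCast_lt_pow (I : Inst E) {x : ℕ} (h : x ≤ I.n) {c : ℕ} (hc : 1 ≤ c) :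
    |(x : ℤ)| < 2 ^ (c * E.w) := by
  rw [abs_of_nonneg (by positivity)]
  have h1 : (x : ℤ) < 2 ^ E.w := by
    have := I.sizes.n_lt
    exact_mod_cast lt_of_le_of_lt h this
  refine h1.trans_le (pow_le_pow_right₀ (by norm_num) ?_)
  nlinarith

theorem wp_refreshEdge {I : Inst E} {d : ℤ × ℤ} {P : ℕ} {dirty : ℕ → Prop} {σ : State}
    (hc : PtrCtx I d P σ) {e : Expr} {x : ℕ} (hs : e.Safe E σ) (hv : e.val E σ = x)
    (hx : x < I.n) (h : Trees I d P dirty σ.arr) :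
    wp E (refreshEdge e) (2 * I.cost + 1) (fun σ' => Frame [.b] σ σ' ∧ σ'.out = σ.out ∧
      SameVertexTree σ.arr σ'.arr ∧ Trees I d P (fun y => dirty y ∧ y ≠ x) σ'.arr) σ := by
  have hval : (e / rg .B).val E σ = ((x / I.B : ℕ) : ℤ) := by
    rw [val_div, hv, val_reg, hc.base.B]
    push_cast; rfl
  have hlt : x / I.B < I.s := (Nat.div_lt_iff_lt_mul I.sizes.B_pos).2 (hx.trans_le I.sizes.n_le)
  refine wp_seq (T₁ := 1) (T₂ := 2 * I.cost) (wp_set_of_lt (T := 0) ⟨hs, trivial⟩ ?_ ?_) (by omega)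
  · rw [hval]
    exact natCast_lt_pow I ((Nat.div_le_self _ _).trans hx.le) (by decide)
  rw [hval]
  have f0 : Frame [.b] σ (σ.set .b (x / I.B : ℕ)) := (Frame.refl _ _).set (by simp)
  refine (wp_refreshBoth (hc.same (f0.sameReg (by norm_num) (by decide)))
    (by simp) hlt h).mono le_rfl ?_
  rintro σ' ⟨s1, o1, a1, t1⟩
  refine ⟨f0.trans (s1.frame le_rfl) (by simp) (by simp), o1, a1, t1.mono fun y _ hy => ⟨hy.1, ?_⟩⟩
  rintro rfl
  exact hy.2 rfl

/-- Recompute the threshold of the pointer. -/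
def ptrKeyCmd : Cmd := .ite (rg .p) 1 (block [.set .pA 0, .set .nA 0, .set .pD 1])
  (block [.set .i (rg .p - 1), edgeCmd, .set .pA (rg .eA), .set .nA (0 - rg .eA),
    .set .pD (rg .eD)])

/-- Pointer 0 stands for the origin, with threshold 0/1; otherwise the threshold is the key of edge
`p - 1`. It depends on the direction and is computed again after each turn and each move. -/
theorem wp_ptrKey {I : Inst E} {d : ℤ × ℤ} {P : ℕ} {σ : State} (hb : I.Base σ)
    (hdx : σ.reg .dx = d.1) (hdy : σ.reg .dy = d.2) (hp : σ.reg .p = P) (hP : P ≤ I.n) :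
    wp E ptrKeyCmd 24 (fun σ' => PtrCtx I d P σ' ∧ Frame [.pA, .nA, .pD] σ σ' ∧
      σ'.arr = σ.arr ∧ σ'.out = σ.out) σ := by
  refine wp_ite (T := 23) (by simp) (by simp) (fun h => ?_) fun h => ?_
  · simp only [val_reg, val_one, hp] at h
    have h0 : P = 0 := by omega
    subst h0
    refine wp_cons_set (T := 22) (by simp) (by decide) ?_
    refine wp_cons_set (T := 21) (by simp) (by decide) ?_
    refine wp_cons_set (T := 20) (by simp) (by decide) (wp_nil ?_)
    have f : Frame [.pA, .nA, .pD] σ (((σ.set .pA 0).set .nA 0).set .pD 1) :=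
      (((Frame.refl _ σ).set (by simp)).set (by simp)).set (by simp)
    simp only [val_zero, val_one]
    exact ⟨⟨hb.same (f.sameReg (by norm_num) (by decide)), by simp [hdx], by simp [hdy],
      by simp [Inst.zA], by simp [Inst.zA], by simp [Inst.zD]⟩, f, rfl, rfl⟩
  · simp only [val_reg, val_one, hp] at h
    have h0 : P ≠ 0 := by omega
    refine wp_cons_set (T := 22) (by simp) (by decide) ?_
    simp only [val_sub, val_reg, hp, val_one]
    have s0 : Same 2 σ (σ.set .i ((P : ℤ) - 1)) := (Same.refl 2 σ).set (by decide)
    refine wp_cons (T₁ := 18) (T₂ := 4) ((wp_edge I (d := d) (i := P - 1)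
      (hb.same (s0.reg.mono (by norm_num))) (by simp [hdx]) (by simp [hdy]) (by omega)
      (by simp; omega)).mono le_rfl ?_) (by omega)
    intro σ₁ h1
    have s1 := s0.trans (h1.same.mono (by norm_num))
    refine wp_cons_set (T := 3) (by simp) (by decide) ?_
    refine wp_cons_set (T := 2) (by simp) (by decide) ?_
    refine wp_cons_set (T := 1) (by simp) (by decide) (wp_nil ?_)
    have f : ∀ a b c, Frame [.pA, .nA, .pD] σ (((σ₁.set .pA a).set .nA b).set .pD c) := fun a b c =>
      ((((s1.reg.frame (by norm_num)).mono (by simp)).set (by simp)).set (by simp)).set (by simp)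
    refine ⟨⟨hb.same ((f _ _ _).sameReg (by norm_num) (by decide)), ?_, ?_, ?_, ?_, ?_⟩,
      f _ _ _, s1.arr, s1.out⟩
    · simp [s1.reg .dx (by decide), hdx]
    · simp [s1.reg .dy (by decide), hdy]
    · simp [h1.eA, Inst.zA, h0]
    · simp [h1.eA, Inst.zA, h0]
    · simp [h1.eD, Inst.zD, h0]

/-! ### Ranks -/

section
open Classical in
/-- The number of active edges up to the pointer. -/
noncomputable def Inst.rank (I : Inst E) (d : ℤ × ℤ) (P : ℕ) : ℕ :=
  ((Finset.range I.n).filter fun e => I.IAct d e ∧ I.key d e ≤ I.tkey d P).card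

open Classical in
/-- The number of active edges. -/
noncomputable def Inst.tot (I : Inst E) (d : ℤ × ℤ) : ℕ :=
  ((Finset.range I.n).filter fun e => I.IAct d e).card

variable {I : Inst E} {d d' : ℤ × ℤ} {P P' : ℕ}

theorem Inst.rank_le_tot : I.rank d P ≤ I.tot d := by
  classical
  unfold Inst.rank Inst.tot
  exact Finset.card_le_card fun e he => by
    rw [Finset.mem_filter] at he ⊢
    exact ⟨he.1, he.2.1⟩

theorem Inst.tot_le : I.tot d ≤ I.n := by
  classical
  unfold Inst.tot
  exact (Finset.card_filter_le _ _).trans (by simp)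

theorem Inst.rank_zero : I.rank d 0 = 0 := by
  classical
  unfold Inst.rank
  rw [Finset.card_eq_zero, Finset.filter_eq_empty_iff]
  rintro e he ⟨h1, h2⟩
  have := key_pos (Finset.mem_range.1 he) h1
  simp only [Inst.tkey, if_true] at h2
  linarith

theorem Inst.tkey_succ (e : ℕ) : I.tkey d (e + 1) = I.key d e := by simp [Inst.tkey]

/-- Keys of active edges are distinct, so `e` is the only edge that is beyond the pointer and not
beyond `e`. -/
theorem Inst.rank_step {e : ℕ} (he : e < I.n) (ha : I.IAct d e) (h1 : I.tkey d P < I.key d e)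
    (h2 : ∀ e', e' < I.n → I.IAct d e' → I.tkey d P < I.key d e' → I.key d e ≤ I.key d e') :
    I.rank d (e + 1) = I.rank d P + 1 := by
  classical
  unfold Inst.rank
  have : ((Finset.range I.n).filter fun e' => I.IAct d e' ∧ I.key d e' ≤ I.tkey d (e + 1)) =
      insert e ((Finset.range I.n).filter fun e' => I.IAct d e' ∧ I.key d e' ≤ I.tkey d P) := by
    ext f
    simp only [Finset.mem_filter, Finset.mem_range, Finset.mem_insert, Inst.tkey_succ]
    constructor
    · rintro ⟨h3, h4, h5⟩
      by_cases h6 : I.key d f ≤ I.tkey d P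
      · exact Or.inr ⟨h3, h4, h6⟩
      · exact Or.inl (Inst.key_injective h3 he h4 ha (le_antisymm h5 (h2 f h3 h4 (not_le.1 h6))))
    · rintro (rfl | ⟨h3, h4, h5⟩)
      · exact ⟨he, ha, le_rfl⟩
      · exact ⟨h3, h4, h5.trans h1.le⟩
  rw [this, Finset.card_insert_of_notMem]
  rw [Finset.mem_filter]
  rintro ⟨_, _, h3⟩
  exact absurd h3 (not_le.2 h1)

theorem Inst.rank_lt_tot {e : ℕ} (he : e < I.n) (ha : I.IAct d e) (h1 : I.tkey d P < I.key d e) :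
    I.rank d P < I.tot d := by
  classical
  unfold Inst.rank Inst.tot
  refine Finset.card_lt_card ⟨fun f hf => ?_, fun h => ?_⟩
  · rw [Finset.mem_filter] at hf ⊢
    exact ⟨hf.1, hf.2.1⟩
  · have := h (Finset.mem_filter.2 ⟨Finset.mem_range.2 he, ha⟩)
    rw [Finset.mem_filter] at this
    exact absurd this.2.2 (not_le.2 h1)

theorem Inst.rank_eq_tot (h : ∀ e, e < I.n → I.IAct d e → ¬ I.tkey d P < I.key d e) :
    I.rank d P = I.tot d := by
  classical
  unfold Inst.rank Inst.tot
  congr 1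
  refine Finset.filter_congr fun e he => ?_
  rw [Finset.mem_range] at he
  exact ⟨fun h1 => h1.1, fun h1 => ⟨h1, not_lt.1 (h e he h1)⟩⟩

/-- The state of the pointer `P`; the content of register `r` is not yet determined. -/
structure Ptr (I : Inst E) (d : ℤ × ℤ) (P : ℕ) (dirty : ℕ → Prop) (σ : State) : Prop where
  ctx : PtrCtx I d P σ
  p : σ.reg .p = P
  act : I.PAct d P
  trees : Trees I d P dirty σ.arr

theorem Inst.PAct.le (h : I.PAct d P) : P ≤ I.n := by
  rcases P with _ | e
  · omega
  · exact (h e rfl).1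

/-- No edge is dirty. -/
abbrev clean : ℕ → Prop := fun _ => False

/-- The successor of the pointer is at the root of the tree. -/
theorem Ptr.succ_root {σ : State} (h : Ptr I d P clean σ) :
    (σ.arr 5 = 0 ∧ I.rank d P = I.tot d) ∨ ∃ e : ℕ, σ.arr 5 = e + 1 ∧ e < I.n ∧ I.IAct d e ∧
      I.tkey d P < I.key d e ∧
      ∀ e', e' < I.n → I.IAct d e' → I.tkey d P < I.key d e' → I.key d e ≤ I.key d e' := by
  rcases h.trees.succ.root I.sizes.s_pos (fun _ _ => id) with ⟨h1, h2⟩ | ⟨e, h1, h2, h3, h4⟩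
  · refine Or.inl ⟨h1, Inst.rank_eq_tot fun e he ha hlt => h2 e he ?_⟩
    exact (cand_succ_iff h.act).2 ⟨ha, hlt⟩
  · obtain ⟨h5, h6⟩ := (cand_succ_iff h.act).1 h3
    exact Or.inr ⟨e, h1, h2, h5, h6, fun e' he' ha' hlt =>
      h4 e' he' ((cand_succ_iff h.act).2 ⟨ha', hlt⟩)⟩

/-- The predecessor of the pointer is at the root of the tree. -/
theorem Ptr.pred_root {σ : State} (h : Ptr I d P clean σ) :
    (σ.arr 4 = 0 ∧ ∀ e, e < I.n → I.IAct d e → ¬ I.key d e < I.tkey d P) ∨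
    ∃ e : ℕ, σ.arr 4 = e + 1 ∧ e < I.n ∧ I.IAct d e ∧ I.key d e < I.tkey d P ∧
      ∀ e', e' < I.n → I.IAct d e' → I.key d e' < I.tkey d P → I.key d e' ≤ I.key d e := by
  rcases h.trees.pred.root I.sizes.s_pos (fun _ _ => id) with ⟨h1, h2⟩ | ⟨e, h1, h2, h3, h4⟩
  · refine Or.inl ⟨h1, fun e he ha hlt => h2 e he ?_⟩
    exact (cand_pred_iff h.act).2 ⟨ha, hlt⟩
  · obtain ⟨h5, h6⟩ := (cand_pred_iff h.act).1 h3
    refine Or.inr ⟨e, h1, h2, h5, h6, fun e' he' ha' hlt => ?_⟩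
    have := h4 e' he' ((cand_pred_iff h.act).2 ⟨ha', hlt⟩)
    rw [ratio_neg, ratio_neg, neg_le_neg_iff] at this
    exact this

end

/-! ### Moving the pointer -/

/-- Move the pointer to the value of register `new`. -/
def moveTail : List Cmd := [.set .old (rg .p), .set .p (rg .new), ptrKeyCmd,
  when 0 (rg .old) (refreshEdge (rg .old - 1)), when 0 (rg .new) (refreshEdge (rg .new - 1))]

/-- The registers that change when the pointer moves. -/
abbrev moveRegs : List Reg := [.p, .pA, .nA, .pD, .old, .new, .b]

theorem wp_refresh_when {I : Inst E} {d : ℤ × ℤ} {P : ℕ} {dirty : ℕ → Prop} {σ : State}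
    (hc : PtrCtx I d P σ) {x : Reg} {y : ℕ} (hx : σ.reg x = y) (hy : y ≤ I.n)
    (h : Trees I d P dirty σ.arr) :
    wp E (when 0 (rg x) (refreshEdge (rg x - 1))) (2 * I.cost + 2) (fun σ' => Frame [.b] σ σ' ∧
      σ'.out = σ.out ∧ SameVertexTree σ.arr σ'.arr ∧
      Trees I d P (fun z => dirty z ∧ z + 1 ≠ y) σ'.arr) σ := by
  refine wp_ite (T := 2 * I.cost + 1) (by simp) (by simp) (fun h1 => ?_) fun h1 => ?_
  · simp only [val_reg, val_zero, hx] at h1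
    refine (wp_refreshEdge hc (x := y - 1) (by simp) ?_ (by omega) h).mono le_rfl ?_
    · simp only [val_sub, val_reg, hx, val_one]; omega
    · rintro σ' ⟨h2, h3, h4, h5⟩
      exact ⟨h2, h3, h4, h5.mono fun z _ hz => ⟨hz.1, by have := hz.2; omega⟩⟩
  · simp only [val_reg, val_zero, hx] at h1
    refine wp_skip ⟨Frame.refl _ _, rfl, fun _ _ => rfl, h.mono fun z _ hz => ⟨hz, by omega⟩⟩

/-- If only the edges at the old and the new pointer change sides of the threshold, it suffices to
refresh their two blocks. -/
theorem wp_moveTail {I : Inst E} {d : ℤ × ℤ} {P P' : ℕ} {σ : State} (h : Ptr I d P clean σ)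
    (hP' : I.PAct d P') (hn : σ.reg .new = P')
    (hgt : ∀ e, e < I.n → e + 1 ≠ P → e + 1 ≠ P' → I.IAct d e →
      (I.tkey d P' < I.key d e ↔ I.tkey d P < I.key d e))
    (hlt : ∀ e, e < I.n → e + 1 ≠ P → e + 1 ≠ P' → I.IAct d e →
      (I.key d e < I.tkey d P' ↔ I.key d e < I.tkey d P)) :
    wp E (block moveTail) (4 * I.cost + 30) (fun σ' => Ptr I d P' clean σ' ∧ Frame moveRegs σ σ' ∧
      σ'.out = σ.out ∧ SameVertexTree σ.arr σ'.arr) σ := by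
  unfold moveTail
  refine wp_cons_set (T := 4 * I.cost + 29) (by simp) (by decide) ?_
  refine wp_cons_set (T := 4 * I.cost + 28) (by simp) (by decide) ?_
  simp only [val_reg, State.set_reg, reduceCtorEq, if_false, h.p, hn]
  have f1 : Frame moveRegs σ ((σ.set .old P).set .p P') :=
    ((Frame.refl _ σ).set (by simp)).set (by simp)
  refine wp_cons (T₁ := 24) (T₂ := 4 * I.cost + 4) ((wp_ptrKey (d := d) (P := P')
    (h.ctx.base.same (f1.sameReg (by norm_num) (by decide))) (by simp [h.ctx.dx])
    (by simp [h.ctx.dy]) (by simp) hP'.le).mono le_rfl ?_) (by omega)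
  rintro σ₁ ⟨c1, f2, a2, o2⟩
  have t1 : Trees I d P' (fun z => z + 1 = P ∨ z + 1 = P') σ₁.arr := by
    rw [a2]
    refine h.trees.congr h.act hP' (fun _ _ _ => id) (fun _ _ _ => Iff.rfl) (fun e he hd ha _ => ?_)
      fun e he hd ha _ => ?_
    · rw [not_or] at hd
      exact hgt e he hd.1 hd.2 ha
    · rw [not_or] at hd
      exact hlt e he hd.1 hd.2 ha
  have hold : σ₁.reg .old = P := by
    rw [f2 _ (by decide) (by simp)]
    simp
  have hnew : σ₁.reg .new = P' := by
    rw [f2 _ (by decide) (by simp)]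
    simp [hn]
  have hp : σ₁.reg .p = P' := by
    rw [f2 _ (by decide) (by simp)]
    simp
  refine wp_cons (T₁ := 2 * I.cost + 2) (T₂ := 2 * I.cost + 2)
    ((wp_refresh_when c1 hold h.act.le t1).mono le_rfl ?_) (by omega)
  rintro σ₂ ⟨f3, o3, v3, t3⟩
  have c2 := c1.same (f3.sameReg (by norm_num) (by decide))
  refine wp_cons (T₁ := 2 * I.cost + 2) (T₂ := 0)
    ((wp_refresh_when c2 ((f3 _ (by decide) (by simp)).trans hnew) hP'.le t3).mono le_rfl ?_)
    (by omega)
  rintro σ₃ ⟨f4, o4, v4, t4⟩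
  refine wp_nil ⟨⟨c2.same (f4.sameReg (by norm_num) (by decide)), ?_, hP', t4.mono ?_⟩, ?_, ?_, ?_⟩
  · rw [f4 _ (by decide) (by simp), f3 _ (by decide) (by simp), hp]
  · rintro z _ ⟨⟨h1 | h1, h2⟩, h3⟩
    · exact h2 h1
    · exact h3 h1
  · exact (f1.trans f2 (l'' := moveRegs) (by simp) (by simp)).trans
      (f3.trans f4 (l'' := moveRegs) (by simp) (by simp)) (by simp) (by simp)
  · rw [o4, o3, o2]; rfl
  · have := v3.trans v4
    rw [a2] at this
    exact this

/-- Move the pointer to the next edge. -/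
def moveSucc : Cmd := block (.set .new (.ld 5) :: .set .r (rg .r + 1) :: moveTail)

/-- Move the pointer to the previous edge. -/
def movePred : Cmd := block (.set .new (.ld (.lit 4)) :: .set .r (rg .r - 1) :: moveTail)

/-- The registers that change when the pointer moves and is counted. -/
abbrev ptrRegs : List Reg := [.p, .pA, .nA, .pD, .old, .new, .b, .r]

/-- The slack of 8 leaves room for the counter `r` during the processing of a vertex, when it need
not be a rank. -/
theorem abs_lt_pow (I : Inst E) {x : ℤ} (h : |x| ≤ I.n + 8) {c : ℕ} (hc : 5 ≤ c) :
    |x| < 2 ^ (c * E.w) := by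
  have h1 : (I.n : ℤ) < 2 ^ E.w := by exact_mod_cast I.sizes.n_lt
  have hw := E.pos
  have h2 : (2 : ℤ) ^ E.w * 2 ^ 4 ≤ 2 ^ (c * E.w) := by
    rw [← pow_add]
    exact pow_le_pow_right₀ (by norm_num) (by nlinarith)
  have h3 : (2 : ℤ) ≤ 2 ^ E.w := by
    calc (2 : ℤ) = 2 ^ 1 := by norm_num
      _ ≤ 2 ^ E.w := pow_le_pow_right₀ (by norm_num) hw
  omega

section
variable {I : Inst E} {d : ℤ × ℤ} {P : ℕ} {σ : State}

theorem six_le_N (I : Inst E) : 6 ≤ E.N := by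
  have h1 := I.sizes.N_le
  have h2 := I.sizes.s_pos
  omega

theorem Ptr.set_of_low {dirty : ℕ → Prop} (h : Ptr I d P dirty σ) {x : Reg} {v : ℤ}
    (hx : x = .r ∨ x.level < 3) : Ptr I d P dirty (σ.set x v) := by
  have hne : ∀ y : Reg, 3 ≤ y.level → y ≠ .r → (σ.set x v).reg y = σ.reg y := by
    intro y hy hr
    rw [State.set_reg, if_neg]
    rintro rfl
    rcases hx with hx | hx
    · exact hr hx
    · omega
  refine ⟨⟨h.ctx.base.same fun y hy => hne y (by omega) (by rintro rfl; simp [Reg.level] at hy),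
    ?_, ?_, ?_, ?_, ?_⟩, ?_, h.act, h.trees⟩
  · rw [hne _ (by decide) (by decide), h.ctx.dx]
  · rw [hne _ (by decide) (by decide), h.ctx.dy]
  · rw [hne _ (by decide) (by decide), h.ctx.pA]
  · rw [hne _ (by decide) (by decide), h.ctx.nA]
  · rw [hne _ (by decide) (by decide), h.ctx.pD]
  · rw [hne _ (by decide) (by decide), h.p]

/-- The common post-condition of commands that move the pointer. -/
structure Moved (I : Inst E) (d : ℤ × ℤ) (r : ℤ) (σ σ' : State) : Prop where
  ptr : ∃ P', Ptr I d P' clean σ' ∧ σ'.reg .r = I.rank d P'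
  r : σ'.reg .r = r
  frame : Frame ptrRegs σ σ'
  out : σ'.out = σ.out
  vtree : SameVertexTree σ.arr σ'.arr

theorem Moved.trans {r r' : ℤ} {σ σ' σ'' : State} (h : Moved I d r σ σ') (h' : Moved I d r' σ' σ'') :
    Moved I d r' σ σ'' :=
  ⟨h'.ptr, h'.r, h.frame.trans h'.frame (by simp) (by simp), h'.out.trans h.out,
    h.vtree.trans h'.vtree⟩

/-- The root of the tree of successors is the new pointer. No active edge lies strictly between, so
the status of all other edges is unchanged. -/
theorem wp_moveSucc (h : Ptr I d P clean σ) (hr : σ.reg .r = I.rank d P)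
    (h0 : I.rank d P < I.tot d) :
    wp E moveSucc (4 * I.cost + 32) (Moved I d (σ.reg .r + 1) σ) σ := by
  rcases h.succ_root with ⟨h1, h2⟩ | ⟨e, h1, h2, h3, h4, h5⟩
  · omega
  have hN := six_le_N I
  refine wp_cons_set (T := 4 * I.cost + 31) ⟨trivial, by simp, by simp; omega⟩ (by decide) ?_
  have hv : (Expr.ld 5).val E σ = e + 1 := by
    rw [val_ld, val_five]; exact h1
  rw [hv]
  have hle := Inst.tot_le (I := I) (d := d)
  refine wp_cons (T₁ := 1) (T₂ := 4 * I.cost + 30) (wp_set_of_lt (T := 0) (by simp) ?_ ?_) (by omega)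
  · simp only [val_add, val_reg, State.set_reg, reduceCtorEq, if_false, val_one, hr]
    exact abs_lt_pow I (by rw [abs_of_nonneg (by positivity)]; omega) (by decide)
  simp only [val_add, val_reg, State.set_reg, reduceCtorEq, if_false, val_one]
  refine (wp_moveTail (P' := e + 1) ((h.set_of_low (Or.inr (by decide))).set_of_low (Or.inl rfl))
    ?_ (by simp) ?_ ?_).mono le_rfl ?_
  · rintro e' he'
    obtain rfl : e = e' := by omega
    exact ⟨h2, h3⟩
  · intro f hf hfP hfe ha
    rw [Inst.tkey_succ]
    constructor
    · exact fun h6 => h4.trans h6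
    · intro h6
      refine lt_of_le_of_ne (h5 f hf ha h6) fun h7 => hfe ?_
      rw [Inst.key_injective h2 hf h3 ha h7]
  · intro f hf hfP hfe ha
    rw [Inst.tkey_succ]
    constructor
    · intro h6
      by_contra h7
      rcases lt_or_eq_of_le (not_lt.1 h7) with h8 | h8
      · exact absurd (h5 f hf ha h8) (not_le.2 h6)
      · rcases P with _ | g
        · have := Inst.key_pos hf ha
          rw [← h8] at this
          simp [Inst.tkey] at this
        · rw [Inst.tkey_succ] at h8
          exact hfP (by rw [Inst.key_injective (h.act g rfl).1 hf (h.act g rfl).2 ha h8])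
    · exact fun h6 => h6.trans h4
  · rintro σ' ⟨q1, q2, q3, q4⟩
    have hreg : σ'.reg .r = σ.reg .r + 1 := by
      rw [q2 _ (by decide) (by simp)]
      simp
    refine ⟨⟨e + 1, q1, ?_⟩, hreg, ?_, q3, q4⟩
    · rw [hreg, hr, Inst.rank_step h2 h3 h4 h5]
      push_cast; rfl
    · exact (((Frame.refl _ σ).set (by simp)).set (by simp)).trans q2 (l := ptrRegs) (by simp) (by simp)

theorem wp_movePred (h : Ptr I d P clean σ) (hr : σ.reg .r = I.rank d P) (h0 : P ≠ 0) :
    wp E movePred (4 * I.cost + 32) (Moved I d (σ.reg .r - 1) σ) σ := by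
  have hN := six_le_N I
  obtain ⟨g, rfl⟩ := Nat.exists_eq_succ_of_ne_zero h0
  obtain ⟨hg, hga⟩ := h.act g rfl
  have hle := (Inst.rank_le_tot (P := g + 1)).trans (Inst.tot_le (I := I) (d := d))
  -- An empty root of the tree of predecessors sends the pointer back to the origin, otherwise it
  -- names the previous edge. In both cases the content of cell 4 is the new pointer.
  obtain ⟨P', hP, hact, hlt, hbetw, hrank⟩ : ∃ P' : ℕ, σ.arr 4 = P' ∧ I.PAct d P' ∧
      I.tkey d P' < I.key d g ∧ (∀ e, e < I.n → I.IAct d e → I.key d e < I.key d g →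
        I.key d e ≤ I.tkey d P') ∧ I.rank d (g + 1) = I.rank d P' + 1 := by
    have := h.pred_root
    simp only [Inst.tkey_succ] at this
    rcases this with ⟨h1, h2⟩ | ⟨e, h1, h2, h3, h4, h5⟩
    · refine ⟨0, h1, fun e he => by omega, ?_, fun e he ha hl => absurd hl (h2 e he ha), ?_⟩
      · simpa [Inst.tkey] using Inst.key_pos hg hga
      · refine Inst.rank_step hg hga ?_ fun e he ha _ => not_lt.1 (h2 e he ha)
        simpa [Inst.tkey] using Inst.key_pos hg hga
    · refine ⟨e + 1, by rw [h1]; push_cast; rfl, ?_, by rwa [Inst.tkey_succ], fun f hf ha hl => ?_,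
        ?_⟩
      · rintro e' he'
        obtain rfl : e = e' := by omega
        exact ⟨h2, h3⟩
      · rw [Inst.tkey_succ]; exact h5 f hf ha hl
      · refine Inst.rank_step hg hga (by rwa [Inst.tkey_succ]) fun f hf ha hl => ?_
        rw [Inst.tkey_succ] at hl
        by_contra hcon
        exact absurd (h5 f hf ha (not_le.1 hcon)) (not_le.2 hl)
  refine wp_cons_set (T := 4 * I.cost + 31) ⟨trivial, by simp, by simp; omega⟩ (by decide) ?_
  have hv : (Expr.ld (.lit 4)).val E σ = P' := by
    rw [val_ld, val_lit]; exact hP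
  rw [hv]
  refine wp_cons (T₁ := 1) (T₂ := 4 * I.cost + 30) (wp_set_of_lt (T := 0) (by simp) ?_ ?_) (by omega)
  · simp only [val_sub, val_reg, State.set_reg, reduceCtorEq, if_false, val_one, hr, hrank]
    exact abs_lt_pow I (by rw [abs_of_nonneg (by push_cast; linarith)]; push_cast; omega) (by decide)
  simp only [val_sub, val_reg, State.set_reg, reduceCtorEq, if_false, val_one]
  refine (wp_moveTail (P' := P') ((h.set_of_low (Or.inr (by decide))).set_of_low (Or.inl rfl))
    hact (by simp) ?_ ?_).mono le_rfl ?_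
  · intro f hf hfP hfe ha
    rw [Inst.tkey_succ]
    constructor
    · intro h6
      by_contra h7
      rcases lt_or_eq_of_le (not_lt.1 h7) with h8 | h8
      · exact absurd (hbetw f hf ha h8) (not_le.2 h6)
      · exact hfP (by rw [Inst.key_injective hf hg ha hga h8])
    · exact fun h6 => hlt.trans h6
  · intro f hf hfP hfe ha
    rw [Inst.tkey_succ]
    constructor
    · exact fun h6 => h6.trans hlt
    · intro h6
      refine lt_of_le_of_ne (hbetw f hf ha h6) fun h7 => ?_
      rcases P' with _ | e
      · have := Inst.key_pos hf ha
        rw [h7] at this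
        simp [Inst.tkey] at this
      · rw [Inst.tkey_succ] at h7
        exact hfe (by rw [Inst.key_injective (hact e rfl).1 hf (hact e rfl).2 ha h7.symm])
  · rintro σ' ⟨q1, q2, q3, q4⟩
    have hreg : σ'.reg .r = σ.reg .r - 1 := by
      rw [q2 _ (by decide) (by simp)]
      simp
    refine ⟨⟨P', q1, ?_⟩, hreg, ?_, q3, q4⟩
    · rw [hreg, hr, hrank]
      push_cast; ring
    · exact (((Frame.refl _ σ).set (by simp)).set (by simp)).trans q2 (l := ptrRegs) (by simp) (by simp)

/-- Move the pointer to the edge number `k`, or to the last edge. -/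
def rebalanceCmd : Cmd := block [
  .loop 0 (.ld 5 * (rg .k - rg .r)) moveSucc,
  .loop (rg .k) (rg .r) movePred]

/-- The first loop raises the rank at least to the target, the second one lowers it at most to `k`;
the number `f` bounds the moves in each. -/
theorem wp_rebalance (h : Ptr I d P clean σ) (hr : σ.reg .r = I.rank d P) {f : ℕ}
    (h1 : min I.k (I.tot d) ≤ I.rank d P + f) (h2 : I.rank d P ≤ I.k + f) :
    wp E rebalanceCmd (2 * (f * (4 * I.cost + 33) + 1))
      (Moved I d (min I.k (I.tot d) : ℕ) σ) σ := by
  have hN := six_le_N I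
  have hMr : Moved I d (σ.reg .r) σ σ := ⟨⟨P, h, hr⟩, rfl, Frame.refl _ _, rfl, fun _ _ => rfl⟩
  refine wp_cons (T₁ := f * (4 * I.cost + 33) + 1) (T₂ := f * (4 * I.cost + 33) + 1)
    ((wp_loop (T := 4 * I.cost + 32) (fun f' σ' => f' ≤ f ∧ ∃ r : ℕ, Moved I d r σ σ' ∧
      min I.k (I.tot d) ≤ r + f' ∧ r ≤ I.k + f) ?_ f σ
      ⟨le_rfl, _, hr ▸ hMr, h1, h2⟩).mono le_rfl ?_) (by omega)
  · rintro f' σ' ⟨hff, r, hM, g1, g2⟩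
    obtain ⟨P', hP, hP'⟩ := hM.ptr
    have hrr : I.rank d P' = r := by
      have := hM.r
      rw [hP'] at this
      exact_mod_cast this
    refine ⟨by simp, ⟨⟨trivial, by simp, by simp; omega⟩, trivial, trivial⟩, fun hlt => ?_⟩
    simp only [val_zero, val_mul, val_ld, val_five, val_sub, val_reg, hP.ctx.base.k, hM.r] at hlt
    have hlt' : 0 < σ'.arr 5 * ((I.k : ℤ) - r) := hlt
    -- Cell 5 is never negative. Hence a positive product says both that a successor exists and that
    -- the rank is below `k`, so that one comparison suffices.
    have hrk : r < I.k ∧ r < I.tot d := by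
      rcases hP.succ_root with ⟨h3, h4⟩ | ⟨e, h3, h4, h5, h6, h7⟩
      · rw [h3] at hlt'; simp at hlt'
      · rw [h3] at hlt'
        have := pos_of_mul_pos_right hlt' (by positivity)
        refine ⟨by omega, ?_⟩
        rw [← hrr]
        exact Inst.rank_lt_tot h4 h5 h6
    refine ⟨by omega, (wp_moveSucc hP hP' (by omega)).mono le_rfl fun σ'' hM' =>
      ⟨f' - 1, by omega, by omega, r + 1, ?_, by omega, by omega⟩⟩
    have := hM.trans hM'
    rw [hM.r] at this
    exact_mod_cast this
  rintro σ₁ ⟨⟨f', hff, r, hM, g1, g2⟩, hexit⟩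
  obtain ⟨P₁, hP, hP'⟩ := hM.ptr
  have hrr : I.rank d P₁ = r := by
    have := hM.r
    rw [hP'] at this
    exact_mod_cast this
  have hge : min I.k (I.tot d) ≤ r := by
    simp only [val_zero, val_mul, val_ld, val_five, val_sub, val_reg, hP.ctx.base.k, hM.r] at hexit
    have hexit' : ¬ 0 < σ₁.arr 5 * ((I.k : ℤ) - r) := hexit
    rcases hP.succ_root with ⟨h3, h4⟩ | ⟨e, h3, h4, h5, h6, h7⟩
    · omega
    · by_contra hcon
      apply hexit'
      rw [h3]
      exact mul_pos (by positivity) (by omega)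
  refine wp_cons (T₁ := f * (4 * I.cost + 33) + 1) (T₂ := 0)
    ((wp_loop (T := 4 * I.cost + 32) (fun f' σ' => ∃ r : ℕ, Moved I d r σ σ' ∧
      min I.k (I.tot d) ≤ r ∧ r ≤ I.k + f') ?_ f σ₁ ⟨_, hM, hge, g2⟩).mono le_rfl ?_) (by omega)
  · rintro f'' σ' ⟨r', hM', g3, g4⟩
    obtain ⟨P', hP', hPr⟩ := hM'.ptr
    refine ⟨by simp, by simp, fun hlt => ?_⟩
    simp only [val_reg, hP'.ctx.base.k, hM'.r] at hlt
    have hlt' : I.k < r' := by exact_mod_cast hlt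
    have hP0 : P' ≠ 0 := by
      rintro rfl
      rw [Inst.rank_zero, hM'.r] at hPr
      have : r' = 0 := by exact_mod_cast hPr
      omega
    refine ⟨by omega, (wp_movePred hP' hPr hP0).mono le_rfl fun σ'' hM'' =>
      ⟨f'' - 1, by omega, r' - 1, ?_, by omega, by omega⟩⟩
    have := hM'.trans hM''
    rw [hM'.r] at this
    have e : ((r' - 1 : ℕ) : ℤ) = (r' : ℤ) - 1 := by omega
    rw [e]
    exact this
  · rintro σ₂ ⟨⟨f'', r', hM', g3, g4⟩, hexit'⟩
    obtain ⟨P', hP', hPr⟩ := hM'.ptr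
    simp only [val_reg, hP'.ctx.base.k, hM'.r] at hexit'
    have h3 : ¬ I.k < r' := by exact_mod_cast hexit'
    have h4 : r' ≤ I.tot d := by
      have h5 := hM'.r
      rw [hPr] at h5
      have h6 : I.rank d P' = r' := by exact_mod_cast h5
      rw [← h6]
      exact Inst.rank_le_tot
    have : r' = min I.k (I.tot d) := by omega
    rw [← this]
    exact wp_nil hM'

end


/-! ## Directions close to the vertices -/

variable {E : Env}

/-- The scalar product of two integer vectors. -/
def idot (a b : ℤ × ℤ) : ℤ := a.1 * b.1 + a.2 * b.2

/-- The index of the previous vertex. -/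
def prv (n m : ℕ) : ℕ := if m = 0 then n - 1 else m - 1

theorem prv_lt {n m : ℕ} (h : m < n) : prv n m < n := by
  unfold prv; split_ifs <;> omega

theorem nxt_prv {n m : ℕ} (h : m < n) : nxt n (prv n m) = m := by
  unfold nxt prv; split_ifs <;> omega

theorem prv_ne {n m : ℕ} (hn : 3 ≤ n) : prv n m ≠ m := by
  unfold prv; split_ifs <;> omega

/-- The edges at the vertex `m`. -/
def Inc (n m e : ℕ) : Prop := e = m ∨ e = prv n m

namespace Inst
variable (I : Inst E)

/-- A direction close to the vertex `m`, to the left of it for `ε = 1` and to the right of it for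
`ε = -1`. -/
def dir (ε : ℤ) (m : ℕ) : ℤ × ℤ :=
  (I.K * (I.U m).1 - ε * (I.U m).2, I.K * (I.U m).2 + ε * (I.U m).1)

variable {I}

theorem icross_ne_zero {i j : ℕ} (hi : i < I.n) (hj : j < I.n) (h : i ≠ j) :
    icross (I.U i) (I.U j) ≠ 0 := fun h0 => by
  have := I.star_u.cross_ne ⟨i, hi⟩ ⟨j, hj⟩ (by simpa using h)
  rw [u, u, cross_toPoint] at this
  exact this (by exact_mod_cast h0)

/-- Twice a scalar product is at most the sum of the two squared norms, and each of these is at most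
half of `K - 1`. -/
theorem two_mul_abs_idot_lt {i j : ℕ} (hi : i < I.n) (hj : j < I.n) :
    2 * |idot (I.U i) (I.U j)| ≤ I.K - 1 := by
  have h1 := I.K_ge i hi
  have h2 := I.K_ge j hj
  unfold idot
  rcases abs_cases ((I.U i).1 * (I.U j).1 + (I.U i).2 * (I.U j).2) with ⟨h, _⟩ | ⟨h, _⟩ <;> rw [h]
  · nlinarith [sq_nonneg ((I.U i).1 - (I.U j).1), sq_nonneg ((I.U i).2 - (I.U j).2)]
  · nlinarith [sq_nonneg ((I.U i).1 + (I.U j).1), sq_nonneg ((I.U i).2 + (I.U j).2)]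

theorem norm_pos {i : ℕ} (hi : i < I.n) : 0 < (I.U i).1 * (I.U i).1 + (I.U i).2 * (I.U i).2 := by
  have h := I.star_u.ne_zero ⟨i, hi⟩
  have h2 := Complex.normSq_pos.2 h
  simp only [u, toPoint, Complex.normSq_apply] at h2
  exact_mod_cast h2

theorem three_le : 3 ≤ I.n := I.star_u.three_le

theorem K_pos : 3 ≤ I.K := by
  have h0 : 0 < I.n := by have := I.three_le; omega
  have h1 := I.K_ge 0 h0
  have h2 := I.norm_pos h0
  omega

/-- The determinant of the direction with `u j` is `K * cross - ε * dot`, in the determinant and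
scalar product of vertices `m` and `j`. A nonzero integer determinant is at least 1 in absolute
value, so the first term outweighs the second and keeps its sign. -/
theorem near_dir {ε : ℤ} (hε : ε = 1 ∨ ε = -1) {m : ℕ} (hm : m < I.n) :
    Near I.u ⟨m, hm⟩ ε (toPoint (I.dir ε m)) := by
  refine ⟨fun j hj => ?_, ?_⟩
  · have hjm : m ≠ (j : ℕ) := fun h => hj (Fin.ext h.symm)
    have hc := I.icross_ne_zero hm j.isLt hjm
    have hd := I.two_mul_abs_idot_lt hm j.isLt
    have hK := I.K_pos
    rw [u, u, cross_toPoint, cross_toPoint]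
    have e : icross (I.dir ε m) (I.U j) = I.K * icross (I.U m) (I.U j) -
        ε * idot (I.U m) (I.U j) := by
      unfold icross dir idot; ring
    rw [e]
    have key : 0 < (I.K * icross (I.U m) (I.U j) - ε * idot (I.U m) (I.U j)) *
        icross (I.U m) (I.U j) := by
      set c := icross (I.U m) (I.U j)
      set t := idot (I.U m) (I.U j)
      have h1 : 1 ≤ |c| := Int.one_le_abs hc
      have h2 : ε * t * c ≤ |t| * |c| := by
        rw [← abs_mul]
        rcases hε with rfl | rfl
        · rw [one_mul]; exact le_abs_self _
        · rw [neg_one_mul, neg_mul]; exact neg_le_abs _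
      have h3 : c * c = |c| * |c| := (abs_mul_abs_self c).symm
      have h4 : |t| < I.K := by have := abs_nonneg t; omega
      have h5 : |t| < I.K * |c| := by nlinarith
      have h6 : 0 < (I.K * |c| - |t|) * |c| := mul_pos (by linarith) (by linarith)
      linear_combination h6 + h2 - I.K * h3
    exact_mod_cast key
  · rw [u, cross_toPoint]
    have e : icross (I.U m) (I.dir ε m) = ε * ((I.U m).1 * (I.U m).1 + (I.U m).2 * (I.U m).2) := by
      unfold icross dir; ring
    have hn := I.norm_pos hm
    have key : 0 < ε * icross (I.U m) (I.dir ε m) := by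
      rw [e]
      rcases hε with rfl | rfl <;> linarith
    exact_mod_cast key

theorem inc_iff {m e : ℕ} (hm : m < I.n) (he : e < I.n) :
    Inc I.n m e ↔ Incident (⟨m, hm⟩ : Fin I.n) ⟨e, he⟩ := by
  unfold Inc Incident
  rw [Fin.mk.injEq, Fin.ext_iff, val_finRotate]
  refine or_congr Iff.rfl ?_
  simp only
  unfold prv
  split_ifs <;> omega

theorem iAct_dir_iff {m e : ℕ} (hm : m < I.n) (he : e < I.n) (hi : ¬ Inc I.n m e) :
    I.IAct (I.dir 1 m) e ↔ I.IAct (I.dir (-1) m) e := by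
  rw [inc_iff hm he, not_incident] at hi
  rw [iAct_iff he, iAct_iff he, (near_dir (Or.inl rfl) hm).eact_iff_vertex hi.1 hi.2,
    (near_dir (Or.inr rfl) hm).eact_iff_vertex hi.1 hi.2]

/-! ### The cyclic order of the vertices -/

variable (I) in
/-- On which side of the ray through vertex `0` vertex `i` lies. -/
def side0 (i : ℕ) : ℤ := icross (I.U 0) (I.U i)

variable (I) in
/-- The numerator of the pseudo-angle of a vertex. -/
def vA (i : ℕ) : ℤ :=
  if i = 0 then 3 * I.K else if 0 < I.side0 i then -idot (I.U 0) (I.U i)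
  else 2 * I.K * -I.side0 i + idot (I.U 0) (I.U i)

variable (I) in
/-- The denominator of the pseudo-angle of a vertex. -/
def vD (i : ℕ) : ℤ := if i = 0 then 1 else |I.side0 i|

theorem side0_ne {i : ℕ} (hi : i < I.n) (h : i ≠ 0) : I.side0 i ≠ 0 :=
  I.icross_ne_zero (by omega) hi (Ne.symm h)

theorem vD_pos {i : ℕ} (hi : i < I.n) : 0 < I.vD i := by
  unfold vD
  split_ifs with h
  · norm_num
  · exact abs_pos.2 (side0_ne hi h)

/-- The cotangent of the angle at vertex 0 is less than `K` in absolute value. So the pseudo-angle,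
the negative cotangent, lies between `-K` and `K` on the left side of the ray through vertex 0;
shifted by `2 * K`, it lies between `K` and `3 * K` on the right side. Vertex 0 gets `3 * K` and
comes last, and the threshold `-K` comes before all. -/
theorem idot_bound {i : ℕ} (hi : i < I.n) (h : i ≠ 0) :
    |idot (I.U 0) (I.U i)| < I.K * |I.side0 i| := by
  have h1 := I.two_mul_abs_idot_lt (show 0 < I.n by omega) hi
  have h2 : 1 ≤ |I.side0 i| := Int.one_le_abs (side0_ne hi h)
  have h3 := I.K_pos
  nlinarith [abs_nonneg (idot (I.U 0) (I.U i))]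

variable (I) in
/-- Vertex `i` comes before vertex `j` in the order that starts after vertex `0`. -/
def VLt (i j : ℕ) : Prop := I.vA i * I.vD j < I.vA j * I.vD i

theorem vLt_zero {i : ℕ} (hi : i < I.n) (h : i ≠ 0) : I.VLt i 0 := by
  have h1 := idot_bound hi h
  have h2 := abs_lt.1 h1
  have hK := I.K_pos
  have hs := side0_ne hi h
  unfold VLt vA vD
  simp only [h, if_true, if_false, mul_one]
  split_ifs with h3
  · rw [abs_of_pos h3] at *
    nlinarith
  · rw [abs_of_neg (lt_of_le_of_ne (not_lt.1 h3) hs)] at *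
    nlinarith

theorem start_lt {i : ℕ} (hi : i < I.n) : -I.K * I.vD i < I.vA i * 1 := by
  have hK := I.K_pos
  by_cases h : i = 0
  · simp [vA, vD, h]; omega
  have h1 := idot_bound hi h
  have h2 := abs_lt.1 h1
  have hs := side0_ne hi h
  unfold vA vD
  simp only [h, if_false, mul_one]
  split_ifs with h3
  · rw [abs_of_pos h3] at *
    nlinarith
  · rw [abs_of_neg (lt_of_le_of_ne (not_lt.1 h3) hs)] at *
    nlinarith

variable (I) in
/-- The order of the vertices different from vertex `0`. -/
def GLt (i j : ℕ) : Prop := (0 < I.side0 i ∧ I.side0 j < 0) ∨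
  (0 < I.side0 i * I.side0 j ∧ 0 < icross (I.U i) (I.U j))

/-- On one side of vertex 0 the difference of two cotangents has the sign of the determinant of the
two vertices, by the identity `hid`; on different sides the shift decides. -/
theorem vLt_iff {i j : ℕ} (hi : i < I.n) (hj : j < I.n) (hi0 : i ≠ 0) (hj0 : j ≠ 0) :
    I.VLt i j ↔ I.GLt i j := by
  have h1 := abs_lt.1 (idot_bound hi hi0)
  have h2 := abs_lt.1 (idot_bound hj hj0)
  have hs := side0_ne hi hi0
  have ht := side0_ne hj hj0
  have hK := I.K_pos
  have hn := I.norm_pos (show 0 < I.n by omega)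
  have hid : idot (I.U 0) (I.U i) * I.side0 j - idot (I.U 0) (I.U j) * I.side0 i =
      ((I.U 0).1 * (I.U 0).1 + (I.U 0).2 * (I.U 0).2) * icross (I.U i) (I.U j) := by
    unfold idot side0 icross; ring
  have hc : 0 < icross (I.U i) (I.U j) ↔
      0 < idot (I.U 0) (I.U i) * I.side0 j - idot (I.U 0) (I.U j) * I.side0 i := by
    rw [hid, mul_pos_iff_of_pos_left hn]
  unfold GLt
  rw [hc]
  unfold VLt vA vD
  simp only [hi0, hj0, if_false]
  set a := idot (I.U 0) (I.U i)
  set b := idot (I.U 0) (I.U j)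
  set s := I.side0 i
  set t := I.side0 j
  rcases lt_or_gt_of_ne hs with s1 | s1 <;> rcases lt_or_gt_of_ne ht with t1 | t1
  · have := mul_pos_of_neg_of_neg s1 t1
    simp only [s1.not_gt, t1.not_gt, if_false, abs_of_neg s1, abs_of_neg t1, this, true_and,
      false_and, false_or]
    constructor <;> intro h <;> nlinarith
  · have := mul_neg_of_neg_of_pos s1 t1
    simp only [s1.not_gt, t1, if_false, if_true, abs_of_neg s1, abs_of_pos t1, this.not_gt,
      false_and, false_or, iff_false, not_lt]
    rw [abs_of_neg s1] at h1
    rw [abs_of_pos t1] at h2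
    nlinarith [mul_pos t1 (neg_pos.2 s1)]
  · simp only [s1, t1, t1.not_gt, if_false, if_true, abs_of_pos s1, abs_of_neg t1, true_and,
      true_or, iff_true]
    rw [abs_of_pos s1] at h1
    rw [abs_of_neg t1] at h2
    nlinarith [mul_pos s1 (neg_pos.2 t1)]
  · have := mul_pos s1 t1
    simp only [s1, t1, t1.not_gt, if_true, abs_of_pos s1, abs_of_pos t1, this, true_and,
      and_false, false_or]
    constructor <;> intro h <;> nlinarith

variable (I) in
/-- The pseudo-angle of a vertex. -/
noncomputable def vkey (i : ℕ) : ℝ := ratio I.vA I.vD i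

theorem vkey_lt_iff {i j : ℕ} (hi : i < I.n) (hj : j < I.n) :
    I.vkey i < I.vkey j ↔ I.VLt i j := ratio_lt (vD_pos hi) (vD_pos hj)

theorem vkey_injective {i j : ℕ} (hi : i < I.n) (hj : j < I.n) (h : I.vkey i = I.vkey j) :
    i = j := by
  by_contra hij
  by_cases hi0 : i = 0
  · subst hi0
    exact absurd ((vkey_lt_iff hj hi).2 (vLt_zero hj (Ne.symm hij))) (by rw [h]; exact lt_irrefl _)
  by_cases hj0 : j = 0
  · subst hj0
    exact absurd ((vkey_lt_iff hi hj).2 (vLt_zero hi hij)) (by rw [h]; exact lt_irrefl _)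
  have h1 : ¬ I.GLt i j := by
    rw [← vLt_iff hi hj hi0 hj0, ← vkey_lt_iff hi hj, h]; exact lt_irrefl _
  have h2 : ¬ I.GLt j i := by
    rw [← vLt_iff hj hi hj0 hi0, ← vkey_lt_iff hj hi, h]; exact lt_irrefl _
  have hs := side0_ne hi hi0
  have ht := side0_ne hj hj0
  have hc := I.icross_ne_zero hi hj hij
  have hsw : icross (I.U j) (I.U i) = -icross (I.U i) (I.U j) := by unfold icross; ring
  unfold GLt at h1 h2
  rw [hsw] at h2
  rcases lt_or_gt_of_ne hs with s1 | s1 <;> rcases lt_or_gt_of_ne ht with t1 | t1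
  · have := mul_pos_of_neg_of_neg s1 t1
    rcases lt_or_gt_of_ne hc with c1 | c1
    · exact h2 (Or.inr ⟨by linarith, by linarith⟩)
    · exact h1 (Or.inr ⟨this, c1⟩)
  · exact h2 (Or.inl ⟨t1, s1⟩)
  · exact h1 (Or.inl ⟨s1, t1⟩)
  · have := mul_pos s1 t1
    rcases lt_or_gt_of_ne hc with c1 | c1
    · exact h2 (Or.inr ⟨by linarith, by linarith⟩)
    · exact h1 (Or.inr ⟨this, c1⟩)

variable (I) in
/-- Vertex `m` comes next after the vertex `c`, where `c = 0` stands for the start. -/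
structure Next (c m : ℕ) : Prop where
  lt_fst : c < I.n
  lt_snd : m < I.n
  lt : c ≠ 0 → I.VLt c m
  min : ∀ j, j < I.n → (c ≠ 0 → I.VLt c j) → ¬ I.VLt j m

variable (I) in
/-- The three positions of vertex `0` relative to two consecutive vertices. -/
def NextCases (c m : ℕ) : Prop :=
  (c = 0 ∧ m ≠ 0 ∧ ∀ j, j < I.n → j ≠ 0 → ¬ I.GLt j m) ∨
  (c ≠ 0 ∧ m = 0 ∧ ∀ j, j < I.n → j ≠ 0 → ¬ I.GLt c j) ∨
  (c ≠ 0 ∧ m ≠ 0 ∧ I.GLt c m ∧ ∀ j, j < I.n → j ≠ 0 → I.GLt c j → ¬ I.GLt j m)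

theorem Next.cases {c m : ℕ} (h : I.Next c m) : I.NextCases c m := by
  have hn := I.three_le
  by_cases hc : c = 0
  · have hm : m ≠ 0 := by
      rintro rfl
      exact h.min 1 (by omega) (fun h => absurd hc h) (vLt_zero (by omega) (by omega))
    refine Or.inl ⟨hc, hm, fun j hj hj0 hg => ?_⟩
    exact h.min j hj (fun h => absurd hc h) ((vLt_iff hj h.lt_snd hj0 hm).2 hg)
  · by_cases hm : m = 0
    · refine Or.inr (Or.inl ⟨hc, hm, fun j hj hj0 hg => ?_⟩)
      refine h.min j hj (fun _ => (vLt_iff h.lt_fst hj hc hj0).2 hg) ?_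
      rw [hm]
      exact vLt_zero hj hj0
    · refine Or.inr (Or.inr ⟨hc, hm, (vLt_iff h.lt_fst h.lt_snd hc hm).1 (h.lt hc),
        fun j hj hj0 hg hg' => ?_⟩)
      exact h.min j hj (fun _ => (vLt_iff h.lt_fst hj hc hj0).2 hg)
        ((vLt_iff hj h.lt_snd hj0 hm).2 hg')

theorem Next.ne {c m : ℕ} (h : I.Next c m) : c ≠ m := by
  rcases h.cases with ⟨h1, h2, _⟩ | ⟨h1, h2, _⟩ | ⟨h1, h2, h3, _⟩
  · omega
  · omega
  · rintro rfl
    exact lt_irrefl _ (h.lt h1)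

theorem icross_swap (a b : ℤ × ℤ) : icross b a = -icross a b := by unfold icross; ring

/-- If the angle between two consecutive vertices is greater than `π`, then all vertices lie in a
half-plane. -/
theorem Next.neg {c m : ℕ} (h : I.Next c m) (hneg : icross (I.U c) (I.U m) < 0) {j : ℕ}
    (hj : j < I.n) (hjc : j ≠ c) : icross (I.U c) (I.U j) < 0 := by
  have hcj := I.icross_ne_zero h.lt_fst hj (Ne.symm hjc)
  have h0 : 0 < I.n := by have := I.three_le; omega
  by_contra hcon
  replace hcon : 0 < icross (I.U c) (I.U j) := by omega
  rcases h.cases with ⟨rfl, hm, hmin⟩ | ⟨hc, rfl, hmin⟩ | ⟨hc, hm, hg, hmin⟩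
  · exact hmin j hj hjc (Or.inl ⟨hcon, hneg⟩)
  · rw [icross_swap] at hneg
    have hs : 0 < I.side0 c := by unfold side0; linarith
    by_cases hj0 : j = 0
    · subst hj0
      rw [icross_swap] at hcon; linarith
    rcases lt_or_gt_of_ne (side0_ne hj hj0) with t | t
    · exact hmin j hj hj0 (Or.inl ⟨hs, t⟩)
    · exact hmin j hj hj0 (Or.inr ⟨mul_pos hs t, hcon⟩)
  · rcases hg with ⟨g1, g2⟩ | ⟨g1, g2⟩
    swap
    · linarith
    by_cases hj0 : j = 0
    · subst hj0
      rw [icross_swap] at hcon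
      unfold side0 at g1; linarith
    rcases lt_or_gt_of_ne (side0_ne hj hj0) with t | t
    · have hng : ¬ I.GLt j m := hmin j hj hj0 (Or.inl ⟨g1, t⟩)
      have hjm : j ≠ m := by rintro rfl; linarith
      have h1 : 0 < icross (I.U m) (I.U j) := by
        have hne := I.icross_ne_zero h.lt_snd hj hjm.symm
        by_contra h2
        refine hng (Or.inr ⟨mul_pos_of_neg_of_neg t g2, ?_⟩)
        rw [icross_swap]; omega
      -- In this three-term relation the left side would be positive and both terms on the right
      -- negative.
      have hid : icross (I.U c) (I.U j) * -I.side0 m =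
          -I.side0 j * icross (I.U c) (I.U m) + icross (I.U m) (I.U j) * -I.side0 c := by
        unfold side0 icross; ring
      have e1 := mul_pos hcon (neg_pos.2 g2)
      have e2 := mul_neg_of_pos_of_neg (neg_pos.2 t) hneg
      have e3 := mul_neg_of_pos_of_neg h1 (neg_neg_of_pos g1)
      linarith
    · exact hmin j hj hj0 (Or.inr ⟨mul_pos g1 t, hcon⟩) (Or.inl ⟨t, g2⟩)

/-- There is no vertex between two consecutive vertices. -/
theorem Next.no_between {c m : ℕ} (h : I.Next c m) (hpos : 0 < icross (I.U c) (I.U m)) {j : ℕ}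
    (hj : j < I.n) (h1 : 0 < icross (I.U c) (I.U j)) (h2 : 0 < icross (I.U j) (I.U m)) : False := by
  have h0 : 0 < I.n := by have := I.three_le; omega
  have hself : ∀ a, icross a a = 0 := fun a => by unfold icross; ring
  have hjc : j ≠ c := by rintro rfl; rw [hself] at h1; exact lt_irrefl _ h1
  -- If vertices `c` and `m` are on the same side of vertex 0, this relation puts `j` on that side
  -- as well.
  have hid : I.side0 j * icross (I.U c) (I.U m) =
      icross (I.U j) (I.U m) * I.side0 c + icross (I.U c) (I.U j) * I.side0 m := by
    unfold side0 icross; ring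
  rcases h.cases with ⟨rfl, hm, hmin⟩ | ⟨hc, rfl, hmin⟩ | ⟨hc, hm, hg, hmin⟩
  · exact hmin j hj hjc (Or.inr ⟨mul_pos h1 hpos, h2⟩)
  · rw [icross_swap] at hpos h2
    have hj0 : j ≠ 0 := by rintro rfl; rw [hself] at h2; simp at h2
    refine hmin j hj hj0 (Or.inr ⟨mul_pos_of_neg_of_neg ?_ ?_, h1⟩) <;> unfold side0 <;> linarith
  · by_cases hj0 : j = 0
    · subst hj0
      rw [icross_swap] at h1
      have g1 : I.side0 c < 0 := by unfold side0; linarith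
      have g2 : 0 < I.side0 m := h2
      rcases hg with ⟨g3, g4⟩ | ⟨g3, g4⟩
      · linarith
      · have := mul_neg_of_neg_of_pos g1 g2
        linarith
    have ht := side0_ne hj hj0
    rcases hg with ⟨g1, g2⟩ | ⟨g1, g2⟩
    · rcases lt_or_gt_of_ne ht with t | t
      · exact hmin j hj hj0 (Or.inl ⟨g1, t⟩) (Or.inr ⟨mul_pos_of_neg_of_neg t g2, h2⟩)
      · exact hmin j hj hj0 (Or.inr ⟨mul_pos g1 t, h1⟩) (Or.inl ⟨t, g2⟩)
    · rcases pos_and_pos_or_neg_and_neg_of_mul_pos g1 with ⟨s1, s2⟩ | ⟨s1, s2⟩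
      · have t : 0 < I.side0 j := by
          have e1 := mul_pos h2 s1
          have e2 := mul_pos h1 s2
          exact pos_of_mul_pos_left (by linarith : 0 < I.side0 j * icross (I.U c) (I.U m)) hpos.le
        exact hmin j hj hj0 (Or.inr ⟨mul_pos s1 t, h1⟩) (Or.inr ⟨mul_pos t s2, h2⟩)
      · have t : I.side0 j < 0 := by
          have e1 := mul_neg_of_pos_of_neg h2 s1
          have e2 := mul_neg_of_pos_of_neg h1 s2
          by_contra h3
          have := mul_nonneg (not_lt.1 h3) hpos.le
          linarith
        exact hmin j hj hj0 (Or.inr ⟨mul_pos_of_neg_of_neg s1 t, h1⟩)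
          (Or.inr ⟨mul_pos_of_neg_of_neg t s2, h2⟩)

theorem dir_ne_zero {ε : ℤ} (hε : ε = 1 ∨ ε = -1) {m : ℕ} (hm : m < I.n) :
    toPoint (I.dir ε m) ≠ 0 := fun h => by
  have := (near_dir hε hm).self
  rw [h] at this
  simp [cross] at this

/-- Otherwise the gap between the two vertices would exceed π. All vertices would be on the right of
the direction just after `c`, and that ray would cross no edge, although the number of crossed edges
is odd because `q` is in the polygon. -/
theorem Next.pos {c m : ℕ} (h : I.Next c m) : 0 < icross (I.U c) (I.U m) := by
  by_contra hcon
  have hne := I.icross_ne_zero h.lt_fst h.lt_snd h.ne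
  have hneg : icross (I.U c) (I.U m) < 0 := by omega
  have hnear := near_dir (I := I) (Or.inl rfl) h.lt_fst
  have hodd := I.odd _ (dir_ne_zero (Or.inl rfl) h.lt_fst) hnear.generic
  have hall : ∀ i : Fin I.n, cross (toPoint (I.dir 1 c)) (I.u i) < 0 := by
    intro i
    by_cases hi : i = ⟨c, h.lt_fst⟩
    · have := hnear.self
      rw [hi, cross_swap]
      push_cast at this
      linarith
    · have h1 := hnear.other i hi
      have h2 : cross (I.u ⟨c, h.lt_fst⟩) (I.u i) < 0 := by
        rw [u, u, cross_toPoint]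
        exact_mod_cast h.neg hneg i.isLt fun h => hi (Fin.ext h)
      exact neg_of_mul_pos_left h1 h2.le
  have h0 : total I.u (toPoint (I.dir 1 c)) = 0 := by
    unfold total
    rw [Set.ncard_eq_zero (Set.toFinite _)]
    refine Set.eq_empty_of_forall_notMem fun i hi => ?_
    obtain ⟨h1, h2⟩ := hi
    have g1 := hall i
    have g2 := hall (finRotate I.n i)
    have g3 := pos_of_mul_neg_left h1 g1.le
    have g4 := neg_of_mul_pos_left h2 g2.le
    linarith
  have h1 : Odd (total I.u (toPoint (I.dir 1 c))) := hodd
  rw [h0] at h1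
  exact absurd h1 (by decide)

/-- Between two consecutive vertices the set of active edges does not change. -/
theorem Next.iAct_iff {c m : ℕ} (h : I.Next c m) {e : ℕ} (he : e < I.n) :
    I.IAct (I.dir (-1) m) e ↔ I.IAct (I.dir 1 c) e := by
  have hpos := h.pos
  have n1 := near_dir (I := I) (Or.inl rfl) h.lt_fst
  have n2 := near_dir (I := I) (Or.inr rfl) h.lt_snd
  have hd : 0 < cross (toPoint (I.dir 1 c)) (toPoint (I.dir (-1) m)) := by
    rw [cross_toPoint]
    -- The scalar product contributes at most `K * (K - 1)`, which is less than `K * K - 1`, while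
    -- the determinant of the vertices is at least 1. So the direction after `c` precedes the one
    -- before `m` by less than π.
    have e1 : icross (I.dir 1 c) (I.dir (-1) m) = (I.K * I.K - 1) * icross (I.U c) (I.U m) -
        2 * I.K * idot (I.U c) (I.U m) := by
      unfold icross dir idot; ring
    have h1 := I.two_mul_abs_idot_lt h.lt_fst h.lt_snd
    have h2 := le_abs_self (idot (I.U c) (I.U m))
    have hK := I.K_pos
    have key : 0 < icross (I.dir 1 c) (I.dir (-1) m) := by
      rw [e1]
      have h3 : I.K * (2 * idot (I.U c) (I.U m)) ≤ I.K * (I.K - 1) :=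
        mul_le_mul_of_nonneg_left (by linarith) (by linarith)
      have h4 : (I.K * I.K - 1) * 1 ≤ (I.K * I.K - 1) * icross (I.U c) (I.U m) :=
        mul_le_mul_of_nonneg_left (by linarith) (by nlinarith)
      linarith
    exact_mod_cast key
  have hno : ∀ j : Fin I.n, ¬ (0 < cross (toPoint (I.dir 1 c)) (I.u j) ∧
      cross (toPoint (I.dir (-1) m)) (I.u j) < 0) := by
    rintro j ⟨h1, h2⟩
    by_cases hjc : j = ⟨c, h.lt_fst⟩
    · have := n1.self
      rw [hjc, cross_swap] at h1
      push_cast at this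
      linarith
    by_cases hjm : j = ⟨m, h.lt_snd⟩
    · have := n2.self
      rw [hjm, cross_swap] at h2
      push_cast at this
      linarith
    have h3 := pos_of_mul_pos_right (n1.other j hjc) h1.le
    have h4 := neg_of_mul_pos_right (n2.other j hjm) h2.le
    rw [u, u, cross_toPoint] at h3 h4
    refine h.no_between hpos j.isLt (by exact_mod_cast h3) ?_
    rw [icross_swap]
    have : icross (I.U m) (I.U j) < 0 := by exact_mod_cast h4
    linarith
  rw [Inst.iAct_iff he, Inst.iAct_iff he]
  have := act_parity hd (I.star_u.edge_ne ⟨e, he⟩) (n1.generic _) (n1.generic _) (n2.generic _)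
    (n2.generic _)
  have h5 := this.2 (iff_of_false (hno _) (hno _))
  exact h5.symm

/-! ### The active edges before and after a change of direction -/

open Classical in
/-- The number of active edges in the set `X` up to the pointer. -/
noncomputable def cnt (I : Inst E) (X : ℕ → Prop) (d : ℤ × ℤ) (P : ℕ) : ℕ :=
  ((Finset.range I.n).filter fun e => X e ∧ I.IAct d e ∧ I.key d e ≤ I.tkey d P).card

theorem tkey_lt_key_iff {d d' : ℤ × ℤ} {P e : ℕ} (hP : I.PAct d P) (hP' : I.PAct d' P)
    (he : e < I.n) (h1 : I.IAct d e) (h2 : I.IAct d' e) :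
    I.tkey d' P < I.key d' e ↔ I.tkey d P < I.key d e := by
  rcases P with _ | f
  · simp only [tkey, if_true]
    exact iff_of_true (key_pos he h2) (key_pos he h1)
  · rw [tkey_succ, tkey_succ, ← not_le, ← not_le,
      key_le_iff he (hP f rfl).1 h2 (hP' f rfl).2 h1 (hP f rfl).2]

theorem key_lt_tkey_iff {d d' : ℤ × ℤ} {P e : ℕ} (hP : I.PAct d P) (hP' : I.PAct d' P)
    (he : e < I.n) (h1 : I.IAct d e) (h2 : I.IAct d' e) :
    I.key d' e < I.tkey d' P ↔ I.key d e < I.tkey d P := by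
  rcases P with _ | f
  · simp only [tkey, if_true]
    exact iff_of_false (key_pos he h2).not_gt (key_pos he h1).not_gt
  · rw [tkey_succ, tkey_succ, ← not_le, ← not_le,
      key_le_iff (hP f rfl).1 he (hP' f rfl).2 h2 (hP f rfl).2 h1]

variable (I) in
/-- A change of direction that only affects the activity of the edges in `X`. -/
structure Turn (X : ℕ → Prop) (d d' : ℤ × ℤ) (P : ℕ) : Prop where
  act : ∀ e, e < I.n → ¬ X e → (I.IAct d' e ↔ I.IAct d e)
  ptr : I.PAct d P
  off : ∀ e, P = e + 1 → ¬ X e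

theorem Turn.ptr' {X : ℕ → Prop} {d d' : ℤ × ℤ} {P : ℕ} (h : I.Turn X d d' P) : I.PAct d' P :=
  fun e he => ⟨(h.ptr e he).1, (h.act e (h.ptr e he).1 (h.off e he)).2 (h.ptr e he).2⟩

/-- The pointer stays at an active edge, and the order of other edges relative to it does not depend
on the direction; only edges in `X` become dirty. -/
theorem Turn.trees {X : ℕ → Prop} {d d' : ℤ × ℤ} {P : ℕ} (h : I.Turn X d d' P)
    {arr : ℕ → ℤ} (ht : Trees I d P clean arr) : Trees I d' P X arr :=
  ht.congr h.ptr h.ptr' (fun _ _ _ => id) (fun e he hX => h.act e he hX)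
    (fun _ he _ h1 h2 => tkey_lt_key_iff h.ptr h.ptr' he h1 h2)
    fun _ he _ h1 h2 => key_lt_tkey_iff h.ptr h.ptr' he h1 h2

/-- Edges outside `X` contribute equally to both ranks. The new rank is obtained by subtracting the
old contribution of `X` and adding the new one. -/
theorem Turn.rank {X : ℕ → Prop} {d d' : ℤ × ℤ} {P : ℕ} (h : I.Turn X d d' P) :
    I.rank d' P + I.cnt X d P = I.rank d P + I.cnt X d' P := by
  classical
  have split : ∀ x, I.rank x P = I.cnt X x P + ((Finset.range I.n).filter fun e =>
      ¬ X e ∧ I.IAct x e ∧ I.key x e ≤ I.tkey x P).card := by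
    intro x
    unfold Inst.rank cnt
    rw [← Finset.card_filter_add_card_filter_not (s := (Finset.range I.n).filter fun e =>
      I.IAct x e ∧ I.key x e ≤ I.tkey x P) X, Finset.filter_filter, Finset.filter_filter]
    congr 2 <;> refine Finset.filter_congr fun e _ => ?_ <;> tauto
  have heq : ((Finset.range I.n).filter fun e => ¬ X e ∧ I.IAct d' e ∧ I.key d' e ≤ I.tkey d' P) =
      (Finset.range I.n).filter fun e => ¬ X e ∧ I.IAct d e ∧ I.key d e ≤ I.tkey d P := by
    refine Finset.filter_congr fun e he => ?_
    rw [Finset.mem_range] at he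
    refine and_congr_right fun hX => ?_
    rw [← h.act e he hX]
    refine and_congr_right fun ha => ?_
    rw [← not_lt, ← not_lt, tkey_lt_key_iff h.ptr h.ptr' he ((h.act e he hX).1 ha) ha]
  rw [split d', split d, heq]
  omega

open Classical in
theorem Turn.tot_le {X : ℕ → Prop} {d d' : ℤ × ℤ} {P : ℕ} (h : I.Turn X d d' P) :
    I.tot d' ≤ I.tot d + ((Finset.range I.n).filter X).card := by
  unfold tot
  refine (Finset.card_le_card fun e he => ?_).trans (Finset.card_union_le _ _)
  rw [Finset.mem_filter] at he
  rw [Finset.mem_union, Finset.mem_filter, Finset.mem_filter]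
  by_cases hX : X e
  · exact Or.inr ⟨he.1, hX⟩
  · exact Or.inl ⟨he.1, (h.act e (Finset.mem_range.1 he.1) hX).1 he.2⟩

theorem Turn.symm {X : ℕ → Prop} {d d' : ℤ × ℤ} {P : ℕ} (h : I.Turn X d d' P) :
    I.Turn X d' d P := ⟨fun e he hX => (h.act e he hX).symm, h.ptr', h.off⟩

end Inst


/-! ## The parts of the processing of a vertex -/

variable {E : Env} {I : Inst E}

theorem Inst.Base.frame {l : List Reg} {σ σ' : State} (h : I.Base σ) (hf : Frame l σ σ')
    (hl : ∀ x ∈ l, x.level < 6) : I.Base σ' := h.same (hf.sameReg (by norm_num) hl)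

theorem PtrCtx.frame {d : ℤ × ℤ} {P : ℕ} {l : List Reg} {σ σ' : State} (h : PtrCtx I d P σ)
    (hf : Frame l σ σ') (hl : ∀ x ∈ l, x.level < 6 ∧ x ∉ [Reg.dx, .dy, .pA, .nA, .pD]) :
    PtrCtx I d P σ' := by
  have hne : ∀ x ∈ [Reg.dx, .dy, .pA, .nA, .pD], x ∉ l := fun x hx hxl => (hl x hxl).2 hx
  exact ⟨h.base.frame hf fun x hx => (hl x hx).1,
    (hf _ (by decide) (hne _ (by simp))).trans h.dx, (hf _ (by decide) (hne _ (by simp))).trans h.dy,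
    (hf _ (by decide) (hne _ (by simp))).trans h.pA, (hf _ (by decide) (hne _ (by simp))).trans h.nA,
    (hf _ (by decide) (hne _ (by simp))).trans h.pD⟩

/-- Compute the data of the edge in register `x`. -/
def edgeAt (x : Reg) : Cmd := block [.set .i (rg x), edgeCmd]

theorem wp_edgeAt {d : ℤ × ℤ} {e : ℕ} {σ : State} {x : Reg} (hb : I.Base σ)
    (hdx : σ.reg .dx = d.1) (hdy : σ.reg .dy = d.2) (he : e < I.n) (hx : σ.reg x = e)
    (hbits : x.bits ≤ 20) :
    wp E (edgeAt x) 19 (fun σ' => Same 2 σ σ' ∧ ∃ σ₁, EdgeData I d e σ₁ σ') σ := by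
  refine wp_cons_set (T := 18) (by simp) hbits ?_
  simp only [val_reg, hx]
  have s0 : Same 2 σ (σ.set .i e) := (Same.refl 2 σ).set (by decide)
  refine wp_cons (T₁ := 18) (T₂ := 0) ((wp_edge I (d := d) (i := e)
    (hb.same (s0.reg.mono (by norm_num))) (by simp [hdx]) (by simp [hdy]) he (by simp)).mono
    le_rfl fun σ₁ h1 => ?_) (by omega)
  exact wp_nil ⟨s0.trans (h1.same.mono (by norm_num)), _, h1⟩

/-- Compute the incident edges of vertex `m`, and the direction just before it. -/
def setupCmd : Cmd := block [.set .e2 (rg .m),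
  .ite (rg .m) 1 (.set .e1 (rg .n - 1)) (.set .e1 (rg .m - 1)),
  edgeAt .e1, .set .h1 (rg .dot), edgeAt .e2, .set .h2 (rg .dot),
  .set .dx (rg .K * rg .ux + rg .uy), .set .dy (rg .K * rg .uy - rg .ux)]

/-- The registers that describe vertex `m`. -/
structure AtVertex (I : Inst E) (m : ℕ) (σ : State) : Prop where
  lt : m < I.n
  vertex : σ.reg .m = m
  e1 : σ.reg .e1 = prv I.n m
  e2 : σ.reg .e2 = m
  h1 : σ.reg .h1 = I.det (prv I.n m)
  h2 : σ.reg .h2 = I.det m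

theorem AtVertex.frame {m : ℕ} {l : List Reg} {σ σ' : State} (h : AtVertex I m σ)
    (hf : Frame l σ σ') (hl : ∀ x ∈ l, x ∉ [Reg.m, .e1, .e2, .h1, .h2]) : AtVertex I m σ' := by
  have hne : ∀ x ∈ [Reg.m, .e1, .e2, .h1, .h2], x ∉ l := fun x hx hxl => hl x hxl hx
  exact ⟨h.lt,
    (hf _ (by decide) (hne _ (by simp))).trans h.vertex, (hf _ (by decide) (hne _ (by simp))).trans h.e1,
    (hf _ (by decide) (hne _ (by simp))).trans h.e2, (hf _ (by decide) (hne _ (by simp))).trans h.h1,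
    (hf _ (by decide) (hne _ (by simp))).trans h.h2⟩

/-- The edges are loaded for the previous direction `d`. Only coordinates and determinants are used,
and they do not depend on it. -/
theorem wp_setup {d : ℤ × ℤ} {m : ℕ} {σ : State} (hb : I.Base σ)
    (hdx : σ.reg .dx = d.1) (hdy : σ.reg .dy = d.2) (hm : m < I.n) (hx : σ.reg .m = m) :
    wp E setupCmd 46 (fun σ' => AtVertex I m σ' ∧ I.Base σ' ∧ σ'.reg .dx = (I.dir (-1) m).1 ∧
      σ'.reg .dy = (I.dir (-1) m).2 ∧ Frame [.e1, .e2, .h1, .h2, .dx, .dy] σ σ' ∧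
      σ'.arr = σ.arr ∧ σ'.out = σ.out) σ := by
  have hn := I.three_le
  refine wp_cons_set (T := 45) (by simp) (by decide) ?_
  simp only [val_reg, hx]
  refine wp_cons (T₁ := 2) (T₂ := 43) (wp.mono (T := 2) (Q := fun σ' =>
    σ'.reg .e1 = prv I.n m ∧ σ'.reg .e2 = m ∧ Frame [.e1, .e2, .h1, .h2, .dx, .dy] σ σ' ∧
    σ'.reg .dx = d.1 ∧ σ'.reg .dy = d.2 ∧ σ'.arr = σ.arr ∧ σ'.out = σ.out)
    (wp_ite (T := 1) (by simp) (by simp) (fun h => ?_) fun h => ?_) le_rfl ?_) (by omega)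
  · simp only [val_reg, State.set_reg, reduceCtorEq, if_false, hx, val_one] at h
    have h0 : m = 0 := by omega
    refine wp_set_of_lt (T := 0) (by simp) ?_ ⟨?_, by simp,
      ((Frame.refl _ σ).set (by simp)).set (by simp), by simp [hdx], by simp [hdy], rfl, rfl⟩
    · simp only [val_sub, val_reg, State.set_reg, reduceCtorEq, if_false, hb.n, val_one]
      exact abs_lt_pow I (by rw [abs_of_nonneg (by omega)]; omega) (by decide)
    · simp only [State.set_reg, if_true, val_sub, val_reg, reduceCtorEq, if_false, hb.n, val_one,
        prv, h0]
      omega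
  · simp only [val_reg, State.set_reg, reduceCtorEq, if_false, hx, val_one] at h
    have h0 : m ≠ 0 := by omega
    refine wp_set_of_lt (T := 0) (by simp) ?_ ⟨?_, by simp,
      ((Frame.refl _ σ).set (by simp)).set (by simp), by simp [hdx], by simp [hdy], rfl, rfl⟩
    · simp only [val_sub, val_reg, State.set_reg, reduceCtorEq, if_false, hx, val_one]
      exact abs_lt_pow I (by rw [abs_of_nonneg (by omega)]; omega) (by decide)
    · simp only [State.set_reg, if_true, val_sub, val_reg, reduceCtorEq, if_false, hx, val_one,
        prv, h0]
      omega
  rintro σ₁ ⟨r1, r2, f1, dx1, dy1, a1, o1⟩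
  have b1 := hb.frame f1 (by decide)
  refine wp_cons (T₁ := 19) (T₂ := 24) ((wp_edgeAt b1 dx1 dy1 (prv_lt hm) r1 (by decide)).mono le_rfl
    ?_) (by omega)
  rintro σ₂ ⟨s2, _, d2⟩
  refine wp_cons_set (T := 23) (by simp) (by decide) ?_
  simp only [val_reg, d2.dot]
  have b2 := b1.same (s2.reg.mono (by norm_num))
  have f2 : Frame [.e1, .e2, .h1, .h2, .dx, .dy] σ (σ₂.set .h1 (I.det (prv I.n m))) :=
    (f1.trans (s2.reg.frame le_rfl) (l'' := [.e1, .e2, .h1, .h2, .dx, .dy]) (by simp)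
      (by simp)).set (by simp)
  refine wp_cons (T₁ := 19) (T₂ := 4) ((wp_edgeAt (x := .e2) (d := d) (e := m)
    (hb.frame f2 (by decide)) ?_ ?_ hm ?_ (by decide)).mono le_rfl ?_) (by omega)
  · simp [s2.reg .dx (by decide), dx1]
  · simp [s2.reg .dy (by decide), dy1]
  · simp [s2.reg .e2 (by decide), r2]
  rintro σ₃ ⟨s3, _, d3⟩
  refine wp_cons_set (T := 3) (by simp) (by decide) ?_
  simp only [val_reg, d3.dot]
  refine wp_cons_set (T := 2) (by simp) (by decide) ?_
  refine wp_cons_set (T := 1) (by simp) (by decide) (wp_nil ?_)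
  have hK : σ₃.reg .K = I.K := by
    rw [s3.reg .K (by decide)]
    simp [b2.K]
  simp only [val_add, val_sub, val_mul, val_reg, State.set_reg, reduceCtorEq, if_false, hK, d3.ux,
    d3.uy]
  have f3 : ∀ x y z, Frame [.e1, .e2, .h1, .h2, .dx, .dy] σ
      (((σ₃.set .h2 x).set .dx y).set .dy z) := fun x y z =>
    (((f2.trans (s3.reg.frame le_rfl) (l'' := [.e1, .e2, .h1, .h2, .dx, .dy]) (by simp)
      (by simp)).set (by simp)).set (by simp)).set (by simp)
  refine ⟨⟨hm, ?_, ?_, ?_, ?_, ?_⟩, hb.frame (f3 _ _ _) (by decide), ?_, ?_, f3 _ _ _, ?_, ?_⟩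
  · rw [f3 _ _ _ .m (by decide) (by simp), hx]
  · simp [s3.reg .e1 (by decide), s2.reg .e1 (by decide), r1]
  · simp [s3.reg .e2 (by decide), s2.reg .e2 (by decide), r2]
  · simp [s3.reg .h1 (by decide)]
  · simp
  · simp [Inst.dir]
  · simp [Inst.dir]; ring
  · simp [s3.arr, s2.arr, a1]
  · simp [s3.out, s2.out, o1]

/-- Compute the direction just after vertex `m`. -/
def turnCmd : Cmd := block [edgeAt .m, .set .dx (rg .K * rg .ux - rg .uy),
  .set .dy (rg .K * rg .uy + rg .ux)]

theorem wp_turn {d : ℤ × ℤ} {m : ℕ} {σ : State} (hb : I.Base σ)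
    (hdx : σ.reg .dx = d.1) (hdy : σ.reg .dy = d.2) (hm : m < I.n) (hx : σ.reg .m = m) :
    wp E turnCmd 21 (fun σ' => σ'.reg .dx = (I.dir 1 m).1 ∧
      σ'.reg .dy = (I.dir 1 m).2 ∧ Frame [.dx, .dy] σ σ' ∧
      σ'.arr = σ.arr ∧ σ'.out = σ.out) σ := by
  refine wp_cons (T₁ := 19) (T₂ := 2) ((wp_edgeAt hb hdx hdy hm hx (by decide)).mono le_rfl
    ?_) (by omega)
  rintro σ₁ ⟨s1, _, d1⟩
  refine wp_cons_set (T := 1) (by simp) (by decide) ?_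
  refine wp_cons_set (T := 0) (by simp) (by decide) (wp_nil ?_)
  have hK : σ₁.reg .K = I.K := (s1.reg .K (by decide)).trans hb.K
  refine ⟨?_, ?_, (((s1.reg.frame le_rfl).mono (by simp)).set (by simp)).set (by simp), s1.arr,
    s1.out⟩
  · simp [hK, d1.ux, d1.uy, Inst.dir]
  · simp [hK, d1.ux, d1.uy, Inst.dir]

/-! ### Counting -/

/-- Change the counter if the edge in register `x` is active and not beyond the pointer. -/
def countOne (x : Reg) (op : Expr) : Cmd := block [edgeAt x,
  when 0 (rg .act) (.ite (rg .pA * rg .eD) (rg .eA * rg .pD) .skip (.set .r op))]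

theorem Inst.cnt_eq_ncard (X : ℕ → Prop) (d : ℤ × ℤ) (P : ℕ) :
    I.cnt X d P = {e | e < I.n ∧ X e ∧ I.IAct d e ∧ I.key d e ≤ I.tkey d P}.ncard := by
  classical
  unfold Inst.cnt
  rw [← Set.ncard_coe_finset]
  congr 1
  ext e
  rw [Finset.mem_coe, Finset.mem_filter, Finset.mem_range]
  rfl

theorem Inst.cnt_eq_one {d : ℤ × ℤ} {P e : ℕ} (he : e < I.n) (h : I.IAct d e)
    (hk : I.key d e ≤ I.tkey d P) : I.cnt (· = e) d P = 1 := by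
  rw [Inst.cnt_eq_ncard, Set.ncard_eq_one]
  refine ⟨e, Set.ext fun f => ?_⟩
  rw [Set.mem_ofPred_eq, Set.mem_singleton_iff]
  constructor
  · exact fun h1 => h1.2.1
  · rintro rfl
    exact ⟨he, rfl, h, hk⟩

theorem Inst.cnt_eq_zero {d : ℤ × ℤ} {P e : ℕ} (h : I.IAct d e → ¬ I.key d e ≤ I.tkey d P) :
    I.cnt (· = e) d P = 0 := by
  rw [Inst.cnt_eq_ncard]
  have : {f | f < I.n ∧ f = e ∧ I.IAct d f ∧ I.key d f ≤ I.tkey d P} = ∅ := by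
    refine Set.eq_empty_of_forall_notMem ?_
    rintro f ⟨_, rfl, h1, h2⟩
    exact h h1 h2
  rw [this, Set.ncard_empty]

theorem Inst.cnt_le_one {d : ℤ × ℤ} {P e : ℕ} : I.cnt (· = e) d P ≤ 1 := by
  rw [Inst.cnt_eq_ncard]
  refine (Set.ncard_le_ncard (t := {e}) (fun f hf => hf.2.1) (Set.toFinite _)).trans ?_
  rw [Set.ncard_singleton]

theorem Inst.cnt_inc {d : ℤ × ℤ} {P m : ℕ} (hm : m < I.n) :
    I.cnt (Inc I.n m) d P = I.cnt (· = prv I.n m) d P + I.cnt (· = m) d P := by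
  have hfin : ∀ X : ℕ → Prop,
      {e | e < I.n ∧ X e ∧ I.IAct d e ∧ I.key d e ≤ I.tkey d P}.Finite := fun X =>
    (Set.finite_lt_nat I.n).subset fun e he => he.1
  rw [Inst.cnt_eq_ncard, Inst.cnt_eq_ncard, Inst.cnt_eq_ncard,
    ← Set.ncard_union_eq ?_ (hfin _) (hfin _)]
  · congr 1
    ext e
    simp only [Set.mem_ofPred_eq, Set.mem_union, Inc]
    tauto
  · rw [Set.disjoint_left]
    intro e h1 h2
    exact prv_ne I.three_le (h1.2.1.symm.trans h2.2.1)

/-- With `δ = -1` before a turn and `δ = 1` after it, this performs the correction of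
`Inst.Turn.rank` for one incident edge. -/
theorem wp_countOne {d : ℤ × ℤ} {P e : ℕ} {σ : State} {x : Reg} {op : Expr} {δ : ℤ}
    (hc : PtrCtx I d P σ) (hP : I.PAct d P) (he : e < I.n) (hx : σ.reg x = e)
    (hbits : x.bits ≤ 20) (hop : op = rg .r + 1 ∧ δ = 1 ∨ op = rg .r - 1 ∧ δ = -1)
    (hr : |σ.reg .r| ≤ I.n + 7) :
    wp E (countOne x op) 22 (fun σ' => σ'.reg .r = σ.reg .r + δ * I.cnt (· = e) d P ∧
      Frame [.r] σ σ' ∧ σ'.arr = σ.arr ∧ σ'.out = σ.out) σ := by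
  refine wp_cons (T₁ := 19) (T₂ := 3) ((wp_edgeAt hc.base hc.dx hc.dy he hx hbits).mono le_rfl
    ?_) (by omega)
  rintro σ₁ ⟨s1, _, d1⟩
  have c1 := hc.same (s1.reg.mono (by norm_num))
  have f1 : Frame [.r] σ σ₁ := (s1.reg.frame le_rfl).mono (by simp)
  have r1 : σ₁.reg .r = σ.reg .r := s1.reg .r (by decide)
  refine wp_cons (T₁ := 3) (T₂ := 0) (wp_ite (T := 2) (by simp) (by simp) (fun h => ?_)
    fun h => ?_) (by omega)
  · simp only [val_zero, val_reg] at h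
    have ha : I.IAct d e := by
      by_contra h1
      rw [d1.nact h1] at h
      exact lt_irrefl _ h
    refine wp_ite (T := 1) (by simp) (by simp) (fun h2 => ?_) fun h2 => ?_
    · simp only [val_mul, val_reg, c1.pA, c1.pD, d1.eA, d1.eD, Inst.lt_key_iff hP ha] at h2
      refine wp_skip (wp_nil ⟨?_, f1, s1.arr, s1.out⟩)
      rw [Inst.cnt_eq_zero fun _ => not_le.2 h2, r1]
      simp
    · simp only [val_mul, val_reg, c1.pA, c1.pD, d1.eA, d1.eD, Inst.lt_key_iff hP ha, not_lt] at h2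
      have hv : op.val E σ₁ = σ.reg .r + δ ∧ op.Safe E σ₁ := by
        rcases hop with ⟨rfl, rfl⟩ | ⟨rfl, rfl⟩ <;> simp [r1, sub_eq_add_neg]
      have hδ : |δ| = 1 := by rcases hop with ⟨_, rfl⟩ | ⟨_, rfl⟩ <;> simp
      refine wp_set_of_lt (T := 0) hv.2 ?_ (wp_nil ⟨?_, f1.set (by simp), s1.arr, s1.out⟩)
      · rw [hv.1]
        refine abs_lt_pow I ((abs_add_le _ _).trans ?_) (by decide)
        omega
      · rw [Inst.cnt_eq_one he ha h2, hv.1]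
        simp
  · simp only [val_zero, val_reg] at h
    have ha : ¬ I.IAct d e := by
      intro h1
      rw [d1.act h1] at h
      norm_num at h
    refine wp_skip (wp_nil ⟨?_, f1, s1.arr, s1.out⟩)
    rw [Inst.cnt_eq_zero fun h1 => absurd h1 ha, r1]
    simp

/-! ### Moving the pointer away from the vertex -/

/-- Move the pointer if it is at an edge incident to the vertex. -/
def dodgeCmd : Cmd := when
  ((rg .p - rg .e1 - 1) * (rg .p - rg .e2 - 1) * ((rg .p - rg .e1 - 1) * (rg .p - rg .e2 - 1))) 1
  movePred

/-- The pointer is at an edge incident to the vertex `m`. -/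
def AtInc (n m P : ℕ) : Prop := P = prv n m + 1 ∨ P = m + 1

/-- A pointer at an incident edge could become inactive in the turn. The square of a product of two
integers is less than 1 exactly if one factor vanishes, so one comparison tests both edges. -/
theorem wp_dodge {d : ℤ × ℤ} {P m : ℕ} {σ : State} (h : Ptr I d P clean σ)
    (hr : σ.reg .r = I.rank d P) (hv : AtVertex I m σ) :
    wp E dodgeCmd (4 * I.cost + 33) (fun σ' => ∃ P', Ptr I d P' clean σ' ∧
      σ'.reg .r = I.rank d P' ∧ Frame ptrRegs σ σ' ∧ σ'.out = σ.out ∧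
      SameVertexTree σ.arr σ'.arr ∧
      ((¬ AtInc I.n m P ∧ P' = P) ∨ (AtInc I.n m P ∧ I.rank d P' + 1 = I.rank d P))) σ := by
  refine wp_ite (T := 4 * I.cost + 32) (by simp) (by simp) (fun h1 => ?_) fun h1 => ?_
  · simp only [val_mul, val_sub, val_reg, val_one, h.p, hv.e1, hv.e2] at h1
    have h2 : ((P : ℤ) - prv I.n m - 1) * ((P : ℤ) - m - 1) = 0 := by
      by_contra h0
      have := mul_self_pos.2 h0
      omega
    have h3 : AtInc I.n m P := by
      rcases mul_eq_zero.1 h2 with h3 | h3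
      · exact Or.inl (by omega)
      · exact Or.inr (by omega)
    have hP0 : P ≠ 0 := by rcases h3 with h3 | h3 <;> omega
    refine (wp_movePred h hr hP0).mono le_rfl ?_
    rintro σ' ⟨⟨P', p1, p2⟩, r1, f1, o1, v1⟩
    refine ⟨P', p1, p2, f1, o1, v1, Or.inr ⟨h3, ?_⟩⟩
    rw [p2, hr] at r1
    omega
  · simp only [val_mul, val_sub, val_reg, val_one, h.p, hv.e1, hv.e2] at h1
    refine wp_skip ⟨P, h, hr, Frame.refl _ _, rfl, fun _ _ => rfl, Or.inl ⟨fun h2 => h1 ?_, rfl⟩⟩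
    have h3 : ((P : ℤ) - prv I.n m - 1) * ((P : ℤ) - m - 1) = 0 := by
      rcases h2 with h2 | h2
      · rw [show (P : ℤ) - prv I.n m - 1 = 0 by omega, zero_mul]
      · rw [show (P : ℤ) - m - 1 = 0 by omega, mul_zero]
    rw [h3]; norm_num

/-- There are only two incident edges, and each move lowers the rank, so the pointer cannot return
to the first one. -/
theorem wp_dodge_twice {d : ℤ × ℤ} {P m : ℕ} {σ : State} {l : List Cmd} {T : ℕ}
    {Q : State → Prop} (h : Ptr I d P clean σ)
    (hr : σ.reg .r = I.rank d P) (hv : AtVertex I m σ)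
    (hQ : ∀ σ' P', Ptr I d P' clean σ' → σ'.reg .r = I.rank d P' → Frame ptrRegs σ σ' →
      σ'.out = σ.out → SameVertexTree σ.arr σ'.arr → ¬ AtInc I.n m P' →
      I.rank d P' ≤ I.rank d P → I.rank d P ≤ I.rank d P' + 2 → wp E (block l) T Q σ') :
    wp E (block (dodgeCmd :: dodgeCmd :: l)) (T + 2 * (4 * I.cost + 33)) Q σ := by
  refine wp_cons (T₁ := 4 * I.cost + 33) (T₂ := T + (4 * I.cost + 33))
    ((wp_dodge h hr hv).mono le_rfl ?_) (by omega)
  rintro σ₁ ⟨P₁, p1, r1, f1, o1, v1, c1⟩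
  refine wp_cons (T₁ := 4 * I.cost + 33) (T₂ := T)
    ((wp_dodge p1 r1 (hv.frame f1 (by decide))).mono le_rfl ?_) (by omega)
  rintro σ₂ ⟨P₂, p2, r2, f2, o2, v2, c2⟩
  refine hQ σ₂ P₂ p2 r2 (f1.trans f2 (by simp) (by simp)) (o2.trans o1) (v1.trans v2) ?_ ?_ ?_
  · rcases c1 with ⟨n1, rfl⟩ | ⟨n1, e1⟩ <;> rcases c2 with ⟨n2, rfl⟩ | ⟨n2, e2⟩
    · exact n1
    · exact absurd n2 n1
    · exact n2
    · have h1 : P₁ ≠ P := by rintro rfl; omega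
      have h2 : P₂ ≠ P := by rintro rfl; omega
      have h3 : P₂ ≠ P₁ := by rintro rfl; omega
      unfold AtInc at *
      omega
  · rcases c1 with ⟨n1, rfl⟩ | ⟨n1, e1⟩ <;> rcases c2 with ⟨n2, rfl⟩ | ⟨n2, e2⟩ <;> omega
  · rcases c1 with ⟨n1, rfl⟩ | ⟨n1, e1⟩ <;> rcases c2 with ⟨n2, rfl⟩ | ⟨n2, e2⟩ <;> omega

/-! ### Reports -/

theorem Inst.rank_eq_rk {d : ℤ × ℤ} {e : ℕ} (he : e < I.n) (ha : I.IAct d e) :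
    I.rank d (e + 1) = rk I.u (toPoint d) ⟨e, he⟩ := by
  classical
  rw [rk_eq_ncard_le I.star_u ((Inst.iAct_iff he).1 ha), Set.ncard_eq_toFinset_card']
  unfold Inst.rank
  rw [Inst.tkey_succ]
  symm
  rw [← Finset.card_map Fin.valEmbedding]
  congr 1
  ext f
  simp only [Finset.mem_map, Set.mem_toFinset, Set.mem_ofPred_eq, Fin.valEmbedding_apply,
    Finset.mem_filter, Finset.mem_range]
  constructor
  · rintro ⟨j, ⟨h1, h2⟩, rfl⟩
    refine ⟨j.isLt, (Inst.iAct_iff j.isLt).2 h1, ?_⟩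
    rw [Inst.key_eq j.isLt, Inst.key_eq he]
    exact h2
  · rintro ⟨hf, h1, h2⟩
    refine ⟨⟨f, hf⟩, ⟨(Inst.iAct_iff hf).1 h1, ?_⟩, rfl⟩
    rw [Inst.key_eq hf, Inst.key_eq he] at h2
    exact h2

theorem rk_injective {n : ℕ} {u : Fin n → ℂ} (S : Star u) {d : ℂ} {i j : Fin n}
    (hi : EAct u d i) (hj : EAct u d j) (h : rk u d i = rk u d j) : i = j := by
  rcases lt_trichotomy (ekey u d i) (ekey u d j) with h1 | h1 | h1
  · have := (rk_lt_iff hi).2 h1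
    omega
  · exact ekey_injective S hi hj h1
  · have := (rk_lt_iff hj).2 h1
    omega

theorem Win.unique {n : ℕ} {u : Fin n → ℂ} (S : Star u) {k : ℕ} {m : Fin n} {d : ℂ}
    {a b a' b' : Fin n} (h : Win u k m d a b) (h' : Win u k m d a' b') : a = a' ∧ b = b' :=
  ⟨rk_injective S h.fst.1 h'.fst.1 (h.fst.2.trans h'.fst.2.symm),
    rk_injective S h.snd.1 h'.snd.1 (h.snd.2.trans h'.snd.2.symm)⟩

/-- The type of the windows at start (`ε = 1`) and end (`ε = -1`) vertices. -/
def typeOf (ε : ℤ) : WindowType := if ε = 1 then .cw else .ccw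

open Classical in
/-- The reports for the vertex `m`, if it is a start or end vertex according to `ε`. -/
noncomputable def Inst.reports (I : Inst E) (ε : ℤ) (m : Fin I.n) : List (Report I.n) :=
  if h : ∃ ab : Fin I.n × Fin I.n, Win I.u (I.k - 2) m (toPoint (I.dir ε m)) ab.1 ab.2 then
    [(m, h.choose.1, typeOf ε), (m, h.choose.2, typeOf ε)] else []

theorem Inst.reports_eq {ε : ℤ} {m a b : Fin I.n}
    (h : Win I.u (I.k - 2) m (toPoint (I.dir ε m)) a b) :
    I.reports ε m = [(m, a, typeOf ε), (m, b, typeOf ε)] := by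
  have hex : ∃ ab : Fin I.n × Fin I.n,
    Win I.u (I.k - 2) m (toPoint (I.dir ε m)) ab.1 ab.2 := ⟨(a, b), h⟩
  obtain ⟨h1, h2⟩ := h.unique I.star_u hex.choose_spec
  rw [Inst.reports, dif_pos hex, ← h1, ← h2]

theorem Inst.reports_eq_nil {ε : ℤ} {m : Fin I.n}
    (h : ∀ a b, ¬ Win I.u (I.k - 2) m (toPoint (I.dir ε m)) a b) : I.reports ε m = [] := by
  rw [Inst.reports, dif_neg]
  rintro ⟨ab, h1⟩
  exact h _ _ h1

/-- Report the window at vertex `m`, if there is one. -/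
def reportCmd (t : ℤ) : Cmd := .ite (rg .r) (rg .k) .skip (when 0 (.ld 5)
  (block [edgeAt .e1, .ite (rg .pA * rg .eD) (rg .eA * rg .pD) .skip
    (block [edgeAt .e2, .ite (rg .pA * rg .eD) (rg .eA * rg .pD) .skip
      (block [.emit (rg .m), .emit (rg .p - 1), .emit (.lit t),
        .emit (rg .m), .emit (.ld 5 - 1), .emit (.lit t)])])]))

/-- The target of the pointer is two more than the visibility parameter. So the pointer is the near
edge of the window and the root of the tree of successors is its far edge. If both exist, it only
remains to check that no incident edge lies beyond the pointer. -/
theorem wp_report {ε : ℤ} {P m : ℕ} {σ : State} (hm : m < I.n)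
    (h : Ptr I (I.dir ε m) P clean σ)
    (hr : σ.reg .r = I.rank (I.dir ε m) P)
    (hmin : I.rank (I.dir ε m) P = min I.k (I.tot (I.dir ε m))) (hv : AtVertex I m σ)
    (hε : ε = 1 ∨ ε = -1) (hcrit : Crit I.u ε ⟨m, hm⟩) :
    wp E (reportCmd (typeOf ε).code) 60 (fun σ' => SameReg 2 σ σ' ∧ σ'.arr = σ.arr ∧
      σ'.out = σ.out ++ (I.reports ε ⟨m, hm⟩).flatMap Report.words) σ := by
  have hN := six_le_N I
  have hk := I.k_ge
  set d := I.dir ε m with hd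
  have hnear := I.near_dir hε hm
  have hwin : ∀ a b : Fin I.n, Win I.u (I.k - 2) ⟨m, hm⟩ (toPoint d) a b →
      I.rank d (a + 1) = I.k ∧ I.rank d (b + 1) = I.k + 1 := by
    intro a b hw
    rw [Inst.rank_eq_rk a.isLt ((Inst.iAct_iff a.isLt).2 hw.fst.1),
      Inst.rank_eq_rk b.isLt ((Inst.iAct_iff b.isLt).2 hw.snd.1)]
    have h1 := hw.fst.2
    have h2 := hw.snd.2
    simp only [Fin.eta]
    omega
  have hnil : (I.rank d P < I.k ∨ I.rank d P = I.tot d) → I.reports ε ⟨m, hm⟩ = [] := by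
    intro h1
    refine Inst.reports_eq_nil fun a b hw => ?_
    have h2 := (hwin a b hw).2
    have h3 := Inst.rank_le_tot (I := I) (d := d) (P := b + 1)
    omega
  refine wp_ite (T := 59) (by simp) (by simp) (fun h1 => ?_) fun h1 => ?_
  · simp only [val_reg, hr, h.ctx.base.k] at h1
    refine wp_skip ⟨SameReg.refl _ _, rfl, ?_⟩
    rw [hnil (Or.inl (by exact_mod_cast h1))]
    simp
  simp only [val_reg, hr, h.ctx.base.k] at h1
  have hrk : I.rank d P = I.k := by
    have : ¬ I.rank d P < I.k := by exact_mod_cast h1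
    omega
  refine wp_ite (T := 58) (by simp) ⟨trivial, by simp, by simp; omega⟩ (fun h2 => ?_) fun h2 => ?_
  swap
  · rcases h.succ_root with ⟨_, h3⟩ | ⟨e, h3, _⟩
    · refine wp_skip ⟨SameReg.refl _ _, rfl, ?_⟩
      rw [hnil (Or.inr h3)]
      simp
    · exfalso
      apply h2
      have : (Expr.ld 5).val E σ = e + 1 := by rw [val_ld, val_five]; exact h3
      rw [this, val_zero]
      omega
  have h2' : 0 < σ.arr 5 := by
    rw [val_ld, val_five, val_zero] at h2
    exact h2
  obtain ⟨e, h3, he, hea, hlt, hnext⟩ := h.succ_root.resolve_left fun h4 => by omega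
  have hP0 : P ≠ 0 := by
    rintro rfl
    rw [Inst.rank_zero] at hrk
    omega
  obtain ⟨g, rfl⟩ := Nat.exists_eq_succ_of_ne_zero hP0
  obtain ⟨hg, hga⟩ := h.act g rfl
  have hEg := (Inst.iAct_iff hg).1 hga
  have hEe := (Inst.iAct_iff he).1 hea
  have hg1 : rk I.u (toPoint d) ⟨g, hg⟩ = I.k - 2 + 2 := by
    rw [← Inst.rank_eq_rk hg hga]
    have : I.rank d (g + 1) = I.k := hrk
    omega
  have he1 : rk I.u (toPoint d) ⟨e, he⟩ = I.k - 2 + 3 := by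
    rw [← Inst.rank_eq_rk he hea, Inst.rank_step he hea hlt hnext]
    have : I.rank d (g + 1) = I.k := hrk
    omega
  have hincact : ∀ f, f < I.n → Inc I.n m f → I.IAct d f := fun f hf hi => by
    rw [Inst.iAct_iff hf]
    have hreal : (ε : ℝ) = 1 ∨ (ε : ℝ) = -1 := by
      rcases hε with rfl | rfl <;> norm_num
    exact (hcrit.incident_iff I.star_u hreal hnear ((Inst.inc_iff hm hf).1 hi)).2 rfl
  have hnil2 : ∀ f, f < I.n → Inc I.n m f → I.tkey d (g + 1) < I.key d f →
      I.reports ε ⟨m, hm⟩ = [] := by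
    intro f hf hi hk
    refine Inst.reports_eq_nil fun a b hw => ?_
    have h4 : a = ⟨g, hg⟩ := rk_injective I.star_u hw.fst.1 hEg (hw.fst.2.trans hg1.symm)
    have h5 := hw.inc ⟨f, hf⟩ ((Inst.inc_iff hm hf).1 hi)
    rw [h4, ← Inst.key_eq hf, ← Inst.key_eq hg] at h5
    rw [Inst.tkey_succ] at hk
    exact absurd h5 (not_le.2 hk)
  have hp := prv_lt hm
  have ha1 := hincact _ hp (Or.inr rfl)
  have ha2 := hincact _ hm (Or.inl rfl)
  refine wp_cons (T₁ := 19) (T₂ := 39) ((wp_edgeAt h.ctx.base h.ctx.dx h.ctx.dy hp hv.e1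
    (by decide)).mono le_rfl ?_) (by omega)
  rintro σ₁ ⟨s1, _, d1⟩
  have c1 := h.ctx.same (s1.reg.mono (by norm_num))
  refine wp_cons (T₁ := 30) (T₂ := 0) (wp_ite (T := 29) (by simp) (by simp) (fun h4 => ?_)
    fun h4 => ?_) (by omega)
  · simp only [val_mul, val_reg, c1.pA, c1.pD, d1.eA, d1.eD, Inst.lt_key_iff h.act ha1] at h4
    refine wp_skip (wp_nil ⟨s1.reg, s1.arr, ?_⟩)
    rw [hnil2 _ hp (Or.inr rfl) h4, s1.out]
    simp
  simp only [val_mul, val_reg, c1.pA, c1.pD, d1.eA, d1.eD, Inst.lt_key_iff h.act ha1, not_lt] at h4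
  refine wp_cons (T₁ := 19) (T₂ := 10) ((wp_edgeAt c1.base c1.dx c1.dy hm
    ((s1.reg .e2 (by decide)).trans hv.e2) (by decide)).mono le_rfl ?_) (by omega)
  rintro σ₂ ⟨s2, _, d2⟩
  have c2 := c1.same (s2.reg.mono (by norm_num))
  have s := s1.trans s2
  refine wp_cons (T₁ := 10) (T₂ := 0) (wp_ite (T := 9) (by simp) (by simp) (fun h5 => ?_)
    fun h5 => ?_) (by omega)
  · simp only [val_mul, val_reg, c2.pA, c2.pD, d2.eA, d2.eD, Inst.lt_key_iff h.act ha2] at h5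
    refine wp_skip (wp_nil (wp_nil ⟨s.reg, s.arr, ?_⟩))
    rw [hnil2 _ hm (Or.inl rfl) h5, s.out]
    simp
  simp only [val_mul, val_reg, c2.pA, c2.pD, d2.eA, d2.eD, Inst.lt_key_iff h.act ha2, not_lt] at h5
  have hW : Win I.u (I.k - 2) ⟨m, hm⟩ (toPoint d) ⟨g, hg⟩ ⟨e, he⟩ := by
    refine ⟨⟨hEg, hg1⟩, ⟨hEe, he1⟩, fun f hf => ?_⟩
    rw [Inst.tkey_succ] at h4 h5
    have hf' := (Inst.inc_iff hm f.isLt).2 hf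
    have : ekey I.u (toPoint d) f = I.key d f := (Inst.key_eq f.isLt).symm
    rw [this, ← Inst.key_eq hg]
    rcases hf' with hf' | hf' <;> rw [hf']
    · exact h5
    · exact h4
  have hm2 : σ₂.reg .m = m := (s.reg .m (by decide)).trans hv.vertex
  have hp2 : σ₂.reg .p = ((g + 1 : ℕ) : ℤ) := (s.reg .p (by decide)).trans h.p
  have ha5 : σ₂.arr 5 = e + 1 := by rw [s.arr]; exact h3
  refine wp_cons (T₁ := 1) (T₂ := 8) (wp_emit (T := 0) (by simp) ?_) (by omega)
  refine wp_cons (T₁ := 1) (T₂ := 7) (wp_emit (T := 0) (by simp) ?_) (by omega)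
  refine wp_cons (T₁ := 1) (T₂ := 6) (wp_emit (T := 0) (by simp) ?_) (by omega)
  refine wp_cons (T₁ := 1) (T₂ := 5) (wp_emit (T := 0) (by simp) ?_) (by omega)
  refine wp_cons (T₁ := 1) (T₂ := 4) (wp_emit (T := 0) ⟨⟨trivial, by simp, by simp; omega⟩, trivial⟩
    ?_) (by omega)
  refine wp_cons (T₁ := 1) (T₂ := 3) (wp_emit (T := 0) (by simp) (wp_nil (wp_nil (wp_nil ?_))))
    (by omega)
  refine ⟨fun x hx => s.reg x hx, s.arr, ?_⟩
  rw [Inst.reports_eq hW]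
  simp only [State.emit_out, State.emit_reg, State.emit_arr, val_reg, val_sub, val_one, val_lit,
    val_ld, val_five, hm2, hp2, s.out, List.flatMap_cons, List.flatMap_nil, Report.words,
    List.append_assoc, List.cons_append, List.nil_append, List.append_nil]
  have e5 : σ₂.arr (5 : ℤ).toNat = e + 1 := ha5
  rw [e5]
  simp


/-! ## The processing of a vertex -/

variable {E : Env} {I : Inst E}

/-- Process the vertex in register `m`. -/
def eventCmd : Cmd := block [setupCmd, ptrKeyCmd,
  when (rg .h2) 0 (when 0 (rg .h1) (reportCmd 0)),
  dodgeCmd, dodgeCmd,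
  countOne .e1 (rg .r - 1), countOne .e2 (rg .r - 1),
  turnCmd, ptrKeyCmd, refreshEdge (rg .e1), refreshEdge (rg .e2),
  countOne .e1 (rg .r + 1), countOne .e2 (rg .r + 1),
  rebalanceCmd,
  when 0 (rg .h2) (when (rg .h1) 0 (reportCmd 1))]

theorem u_pred (m : ℕ) (hm : m < I.n) :
    I.u ((finRotate I.n).symm ⟨m, hm⟩) = toPoint (I.U (prv I.n m)) := by
  have : (finRotate I.n).symm ⟨m, hm⟩ = ⟨prv I.n m, prv_lt hm⟩ := by
    rw [Equiv.symm_apply_eq, Fin.ext_iff, val_finRotate]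
    exact (nxt_prv hm).symm
  rw [this]
  rfl

/-- The determinant of the incoming edge has `m` as its second vector, which reverses its sign; a
vertex is critical if the two edge determinants have opposite signs. -/
theorem crit_iff {ε : ℤ} (hε : ε = 1 ∨ ε = -1) {m : ℕ} (hm : m < I.n) :
    Crit I.u ε ⟨m, hm⟩ ↔ 0 < ε * I.det m ∧ ε * I.det (prv I.n m) < 0 := by
  have h1 : cross (I.u ⟨m, hm⟩) (I.u (finRotate I.n ⟨m, hm⟩)) = I.det m := by
    rw [Inst.u_finRotate, Inst.u, cross_toPoint]
    rfl
  have h2 : cross (I.u ⟨m, hm⟩) (I.u ((finRotate I.n).symm ⟨m, hm⟩)) = -I.det (prv I.n m) := by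
    rw [u_pred, Inst.u, cross_toPoint, Inst.icross_swap]
    unfold Inst.det
    rw [nxt_prv hm]
    push_cast; rfl
  constructor
  · intro h
    have h3 := h.fst
    have h4 := h.snd
    rw [h1] at h3
    rw [h2] at h4
    constructor
    · exact_mod_cast h3
    · have : (0 : ℝ) < ((ε * -I.det (prv I.n m) : ℤ) : ℝ) := by push_cast; exact h4
      have h5 : 0 < ε * -I.det (prv I.n m) := by exact_mod_cast this
      linarith
  · rintro ⟨h3, h4⟩
    refine ⟨by rcases hε with rfl | rfl <;> norm_num, ?_, ?_⟩
    · rw [h1]; exact_mod_cast h3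
    · rw [h2]
      have h5 : 0 < ε * -I.det (prv I.n m) := by linarith
      exact_mod_cast h5

open Classical in
/-- All reports for the vertex `m`. -/
noncomputable def Inst.allReports (I : Inst E) (m : Fin I.n) : List (Report I.n) :=
  (if Crit I.u (-1) m then I.reports (-1) m else []) ++ if Crit I.u 1 m then I.reports 1 m else []

/-- The state between two vertices: the pointer is at edge number `k` or at the last edge. -/
structure Ready (I : Inst E) (d : ℤ × ℤ) (σ : State) : Prop where
  ptr : ∃ P, Ptr I d P clean σ ∧ I.rank d P = min I.k (I.tot d)
  r : σ.reg .r = (min I.k (I.tot d) : ℕ)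

/-- The registers that change when a vertex is processed. -/
abbrev eventRegs : List Reg := [.e1, .e2, .h1, .h2, .dx, .dy, .p, .pA, .nA, .pD, .old, .new, .b, .r]

theorem Ptr.frame {d : ℤ × ℤ} {P : ℕ} {dirty : ℕ → Prop} {l : List Reg} {σ σ' : State}
    (h : Ptr I d P dirty σ)
    (hf : Frame l σ σ') (hl : ∀ x ∈ l, x.level < 6 ∧ x ∉ [Reg.dx, .dy, .pA, .nA, .pD])
    (hp : Reg.p ∉ l) (ha : σ'.arr = σ.arr) : Ptr I d P dirty σ' :=
  ⟨h.ctx.frame hf hl, (hf _ (by decide) hp).trans h.p, h.act, by rw [ha]; exact h.trees⟩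

theorem Inst.turn_inc {m P : ℕ} (hm : m < I.n) (h : I.PAct (I.dir (-1) m) P)
    (hinc : ¬ AtInc I.n m P) : I.Turn (Inc I.n m) (I.dir (-1) m) (I.dir 1 m) P := by
  refine ⟨fun e he hi => Inst.iAct_dir_iff hm he hi, h, fun e he hi => hinc ?_⟩
  rcases hi with hi | hi
  · exact Or.inr (by omega)
  · exact Or.inl (by omega)

open Classical in
theorem card_inc_le (n m : ℕ) : ((Finset.range n).filter (Inc n m)).card ≤ 2 := by
  refine (Finset.card_le_card (t := {m, prv n m}) fun e he => ?_).trans Finset.card_le_two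
  rw [Finset.mem_filter] at he
  rcases he.2 with h | h <;> simp [h]

theorem Inst.turn_next {c m P : ℕ} (h : I.Next c m) (hP : I.PAct (I.dir 1 c) P) :
    I.Turn clean (I.dir 1 c) (I.dir (-1) m) P :=
  ⟨fun _ he _ => h.iAct_iff he, hP, fun _ _ => id⟩

theorem Inst.Turn.rank_clean {d d' : ℤ × ℤ} {P : ℕ} (h : I.Turn clean d d' P) :
    I.rank d' P = I.rank d P := by
  have := h.rank
  have h0 : ∀ x, I.cnt clean x P = 0 := fun x => by
    rw [Inst.cnt_eq_ncard]
    have : {e | e < I.n ∧ clean e ∧ I.IAct x e ∧ I.key x e ≤ I.tkey x P} = ∅ :=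
      Set.eq_empty_of_forall_notMem fun e he => he.2.1
    rw [this, Set.ncard_empty]
  rw [h0, h0] at this
  omega

theorem Inst.Turn.tot_clean {d d' : ℤ × ℤ} {P : ℕ} (h : I.Turn clean d d' P) :
    I.tot d' = I.tot d := by
  have h1 := h.tot_le
  have h2 := h.symm.tot_le
  have h0 : ∀ inst : DecidablePred clean,
      (@Finset.filter _ clean inst (Finset.range I.n)).card = 0 := fun _ =>
    Finset.card_eq_zero.2 (Finset.filter_eq_empty_iff.2 fun _ _ => id)
  rw [h0] at h1 h2
  omega

theorem wp_report_when {ε : ℤ} {P m : ℕ} {σ : State} {a b a' b' : Expr}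
    (h : Ptr I (I.dir ε m) P clean σ) (hr : σ.reg .r = I.rank (I.dir ε m) P)
    (hmin : I.rank (I.dir ε m) P = min I.k (I.tot (I.dir ε m))) (hv : AtVertex I m σ)
    (hε : ε = 1 ∨ ε = -1) (hs : a.Safe E σ ∧ b.Safe E σ ∧ a'.Safe E σ ∧ b'.Safe E σ)
    (hiff : Crit I.u ε ⟨m, hv.lt⟩ ↔ a.val E σ < b.val E σ ∧ a'.val E σ < b'.val E σ)
    {L : List (Report I.n)} (hL : Crit I.u ε ⟨m, hv.lt⟩ → L = I.reports ε ⟨m, hv.lt⟩)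
    (hL' : ¬ Crit I.u ε ⟨m, hv.lt⟩ → L = []) :
    wp E (when a b (when a' b' (reportCmd (typeOf ε).code))) 62 (fun σ' => SameReg 2 σ σ' ∧
      σ'.arr = σ.arr ∧ σ'.out = σ.out ++ L.flatMap Report.words) σ := by
  refine wp_ite (T := 61) hs.1 hs.2.1 (fun h1 => wp_ite (T := 60) hs.2.2.1 hs.2.2.2
    (fun h2 => ?_) fun h2 => ?_) fun h1 => ?_
  · have hc := hiff.2 ⟨h1, h2⟩
    rw [hL hc]
    exact wp_report hv.lt h hr hmin hv hε hc
  · refine wp_skip ⟨SameReg.refl _ _, rfl, ?_⟩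
    rw [hL' fun hc => h2 (hiff.1 hc).2]
    simp
  · refine wp_skip ⟨SameReg.refl _ _, rfl, ?_⟩
    rw [hL' fun hc => h1 (hiff.1 hc).1]
    simp

theorem Inst.cost_ge : 100 ≤ I.cost := by unfold Inst.cost; omega

theorem wp_event {c m : ℕ} {σ : State} (h : Ready I (I.dir 1 c) σ) (hnext : I.Next c m)
    (hm : σ.reg .m = m) :
    wp E eventCmd (70 * I.cost) (fun σ' => Ready I (I.dir 1 m) σ' ∧ Frame eventRegs σ σ' ∧
      SameVertexTree σ.arr σ'.arr ∧
      σ'.out = σ.out ++ (I.allReports ⟨m, hnext.lt_snd⟩).flatMap Report.words) σ := by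
  classical
  have hcost := I.cost_ge
  obtain ⟨⟨P, hp, hrank⟩, hr⟩ := h
  have hmn := hnext.lt_snd
  -- No activity changes between consecutive vertices, so the turn to the direction just before `m`
  -- needs no refresh.
  have t0 := Inst.turn_next hnext hp.act
  have htot := t0.tot_clean
  have hrk := t0.rank_clean
  set d' := I.dir (-1) m with hd'
  refine wp_cons (T₁ := 46) (T₂ := 70 * I.cost - 46)
    ((wp_setup hp.ctx.base hp.ctx.dx hp.ctx.dy hmn hm).mono le_rfl ?_) (by omega)
  rintro σ₁ ⟨v1, b1, dx1, dy1, f1, a1, o1⟩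
  refine wp_cons (T₁ := 24) (T₂ := 70 * I.cost - 70)
    ((wp_ptrKey (d := d') b1 dx1 dy1 ((f1 .p (by decide) (by decide)).trans hp.p)
      hp.act.le).mono le_rfl ?_) (by omega)
  rintro σ₂ ⟨c2, f2, a2, o2⟩
  have v2 := v1.frame f2 (by decide)
  have p2 : Ptr I d' P clean σ₂ := by
    refine ⟨c2, ?_, t0.ptr', ?_⟩
    · rw [f2 .p (by decide) (by decide), f1 .p (by decide) (by decide), hp.p]
    · rw [a2, a1]
      exact t0.trees hp.trees
  have r2 : σ₂.reg .r = I.rank d' P := by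
    rw [f2 .r (by decide) (by decide), f1 .r (by decide) (by decide), hr, hrk, hrank]
  have min2 : I.rank d' P = min I.k (I.tot d') := by rw [hrk, htot, hrank]
  -- The edges at an end vertex are crossed only before it, so its window is read off before the
  -- turn; that of a start vertex is read off after it.
  refine wp_cons (T₁ := 62) (T₂ := 70 * I.cost - 132) ((wp_report_when (ε := -1) p2 r2 min2 v2
    (Or.inr rfl) (by simp) ?_ (L := if Crit I.u (-1) ⟨m, hmn⟩ then I.reports (-1) ⟨m, hmn⟩ else [])
    ?_ ?_).mono le_rfl ?_) (by omega)
  · rw [crit_iff (Or.inr rfl) hmn]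
    simp only [val_zero, val_reg, v2.h1, v2.h2]
    constructor <;> rintro ⟨h1, h2⟩ <;> constructor <;> linarith
  · intro hc
    push_cast at hc
    rw [if_pos hc]
  · intro hc
    push_cast at hc
    rw [if_neg hc]
  rintro σ₃ ⟨s3, a3, o3⟩
  have f3 := s3.frame le_rfl
  have v3 := v2.frame f3 (by decide)
  have p3 := p2.frame f3 (by decide) (by decide) a3
  have r3 : σ₃.reg .r = I.rank d' P := by rw [s3 .r (by decide), r2]
  -- The pointer leaves the incident edges first, since the turn must not affect the edge it is at.
  refine wp.mono (wp_dodge_twice (T := 70 * I.cost - 132 - 2 * (4 * I.cost + 33)) p3 r3 v3 ?_)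
    (by omega) (fun _ h => h)
  rintro σ₄ Q p4 r4 f4 o4 va4 hinc hle hge
  have v4 := v3.frame f4 (by decide)
  have hQn := (Inst.rank_le_tot (I := I) (d := d') (P := Q)).trans Inst.tot_le
  have hn := I.three_le
  have hprv := prv_lt hmn
  have hc1 := Inst.cnt_le_one (I := I) (d := d') (P := Q) (e := prv I.n m)
  have hc2 := Inst.cnt_le_one (I := I) (d := d') (P := Q) (e := m)
  refine wp_cons (T₁ := 22) (T₂ := 62 * I.cost - 230) ((wp_countOne p4.ctx p4.act hprv v4.e1
    (by decide) (Or.inr ⟨rfl, rfl⟩) ?_).mono le_rfl ?_) (by omega)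
  · rw [r4, abs_of_nonneg (by positivity)]; omega
  rintro σ₅ ⟨r5, f5, a5, o5⟩
  have v5 := v4.frame f5 (by decide)
  have p5 := p4.frame f5 (by decide) (by decide) a5
  refine wp_cons (T₁ := 22) (T₂ := 62 * I.cost - 252) ((wp_countOne p5.ctx p5.act hmn v5.e2
    (by decide) (Or.inr ⟨rfl, rfl⟩) ?_).mono le_rfl ?_) (by omega)
  · rw [r5, r4, abs_le]; omega
  rintro σ₆ ⟨r6, f6, a6, o6⟩
  have v6 := v5.frame f6 (by decide)
  have p6 := p5.frame f6 (by decide) (by decide) a6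
  refine wp_cons (T₁ := 21) (T₂ := 62 * I.cost - 273)
    ((wp_turn p6.ctx.base p6.ctx.dx p6.ctx.dy hmn v6.vertex).mono le_rfl ?_) (by omega)
  rintro σ₇ ⟨dx7, dy7, f7, a7, o7⟩
  have v7 := v6.frame f7 (by decide)
  refine wp_cons (T₁ := 24) (T₂ := 62 * I.cost - 297)
    ((wp_ptrKey (d := I.dir 1 m) (p6.ctx.base.frame f7 (by decide)) dx7 dy7
      ((f7 .p (by decide) (by decide)).trans p6.p) p6.act.le).mono le_rfl ?_) (by omega)
  rintro σ₈ ⟨c8, f8, a8, o8⟩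
  have v8 := v7.frame f8 (by decide)
  have t8 := Inst.turn_inc hmn p6.act hinc
  have htot8 := t8.tot_le
  have htot8' := t8.symm.tot_le
  have hrk8 := t8.rank
  rw [Inst.cnt_inc hmn, Inst.cnt_inc hmn] at hrk8
  rw [← hd'] at t8 htot8 htot8' hrk8
  have hcard := card_inc_le I.n m
  set d := I.dir 1 m with hd
  have hc3 := Inst.cnt_le_one (I := I) (d := d) (P := Q) (e := prv I.n m)
  have hc4 := Inst.cnt_le_one (I := I) (d := d) (P := Q) (e := m)
  have trees8 : Trees I d Q (Inc I.n m) σ₈.arr := by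
    rw [a8, a7]
    exact t8.trees p6.trees
  refine wp_cons (T₁ := 2 * I.cost + 1) (T₂ := 60 * I.cost - 298)
    ((wp_refreshEdge c8 (e := rg .e1) (x := prv I.n m) (by simp) v8.e1 hprv trees8).mono le_rfl ?_) (by omega)
  rintro σ₉ ⟨f9, o9, va9, t9⟩
  have v9 := v8.frame f9 (by decide)
  have c9 := c8.frame f9 (by decide)
  refine wp_cons (T₁ := 2 * I.cost + 1) (T₂ := 58 * I.cost - 299)
    ((wp_refreshEdge c9 (e := rg .e2) (x := m) (by simp) v9.e2 hmn t9).mono le_rfl ?_) (by omega)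
  rintro σ₁₀ ⟨f10, o10, va10, t10⟩
  have v10 := v9.frame f10 (by decide)
  have p10 : Ptr I d Q clean σ₁₀ := by
    refine ⟨c9.frame f10 (by decide), ?_, t8.ptr', t10.mono ?_⟩
    · rw [f10 .p (by decide) (by decide), f9 .p (by decide) (by decide),
        f8 .p (by decide) (by decide), f7 .p (by decide) (by decide), p6.p]
    · rintro e _ ⟨⟨h1 | h1, h2⟩, h3⟩
      · exact h3 h1
      · exact h2 h1
  -- In between, the counter holds the number of active edges up to the pointer that are not
  -- incident to `m`; the turn does not change this number.
  have r10 : σ₁₀.reg .r = (I.rank d' Q : ℤ) - I.cnt (· = prv I.n m) d' Q - I.cnt (· = m) d' Q := by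
    rw [f10 .r (by decide) (by decide), f9 .r (by decide) (by decide),
      f8 .r (by decide) (by decide), f7 .r (by decide) (by decide), r6, r5, r4]
    ring
  refine wp_cons (T₁ := 22) (T₂ := 58 * I.cost - 321) ((wp_countOne p10.ctx p10.act hprv v10.e1
    (by decide) (Or.inl ⟨rfl, rfl⟩) ?_).mono le_rfl ?_) (by omega)
  · rw [r10, abs_le]; omega
  rintro σ₁₁ ⟨r11, f11, a11, o11⟩
  have v11 := v10.frame f11 (by decide)
  have p11 := p10.frame f11 (by decide) (by decide) a11
  refine wp_cons (T₁ := 22) (T₂ := 58 * I.cost - 343) ((wp_countOne p11.ctx p11.act hmn v11.e2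
    (by decide) (Or.inl ⟨rfl, rfl⟩) ?_).mono le_rfl ?_) (by omega)
  · rw [r11, r10, abs_le]; omega
  rintro σ₁₂ ⟨r12, f12, a12, o12⟩
  have v12 := v11.frame f12 (by decide)
  have p12 := p11.frame f12 (by decide) (by decide) a12
  have r12' : σ₁₂.reg .r = I.rank d Q := by
    rw [r12, r11, r10]
    omega
  -- Leaving the incident edges costs at most 2 in rank, the turn changes the rank by at most 2 and
  -- the total by at most 2; hence 6 moves suffice.
  refine wp_cons (T₁ := 48 * I.cost + 398) (T₂ := 10 * I.cost - 741)
    ((wp_rebalance p12 r12' (f := 6) ?_ ?_).mono (by omega) ?_) (by omega)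
  · omega
  · omega
  rintro σ₁₃ ⟨⟨R, p13, r13⟩, r13', f13, o13, va13⟩
  have v13 := v12.frame f13 (by decide)
  have min13 : I.rank d R = min I.k (I.tot d) := by
    rw [r13] at r13'
    exact_mod_cast r13'
  refine wp_cons (T₁ := 62) (T₂ := 10 * I.cost - 803) ((wp_report_when (ε := 1) p13 r13 min13 v13
    (Or.inl rfl) (by simp) ?_ (L := if Crit I.u 1 ⟨m, hmn⟩ then I.reports 1 ⟨m, hmn⟩ else [])
    ?_ ?_).mono le_rfl ?_) (by omega)
  · rw [crit_iff (Or.inl rfl) hmn]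
    simp only [val_zero, val_reg, v13.h1, v13.h2]
    constructor <;> rintro ⟨h1, h2⟩ <;> constructor <;> linarith
  · intro hc
    push_cast at hc
    rw [if_pos hc]
  · intro hc
    push_cast at hc
    rw [if_neg hc]
  rintro σ₁₄ ⟨s14, a14, o14⟩
  have f14 := s14.frame le_rfl
  have p14 := p13.frame f14 (by decide) (by decide) a14
  refine wp_nil ⟨⟨⟨R, p14, min13⟩, ?_⟩, ?_, ?_, ?_⟩
  · rw [s14 .r (by decide), r13']
  · have g : ∀ {l : List Reg} {x y : State}, Frame l x y → l ⊆ eventRegs → Frame eventRegs x y :=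
      fun h hl => h.mono hl
    have tr : ∀ {x y z : State}, Frame eventRegs x y → Frame eventRegs y z → Frame eventRegs x z :=
      fun h h' => h.trans h' (List.Subset.refl _) (List.Subset.refl _)
    exact tr (tr (tr (tr (tr (tr (tr (tr (tr (tr (tr (tr (tr (g f1 (by simp)) (g f2 (by simp)))
      (g f3 (by simp))) (g f4 (by simp))) (g f5 (by simp))) (g f6 (by simp))) (g f7 (by simp)))
      (g f8 (by simp))) (g f9 (by simp))) (g f10 (by simp))) (g f11 (by simp))) (g f12 (by simp)))
      (g f13 (by simp))) (g f14 (by simp))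
  · rw [a14]
    have e1 : SameVertexTree σ.arr σ₄.arr := by
      rw [← a1, ← a2, ← a3]; exact va4
    have e2 : SameVertexTree σ₄.arr σ₈.arr := by
      rw [a8, a7, a6, a5]; exact fun _ _ => rfl
    have e3 : SameVertexTree σ₁₀.arr σ₁₂.arr := by
      rw [a12, a11]; exact fun _ _ => rfl
    exact ((((e1.trans e2).trans va9).trans va10).trans e3).trans va13
  · rw [o14, o13, o12, o11, o10, o9, o8, o7, o6, o5, o4, o3, o2, o1, List.append_assoc,
      ← List.flatMap_append]
    rfl


/-! ## The tree of vertices -/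

variable {E : Env} {I : Inst E}

/-- Compute the pseudo-angle of the vertex in register `i`. -/
def loadVertex : Cmd := .ite (rg .i) 1
  (block [.set .A (3 * rg .K), .set .D 1, .set .act 1])
  (block [.set .ux (.rd (5 + 2 * rg .i) - rg .qx),
    .set .uy (.rd (6 + 2 * rg .i) - rg .qy),
    .set .cu (rg .u0x * rg .uy - rg .u0y * rg .ux),
    .set .dot (rg .u0x * rg .ux + rg .u0y * rg .uy),
    .set .act 1,
    .ite 0 (rg .cu) (block [.set .A (0 - rg .dot), .set .D (rg .cu)])
      (block [.set .A (2 * rg .K * (rg .u0y * rg .ux - rg .u0x * rg .uy) + rg .dot),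
        .set .D (0 - rg .cu)])])

/-- The threshold for the vertices is in its registers. -/
structure VertexCtx (I : Inst E) (zA zD : ℤ) (σ : State) : Prop where
  base : I.Base σ
  cA : σ.reg .cA = zA
  cD : σ.reg .cD = zD

theorem wp_loadVertex {σ : State} {i : ℕ} (hb : I.Base σ) (hi : i < I.n) (hr : σ.reg .i = i) :
    wp E loadVertex 10 (fun σ' => σ'.reg .act = 1 ∧ σ'.reg .A = I.vA i ∧ σ'.reg .D = I.vD i ∧
      Same 1 σ σ') σ := by
  refine wp_ite (T := 9) (by simp) (by simp) (fun h => ?_) fun h => ?_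
  · simp only [val_reg, val_one, hr] at h
    obtain rfl : i = 0 := by omega
    refine wp_cons_set (T := 8) (by simp) (by decide) ?_
    refine wp_cons_set (T := 7) (by simp) (by decide) ?_
    refine wp_cons_set (T := 6) (by simp) (by decide) (wp_nil ⟨by simp, ?_, ?_,
      (((Same.refl 1 σ).set (by decide)).set (by decide)).set (by decide)⟩)
    · simp [Inst.vA, hb.K]
    · simp [Inst.vD]
  · simp only [val_reg, val_one, hr] at h
    have hi0 : i ≠ 0 := by omega
    obtain ⟨l1, g1⟩ := getD_of_getElem? (I.inp_fst i hi)
    obtain ⟨l2, g2⟩ := getD_of_getElem? (I.inp_snd i hi)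
    have a1 : ((5 : ℤ) + 2 * (i : ℤ)).toNat = 5 + 2 * i := by omega
    have a2 : ((6 : ℤ) + 2 * (i : ℤ)).toNat = 6 + 2 * i := by omega
    refine wp_cons_set (T := 8) ?_ (by decide) ?_
    · simp only [safe_sub, safe_rd, safe_add, safe_mul, safe_reg, safe_five, safe_two, val_add,
        val_mul, val_five, val_two, val_reg, hr, a1, l1, and_true, true_and]
      positivity
    simp only [val_sub, val_rd, val_add, val_mul, val_five, val_two, val_reg, hr, a1, g1, hb.qx,
      add_sub_cancel_right]
    refine wp_cons_set (T := 7) ?_ (by decide) ?_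
    · simp only [safe_sub, safe_rd, safe_add, safe_mul, safe_reg, safe_six, safe_two, val_add,
        val_mul, val_six, val_two, val_reg, State.set_reg, reduceCtorEq, if_false, hr, a2, l2,
        and_true, true_and]
      positivity
    simp only [val_sub, val_rd, val_add, val_mul, val_six, val_two, val_reg, State.set_reg,
      reduceCtorEq, if_false, hr, a2, g2, hb.qy, add_sub_cancel_right]
    refine wp_cons_set (T := 6) (by simp) (by decide) ?_
    refine wp_cons_set (T := 5) (by simp) (by decide) ?_
    refine wp_cons_set (T := 4) (by simp) (by decide) ?_
    simp only [val_add, val_sub, val_mul, val_reg, State.set_reg, reduceCtorEq, if_false, if_true,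
      hb.u0x, hb.u0y, val_one]
    have e1 : (I.U 0).1 * (I.U i).2 - (I.U 0).2 * (I.U i).1 = I.side0 i := rfl
    have e2 : (I.U 0).1 * (I.U i).1 + (I.U 0).2 * (I.U i).2 = idot (I.U 0) (I.U i) := rfl
    simp only [e1, e2]
    have s : Same 1 σ (((((σ.set .ux (I.U i).1).set .uy (I.U i).2).set .cu (I.side0 i)).set .dot
        (idot (I.U 0) (I.U i))).set .act 1) :=
      (((((Same.refl 1 σ).set (by decide)).set (by decide)).set (by decide)).set (by decide)).set
        (by decide)
    refine wp_cons (T₁ := 3) (T₂ := 1) (wp_ite (T := 2) (by simp) (by simp) (fun h => ?_)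
      fun h => ?_) (by omega)
    · simp only [val_reg, State.set_reg, reduceCtorEq, if_false, if_true, val_zero] at h
      refine wp_cons_set (T := 1) (by simp) (by decide) ?_
      refine wp_cons_set (T := 0) (by simp) (by decide) (wp_nil (wp_nil ⟨by simp, ?_, ?_,
        (s.set (by decide)).set (by decide)⟩))
      · simp [Inst.vA, hi0, h]
      · simp [Inst.vD, hi0, abs_of_pos h]
    · simp only [val_reg, State.set_reg, reduceCtorEq, if_false, if_true, val_zero] at h
      refine wp_cons_set (T := 1) (by simp) (by decide) ?_
      refine wp_cons_set (T := 0) (by simp) (by decide) (wp_nil (wp_nil ⟨by simp, ?_, ?_,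
        (s.set (by decide)).set (by decide)⟩))
      · simp only [val_add, val_sub, val_mul, val_reg, State.set_reg, reduceCtorEq, if_false,
          if_true, hb.u0x, hb.u0y, hb.K, val_two]
        rw [Inst.vA, if_neg hi0, if_neg h, ← e1]
        ring
      · simp [Inst.vD, hi0, abs_of_nonpos (not_lt.1 h)]

theorem loadVertex_spec (I : Inst E) (zA zD : ℤ) :
    LoadSpec E loadVertex (VertexCtx I zA zD) I.n (fun _ => True) I.vA I.vD := by
  refine ⟨fun σ i hc hi hr => (wp_loadVertex hc.base hi hr).mono (by norm_num) ?_,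
    fun i hi _ => Inst.vD_pos hi, fun σ σ' h hs => ⟨h.base.same (hs.mono (by norm_num)),
      (hs _ (by decide)).trans h.cA, (hs _ (by decide)).trans h.cD⟩⟩
  rintro σ' ⟨h1, h2, h3, h4⟩
  exact ⟨fun _ => h1, fun h => absurd trivial h, h2, h3, h4⟩

variable (I) in
/-- The tree of the vertices after the threshold. -/
def VertexTree (zA zD : ℤ) (dirty : ℕ → Prop) (arr : ℕ → ℤ) : Prop :=
  TreeOK I.n I.s I.B 0 (Cand (fun _ => True) I.vA I.vD zA zD) (ratio I.vA I.vD) dirty arr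

/-- Refresh the block in register `b` of the tree of vertices. -/
def refreshVertex : Cmd := refreshCmd loadVertex .cA .cD 0

theorem wp_refreshVertex {zA zD : ℤ} {σ : State} (hc : VertexCtx I zA zD σ) {b : ℕ}
    (hb : σ.reg .b = b) (hbs : b < I.s) {dirty : ℕ → Prop} (h : VertexTree I zA zD dirty σ.arr) :
    wp E refreshVertex I.cost (fun σ' => SameReg 2 σ σ' ∧ σ'.out = σ.out ∧
      SameArr 0 σ.arr σ'.arr ∧ VertexTree I zA zD (fun e => dirty e ∧ e / I.B ≠ b) σ'.arr) σ :=
  wp_refresh (by norm_num) ⟨I.sizes, loadVertex_spec I zA zD,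
    fun σ h => ⟨h.base.n, h.base.s, h.base.B, h.cA, h.cD⟩⟩ hc hb hbs h

theorem TreeOK.mono {n s B τ : ℕ} {cand : ℕ → Prop} {key : ℕ → ℝ} {dirty dirty' : ℕ → Prop}
    {arr : ℕ → ℤ} (h : TreeOK n s B τ cand key dirty arr)
    (hd : ∀ e, e < n → dirty e → dirty' e) : TreeOK n s B τ cand key dirty' arr :=
  h.congr (fun e he h1 h2 => h1 (hd e he h2)) (fun _ _ _ => Iff.rfl) fun _ _ _ _ _ _ _ _ h => h

/-- If all elements are dirty, only nodes without elements below them are constrained, and there 0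
is correct. The cleared workspace is thus a valid tree to start from. -/
theorem TreeOK.of_zero {n s B τ : ℕ} {cand : ℕ → Prop} {key : ℕ → ℝ} {arr : ℕ → ℤ}
    (h : ∀ a, a % 3 = τ % 3 → arr a = 0) : TreeOK n s B τ cand key (fun _ => True) arr := by
  intro node _ _
  rw [h _ (by omega)]
  exact ⟨⟨le_rfl, by positivity⟩, fun h1 => Or.inl ⟨rfl, fun e he _ => h1 e he.1 he.2 trivial⟩⟩

theorem VertexTree.congr {zA zD : ℤ} {dirty : ℕ → Prop} {arr arr' : ℕ → ℤ}
    (h : VertexTree I zA zD dirty arr) (ha : SameVertexTree arr arr') :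
    VertexTree I zA zD dirty arr' := fun node h1 h2 => by
  rw [ha _ (by omega)]
  exact h node h1 h2

theorem Trees.sameArr {d : ℤ × ℤ} {P : ℕ} {dirty : ℕ → Prop} {arr arr' : ℕ → ℤ}
    (h : Trees I d P dirty arr) (ha : SameArr 0 arr arr') : Trees I d P dirty arr' :=
  ⟨h.pred.sameArr (by norm_num) ha, h.succ.sameArr (by norm_num) ha⟩

/-- Refresh all blocks. -/
def buildCmd (body : Cmd) : Cmd := .seq (.set .b 0)
  (.loop (rg .b) (rg .s) (block [body, .set .b (rg .b + 1)]))

/-- `Φ b` expresses that the blocks before `b` are clean. -/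
theorem wp_build {σ₀ : State} (hb : I.Base σ₀) (hsn : I.s ≤ I.n) {body : Cmd} {T : ℕ}
    (Φ : ℕ → (ℕ → ℤ) → Prop)
    (hΦ : ∀ b σ, b < I.s → SameReg 3 σ₀ σ → σ.reg .b = b → Φ b σ.arr →
      wp E body T (fun σ' => SameReg 2 σ σ' ∧ σ'.out = σ.out ∧ Φ (b + 1) σ'.arr) σ)
    (h0 : Φ 0 σ₀.arr) :
    wp E (buildCmd body) (I.s * (T + 2) + 2) (fun σ' => SameReg 3 σ₀ σ' ∧ σ'.out = σ₀.out ∧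
      Φ I.s σ'.arr) σ₀ := by
  refine wp_seq (T₁ := 1) (T₂ := I.s * (T + 2) + 1) (wp_set (T := 0) (by simp) (by decide) ?_)
    (by omega)
  refine (wp_loop (T := T + 1) (fun f σ' => ∃ b : ℕ, b + f = I.s ∧ σ'.reg .b = b ∧
    SameReg 3 σ₀ σ' ∧ σ'.out = σ₀.out ∧ Φ b σ'.arr) ?_ I.s _
    ⟨0, by simp, by simp, (SameReg.refl 3 σ₀).set (by decide), rfl, h0⟩).mono le_rfl ?_
  · rintro f σ ⟨b, h1, h2, h3, h4, h5⟩
    refine ⟨by simp, by simp, fun hlt => ?_⟩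
    simp only [val_reg, h2, h3 .s (by decide), hb.s] at hlt
    refine ⟨by omega, wp_cons (T₁ := T) (T₂ := 1) ((hΦ b σ (by omega) h3 h2 h5).mono le_rfl ?_)
      le_rfl⟩
    rintro σ' ⟨g1, g2, g3⟩
    have hb' : σ'.reg .b = b := (g1 .b (by decide)).trans h2
    refine wp_cons (T₁ := 1) (T₂ := 0) (wp_set_of_lt (T := 0) (by simp) ?_ (wp_nil ?_)) le_rfl
    · simp only [val_add, val_reg, val_one, hb']
      exact_mod_cast natCast_lt_pow I (x := b + 1) (by omega) (c := Reg.bits .b) (by decide)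
    · refine ⟨f - 1, by omega, b + 1, by omega, by simp [hb'],
        (h3.trans (g1.mono (by norm_num))).set (by decide), g2.trans h4, g3⟩
  · rintro σ' ⟨⟨f, b, h1, h2, h3, h4, h5⟩, h6⟩
    simp only [val_reg, h2, h3 .s (by decide), hb.s] at h6
    obtain rfl : b = I.s := by omega
    exact ⟨h3, h4, h5⟩

theorem Inst.block_lt {e : ℕ} (he : e < I.n) : e / I.B < I.s :=
  (Nat.div_lt_iff_lt_mul I.sizes.B_pos).2 (he.trans_le I.sizes.n_le)

theorem wp_buildVertex {zA zD : ℤ} {σ : State} (hc : VertexCtx I zA zD σ) (hsn : I.s ≤ I.n)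
    (h : ∀ a, σ.arr a = 0) :
    wp E (buildCmd refreshVertex) (I.s * (I.cost + 2) + 2) (fun σ' => SameReg 3 σ σ' ∧
      σ'.out = σ.out ∧ SameArr 0 σ.arr σ'.arr ∧ VertexTree I zA zD clean σ'.arr) σ := by
  refine (wp_build hc.base hsn (fun b arr => SameArr 0 σ.arr arr ∧
    VertexTree I zA zD (fun e => b ≤ e / I.B) arr) ?_ ⟨fun _ _ => rfl, ?_⟩).mono le_rfl ?_
  · rintro b σ₁ hb h1 h2 ⟨h3, h4⟩
    refine (wp_refreshVertex ((loadVertex_spec I zA zD).ctx_same _ _ hc h1) h2 hb h4).mono le_rfl ?_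
    rintro σ' ⟨g1, g2, g3, g4⟩
    exact ⟨g1, g2, fun a ha => (g3 a ha).trans (h3 a ha), g4.mono fun e _ he => by omega⟩
  · exact (TreeOK.of_zero fun a _ => h a).mono fun e _ _ => Nat.zero_le _
  · rintro σ' ⟨h1, h2, h3, h4⟩
    exact ⟨h1, h2, h3, h4.mono fun e he h5 => by have := Inst.block_lt he; omega⟩

theorem wp_buildBoth {d : ℤ × ℤ} {σ : State} (hc : PtrCtx I d 0 σ) (hsn : I.s ≤ I.n)
    (h : ∀ a, a % 3 ≠ 0 → σ.arr a = 0) :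
    wp E (buildCmd refreshBoth) (I.s * (2 * I.cost + 2) + 2) (fun σ' => SameReg 3 σ σ' ∧
      σ'.out = σ.out ∧ SameVertexTree σ.arr σ'.arr ∧ Trees I d 0 clean σ'.arr) σ := by
  refine (wp_build hc.base hsn (fun b arr => SameVertexTree σ.arr arr ∧
    Trees I d 0 (fun e => b ≤ e / I.B) arr) ?_ ⟨fun _ _ => rfl, ?_⟩).mono le_rfl ?_
  · rintro b σ₁ hb h1 h2 ⟨h3, h4⟩
    refine (wp_refreshBoth (hc.same h1) h2 hb h4).mono le_rfl ?_
    rintro σ' ⟨g1, g2, g3, g4⟩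
    exact ⟨g1, g2, h3.trans g3, g4.mono fun e _ he => by omega⟩
  · exact ⟨(TreeOK.of_zero fun a ha => h a (by omega)).mono fun e _ _ => Nat.zero_le _,
      (TreeOK.of_zero fun a ha => h a (by omega)).mono fun e _ _ => Nat.zero_le _⟩
  · rintro σ' ⟨h1, h2, h3, h4⟩
    exact ⟨h1, h2, h3, h4.mono fun e he h5 => by have := Inst.block_lt he; omega⟩

/-! ## Reading the parameters -/

/-- The smallest admissible value of `K` for the first `i` points. -/
def maxNorm (U : ℕ → ℤ × ℤ) : ℕ → ℤ
  | 0 => 0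
  | i + 1 => max (maxNorm U i)
      ((U i).1 * (U i).1 + (U i).2 * (U i).2 + ((U i).1 * (U i).1 + (U i).2 * (U i).2) + 1)

theorem le_maxNorm (U : ℕ → ℤ × ℤ) {n i : ℕ} (h : i < n) :
    2 * ((U i).1 * (U i).1 + (U i).2 * (U i).2) + 1 ≤ maxNorm U n := by
  induction n with
  | zero => omega
  | succ n ih =>
    rcases Nat.lt_succ_iff_lt_or_eq.1 h with h | rfl
    · exact (ih h).trans (le_max_left _ _)
    · exact le_trans (by linarith) (le_max_right _ _)

/-- The instance is given by the input array. -/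
structure Inst.Input (I : Inst E) (k : ℕ) : Prop where
  inp_n : E.inp[0]? = some (I.n : ℤ)
  inp_k : E.inp[1]? = some (k : ℤ)
  inp_s : E.inp[2]? = some (I.s : ℤ)
  inp_qx : E.inp[3]? = some I.q.1
  inp_qy : E.inp[4]? = some I.q.2
  k_eq : I.k = 2 * (k / 2) + 2
  B_eq : I.B = (I.n + I.s - 1) / I.s
  K_eq : I.K = maxNorm I.U I.n
  s_le : I.s ≤ I.n

/-- Twice the square of the norm of the point in `ux`, `uy`, plus one. -/
def normExpr : Expr :=
  rg .ux * rg .ux + rg .uy * rg .uy + (rg .ux * rg .ux + rg .uy * rg .uy) + 1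

/-- Take the point with the number in register `i` into account in `K`. -/
def normBody : Cmd := block [.set .ux (.rd (5 + 2 * rg .i) - rg .qx),
  .set .uy (.rd (6 + 2 * rg .i) - rg .qy), when (rg .K) normExpr (.set .K normExpr),
  .set .i (rg .i + 1)]

theorem wp_normBody {σ : State} {i : ℕ} (hi : i < I.n) (hqx : σ.reg .qx = I.q.1)
    (hqy : σ.reg .qy = I.q.2) (hr : σ.reg .i = i) (hK : σ.reg .K = maxNorm I.U i) :
    wp E normBody 5 (fun σ' => σ'.reg .i = (i + 1 : ℕ) ∧ σ'.reg .K = maxNorm I.U (i + 1) ∧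
      (∀ x : Reg, 6 ≤ x.level → x ≠ .K → σ'.reg x = σ.reg x) ∧ σ'.arr = σ.arr ∧ σ'.out = σ.out) σ := by
  obtain ⟨l1, g1⟩ := getD_of_getElem? (I.inp_fst i hi)
  obtain ⟨l2, g2⟩ := getD_of_getElem? (I.inp_snd i hi)
  have a1 : ((5 : ℤ) + 2 * (i : ℤ)).toNat = 5 + 2 * i := by omega
  have a2 : ((6 : ℤ) + 2 * (i : ℤ)).toNat = 6 + 2 * i := by omega
  refine wp_cons_set (T := 4) ?_ (by decide) ?_
  · simp only [safe_sub, safe_rd, safe_add, safe_mul, safe_reg, safe_five, safe_two, val_add,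
      val_mul, val_five, val_two, val_reg, hr, a1, l1, and_true, true_and]
    positivity
  simp only [val_sub, val_rd, val_add, val_mul, val_five, val_two, val_reg, hr, a1, g1, hqx,
    add_sub_cancel_right]
  refine wp_cons_set (T := 3) ?_ (by decide) ?_
  · simp only [safe_sub, safe_rd, safe_add, safe_mul, safe_reg, safe_six, safe_two, val_add,
      val_mul, val_six, val_two, val_reg, State.set_reg, reduceCtorEq, if_false, hr, a2, l2,
      and_true, true_and]
    positivity
  simp only [val_sub, val_rd, val_add, val_mul, val_six, val_two, val_reg, State.set_reg,
    reduceCtorEq, if_false, hr, a2, g2, hqy, add_sub_cancel_right]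
  have hs : ∀ τ : State, normExpr.Safe E τ := fun τ => by simp [normExpr]
  have hv : normExpr.val E ((σ.set .ux (I.U i).1).set .uy (I.U i).2) =
      (I.U i).1 * (I.U i).1 + (I.U i).2 * (I.U i).2 +
        ((I.U i).1 * (I.U i).1 + (I.U i).2 * (I.U i).2) + 1 := by
    simp [normExpr]
  have hbits : |(i : ℤ) + 1| < 2 ^ (Reg.bits .i * E.w) := by
    exact_mod_cast natCast_lt_pow I (x := i + 1) hi (c := Reg.bits .i) (by decide)
  refine wp_cons (T₁ := 2) (T₂ := 1) (wp_ite (T := 1) (by simp) (hs _) (fun h => ?_) fun h => ?_)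
    le_rfl
  · refine wp_set (T := 0) (hs _) (by decide) ?_
    rw [hv] at h ⊢
    simp only [val_reg, State.set_reg, reduceCtorEq, if_false, hK] at h
    refine wp_cons (T₁ := 1) (T₂ := 0) (wp_set_of_lt (T := 0) (by simp) ?_ (wp_nil ⟨?_, ?_, ?_, rfl, rfl⟩)) le_rfl
    · simpa [hr] using hbits
    · simp [hr]
    · simp only [State.set_reg, reduceCtorEq, if_false, if_true]
      rw [maxNorm, max_eq_right h.le]
    · intro x hx hxK
      have : x ≠ .i ∧ x ≠ .ux ∧ x ≠ .uy := by
        refine ⟨?_, ?_, ?_⟩ <;> rintro rfl <;> exact absurd hx (by decide)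
      simp [this, hxK]
  · rw [hv] at h
    simp only [val_reg, State.set_reg, reduceCtorEq, if_false, hK] at h
    refine wp_skip (wp_cons (T₁ := 1) (T₂ := 0) (wp_set_of_lt (T := 0) (by simp) ?_
      (wp_nil ⟨?_, ?_, ?_, rfl, rfl⟩)) le_rfl)
    · simpa [hr] using hbits
    · simp [hr]
    · simp only [State.set_reg, reduceCtorEq, if_false]
      rw [maxNorm, max_eq_left (not_lt.1 h), hK]
    · intro x hx hxK
      have : x ≠ .i ∧ x ≠ .ux ∧ x ≠ .uy := by
        refine ⟨?_, ?_, ?_⟩ <;> rintro rfl <;> exact absurd hx (by decide)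
      simp [this]

/-- Read the parameters. -/
def paramCmd : Cmd := block [.set .n (.rd 0), .set .k (2 * (.rd 1 / 2) + 2), .set .s (.rd 2),
  .set .qx (.rd 3), .set .qy (.rd (.lit 4)), .set .B ((rg .n + rg .s - 1) / rg .s),
  .set .K 0, .set .i 0, .loop (rg .i) (rg .n) normBody,
  .set .u0x (.rd 5 - rg .qx), .set .u0y (.rd 6 - rg .qy)]

theorem wp_param {k : ℕ} (h : I.Input k) (σ : State) :
    wp E paramCmd (6 * I.n + 20) (fun σ' => I.Base σ' ∧ σ'.arr = σ.arr ∧ σ'.out = σ.out) σ := by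
  have hn := I.three_le
  have hs := I.sizes.s_pos
  obtain ⟨l0, g0⟩ := getD_of_getElem? h.inp_n
  obtain ⟨l1, g1⟩ := getD_of_getElem? h.inp_k
  obtain ⟨l2, g2⟩ := getD_of_getElem? h.inp_s
  obtain ⟨l3, g3⟩ := getD_of_getElem? h.inp_qx
  obtain ⟨l4, g4⟩ := getD_of_getElem? h.inp_qy
  obtain ⟨l5, g5⟩ := getD_of_getElem? (I.inp_fst 0 (by omega))
  obtain ⟨l6, g6⟩ := getD_of_getElem? (I.inp_snd 0 (by omega))
  refine wp_cons_set (T := 6 * I.n + 19) (by simpa using l0) (by decide) ?_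
  refine wp_cons_set (T := 6 * I.n + 18) (by simpa using l1) (by decide) ?_
  refine wp_cons_set (T := 6 * I.n + 17) (by simpa using l2) (by decide) ?_
  refine wp_cons_set (T := 6 * I.n + 16) (by simpa using l3) (by decide) ?_
  refine wp_cons_set (T := 6 * I.n + 15) (by simpa using l4) (by decide) ?_
  refine wp_cons_set (T := 6 * I.n + 14) (by simp) (by decide) ?_
  refine wp_cons_set (T := 6 * I.n + 13) (by simp) (by decide) ?_
  refine wp_cons_set (T := 6 * I.n + 12) (by simp) (by decide) ?_
  simp only [val_rd, val_zero, val_one, val_two, val_three, val_lit, val_add, val_sub, val_mul,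
    val_div, val_reg, State.set_reg, reduceCtorEq, if_false, if_true, Int.toNat_zero, Int.toNat_one,
    Int.reduceToNat, g0, g1, g2, g3, g4]
  set σ₁ := (((((((σ.set .n I.n).set .k (2 * ((k : ℤ) / 2) + 2)).set .s I.s).set .qx I.q.1).set .qy
    I.q.2).set .B (((I.n : ℤ) + I.s - 1) / I.s)).set .K 0).set .i 0 with hσ₁
  refine wp_cons (T₁ := I.n * 6 + 1) (T₂ := 2) ((wp_loop (T := 5) (fun f σ' => ∃ i : ℕ,
    i + f = I.n ∧ σ'.reg .i = i ∧ σ'.reg .K = maxNorm I.U i ∧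
    (∀ x : Reg, 6 ≤ x.level → x ≠ .K → σ'.reg x = σ₁.reg x) ∧ σ'.arr = σ.arr ∧ σ'.out = σ.out) ?_
    I.n σ₁ ⟨0, by simp, by simp [hσ₁], by simp [hσ₁, maxNorm], fun _ _ _ => rfl, rfl, rfl⟩).mono
    le_rfl ?_) (by omega)
  · rintro f σ' ⟨i, h1, h2, h3, h4, h5, h6⟩
    have e1 : σ'.reg .n = I.n := (h4 .n (by decide) (by decide)).trans (by simp [hσ₁])
    have e2 : σ'.reg .qx = I.q.1 := (h4 .qx (by decide) (by decide)).trans (by simp [hσ₁])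
    have e3 : σ'.reg .qy = I.q.2 := (h4 .qy (by decide) (by decide)).trans (by simp [hσ₁])
    refine ⟨by simp, by simp, fun hlt => ?_⟩
    simp only [val_reg, h2, e1] at hlt
    refine ⟨by omega, (wp_normBody (by omega) e2 e3 h2 h3).mono le_rfl ?_⟩
    rintro σ'' ⟨k1, k2, k3, k4, k5⟩
    exact ⟨f - 1, by omega, i + 1, by omega, k1, k2,
      fun x hx hxK => (k3 x hx hxK).trans (h4 x hx hxK), k4.trans h5, k5.trans h6⟩
  · rintro σ' ⟨⟨f, i, h1, h2, h3, h4, h5, h6⟩, h7⟩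
    have e1 : σ'.reg .n = I.n := (h4 .n (by decide) (by decide)).trans (by simp [hσ₁])
    have e2 : σ'.reg .qx = I.q.1 := (h4 .qx (by decide) (by decide)).trans (by simp [hσ₁])
    have e3 : σ'.reg .qy = I.q.2 := (h4 .qy (by decide) (by decide)).trans (by simp [hσ₁])
    have e4 : σ'.reg .k = 2 * ((k : ℤ) / 2) + 2 :=
      (h4 .k (by decide) (by decide)).trans (by simp [hσ₁])
    have e5 : σ'.reg .s = I.s := (h4 .s (by decide) (by decide)).trans (by simp [hσ₁])
    have e6 : σ'.reg .B = ((I.n : ℤ) + I.s - 1) / I.s :=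
      (h4 .B (by decide) (by decide)).trans (by simp [hσ₁])
    simp only [val_reg, h2, e1] at h7
    obtain rfl : i = I.n := by omega
    refine wp_cons_set (T := 1) (by simpa using l5) (by decide) ?_
    refine wp_cons_set (T := 0) (by simpa using l6) (by decide) (wp_nil ⟨⟨?_, ?_, ?_, ?_, ?_, ?_, ?_,
      ?_, ?_⟩, h5, h6⟩)
    · simpa using e1
    · simpa using e5
    · rw [h.B_eq]
      push_cast [show 1 ≤ I.n + I.s by omega]
      simpa using e6
    · rw [h.k_eq]
      simpa using e4
    · rw [h.K_eq]
      simpa using h3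
    · simpa using e2
    · simpa using e3
    · simp only [val_sub, val_rd, val_five, val_reg, State.set_reg, reduceCtorEq, if_false, if_true,
        e2, Int.reduceToNat]
      rw [show 5 + 2 * 0 = 5 from rfl] at g5
      rw [g5, add_sub_cancel_right]
    · simp only [val_sub, val_rd, val_six, val_reg, State.set_reg, reduceCtorEq, if_false, if_true,
        e3, Int.reduceToNat]
      rw [show 6 + 2 * 0 = 6 from rfl] at g6
      rw [g6, add_sub_cancel_right]


/-! ## The sweep -/

variable {E : Env} {I : Inst E}

theorem Ready.frame {d : ℤ × ℤ} {l : List Reg} {σ σ' : State} (h : Ready I d σ) (hf : Frame l σ σ')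
    (hl : ∀ x ∈ l, x.level < 6 ∧ x ∉ [Reg.dx, .dy, .pA, .nA, .pD, .p, .r])
    (ha : SameArr 0 σ.arr σ'.arr) : Ready I d σ' := by
  obtain ⟨⟨P, hp, hk⟩, hr⟩ := h
  have hne : ∀ x ∈ [Reg.dx, .dy, .pA, .nA, .pD, .p, .r], x ∉ l := fun x hx hxl => (hl x hxl).2 hx
  refine ⟨⟨P, ⟨hp.ctx.frame hf fun x hx => ⟨(hl x hx).1, fun h => (hl x hx).2 ?_⟩,
    (hf _ (by decide) (hne _ (by simp))).trans hp.p, hp.act, hp.trees.sameArr ha⟩, hk⟩,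
    (hf _ (by decide) (hne _ (by simp))).trans hr⟩
  simp only [List.mem_cons] at h ⊢
  tauto

variable (I) in
/-- The vertices in `V` have been processed, and `c` is the last one of them, or `c = 0` at the
start; `zA / zD` is the current threshold. -/
structure Visited (c : ℕ) (zA zD : ℤ) (V : List (Fin I.n)) : Prop where
  lt : c < I.n
  cases : (V = [] ∧ c = 0 ∧ zA = -I.K ∧ zD = 1) ∨ (zA = I.vA c ∧ zD = I.vD c)
  nodup : V.Nodup
  mem : ∀ m : Fin I.n, m ∈ V ↔ ¬ zA * I.vD m < I.vA m * zD

theorem Visited.init : Visited I 0 (-I.K) 1 [] := by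
  refine ⟨by have := I.three_le; omega, Or.inl ⟨rfl, rfl, rfl, rfl⟩, List.nodup_nil, fun m => ?_⟩
  simp only [List.not_mem_nil, false_iff, not_not]
  exact Inst.start_lt m.isLt

section
variable {c m : ℕ} {zA zD : ℤ} {V : List (Fin I.n)}

/-- If `c = 0` came from a processed vertex 0 and not from the start, no candidate would be left,
because vertex 0 is the last one in the order. -/
theorem Visited.next (h : Visited I c zA zD V) (hm : m < I.n)
    (hc : zA * I.vD m < I.vA m * zD)
    (hmin : ∀ j, j < I.n → zA * I.vD j < I.vA j * zD → I.vkey m ≤ I.vkey j) : I.Next c m := by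
  have hVLt : ∀ j, j < I.n → (c ≠ 0 → I.VLt c j) → zA * I.vD j < I.vA j * zD := by
    intro j hj hcj
    rcases h.cases with ⟨_, _, rfl, rfl⟩ | ⟨rfl, rfl⟩
    · exact Inst.start_lt hj
    · by_cases h0 : c = 0
      · subst h0
        exfalso
        by_cases hm0 : m = 0
        · subst hm0
          exact lt_irrefl _ hc
        · exact lt_asymm hc (Inst.vLt_zero hm hm0)
      · exact hcj h0
  refine ⟨h.lt, hm, fun h0 => ?_, fun j hj hcj hlt => ?_⟩
  · rcases h.cases with ⟨_, h1, _⟩ | ⟨rfl, rfl⟩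
    · exact absurd h1 h0
    · exact hc
  · exact (hmin j hj (hVLt j hj hcj)).not_gt ((Inst.vkey_lt_iff hj hm).2 hlt)

/-- The keys are distinct and `m` has the smallest one beyond the threshold, so raising the
threshold to `m` passes `m` alone. -/
theorem Visited.mem_step (h : Visited I c zA zD V) (hm : m < I.n)
    (hc : zA * I.vD m < I.vA m * zD)
    (hmin : ∀ j, j < I.n → zA * I.vD j < I.vA j * zD → I.vkey m ≤ I.vkey j) (j : Fin I.n) :
    j ∈ V ∨ (j : ℕ) = m ↔ ¬ I.vA m * I.vD j < I.vA j * I.vD m := by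
  have e : I.vA m * I.vD j < I.vA j * I.vD m ↔ I.vkey m < I.vkey j :=
    (Inst.vkey_lt_iff hm j.isLt).symm
  rw [e]
  constructor
  · rintro (hj | rfl)
    · rcases h.cases with ⟨rfl, _⟩ | ⟨rfl, rfl⟩
      · simp at hj
      · have h1 := (h.mem j).1 hj
        have h2 : ¬ I.vkey c < I.vkey j := fun h2 => h1 ((Inst.vkey_lt_iff h.lt j.isLt).1 h2)
        have h3 : I.vkey c < I.vkey m := (Inst.vkey_lt_iff h.lt hm).2 hc
        exact fun h4 => h2 (h3.trans h4)
    · exact lt_irrefl _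
  · intro hj
    by_cases hjV : j ∈ V
    · exact Or.inl hjV
    · have h1 := not_not.1 (mt (h.mem j).2 hjV)
      exact Or.inr (Inst.vkey_injective j.isLt hm (le_antisymm (not_lt.1 hj) (hmin j j.isLt h1)))

theorem Visited.step (h : Visited I c zA zD V) (hm : m < I.n)
    (hc : zA * I.vD m < I.vA m * zD)
    (hmin : ∀ j, j < I.n → zA * I.vD j < I.vA j * zD → I.vkey m ≤ I.vkey j) :
    Visited I m (I.vA m) (I.vD m) (V ++ [⟨m, hm⟩]) := by
  refine ⟨hm, Or.inr ⟨rfl, rfl⟩, ?_, fun j => ?_⟩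
  · rw [List.nodup_append]
    refine ⟨h.nodup, by simp, ?_⟩
    rintro a ha b hb rfl
    rw [List.mem_singleton] at hb
    subst hb
    exact (h.mem _).1 ha hc
  · rw [← h.mem_step hm hc hmin j, List.mem_append, List.mem_singleton, Fin.ext_iff]

/-- Only `m` ceases to be a candidate, so the block of `m` is the only one to refresh. -/
theorem Visited.tree_step (h : Visited I c zA zD V) (hm : m < I.n)
    (hc : zA * I.vD m < I.vA m * zD)
    (hmin : ∀ j, j < I.n → zA * I.vD j < I.vA j * zD → I.vkey m ≤ I.vkey j) {arr : ℕ → ℤ}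
    (ht : VertexTree I zA zD clean arr) :
    VertexTree I (I.vA m) (I.vD m) (fun e => e = m) arr := by
  refine TreeOK.congr ht (fun _ _ _ => id) (fun e he hne => ?_) fun _ _ _ _ _ _ _ _ h => h
  have h1 := h.mem_step hm hc hmin ⟨e, he⟩
  have h2 := h.mem ⟨e, he⟩
  simp only [hne, or_false] at h1
  refine and_congr_right fun _ => ?_
  rw [← not_iff_not]
  exact h1.symm.trans h2

end

/-- Process the next vertex. -/
def sweepBody : Cmd := block [.set .m (.ld 3 - 1), .set .i (rg .m), loadVertex,
  .set .cA (rg .A), .set .cD (rg .D), .set .b (rg .m / rg .B), refreshVertex, eventCmd]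

variable (I) in
/-- The state of the sweep. -/
structure Sweep (o : List ℤ) (V : List (Fin I.n)) (σ : State) : Prop where
  state : ∃ c zA zD, Visited I c zA zD V ∧ Ready I (I.dir 1 c) σ ∧ σ.reg .cA = zA ∧
    σ.reg .cD = zD ∧ VertexTree I zA zD clean σ.arr
  out : σ.out = o ++ (V.flatMap I.allReports).flatMap Report.words

theorem Ready.base {d : ℤ × ℤ} {σ : State} (h : Ready I d σ) : I.Base σ := by
  obtain ⟨⟨P, hp, _⟩, _⟩ := h
  exact hp.ctx.base

theorem Sweep.root {o : List ℤ} {V : List (Fin I.n)} {σ : State} (h : Sweep I o V σ)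
    (h0 : ¬ 0 < σ.arr 3) (m : Fin I.n) : m ∈ V := by
  obtain ⟨⟨c, zA, zD, hV, -, -, -, ht⟩, -⟩ := h
  rw [hV.mem]
  rcases ht.root I.sizes.s_pos (fun _ _ => id) with ⟨h1, h2⟩ | ⟨e, h1, h2, h3, h4⟩
  · exact fun hc => h2 m m.isLt ⟨trivial, hc⟩
  · rw [Nat.add_zero] at h1
    omega

theorem wp_sweepBody {o : List ℤ} {V : List (Fin I.n)} {σ : State} (h : Sweep I o V σ)
    (h0 : 0 < σ.arr 3) :
    wp E sweepBody (72 * I.cost) (fun σ' => ∃ m, m ∉ V ∧ Sweep I o (V ++ [m]) σ') σ := by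
  have hcost := I.cost_ge
  have hN := six_le_N I
  obtain ⟨⟨c, zA, zD, hV, hR, hA, hD, ht⟩, ho⟩ := h
  obtain ⟨m, e1, hm, hcand, hmin⟩ : ∃ m : ℕ, σ.arr 3 = m + 1 ∧ m < I.n ∧
      zA * I.vD m < I.vA m * zD ∧
      ∀ j, j < I.n → zA * I.vD j < I.vA j * zD → I.vkey m ≤ I.vkey j := by
    rcases ht.root I.sizes.s_pos (fun _ _ => id) with ⟨h1, h2⟩ | ⟨e, h1, h2, h3, h4⟩
    · rw [Nat.add_zero] at h1
      omega
    · exact ⟨e, h1, h2, h3.2, fun j hj hc => h4 j hj ⟨trivial, hc⟩⟩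
  refine wp_cons_set (T := 72 * I.cost - 1) (by simp; omega) (by decide) ?_ |>.mono (by omega)
    fun _ h => h
  have ev : (Expr.ld 3 - 1).val E σ = m := by
    simp only [val_sub, val_ld, val_three, val_one, Int.reduceToNat, e1]
    ring
  rw [ev]
  refine wp_cons_set (T := 72 * I.cost - 2) (by simp) (by decide) ?_ |>.mono (by omega)
    fun _ h => h
  simp only [val_reg, State.set_reg, if_true]
  have f2 : Frame [.m] σ ((σ.set .m m).set .i m) :=
    ((Frame.refl _ _).set (by simp)).set (by simp [Reg.level])
  refine wp_cons (T₁ := 10) (T₂ := 72 * I.cost - 12)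
    ((wp_loadVertex (hR.base.frame f2 (by decide)) hm (by simp)).mono le_rfl ?_) (by omega)
  rintro σ₃ ⟨-, A3, D3, s3⟩
  have f3 : Frame [.m] σ σ₃ := f2.trans (s3.reg.frame (by norm_num)) (by simp) (by simp)
  refine wp_cons_set (T := 72 * I.cost - 13) (by simp) (by decide) ?_ |>.mono (by omega)
    fun _ h => h
  refine wp_cons_set (T := 72 * I.cost - 14) (by simp) (by decide) ?_ |>.mono (by omega)
    fun _ h => h
  refine wp_cons_set (T := 72 * I.cost - 15) (by simp) (by decide) ?_ |>.mono (by omega)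
    fun _ h => h
  have m3 : σ₃.reg .m = m := (s3.reg .m (by decide)).trans (by simp)
  have B3 : σ₃.reg .B = I.B := (hR.base.frame f3 (by decide)).B
  simp only [val_reg, val_div, State.set_reg, reduceCtorEq, if_false, A3, D3, m3, B3]
  set σ₄ := ((σ₃.set .cA (I.vA m)).set .cD (I.vD m)).set .b ((m : ℤ) / I.B) with hσ₄
  have f4 : Frame [.m, .cA, .cD, .b] σ σ₄ :=
    (((f3.mono (by simp)).set (by simp)).set (by simp)).set (by simp)
  have ctx4 : VertexCtx I (I.vA m) (I.vD m) σ₄ :=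
    ⟨hR.base.frame f4 (by decide), by simp [hσ₄], by simp [hσ₄]⟩
  have arr4 : σ₄.arr = σ.arr := s3.arr
  refine wp_cons (T₁ := I.cost) (T₂ := 71 * I.cost - 15) ((wp_refreshVertex ctx4 (b := m / I.B)
    (by simp [hσ₄]) (Inst.block_lt hm) (dirty := fun e => e = m) ?_).mono le_rfl ?_) (by omega)
  · rw [arr4]
    exact hV.tree_step hm hcand hmin ht
  rintro σ₅ ⟨s5, o5, a5, t5⟩
  have f5 : Frame [.m, .cA, .cD, .b] σ σ₅ := f4.trans (s5.frame le_rfl) (by simp) (by simp)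
  have R5 : Ready I (I.dir 1 c) σ₅ := hR.frame f5 (by decide) (by rw [← arr4]; exact a5)
  have m5 : σ₅.reg .m = m := (s5 .m (by decide)).trans (by simp [hσ₄, m3])
  refine wp_cons (T₁ := 70 * I.cost) (T₂ := 0)
    ((wp_event R5 (hV.next hm hcand hmin) m5).mono le_rfl ?_) (by omega)
  rintro σ₆ ⟨R6, f6, v6, o6⟩
  refine wp_nil ⟨⟨m, hm⟩, fun hmem => (hV.mem _).1 hmem hcand, ⟨m, _, _, hV.step hm hcand hmin, R6,
    ?_, ?_, ?_⟩, ?_⟩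
  · rw [f6 .cA (by decide) (by decide), s5 .cA (by decide), ctx4.cA]
  · rw [f6 .cD (by decide) (by decide), s5 .cD (by decide), ctx4.cD]
  · exact VertexTree.congr (t5.mono fun e _ he => he.2 (by rw [he.1])) v6
  · have o4 : σ₄.out = σ.out := s3.out
    rw [o6, o5, o4, ho, List.append_assoc, List.flatMap_append (xs := V), List.flatMap_append]
    simp

/-- Process all vertices in their cyclic order. -/
def sweepCmd : Cmd := .loop 0 (.ld 3) sweepBody

/-- Processed vertices are distinct, so `n` minus their number serves as fuel. -/
theorem wp_sweep {o : List ℤ} {σ : State} (h : Sweep I o [] σ) :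
    wp E sweepCmd (I.n * (72 * I.cost + 1) + 1)
      (fun σ' => ∃ V : List (Fin I.n), V.Nodup ∧ (∀ m, m ∈ V) ∧
        σ'.out = o ++ (V.flatMap I.allReports).flatMap Report.words) σ := by
  have hN := six_le_N I
  refine (wp_loop (T := 72 * I.cost) (fun f σ' => ∃ V : List (Fin I.n), Sweep I o V σ' ∧
    V.length + f = I.n) ?_ I.n σ ⟨[], h, by simp⟩).mono le_rfl ?_
  · rintro f σ' ⟨V, hS, hf⟩
    refine ⟨by simp, by simp; omega, fun hlt => ?_⟩
    simp only [val_zero, val_ld, val_three, Int.reduceToNat] at hlt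
    have hlt' : ∃ m, m ∉ V := by
      by_contra hall
      push Not at hall
      obtain ⟨⟨c, zA, zD, hV, -, -, -, ht⟩, -⟩ := hS
      rcases ht.root I.sizes.s_pos (fun _ _ => id) with ⟨h1, h2⟩ | ⟨e, h1, h2, h3, h4⟩
      · rw [Nat.add_zero] at h1
        omega
      · exact (hV.mem ⟨e, h2⟩).1 (hall _) h3.2
    obtain ⟨⟨c, zA, zD, hV, -⟩, -⟩ := id hS
    obtain ⟨m, hm⟩ := hlt'
    have hlen : (m :: V).length ≤ I.n := by
      have := (List.nodup_cons.2 ⟨hm, hV.nodup⟩).length_le_card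
      simpa using this
    rw [List.length_cons] at hlen
    refine ⟨by omega, (wp_sweepBody hS hlt).mono le_rfl ?_⟩
    rintro σ'' ⟨m', _, hS'⟩
    exact ⟨f - 1, by omega, V ++ [m'], hS', by simp; omega⟩
  · rintro σ' ⟨⟨f, V, hS, _⟩, hlt⟩
    simp only [val_zero, val_ld, val_three, Int.reduceToNat] at hlt
    refine ⟨V, ?_, hS.root hlt, hS.out⟩
    obtain ⟨⟨c, zA, zD, hV, -⟩, -⟩ := hS
    exact hV.nodup

/-- The program. -/
def mainCmd : Cmd := block [paramCmd, .set .cA (0 - rg .K), .set .cD 1, buildCmd refreshVertex,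
  .set .dx (rg .K * rg .u0x - rg .u0y), .set .dy (rg .K * rg .u0y + rg .u0x),
  .set .p 0, .set .r 0, .set .pA 0, .set .nA 0, .set .pD 1, buildCmd refreshBoth,
  rebalanceCmd, sweepCmd]

/-- The sweep starts just after vertex 0 with the pointer at the origin, where the rank is 0 by
definition and need not be counted. Building the trees takes at most `n` refreshes of each, as `s ≤
n`. -/
theorem wp_main {k : ℕ} (h : I.Input k) {σ : State} (ha : ∀ a, σ.arr a = 0) (ho : σ.out = []) :
    wp E mainCmd (100 * I.n * I.cost) (fun σ' => ∃ V : List (Fin I.n), V.Nodup ∧ (∀ m, m ∈ V) ∧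
      σ'.out = (V.flatMap I.allReports).flatMap Report.words) σ := by
  have hcost := I.cost_ge
  have hn := I.three_le
  have hsn := h.s_le
  set X := I.n * I.cost with hX
  have hX1 : 100 * I.n ≤ X := by rw [hX, Nat.mul_comm 100]; exact Nat.mul_le_mul_left _ hcost
  have hX2 : I.s * I.cost ≤ X := Nat.mul_le_mul_right _ hsn
  have e1 : I.s * (I.cost + 2) + 2 = I.s * I.cost + 2 * I.s + 2 := by ring
  have e2 : I.s * (2 * I.cost + 2) + 2 = 2 * (I.s * I.cost) + 2 * I.s + 2 := by ring
  have e3 : 2 * (I.n * (4 * I.cost + 33) + 1) = 8 * X + 66 * I.n + 2 := by rw [hX]; ring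
  have e4 : I.n * (72 * I.cost + 1) + 1 = 72 * X + I.n + 1 := by rw [hX]; ring
  rw [show 100 * I.n * I.cost = 100 * X by rw [hX]; ring]
  refine wp_cons (T₁ := 6 * I.n + 20) (T₂ := 100 * X - (6 * I.n + 20))
    ((wp_param h σ).mono le_rfl ?_) (by omega)
  rintro σ₁ ⟨b1, a1, o1⟩
  refine wp_cons_set (T := 99 * X) (by simp) (by decide) ?_ |>.mono (by omega) fun _ h => h
  refine wp_cons_set (T := 98 * X) (by simp) (by decide) ?_ |>.mono (by omega) fun _ h => h
  simp only [val_sub, val_zero, val_reg, b1.K, val_one, zero_sub]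
  set σ₂ := (σ₁.set .cA (-I.K)).set .cD 1 with hσ₂
  have f2 : Frame [.cA, .cD] σ₁ σ₂ := ((Frame.refl _ _).set (by simp)).set (by simp)
  have c2 : VertexCtx I (-I.K) 1 σ₂ := ⟨b1.frame f2 (by decide), by simp [hσ₂], by simp [hσ₂]⟩
  refine wp_cons (T₁ := X + 2 * I.n + 2) (T₂ := 96 * X) ((wp_buildVertex c2 hsn fun a => ?_).mono
    (by omega) ?_) (by omega)
  · exact (congrFun a1 a).trans (ha a)
  rintro σ₃ ⟨s3, o3, a3, t3⟩
  have b3 : I.Base σ₃ := c2.base.same (s3.mono (by norm_num))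
  have cA3 : σ₃.reg .cA = -I.K := (s3 .cA (by decide)).trans c2.cA
  have cD3 : σ₃.reg .cD = 1 := (s3 .cD (by decide)).trans c2.cD
  have arr3 : ∀ a, a % 3 ≠ 0 → σ₃.arr a = 0 := fun a h0 =>
    (a3 a h0).trans ((congrFun a1 a).trans (ha a))
  refine wp_cons_set (T := 95 * X) (by simp) (by decide) ?_ |>.mono (by omega) fun _ h => h
  refine wp_cons_set (T := 94 * X) (by simp) (by decide) ?_ |>.mono (by omega) fun _ h => h
  refine wp_cons_set (T := 93 * X) (by simp) (by decide) ?_ |>.mono (by omega) fun _ h => h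
  refine wp_cons_set (T := 92 * X) (by simp) (by decide) ?_ |>.mono (by omega) fun _ h => h
  refine wp_cons_set (T := 91 * X) (by simp) (by decide) ?_ |>.mono (by omega) fun _ h => h
  refine wp_cons_set (T := 90 * X) (by simp) (by decide) ?_ |>.mono (by omega) fun _ h => h
  refine wp_cons_set (T := 89 * X) (by simp) (by decide) ?_ |>.mono (by omega) fun _ h => h
  simp only [val_sub, val_add, val_mul, val_zero, val_reg, val_one, State.set_reg, reduceCtorEq,
    if_false, b3.K, b3.u0x, b3.u0y]
  set σ₄ := ((((((σ₃.set .dx (I.K * (I.U 0).1 - (I.U 0).2)).set .dy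
    (I.K * (I.U 0).2 + (I.U 0).1)).set .p 0).set .r 0).set .pA 0).set .nA 0).set .pD 1 with hσ₄
  have f4 : Frame [.dx, .dy, .p, .r, .pA, .nA, .pD] σ₃ σ₄ :=
    (((((((Frame.refl _ _).set (by simp)).set (by simp)).set (by simp)).set (by simp)).set
      (by simp)).set (by simp)).set (by simp)
  have c4 : PtrCtx I (I.dir 1 0) 0 σ₄ := by
    refine ⟨b3.frame f4 (by decide), ?_, ?_, ?_, ?_, ?_⟩ <;>
      simp [hσ₄, Inst.dir, Inst.zA, Inst.zD]
  refine wp_cons (T₁ := 2 * X + 2 * I.n + 2) (T₂ := 86 * X) ((wp_buildBoth c4 hsn arr3).mono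
    (by omega) ?_) (by omega)
  rintro σ₅ ⟨s5, o5, v5, t5⟩
  have p5 : Ptr I (I.dir 1 0) 0 clean σ₅ := by
    refine ⟨c4.same s5, (s5 .p (by decide)).trans (by simp [hσ₄]), ?_, t5⟩
    rintro e he
    omega
  have r5 : σ₅.reg .r = I.rank (I.dir 1 0) 0 := by
    rw [s5 .r (by decide), Inst.rank_zero]
    simp [hσ₄]
  -- From rank 0 the pointer climbs at most to the total number of active edges, so `n` moves are
  -- enough.
  refine wp_cons (T₁ := 8 * X + 66 * I.n + 2) (T₂ := 76 * X)
    ((wp_rebalance p5 r5 (f := I.n) ?_ ?_).mono (by omega) ?_) (by omega)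
  · exact (min_le_right _ _).trans (Inst.tot_le.trans (Nat.le_add_left _ _))
  · rw [Inst.rank_zero]; omega
  rintro σ₆ ⟨⟨R, p6, r6⟩, r6', f6, o6, v6⟩
  refine wp_cons (T₁ := 72 * X + I.n + 1) (T₂ := 0) ((wp_sweep (o := []) ⟨⟨0, -I.K, 1,
    Visited.init, ⟨⟨R, p6, ?_⟩, r6'⟩, ?_, ?_, ?_⟩, ?_⟩).mono (by omega) ?_) (by omega)
  · rw [r6] at r6'
    exact_mod_cast r6'
  · rw [f6 .cA (by decide) (by decide), s5 .cA (by decide), f4 .cA (by decide) (by decide), cA3]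
  · rw [f6 .cD (by decide) (by decide), s5 .cD (by decide), f4 .cD (by decide) (by decide), cD3]
  · exact (VertexTree.congr (arr' := σ₅.arr) t3 v5).congr v6
  · rw [o6, o5]
    exact o3.trans (o1.trans ho)
  · rintro σ' ⟨V, h1, h2, h3⟩
    exact wp_nil ⟨V, h1, h2, by simpa using h3⟩


/-! ## The reported triples -/

section
variable {E : Env} {I : Inst E}

theorem signType_iff {ε : ℤ} (hε : ε = 1 ∨ ε = -1) {t : WindowType} :
    SignType ε t ↔ t = typeOf ε := by
  unfold SignType typeOf
  rcases hε with rfl | rfl <;> norm_num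

theorem mem_reports {ε : ℤ} {m : Fin I.n} {r : Report I.n} : r ∈ I.reports ε m ↔
    ∃ a b, Win I.u (I.k - 2) m (toPoint (I.dir ε m)) a b ∧ r.1 = m ∧ (r.2.1 = a ∨ r.2.1 = b) ∧
      r.2.2 = typeOf ε := by
  by_cases h : ∃ a b, Win I.u (I.k - 2) m (toPoint (I.dir ε m)) a b
  · obtain ⟨a, b, hab⟩ := h
    rw [Inst.reports_eq hab]
    simp only [List.mem_cons, List.not_mem_nil, or_false, Prod.ext_iff]
    constructor
    · rintro (⟨h1, h2, h3⟩ | ⟨h1, h2, h3⟩)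
      · exact ⟨a, b, hab, h1, Or.inl h2, h3⟩
      · exact ⟨a, b, hab, h1, Or.inr h2, h3⟩
    · rintro ⟨a', b', hab', h1, h2, h3⟩
      obtain ⟨rfl, rfl⟩ := hab.unique I.star_u hab'
      exact h2.imp (fun h => ⟨h1, h, h3⟩) fun h => ⟨h1, h, h3⟩
  · rw [Inst.reports_eq_nil fun a b hab => h ⟨a, b, hab⟩]
    simp only [List.not_mem_nil, false_iff]
    rintro ⟨a, b, hab, _⟩
    exact h ⟨a, b, hab⟩

theorem nodup_reports {ε : ℤ} {m : Fin I.n} : (I.reports ε m).Nodup := by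
  by_cases h : ∃ a b, Win I.u (I.k - 2) m (toPoint (I.dir ε m)) a b
  · obtain ⟨a, b, hab⟩ := h
    rw [Inst.reports_eq hab, List.nodup_cons]
    refine ⟨fun h => ?_, List.nodup_singleton _⟩
    rw [List.mem_singleton] at h
    have hab' : a = b := congrArg (fun r : Report I.n => r.2.1) h
    have h1 := hab.fst.2
    have h2 := hab.snd.2
    rw [hab'] at h1
    omega
  · rw [Inst.reports_eq_nil fun a b hab => h ⟨a, b, hab⟩]
    exact List.nodup_nil

theorem mem_allReports {m : Fin I.n} {r : Report I.n} : r ∈ I.allReports m ↔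
    ∃ ε : ℤ, (ε = 1 ∨ ε = -1) ∧ Crit I.u ε m ∧ r ∈ I.reports ε m := by
  classical
  unfold Inst.allReports
  rw [List.mem_append, List.mem_ite_nil_right, List.mem_ite_nil_right]
  constructor
  · rintro (⟨h1, h2⟩ | ⟨h1, h2⟩)
    · exact ⟨-1, Or.inr rfl, by exact_mod_cast h1, h2⟩
    · exact ⟨1, Or.inl rfl, by exact_mod_cast h1, h2⟩
  · rintro ⟨ε, rfl | rfl, h1, h2⟩
    · exact Or.inr ⟨by exact_mod_cast h1, h2⟩
    · exact Or.inl ⟨by exact_mod_cast h1, h2⟩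

theorem fst_of_mem_allReports {m : Fin I.n} {r : Report I.n} (h : r ∈ I.allReports m) :
    r.1 = m := by
  obtain ⟨ε, _, _, h1⟩ := mem_allReports.1 h
  obtain ⟨a, b, _, h2, _⟩ := mem_reports.1 h1
  exact h2

/-- Reports for end and start vertices differ in their type; within one window the two edges have
different numbers. -/
theorem nodup_allReports (m : Fin I.n) : (I.allReports m).Nodup := by
  classical
  unfold Inst.allReports
  rw [List.nodup_append]
  refine ⟨?_, ?_, ?_⟩
  · split_ifs
    exacts [nodup_reports, List.nodup_nil]
  · split_ifs
    exacts [nodup_reports, List.nodup_nil]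
  · rintro x hx y hy rfl
    rw [List.mem_ite_nil_right] at hx hy
    obtain ⟨_, _, _, _, _, h1⟩ := mem_reports.1 hx.2
    obtain ⟨_, _, _, _, _, h2⟩ := mem_reports.1 hy.2
    rw [h1] at h2
    simp [typeOf] at h2

theorem nodup_flatMap_allReports {V : List (Fin I.n)} (hV : V.Nodup) :
    (V.flatMap I.allReports).Nodup := by
  rw [List.nodup_flatMap]
  refine ⟨fun m _ => nodup_allReports m, hV.imp fun hne r h1 h2 => hne ?_⟩
  exact (fst_of_mem_allReports h1).symm.trans (fst_of_mem_allReports h2)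

variable {P : Polygon ℂ I.n} {q : ℂ}

theorem decode_injective (h : rel P q = I.u) : Function.Injective (Report.decode P q) := by
  have hS : Star (rel P q) := h ▸ I.star_u
  rintro ⟨m, j, t⟩ ⟨m', j', t'⟩ hr
  simp only [Report.decode, Prod.mk.injEq] at hr
  rw [angle_injective hS hr.1, hr.2.1, hr.2.2]

theorem decode_allReports (h : rel P q = I.u) (hk : Even (I.k - 2)) {V : List (Fin I.n)}
    (hV : ∀ m, m ∈ V) :
    {x | x ∈ (V.flatMap I.allReports).map (Report.decode P q)} = windowEndpoints P q (I.k - 2) := by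
  have hS : Star (rel P q) := h ▸ I.star_u
  have hodd : OddTotal (rel P q) := h ▸ I.odd
  have hD : ∀ (ε : ℝ) (m : Fin I.n), ε = 1 ∨ ε = -1 →
      Near (rel P q) m ε (toPoint (I.dir (if ε = 1 then 1 else -1) m)) := by
    intro ε m hε
    rw [h]
    rcases hε with rfl | rfl
    · simpa using Inst.near_dir (I := I) (Or.inl rfl) m.isLt
    · have h1 := Inst.near_dir (I := I) (Or.inr rfl) m.isLt
      rw [if_neg (by norm_num)]
      simpa using h1
  rw [windowEndpoints_eq hS hodd hk (fun ε m => toPoint (I.dir (if ε = 1 then 1 else -1) m)) hD, h]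
  ext x
  simp only [Set.mem_ofPred_eq, List.mem_map, List.mem_flatMap, mem_allReports, mem_reports]
  constructor
  · rintro ⟨r, ⟨m, _, ε, hε, hc, a, b, hw, h1, h2, h3⟩, rfl⟩
    refine ⟨ε, m, a, b, hc, ?_, ?_, h2, (signType_iff hε).2 h3⟩
    · rcases hε with rfl | rfl
      · simpa using hw
      · rw [if_neg (by norm_num)]
        exact hw
    · rw [← h1]
      rfl
  · rintro ⟨ε, m, a, b, hc, hw, h1, h2, h3⟩
    obtain ⟨ε', hε', rfl⟩ : ∃ ε' : ℤ, (ε' = 1 ∨ ε' = -1) ∧ (ε' : ℝ) = ε := by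
      rcases hc.sign with h | h
      · exact ⟨1, Or.inl rfl, by simp [h]⟩
      · exact ⟨-1, Or.inr rfl, by simp [h]⟩
    refine ⟨(m, x.2.1, x.2.2), ⟨m, hV m, ε', hε', hc, a, b, ?_, rfl, h2, (signType_iff hε').1 h3⟩, ?_⟩
    · rcases hε' with rfl | rfl
      · simpa using hw
      · rw [if_neg (by norm_num)] at hw
        exact hw
    · exact Prod.ext h1.symm rfl

end

/-! ## The running time and the word size -/

/-- The factor comes from 1 / log 2 < 3 / 2. -/
theorem log_two_le (s : ℕ) (hs : 1 ≤ s) : (Nat.log 2 s : ℝ) ≤ 3 / 2 * Real.log s := by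
  have h1 : (2 : ℝ) ^ Nat.log 2 s ≤ s := by exact_mod_cast Nat.pow_log_le_self 2 (by omega)
  have h2 := Real.log_le_log (by positivity) h1
  rw [Real.log_pow] at h2
  have h3 := Real.log_two_gt_d9
  have h4 : (0 : ℝ) ≤ Nat.log 2 s := by positivity
  nlinarith

/-- Since `n / s` is at least 1, it absorbs both the rounding in the block length and the additive
constant. This leaves 130 · 100 · 200 = 2600000, and it fixes the constant of the theorem. -/
theorem time_bound {n s : ℕ} (hs : 1 ≤ s) (hsn : s ≤ n) :
    ((130 * (100 * n * (41 * ((n + s - 1) / s) + 81 * Nat.log 2 s + 100)) : ℕ) : ℝ) ≤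
      3000000 * ((n : ℝ) ^ 2 / s + n * Real.log s) := by
  have h1 := log_two_le s hs
  have hs' : (0 : ℝ) < s := by exact_mod_cast hs
  have h2 : (((n + s - 1) / s : ℕ) : ℝ) ≤ 2 * (n / s) := by
    refine Nat.cast_div_le.trans ?_
    rw [← mul_div_assoc]
    gcongr
    have : n + s - 1 ≤ 2 * n := by omega
    exact_mod_cast this
  have h3 : (1 : ℝ) ≤ n / s := by
    rw [le_div_iff₀ hs', one_mul]
    exact_mod_cast hsn
  have h4 : 0 ≤ Real.log s := Real.log_natCast_nonneg s
  have hn : (0 : ℝ) ≤ n := by positivity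
  rw [show (n : ℝ) ^ 2 / s + n * Real.log s = n * (n / s + Real.log s) by ring]
  push_cast
  set x : ℝ := n / s
  have h5 : 41 * (((n + s - 1) / s : ℕ) : ℝ) + 81 * (Nat.log 2 s : ℝ) + 100 ≤
      200 * (x + Real.log s) := by linarith
  have h6 := mul_le_mul_of_nonneg_left h5 hn
  have h7 : 0 ≤ (n : ℝ) * (x + Real.log s) := by positivity
  linarith

/-- The machine program. -/
def mainProgram : Program := mainCmd.code 0 ++ [Instr.halt]

/-- A finite computation on the text of the program: sizes, temporary cells and lengths of all its
expressions. -/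
theorem mainCmd_ok : mainCmd.ok 3000000 = true := by decide +kernel

/-- The machine with the given input. -/
def mainMachine (E : Env) {n s : ℕ} (hs : 1 ≤ s) (hsn : s ≤ n) (hn : n < 2 ^ E.w)
    (hN : E.N = 6 * s) : Machine E where
  prog := mainProgram
  S := 3000000 * s
  W := 3000000
  hW := by norm_num
  hS := by unfold arrBase; omega
  hN := by
    have h1 : s < 2 ^ E.w := by omega
    have hw := E.pos
    have h2 : (2 : ℤ) ^ (7 + E.w) ≤ 2 ^ (3000000 * E.w) :=
      pow_le_pow_right₀ (by norm_num) (by omega)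
    refine lt_of_lt_of_le ?_ h2
    rw [hN, pow_add]
    unfold arrBase
    zify at h1
    push_cast
    omega

theorem exec_main {E : Env} {n s : ℕ} (hs : 1 ≤ s) (hsn : s ≤ n) (hn : n < 2 ^ E.w)
    (hN : E.N = 6 * s) {T : ℕ} {Q : State → Prop}
    (h : wp E mainCmd T Q ⟨fun _ => 0, fun _ => 0, []⟩) :
    ∃ σ t, Q σ ∧ t ≤ 130 * T ∧ Computes mainProgram (3000000 * s) (3000000 * E.w) E.inp t σ.out := by
  have hb : Bounded E ⟨fun _ => 0, fun _ => 0, []⟩ := ⟨fun _ => by simp, fun _ => by simp⟩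
  obtain ⟨σ, t, hex, ht, hQ⟩ := h hb
  have hc : CodeAt mainProgram 0 (mainCmd.code 0) := by
    intro i hi
    rw [zero_add, mainProgram, List.getElem?_append_left hi]
  obtain ⟨mem, t', ht', hst, -⟩ := Cmd.code_correct (mainMachine E hs hsn hn hN) hex hb mainCmd_ok 0
    (fun _ => 0) hc ⟨rfl, fun _ => rfl, fun _ => rfl⟩
  refine ⟨σ, t', hQ, by omega, _, (run_eq_steps _ _ _ _ _).trans hst, ?_, rfl⟩
  rw [zero_add, mainProgram, List.getElem?_append_right le_rfl]
  simp

/-! ## The instance of a polygon -/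

section
variable {n : ℕ} (v : Fin n → ℤ × ℤ) (q : ℤ × ℤ)

/-- The positions of the vertices relative to `q`. -/
def relVertex (i : ℕ) : ℤ × ℤ :=
  if h : i < n then ((v ⟨i, h⟩).1 - q.1, (v ⟨i, h⟩).2 - q.2) else 0

theorem toPoint_relVertex : (fun i : Fin n => toPoint (relVertex v q i)) =
    rel (toPolygon v) (toPoint q) := by
  funext i
  rw [relVertex, dif_pos i.isLt]
  apply Complex.ext <;> simp [rel, toPolygon, toPoint]

theorem getElem?_flatMap_pair (l : List (ℤ × ℤ)) (i : ℕ) :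
    (l.flatMap fun p => [p.1, p.2])[2 * i]? = l[i]?.map Prod.fst ∧
      (l.flatMap fun p => [p.1, p.2])[2 * i + 1]? = l[i]?.map Prod.snd := by
  induction l generalizing i with
  | nil => simp
  | cons p l ih =>
    rcases i with _ | i
    · simp
    · have := ih i
      simpa [Nat.mul_add] using this

theorem inputArray_vertex (k s : ℕ) {i : ℕ} (hi : i < n) :
    (inputArray v q k s)[5 + 2 * i]? = some ((relVertex v q i).1 + q.1) ∧
      (inputArray v q k s)[6 + 2 * i]? = some ((relVertex v q i).2 + q.2) := by
  have h := getElem?_flatMap_pair (List.ofFn v) i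
  have hv : (List.ofFn v)[i]? = some (v ⟨i, hi⟩) := by simp [hi]
  rw [hv] at h
  unfold inputArray
  rw [relVertex, dif_pos hi, List.getElem?_append_right (by simp),
    List.getElem?_append_right (by simp; omega)]
  have e1 : 5 + 2 * i - [(n : ℤ), (k : ℤ), (s : ℤ), q.1, q.2].length = 2 * i := by simp
  have e2 : 6 + 2 * i - [(n : ℤ), (k : ℤ), (s : ℤ), q.1, q.2].length = 2 * i + 1 := by
    simp only [List.length_cons, List.length_nil]; omega
  rw [e1, e2, h.1, h.2]
  simp

end

end KVis

/-! ### The program on a polygon given by its input words. -/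

theorem theorem2 :
    ∃ (prog : KVis.Program) (C : ℕ),
      ∀ (n : ℕ) (v : Fin n → ℤ × ℤ) (q : ℤ × ℤ) (k s w : ℕ),
        KVis.IsSimple (KVis.toPolygon v) →
        KVis.WeakGeneralPosition (KVis.toPolygon v) (KVis.toPoint q) →
        KVis.toPoint q ∈ KVis.region (KVis.toPolygon v) →
        1 ≤ s → s ≤ n →
        (∀ x ∈ KVis.inputArray v q k s, |x| < 2 ^ w) →
        ∃ (t : ℕ) (L : List (KVis.Report n)),
          KVis.Computes prog (C * s) (C * w) (KVis.inputArray v q k s) t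
            (L.flatMap KVis.Report.words) ∧
          (t : ℝ) ≤ C * ((n : ℝ) ^ 2 / s + n * Real.log s) ∧
          (L.map (KVis.Report.decode (KVis.toPolygon v) (KVis.toPoint q))).Nodup ∧
          {x | x ∈ L.map (KVis.Report.decode (KVis.toPolygon v) (KVis.toPoint q))} =
            KVis.W (KVis.toPolygon v) (KVis.toPoint q) k := by
  refine ⟨KVis.mainProgram, 3000000, fun n v q k s w hP hG hq hs hsn hin => ?_⟩
  have hn3 := hP.three_le
  have hS := KVis.star_of_simple hP hG
  have hrel := KVis.toPoint_relVertex v q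
  have hn : n < 2 ^ w := by
    have h := hin n (by simp [KVis.inputArray])
    rw [abs_of_nonneg (by positivity)] at h
    exact_mod_cast h
  have hw : 1 ≤ w := by
    by_contra h0
    obtain rfl : w = 0 := by omega
    omega
  -- Three trees with node numbers below `2 * s` fill `6 * s` cells.
  let E : KVis.Env := ⟨KVis.inputArray v q k s, 6 * s, w, hw, hin⟩
  have hdiv : n ≤ s * ((n + s - 1) / s) := by
    have h1 := Nat.div_add_mod (n + s - 1) s
    have h2 := Nat.mod_lt (n + s - 1) (show s > 0 by omega)
    omega
  -- The field `k` is the target of the pointer: the largest even number up to the given `k`, plus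
  -- 2. This also covers the convention for odd `k`.
  let I : KVis.Inst E := {
    n := n, s := s, B := (n + s - 1) / s, k := 2 * (k / 2) + 2
    K := KVis.maxNorm (KVis.relVertex v q) n, q := q, U := KVis.relVertex v q
    k_ge := by omega
    sizes := ⟨hs, by rw [Nat.one_le_div_iff (by omega)]; omega, hdiv, hn, le_rfl⟩
    inp_fst := fun i hi => (KVis.inputArray_vertex v q k s hi).1
    inp_snd := fun i hi => (KVis.inputArray_vertex v q k s hi).2
    star := by rw [hrel]; exact hS
    odd := by rw [hrel]; exact KVis.oddTotal_of_mem_region hS hq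
    K_ge := fun i hi => KVis.le_maxNorm _ hi }
  have hI : I.Input k := ⟨rfl, rfl, rfl, rfl, rfl, rfl, rfl, rfl, hsn⟩
  obtain ⟨σ, t, ⟨V, hV, hall, hout⟩, ht, hcomp⟩ := KVis.exec_main (E := E) hs hsn hn rfl
    (KVis.wp_main hI (fun _ => rfl) rfl)
  refine ⟨t, V.flatMap I.allReports, ?_, ?_, ?_, ?_⟩
  · rw [hout] at hcomp
    exact hcomp
  · refine le_trans ?_ (KVis.time_bound hs hsn)
    exact_mod_cast ht
  · exact (KVis.nodup_flatMap_allReports hV).map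
      (KVis.decode_injective (I := I) (P := KVis.toPolygon v) hrel.symm)
  · exact KVis.decode_allReports (I := I) (P := KVis.toPolygon v) hrel.symm
      (even_two_mul (k / 2)) hall
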